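/- **Soundness of the Casal–Mordido–Vasconcelos encoding.** *Source calculus (mixed sessions, $\mathrm{CMV}^+$).* Values are variables, $\mathsf{true}$, $\mathsf{false}$, $()$. Processes, up to $\alpha$-conversion, are $P ::= q\,x\sum_{i\in I}M_i \mid P|P \mid (\nu yz)P \mid \mathsf{if}\ v\ \mathsf{then}\ P\ \mathsf{else}\ P \mid \mathbf 0$, with branches $M ::= l!v.P \mid l?z.P$, qualifiers $q\in\{\mathsf{lin},\mathsf{un}\}$ and $I$ finite; $(\nu yz)$ binds the two endpoints $y,z$ of a channel. Reduction $\to$ is closed under $|$, $(\nu yz)$ and structural congruence $\equiv$ and generated by the two conditional rules and $(\nu yz)(q_1\,y(l!v.P+M)\mid q_2\,z(l?x.Q+N)\mid R)\to(\nu yz)(P\mid Q\{v/x\}\mid R)$, where a choice qualified $\mathsf{un}$ additionally persists after the step. The congruence $\equiv$ is the least congruence making $|$ commutative and associative with unit $\mathbf 0$, with $(\nu yz)\mathbf 0\equiv\mathbf 0$, $(\nu yz)P\equiv(\nu zy)P$, exchange of restrictions, and scope extrusion. *Types.* $T ::= \mathsf{end}\mid\mathsf{unit}\mid\mathsf{bool}\mid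 \mathsf{lin}\,\sharp\{l_i{*_i}S_i.T_i\}_{i\in I}\mid \mathsf{un}\,\sharp\{l_i{*_i}S_i\}_{i\in I}\mid a\mid\mu a.T$, with view $\sharp\in\{\oplus,\&\}$, polarity ${*}\in\{!,?\}$ and pairwise different pairs $l_i{*_i}$; an unrestricted choice type continues as itself. Subtyping $<:$ and duality $\perp$ are coinductive: $\oplus$-types may lose and $\&$-types may gain labels in a supertype, payloads are contravariant for $!$ and covariant for $?$, continuations are covariant; dual types have dual views, dual polarities, equivalent payloads and dual continuations. $\Gamma\vdash P$ is the linear type system with context splitting (unrestricted entries are shared, linear ones go to one side) in which $(\nu yz)$ introduces dual types for $y,z$; values may be subsumed; $\mathbf 0$ and every $\mathsf{un}$ choice need an unrestricted context; and a choice on $x$ has exactly the label-polarity pairs of the type of $x$, each branch transmitting a value of the payload type, after which $x$ has the continuation type. *Target calculus ($\mathrm{CMV}$, separate choice only).* $P ::= y!v.P\mid q\,y?x.P\mid y\triangleleft l.P\mid y\triangleright\{l_i{:}P_i\}_{i\in I}\mid P|P\mid(\nu yz)P\mid \mathsf{if}\ v\ \mathsf{then}\ P\ \mathsf{else}\ P\mid\mathbf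 0$, with the corresponding $\equiv$ and with reductions, besides the conditional and contextual ones, $(\nu yz)(y!v.P\mid q\,z?x.Q\mid R)\to(\nu yz)(P\mid Q\{v/x\}\mid R)$ (where an input with $q=\mathsf{un}$ additionally persists) and $(\nu yz)(y\triangleleft l_j.P\mid z\triangleright\{l_i{:}Q_i\}_i\mid R)\to(\nu yz)(P\mid Q_j\mid R)$. $P$ has the barb $x$ if it has an unguarded output, input, selection or branching on the free name $x$; it weakly has it if some $P'$ with $P\Rightarrow P'$ has it, where $\Rightarrow$ is the reflexive-transitive closure of $\to$. $\approx$ is weak reduction barbed bisimilarity: the union of all relations $\mathcal R$ such that $P\,\mathcal R\,Q$ implies that every $P\Rightarrow P'$ is matched by some $Q\Rightarrow Q'$ with $P'\,\mathcal R\,Q'$, vice versa, and that $P$ and $Q$ have the same weak barbs. *Encoding.* Write $\mathrm{ND}\{P_i\}_{i\in I}$ for $(\nu st)(s\triangleright\{l_i{:}P_i\}_{i}\mid\prod_{i} t\triangleleft l_i.\mathbf 0)$, $s,t$ fresh. $[\![\Gamma\vdash P]\!]$ is defined on typing derivations. It is homomorphic on all operators except choice. For a choice on $x$ with set $A$ of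 label-polarity pairs, let $D_y(l,*)$ be $\mathrm{ND}$ over all branches $l{*}w.P$ with this label and polarity, of $y!w.[\![P]\!]$ if $*$ is $!$ and of $\mathsf{lin}\,y?w.[\![P]\!]$ if $*$ is $?$; let $\mathsf{off}_y = y\triangleright\{l_{\overline{*}}:D_y(l,*)\}_{(l,*)\in A}$, where $\overline{!}={?}$ and $\overline{?}={!}$. The translation is, with $c,d,u,v$ fresh: - $x$ linear, $\oplus$: $\mathrm{ND}\{x\triangleleft l_{*}.D_x(l,*)\}_{(l,*)\in A}$; $x$ linear, $\&$: $\mathsf{off}_x$; - $x$ unrestricted, $\&$, process qualifier $q$: $q\,x?c.\mathsf{off}_c$; - $x$ unrestricted, $\oplus$, process qualifier $\mathsf{lin}$: $C=\mathrm{ND}\{(\nu cd)(x!c.d\triangleleft l_{*}.D_d(l,*))\}_{(l,*)\in A}$; - $x$ unrestricted, $\oplus$, process qualifier $\mathsf{un}$: $(\nu uv)(u!().\mathbf 0\mid \mathsf{un}\,v?\_.C')$, where $C'$ is $C$ with $u!().\mathbf 0$ put in parallel to each continuation $[\![P]\!]$. **Lemma.** The encoding is operationally sound modulo $\approx$: for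 every typed process $\Gamma\vdash S$ (with a given derivation) and every $\mathrm{CMV}$ process $T$ with $[\![\Gamma\vdash S]\!]\Rightarrow T$, there are a process $S'$ with $S\Rightarrow S'$, a derivation of $\Gamma\vdash S'$, and a process $T'$ such that $T\Rightarrow T'$ and $T'\approx[\![\Gamma\vdash S']\!]$. -/

import Mathlib

namespace MixedSessions

/-! ### Notions shared by the two calculi

Binding is represented with de Bruijn indices, so that alpha-equivalent processes are equal.
A channel restriction `(ν y z) P` binds index `0` (the endpoint `y`) and index `1` (the
endpoint `z`) in `P`; an input binds index `0` in its continuation. -/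

/-- The countably infinite set of choice labels of mixed sessions. -/
abbrev Label : Type := ℕ

/-- Polarities `!` and `?`. -/
inductive Pol
  | snd
  | rcv
  deriving DecidableEq

/-- The dual polarity. -/
def Pol.dual : Pol → Pol
  | .snd => .rcv
  | .rcv => .snd

/-- Qualifiers: linear or unrestricted. -/
inductive Qual
  | lin
  | un
  deriving DecidableEq

/-- The view of a choice type: internal `⊕` or external `&`. -/
inductive View
  | int
  | ext
  deriving DecidableEq

/-- The dual view. -/
def View.dual : View → View
  | .int => .ext
  | .ext => .int

/-- A label together with a polarity. -/
abbrev Key : Type := Label × Pol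

/-- Keep the label, dualise the polarity. -/
def Key.dual (a : Key) : Key := (a.1, a.2.dual)

/-- Values: variables (channel endpoints), booleans, unit. -/
inductive Val
  | var (x : ℕ)
  | tt
  | ff
  | unit
  deriving DecidableEq

/-- Simultaneous substitutions. -/
abbrev Subst : Type := ℕ → Val

/-- Apply a substitution to a value. -/
def Val.subst (σ : Subst) : Val → Val
  | .var x => σ x
  | .tt => .tt
  | .ff => .ff
  | .unit => .unit

/-- The renaming `x ↦ ρ x`, as a substitution. -/
def Subst.ofRen (ρ : ℕ → ℕ) : Subst := fun x => .var (ρ x)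

/-- Weakening by `k` fresh indices. -/
def Subst.shift (k : ℕ) : Subst := Subst.ofRen (· + k)

/-- Push a substitution under one binder. -/
def Subst.up (σ : Subst) : Subst
  | 0 => .var 0
  | x + 1 => (σ x).subst (Subst.shift 1)

/-- The substitution `{v / 0}` that eliminates the outermost bound variable. -/
def Subst.inst (v : Val) : Subst
  | 0 => v
  | x + 1 => .var x

/-- Exchange the two endpoints bound by the innermost restriction. -/
def swapEnds : ℕ → ℕ
  | 0 => 1
  | 1 => 0
  | x + 2 => x + 2

/-- Exchange the two innermost restrictions. -/
def swapRes : ℕ → ℕ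
  | 0 => 2
  | 1 => 3
  | 2 => 0
  | 3 => 1
  | x + 4 => x + 4

section Behaviour

variable {α : Type} (step : α → α → Prop) (barb : α → ℕ → Prop)

/-- `P ⟹ P'`: the reflexive and transitive closure of reduction. -/
def Reduces : α → α → Prop := Relation.ReflTransGen step

/-- `P` reaches the barb `x`. -/
def WeakBarb (P : α) (x : ℕ) : Prop := ∃ P', Reduces step P P' ∧ barb P' x

/-- Weak reduction barbed bisimulations. -/
def IsBisimulation (R : α → α → Prop) : Prop :=
  ∀ P Q, R P Q →
    (∀ P', Reduces step P P' → ∃ Q', Reduces step Q Q' ∧ R P' Q') ∧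
    (∀ Q', Reduces step Q Q' → ∃ P', Reduces step P P' ∧ R P' Q') ∧
    (∀ x, WeakBarb step barb P x ↔ WeakBarb step barb Q x)

/-- Weak reduction barbed bisimilarity. -/
def Bisimilar (P Q : α) : Prop := ∃ R, IsBisimulation step barb R ∧ R P Q

end Behaviour

/-! ### The calculus of mixed sessions -/

namespace Mix

/-- The part `l!v` or `l?x` of a branch in front of its continuation; the variable of an input
is index `0` of the continuation. -/
inductive Pre
  | out (l : Label) (v : Val)
  | inp (l : Label)

/-- Label and polarity of a branch. -/
def Pre.key : Pre → Key
  | .out l _ => (l, .snd)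
  | .inp l => (l, .rcv)

/-- Apply a substitution to a branch prefix. -/
def Pre.subst (σ : Subst) : Pre → Pre
  | .out l v => .out l (v.subst σ)
  | .inp l => .inp l

/-- The substitution to be applied to the continuation of a branch. -/
def Pre.up (σ : Subst) : Pre → Subst
  | .out _ _ => σ
  | .inp _ => σ.up

/-- Processes. `choice q x n pre cont` is the choice `q x Σ_{i < n} preᵢ.contᵢ`. Subjects are
values only to make substitution total: a subject that is not a variable can neither be typed
nor interact nor be observed. -/
inductive Proc
  | choice (q : Qual) (x : Val) (n : ℕ) (pre : Fin n → Pre) (cont : Fin n → Proc)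
  | par (P Q : Proc)
  | res (P : Proc)
  | cond (v : Val) (P Q : Proc)
  | nil

/-- Capture-avoiding simultaneous substitution. -/
def Proc.subst : Proc → Subst → Proc
  | .choice q x n pre cont, σ =>
      .choice q (x.subst σ) n (fun i => (pre i).subst σ)
        (fun i => (cont i).subst ((pre i).up σ))
  | .par P Q, σ => .par (P.subst σ) (Q.subst σ)
  | .res P, σ => .res (P.subst σ.up.up)
  | .cond v P Q, σ => .cond (v.subst σ) (P.subst σ) (Q.subst σ)
  | .nil, _ => .nil

/-- Structural congruence. -/
inductive Cong : Proc → Proc → Prop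
  | refl (P) : Cong P P
  | symm {P Q} : Cong P Q → Cong Q P
  | trans {P Q R} : Cong P Q → Cong Q R → Cong P R
  | choice {q x n pre cont cont'} : (∀ i, Cong (cont i) (cont' i)) →
      Cong (.choice q x n pre cont) (.choice q x n pre cont')
  | par {P P' Q Q'} : Cong P P' → Cong Q Q' → Cong (.par P Q) (.par P' Q')
  | res {P P'} : Cong P P' → Cong (.res P) (.res P')
  | cond {v P P' Q Q'} : Cong P P' → Cong Q Q' → Cong (.cond v P Q) (.cond v P' Q')
  | par_nil (P) : Cong (.par P .nil) P
  | par_comm (P Q) : Cong (.par P Q) (.par Q P)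
  | par_assoc (P Q R) : Cong (.par P (.par Q R)) (.par (.par P Q) R)
  | res_nil : Cong (.res .nil) .nil
  | res_swap (P) : Cong (.res P) (.res (P.subst (Subst.ofRen swapEnds)))
  | res_res (P) : Cong (.res (.res P)) (.res (.res (P.subst (Subst.ofRen swapRes))))
  | res_par (P Q) : Cong (.par P (.res Q)) (.res (.par (P.subst (Subst.shift 2)) Q))

/-- What remains after the choice `C` was used and continues as `P`: an unrestricted choice
persists, a linear one is consumed. -/
def leave : Qual → Proc → Proc → Proc
  | .lin, _, P => P
  | .un, C, P => .par P C

/-- Reduction. -/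
inductive Step : Proc → Proc → Prop
  | cond_tt (P Q) : Step (.cond .tt P Q) P
  | cond_ff (P Q) : Step (.cond .ff P Q) Q
  | com {q₁ q₂ : Qual} {n m : ℕ} {pre₁ : Fin n → Pre} {cont₁ : Fin n → Proc}
      {pre₂ : Fin m → Pre} {cont₂ : Fin m → Proc} {R : Proc}
      (i : Fin n) (j : Fin m) (l : Label) (v : Val)
      (hi : pre₁ i = .out l v) (hj : pre₂ j = .inp l) :
      Step
        (.res (.par (.par (.choice q₁ (.var 0) n pre₁ cont₁)
          (.choice q₂ (.var 1) m pre₂ cont₂)) R))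
        (.res (.par (.par (leave q₁ (.choice q₁ (.var 0) n pre₁ cont₁) (cont₁ i))
          (leave q₂ (.choice q₂ (.var 1) m pre₂ cont₂) ((cont₂ j).subst (Subst.inst v)))) R))
  | par {P P'} (Q) : Step P P' → Step (.par P Q) (.par P' Q)
  | res {P P'} : Step P P' → Step (.res P) (.res P')
  | struct {P Q Q' P'} : Cong P Q → Step Q Q' → Cong Q' P' → Step P P'

/-- `S ⟹ S'`. -/
abbrev Steps : Proc → Proc → Prop := Reduces Step

end Mix

/-! ### The type system of mixed sessions -/

/-- Types. A linear choice type `lin ♯ {lᵢ*ᵢ Sᵢ.Tᵢ}` is given by its finite set of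
label-polarity pairs, the payloads `Sᵢ` and the continuations `Tᵢ`. An unrestricted choice type
`un ♯ {lᵢ*ᵢ Sᵢ}` continues as itself, i.e. it is `μ a. un ♯ {lᵢ*ᵢ Sᵢ.a}`. In `mu T` the
recursion variable is index `0` of `T`. -/
inductive Ty
  | tend
  | unit
  | bool
  | lin (v : View) (dom : Finset Key) (pay cont : {a : Key // a ∈ dom} → Ty)
  | un (v : View) (dom : Finset Key) (pay : {a : Key // a ∈ dom} → Ty)
  | var (a : ℕ)
  | mu (T : Ty)

namespace Ty

/-- Push a renaming under one binder. -/
def upRen (ρ : ℕ → ℕ) : ℕ → ℕ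
  | 0 => 0
  | a + 1 => ρ a + 1

/-- Rename type variables. -/
def rename : Ty → (ℕ → ℕ) → Ty
  | .tend, _ => .tend
  | .unit, _ => .unit
  | .bool, _ => .bool
  | .lin v dom pay cont, ρ =>
      .lin v dom (fun a => (pay a).rename ρ) (fun a => (cont a).rename ρ)
  | .un v dom pay, ρ => .un v dom (fun a => (pay a).rename ρ)
  | .var a, ρ => .var (ρ a)
  | .mu T, ρ => .mu (T.rename (upRen ρ))

/-- Push a type substitution under one binder. -/
def up (σ : ℕ → Ty) : ℕ → Ty
  | 0 => .var 0
  | a + 1 => (σ a).rename (· + 1)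

/-- Substitute types for type variables. -/
def subst : Ty → (ℕ → Ty) → Ty
  | .tend, _ => .tend
  | .unit, _ => .unit
  | .bool, _ => .bool
  | .lin v dom pay cont, σ =>
      .lin v dom (fun a => (pay a).subst σ) (fun a => (cont a).subst σ)
  | .un v dom pay, σ => .un v dom (fun a => (pay a).subst σ)
  | .var a, σ => σ a
  | .mu T, σ => .mu (T.subst (up σ))

/-- The substitution `{U / 0}`. -/
def inst (U : Ty) : ℕ → Ty
  | 0 => U
  | a + 1 => .var a

/-- Types that are neither a variable nor a recursive type. -/
def IsHead : Ty → Prop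
  | .var _ => False
  | .mu _ => False
  | _ => True

/-- `Unfolds T H`: unfolding the leading recursion of `T` yields `H`. Only contractive types
unfold. -/
inductive Unfolds : Ty → Ty → Prop
  | head {T} : IsHead T → Unfolds T T
  | mu {T H} : Unfolds (T.subst (inst (.mu T))) H → Unfolds (.mu T) H

/-- Unrestricted types; every other type is linear. -/
def Unr (T : Ty) : Prop :=
  Unfolds T .tend ∨ Unfolds T .unit ∨ Unfolds T .bool ∨
    ∃ v dom pay, Unfolds T (.un v dom pay)

/-- Payloads are contravariant for sending and covariant for receiving. -/
def PaySub (R : Ty → Ty → Prop) : Pol → Ty → Ty → Prop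
  | .snd, S, S' => R S' S
  | .rcv, S, S' => R S S'

/-- One layer of subtyping on unfolded types: internal choices may lose labels and external
choices may gain labels. -/
inductive SubHead (R : Ty → Ty → Prop) : Ty → Ty → Prop
  | tend : SubHead R .tend .tend
  | unit : SubHead R .unit .unit
  | bool : SubHead R .bool .bool
  | lin_int {dom dom' pay cont pay' cont'} (h : dom' ⊆ dom) :
      (∀ a (ha : a ∈ dom'), PaySub R a.2 (pay ⟨a, h ha⟩) (pay' ⟨a, ha⟩)) →
      (∀ a (ha : a ∈ dom'), R (cont ⟨a, h ha⟩) (cont' ⟨a, ha⟩)) →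
      SubHead R (.lin .int dom pay cont) (.lin .int dom' pay' cont')
  | lin_ext {dom dom' pay cont pay' cont'} (h : dom ⊆ dom') :
      (∀ a (ha : a ∈ dom), PaySub R a.2 (pay ⟨a, ha⟩) (pay' ⟨a, h ha⟩)) →
      (∀ a (ha : a ∈ dom), R (cont ⟨a, ha⟩) (cont' ⟨a, h ha⟩)) →
      SubHead R (.lin .ext dom pay cont) (.lin .ext dom' pay' cont')
  | un_int {dom dom' pay pay'} (h : dom' ⊆ dom) :
      (∀ a (ha : a ∈ dom'), PaySub R a.2 (pay ⟨a, h ha⟩) (pay' ⟨a, ha⟩)) →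
      SubHead R (.un .int dom pay) (.un .int dom' pay')
  | un_ext {dom dom' pay pay'} (h : dom ⊆ dom') :
      (∀ a (ha : a ∈ dom), PaySub R a.2 (pay ⟨a, ha⟩) (pay' ⟨a, h ha⟩)) →
      SubHead R (.un .ext dom pay) (.un .ext dom' pay')

/-- Coinductive subtyping `S <: T`: the largest relation closed under the subtyping rules. -/
def SubTy (S T : Ty) : Prop :=
  ∃ R : Ty → Ty → Prop,
    (∀ S T, R S T → ∃ H K, Unfolds S H ∧ Unfolds T K ∧ SubHead R H K) ∧ R S T

/-- Type equivalence. -/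
def Equiv (S T : Ty) : Prop := SubTy S T ∧ SubTy T S

/-- One layer of duality on unfolded types: dual views, dual polarities, equivalent payloads,
dual continuations. -/
inductive DualHead (R : Ty → Ty → Prop) : Ty → Ty → Prop
  | tend : DualHead R .tend .tend
  | lin {v dom dom' pay cont pay' cont'} (h : ∀ a, a ∈ dom ↔ Key.dual a ∈ dom') :
      (∀ a (ha : a ∈ dom), Equiv (pay ⟨a, ha⟩) (pay' ⟨Key.dual a, (h a).1 ha⟩)) →
      (∀ a (ha : a ∈ dom), R (cont ⟨a, ha⟩) (cont' ⟨Key.dual a, (h a).1 ha⟩)) →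
      DualHead R (.lin v dom pay cont) (.lin v.dual dom' pay' cont')
  | un {v dom dom' pay pay'} (h : ∀ a, a ∈ dom ↔ Key.dual a ∈ dom') :
      (∀ a (ha : a ∈ dom), Equiv (pay ⟨a, ha⟩) (pay' ⟨Key.dual a, (h a).1 ha⟩)) →
      DualHead R (.un v dom pay) (.un v.dual dom' pay')

/-- Coinductive duality `S ⊥ T`. -/
def Dual (S T : Ty) : Prop :=
  ∃ R : Ty → Ty → Prop,
    (∀ S T, R S T → ∃ H K, Unfolds S H ∧ Unfolds T K ∧ DualHead R H K) ∧ R S T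

end Ty

/-- Typing contexts: partial functions from variables to types. -/
abbrev Ctx : Type := ℕ → Option Ty

namespace Ctx

/-- Extend a context by a variable with index `0`. -/
def push (Γ : Ctx) (T : Ty) : Ctx
  | 0 => some T
  | x + 1 => Γ x

/-- Assign the type `T` to `x`. -/
def set (Γ : Ctx) (x : ℕ) (T : Ty) : Ctx := Function.update Γ x (some T)

/-- Unrestricted contexts. -/
def Unr (Γ : Ctx) : Prop := ∀ x T, Γ x = some T → T.Unr

/-- Splitting of a single entry: unrestricted entries are shared, linear ones go to exactly one
side. -/
inductive SplitAt : Option Ty → Option Ty → Option Ty → Prop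
  | none : SplitAt none none none
  | un {T : Ty} : T.Unr → SplitAt (some T) (some T) (some T)
  | left {T : Ty} : ¬ T.Unr → SplitAt (some T) (some T) none
  | right {T : Ty} : ¬ T.Unr → SplitAt (some T) none (some T)

/-- Context splitting `Γ = Γ₁ ∘ Γ₂`. -/
def Split (Γ Γ₁ Γ₂ : Ctx) : Prop := ∀ x, SplitAt (Γ x) (Γ₁ x) (Γ₂ x)

end Ctx

/-- Typing of values `Γ ⊢ v : T`, with subsumption. -/
inductive HasVal : Ctx → Val → Ty → Prop
  | unit {Γ} : Γ.Unr → HasVal Γ .unit .unit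
  | tt {Γ} : Γ.Unr → HasVal Γ .tt .bool
  | ff {Γ} : Γ.Unr → HasVal Γ .ff .bool
  | var {Γ : Ctx} {x T} : Γ x = some T → (∀ y U, y ≠ x → Γ y = some U → U.Unr) →
      HasVal Γ (.var x) T
  | sub {Γ v S T} : HasVal Γ v S → S.SubTy T → HasVal Γ v T

open Mix in
/-- `BranchCtx Γ pre S Δ`: in the context `Γ`, the prefix `pre` carries a payload of type `S`
and its continuation has to be typed in `Δ`. -/
inductive BranchCtx : Ctx → Pre → Ty → Ctx → Prop
  | out {Γ Γ₁ Γ₂ : Ctx} {l v S} : Γ.Split Γ₁ Γ₂ → HasVal Γ₁ v S →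
      BranchCtx Γ (.out l v) S Γ₂
  | inp {Γ : Ctx} {l S} : BranchCtx Γ (.inp l) S (Γ.push S)

open Mix in
/-- Typing derivations `Γ ⊢ P`. The encoding is a function on derivations, which are therefore
data. There is one rule for choices on subjects of linear type (where the process has to be
linear and the subject takes the type of the respective continuation) and one for choices on
subjects of unrestricted type (which keep their type). In both, the label-polarity pairs of the
process are those of the type, and an unrestricted choice needs an unrestricted context. -/
inductive Typing : Ctx → Proc → Type
  | nil {Γ : Ctx} : Γ.Unr → Typing Γ .nil
  | par {Γ Γ₁ Γ₂ : Ctx} {P Q : Proc} : Γ.Split Γ₁ Γ₂ → Typing Γ₁ P → Typing Γ₂ Q →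
      Typing Γ (.par P Q)
  | res {Γ : Ctx} {S T : Ty} {P : Proc} : S.Dual T → Typing ((Γ.push T).push S) P →
      Typing Γ (.res P)
  | cond {Γ Γ₁ Γ₂ : Ctx} {v : Val} {P Q : Proc} : Γ.Split Γ₁ Γ₂ → HasVal Γ₁ v .bool →
      Typing Γ₂ P → Typing Γ₂ Q → Typing Γ (.cond v P Q)
  | choiceLin {Γ Γ₁ Γ₂ : Ctx} {x n : ℕ} {pre : Fin n → Pre} {cont : Fin n → Proc}
      {Δ : Fin n → Ctx} (w : View) {dom : Finset Key} {pay cty : {a : Key // a ∈ dom} → Ty}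
      (split : Γ.Split Γ₁ Γ₂) (subject : HasVal Γ₁ (.var x) (.lin w dom pay cty))
      (mem : ∀ i, (pre i).key ∈ dom) (cover : ∀ a ∈ dom, ∃ i, (pre i).key = a)
      (branch : ∀ i, BranchCtx (Γ₂.set x (cty ⟨_, mem i⟩)) (pre i) (pay ⟨_, mem i⟩) (Δ i))
      (body : ∀ i, Typing (Δ i) (cont i)) :
      Typing Γ (.choice .lin (.var x) n pre cont)
  | choiceUn {Γ Γ₁ Γ₂ : Ctx} {q : Qual} {x n : ℕ} {pre : Fin n → Pre} {cont : Fin n → Proc}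
      {Δ : Fin n → Ctx} (w : View) {dom : Finset Key} {pay : {a : Key // a ∈ dom} → Ty}
      (qual : q = .un → Γ.Unr)
      (split : Γ.Split Γ₁ Γ₂) (subject : HasVal Γ₁ (.var x) (.un w dom pay))
      (mem : ∀ i, (pre i).key ∈ dom) (cover : ∀ a ∈ dom, ∃ i, (pre i).key = a)
      (branch : ∀ i, BranchCtx Γ₂ (pre i) (pay ⟨_, mem i⟩) (Δ i))
      (body : ∀ i, Typing (Δ i) (cont i)) :
      Typing Γ (.choice q (.var x) n pre cont)

/-! ### The calculus with separate choice -/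

namespace CMV

/-- Labels of selections and branchings: a label of mixed sessions decorated with a polarity
(`l_!` or `l_?`), or an auxiliary label `l₀, l₁, …`. -/
inductive Lab
  | tag (a : Key)
  | idx (i : ℕ)
  deriving DecidableEq

/-- Processes: output `x!v.P`, input `q x?y.P` (replicated if unrestricted), selection `x ◁ l.P`,
and branching `x ▷ {lᵢ : Pᵢ}` with pairwise different labels. -/
inductive Proc
  | out (x v : Val) (P : Proc)
  | inp (q : Qual) (x : Val) (P : Proc)
  | sel (x : Val) (l : Lab) (P : Proc)
  | bran (x : Val) (n : ℕ) (lab : Fin n ↪ Lab) (P : Fin n → Proc)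
  | par (P Q : Proc)
  | res (P : Proc)
  | cond (v : Val) (P Q : Proc)
  | nil

/-- Capture-avoiding simultaneous substitution. -/
def Proc.subst : Proc → Subst → Proc
  | .out x v P, σ => .out (x.subst σ) (v.subst σ) (P.subst σ)
  | .inp q x P, σ => .inp q (x.subst σ) (P.subst σ.up)
  | .sel x l P, σ => .sel (x.subst σ) l (P.subst σ)
  | .bran x n lab P, σ => .bran (x.subst σ) n lab (fun i => (P i).subst σ)
  | .par P Q, σ => .par (P.subst σ) (Q.subst σ)
  | .res P, σ => .res (P.subst σ.up.up)
  | .cond v P Q, σ => .cond (v.subst σ) (P.subst σ) (Q.subst σ)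
  | .nil, _ => .nil

/-- Structural congruence. -/
inductive Cong : Proc → Proc → Prop
  | refl (P) : Cong P P
  | symm {P Q} : Cong P Q → Cong Q P
  | trans {P Q R} : Cong P Q → Cong Q R → Cong P R
  | out {x v P P'} : Cong P P' → Cong (.out x v P) (.out x v P')
  | inp {q x P P'} : Cong P P' → Cong (.inp q x P) (.inp q x P')
  | sel {x l P P'} : Cong P P' → Cong (.sel x l P) (.sel x l P')
  | bran {x n lab P P'} : (∀ i, Cong (P i) (P' i)) → Cong (.bran x n lab P) (.bran x n lab P')
  | par {P P' Q Q'} : Cong P P' → Cong Q Q' → Cong (.par P Q) (.par P' Q')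
  | res {P P'} : Cong P P' → Cong (.res P) (.res P')
  | cond {v P P' Q Q'} : Cong P P' → Cong Q Q' → Cong (.cond v P Q) (.cond v P' Q')
  | par_nil (P) : Cong (.par P .nil) P
  | par_comm (P Q) : Cong (.par P Q) (.par Q P)
  | par_assoc (P Q R) : Cong (.par P (.par Q R)) (.par (.par P Q) R)
  | res_nil : Cong (.res .nil) .nil
  | res_swap (P) : Cong (.res P) (.res (P.subst (Subst.ofRen swapEnds)))
  | res_res (P) : Cong (.res (.res P)) (.res (.res (P.subst (Subst.ofRen swapRes))))
  | res_par (P Q) : Cong (.par P (.res Q)) (.res (.par (P.subst (Subst.shift 2)) Q))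

/-- What remains after the input `C` was used and continues as `P`. -/
def leave : Qual → Proc → Proc → Proc
  | .lin, _, P => P
  | .un, C, P => .par P C

/-- Reduction. -/
inductive Step : Proc → Proc → Prop
  | cond_tt (P Q) : Step (.cond .tt P Q) P
  | cond_ff (P Q) : Step (.cond .ff P Q) Q
  | com (q : Qual) (v : Val) (P Q R : Proc) :
      Step (.res (.par (.par (.out (.var 0) v P) (.inp q (.var 1) Q)) R))
        (.res (.par (.par P (leave q (.inp q (.var 1) Q) (Q.subst (Subst.inst v)))) R))
  | sel {n : ℕ} {lab : Fin n ↪ Lab} (j : Fin n) (P : Proc) (Q : Fin n → Proc) (R : Proc) :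
      Step (.res (.par (.par (.sel (.var 0) (lab j) P) (.bran (.var 1) n lab Q)) R))
        (.res (.par (.par P (Q j)) R))
  | par {P P'} (Q) : Step P P' → Step (.par P Q) (.par P' Q)
  | res {P P'} : Step P P' → Step (.res P) (.res P')
  | struct {P Q Q' P'} : Cong P Q → Step Q Q' → Cong Q' P' → Step P P'

/-- `T ⟹ T'`. -/
abbrev Steps : Proc → Proc → Prop := Reduces Step

/-- `Barb P x`: `P` has an unguarded output, input, selection or branching on the free
endpoint `x`. -/
inductive Barb : Proc → ℕ → Prop
  | out {x v P} : Barb (.out (.var x) v P) x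
  | inp {q x P} : Barb (.inp q (.var x) P) x
  | sel {x l P} : Barb (.sel (.var x) l P) x
  | bran {x n lab P} : Barb (.bran (.var x) n lab P) x
  | par_left {P Q x} : Barb P x → Barb (.par P Q) x
  | par_right {P Q x} : Barb Q x → Barb (.par P Q) x
  | res {P x} : Barb P (x + 2) → Barb (.res P) x

/-- Bisimilarity `≈` on the calculus with separate choice. -/
abbrev Bisim : Proc → Proc → Prop := Bisimilar Step Barb

end CMV

/-! ### The encoding -/

namespace Encoding

open CMV

/-- Parallel composition of a list of processes. -/
def parList : List CMV.Proc → CMV.Proc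
  | [] => .nil
  | P :: Ps => .par P (parList Ps)

/-- The auxiliary labels. -/
def idxLab (n : ℕ) : Fin n ↪ Lab :=
  ⟨fun i => .idx i, fun i j h => Fin.ext (by simpa using h)⟩

/-- Nondeterministic choice: `(ν s t) (s ▷ {lᵢ : Pᵢ} | ∏ᵢ t ◁ lᵢ.0)` with fresh `s, t`. -/
def ndChoice {n : ℕ} (P : Fin n → CMV.Proc) : CMV.Proc :=
  .res (.par (.bran (.var 0) n (idxLab n) (fun i => (P i).subst (Subst.shift 2)))
    (parList (List.ofFn (fun i : Fin n => .sel (.var 1) (.idx i) .nil))))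

/-- The branches of a choice: their prefixes, and the translations of their continuations. -/
structure Branches where
  n : ℕ
  pre : Fin n → Mix.Pre
  cont : Fin n → CMV.Proc

namespace Branches

/-- Weakening by `k` fresh indices. -/
def shift (B : Branches) (k : ℕ) : Branches where
  n := B.n
  pre i := (B.pre i).subst (Subst.shift k)
  cont i := (B.cont i).subst ((B.pre i).up (Subst.shift k))

/-- The label-polarity pairs that occur in the branches, without repetition. -/
def keys (B : Branches) : List Key := (List.ofFn fun i => (B.pre i).key).dedup

/-- The branches with label and polarity `a`. -/
def group (B : Branches) (a : Key) : List (Fin B.n) :=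
  (List.finRange B.n).filter fun i => (B.pre i).key = a

/-- Transmission of the value of branch `i` along `y`: `y!v.Q` or `lin y?z.Q`. -/
def comm (B : Branches) (y : Val) (i : Fin B.n) : CMV.Proc :=
  match B.pre i with
  | .out _ v => .out y v (B.cont i)
  | .inp _ => .inp .lin y (B.cont i)

/-- Nondeterministically pick one of the branches with label and polarity `a`, along `y`. -/
def deliver (B : Branches) (y : Val) (a : Key) : CMV.Proc :=
  ndChoice fun j : Fin (B.group a).length => B.comm y ((B.group a).get j)

/-- The labels by which an external choice is offered: polarities are dualised. -/
def extLab (B : Branches) : Fin B.keys.length ↪ Lab :=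
  ⟨fun j => .tag (B.keys.get j).dual, fun i j h => by
    have hd : B.keys.Nodup := List.nodup_dedup _
    have h1 : Key.dual (B.keys.get i) = Key.dual (B.keys.get j) := by simpa using h
    have h2 : ∀ a b : Key, Key.dual a = Key.dual b → a = b := by
      rintro ⟨l, p⟩ ⟨m, q⟩ hab
      cases p <;> cases q <;> simp_all [Key.dual, Pol.dual]
    exact List.nodup_iff_injective_get.1 hd (h2 _ _ h1)⟩

/-- The external choice on `y`. -/
def offer (B : Branches) (y : Val) : CMV.Proc :=
  .bran y B.keys.length B.extLab fun j => B.deliver y (B.keys.get j)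

/-- Internal choice, linear subject: pick a label-polarity pair, select it on `x`, transmit. -/
def linInt (B : Branches) (x : Val) : CMV.Proc :=
  ndChoice fun j : Fin B.keys.length =>
    .sel x (.tag (B.keys.get j)) (B.deliver x (B.keys.get j))

/-- Internal choice, unrestricted subject: pick a label-polarity pair, send one end `c` of a
fresh channel `(ν c d)` along `x`, select on `d`, transmit on `d`. -/
def unInt (B : Branches) (x : Val) : CMV.Proc :=
  ndChoice fun j : Fin B.keys.length =>
    .res (.out (x.subst (Subst.shift 2)) (.var 0)
      (.sel (.var 1) (.tag (B.keys.get j)) ((B.shift 2).deliver (.var 1) (B.keys.get j))))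

/-- External choice, unrestricted subject: receive `c` along `x` and offer the choice on `c`. -/
def unExt (B : Branches) (q : Qual) (x : Val) : CMV.Proc :=
  .inp q x ((B.shift 1).offer (.var 0))

/-- Add the output `u!().0` to all continuations (below an input, `u` has index `u + 1`). -/
def rearm (B : Branches) (u : ℕ) : Branches where
  n := B.n
  pre := B.pre
  cont i := match B.pre i with
    | .out _ _ => .par (.out (.var u) .unit .nil) (B.cont i)
    | .inp _ => .par (.out (.var (u + 1)) .unit .nil) (B.cont i)

end Branches

/-- The translation of a choice `q x B` on a subject of linear type with view `w`. -/
def encLin (w : View) (x : Val) (B : Branches) : CMV.Proc :=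
  match w with
  | .int => B.linInt x
  | .ext => B.offer x

/-- The translation of a choice `q x B` on a subject of unrestricted type with view `w`. An
unrestricted internal choice becomes a loop `(ν u v) (u!().0 | un v?_.C)`, where every
continuation within `C` re-activates the loop by `u!().0`. -/
def encUn (w : View) (q : Qual) (x : Val) (B : Branches) : CMV.Proc :=
  match w, q with
  | .ext, q => B.unExt q x
  | .int, .lin => B.unInt x
  | .int, .un =>
      .res (.par (.out (.var 0) .unit .nil)
        (.inp .un (.var 1) (((B.shift 3).rearm 1).unInt (x.subst (Subst.shift 3)))))

end Encoding

/-- The encoding of typed mixed-session processes `Γ ⊢ P` into the calculus with separate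
choice. -/
def enc : {Γ : Ctx} → {P : Mix.Proc} → Typing Γ P → CMV.Proc
  | _, _, .nil _ => .nil
  | _, _, .par _ d e => .par (enc d) (enc e)
  | _, _, .res _ d => .res (enc d)
  | _, _, .cond (v := v) _ _ d e => .cond v (enc d) (enc e)
  | _, _, .choiceLin (x := x) (n := n) (pre := pre) w _ _ _ _ _ body =>
      Encoding.encLin w (.var x) ⟨n, pre, fun i => enc (body i)⟩
  | _, _, .choiceUn (q := q) (x := x) (n := n) (pre := pre) w _ _ _ _ _ _ body =>
      Encoding.encUn w q (.var x) ⟨n, pre, fun i => enc (body i)⟩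

end MixedSessions

/-! One source communication is carried out by the encoding in several target steps: resolve the
internal choice, possibly exchange a private session channel, select a label, pick a branch on
either side, and finally transmit the value. The proof attaches to every reachable target process a
typed source process that moves only at the final transmission or at a conditional; all other steps
are administrative.

Processes of both calculi are flattened to multisets of threads over global channel names.
Structural congruence then becomes a change of channels together with congruence inside
continuations (`Cong.flattens`), and reduction rewrites one or two threads (`Rep.step`, `Rep.real`).
The threads of a reachable target configuration are grouped into items, each recording how far the
protocol for one choice, or for two connected choices, has progressed; what fired nondeterministic
choices leave behind is dead. The invariant `Inv` says that the choices represented by the items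
form a typed configuration reachable from the source. Typing enters in three ways: the two ends of a
channel carry dual types, so an internal choice meets an external one that offers each of its
labels; a linear endpoint is the subject of at most one thread; and subject reduction keeps all this
true. `Inv.trans_of_mstep` shows that target reductions only move items along the protocol,
`Trans.inv` that such a move performs at most one source reduction, and `Trans.mstep` that each move
is a target reduction.

The difficulty lies in early commitment: once an internal choice has been resolved to a label, the
target may be unable to do what the represented source process still can. Therefore the final target
process is chosen extremal. Among the configurations reachable from the given one without a
communication in progress, take one with as many observable free names as possible and, among those,
as few resolved but uncommunicated internal choices as possible (`World.exists_good`). A maximum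
exists because all observable names lie below a fixed bound. Such a configuration can imitate every
reduction of its source (`Good.follow`): the only obstacle is a committed internal choice, but its
partner is present and offers the label, so the committed communication could be completed. This
would lower the number of commitments without losing an observable name, contrary to the choice.

The bisimulation is then simple. Source reductions consume no choice on a free name, so observable
names are never lost; in an extremal configuration they also cannot grow. Every target process that
represents the same source configuration as an extremal one has exactly these names as weak barbs,
and this class, `Like`, is closed under reduction. Any two of its members are bisimilar, each move
of one being answered by the other doing nothing. The extremal target process and the encoding of
its source process both belong to the class. -/

namespace MixedSessions

/-! ### Substitutions -/

namespace Subst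

/-- Composition of substitutions: first `σ`, then `τ`. -/
def comp (σ τ : Subst) : Subst := fun x => (σ x).subst τ

/-- The substitution that replaces the two innermost indices by the variables `a` and `b`. -/
def opn (a b : ℕ) : Subst
  | 0 => .var a
  | 1 => .var b
  | x + 2 => .var x

end Subst

theorem Val.subst_subst (v : Val) (σ τ : Subst) :
    (v.subst σ).subst τ = v.subst (σ.comp τ) := by
  cases v <;> rfl

@[simp] theorem Val.subst_var (v : Val) : v.subst .var = v := by
  cases v <;> rfl

@[simp] theorem Subst.up_var : Subst.up .var = .var := by
  funext x; cases x <;> rfl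

theorem Subst.up_comp (σ τ : Subst) : (σ.comp τ).up = σ.up.comp τ.up := by
  funext x
  cases x with
  | zero => rfl
  | succ x =>
    show ((σ x).subst τ).subst _ = ((σ x).subst _).subst _
    rw [Val.subst_subst, Val.subst_subst]; rfl

/-- This commutation lets a substitution pass the instantiation of a received value, so
communications survive the opening and closing of restrictions. -/
theorem Subst.up_inst (σ : Subst) (v : Val) :
    σ.up.comp (Subst.inst (v.subst σ)) = (Subst.inst v).comp σ := by
  funext x
  cases x with
  | zero => rfl
  | succ x =>
    show ((σ x).subst _).subst _ = σ x
    rw [Val.subst_subst]; exact Val.subst_var _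

@[simp] theorem Subst.shift_two_opn (a b : ℕ) : (Subst.shift 2).comp (Subst.opn a b) = .var := by
  funext x; rfl

theorem Subst.shift_comp_up (σ : Subst) :
    (Subst.shift 1).comp σ.up = σ.comp (Subst.shift 1) := by
  funext x; rfl

theorem Subst.shift_two_comp_up (σ : Subst) :
    (Subst.shift 2).comp σ.up.up = σ.comp (Subst.shift 2) := by
  funext x
  show ((σ x).subst _).subst _ = (σ x).subst _
  rw [Val.subst_subst]; rfl

theorem Subst.up_up_opn (σ : Subst) (a b : ℕ) (x : ℕ) :
    σ.up.up.comp (Subst.opn a b) (x + 2) = σ x := by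
  show (((σ x).subst _).subst _).subst _ = _
  rw [Val.subst_subst, Val.subst_subst]; exact Val.subst_var _

@[simp] theorem Mix.Pre.key_subst (p : Mix.Pre) (σ : Subst) : (p.subst σ).key = p.key := by
  cases p <;> rfl

theorem Mix.Pre.subst_subst (p : Mix.Pre) (σ τ : Subst) :
    (p.subst σ).subst τ = p.subst (σ.comp τ) := by
  cases p with
  | out l v => simp [Pre.subst, Val.subst_subst]
  | inp l => rfl

@[simp] theorem Mix.Pre.subst_var (p : Mix.Pre) : p.subst .var = p := by
  cases p <;> simp [Pre.subst]

theorem Mix.Pre.up_comp (p : Mix.Pre) (σ τ : Subst) :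
    p.up (σ.comp τ) = (p.up σ).comp ((p.subst σ).up τ) := by
  cases p with
  | out l v => rfl
  | inp l => exact Subst.up_comp σ τ

@[simp] theorem Mix.Pre.up_var (p : Mix.Pre) : p.up .var = .var := by
  cases p <;> simp [Pre.up]

theorem CMV.Proc.subst_subst (P : CMV.Proc) (σ τ : Subst) :
    (P.subst σ).subst τ = P.subst (σ.comp τ) := by
  induction P generalizing σ τ <;> simp_all [CMV.Proc.subst, Val.subst_subst, Subst.up_comp]

@[simp] theorem CMV.Proc.subst_var (P : CMV.Proc) : P.subst .var = P := by
  induction P <;> simp_all [CMV.Proc.subst]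

/-! ### Source processes annotated with the data that the encoding reads off a derivation -/

/-- Processes of mixed sessions in which each choice records the typing rule used for its subject
(linear or unrestricted) and the view of the type of the subject. -/
inductive AProc
  | choice (lu : Qual) (w : View) (q : Qual) (x : Val) (n : ℕ) (pre : Fin n → Mix.Pre)
      (cont : Fin n → AProc)
  | par (P Q : AProc)
  | res (P : AProc)
  | cond (v : Val) (P Q : AProc)
  | nil

namespace AProc

/-- Capture-avoiding simultaneous substitution. -/
def subst : AProc → Subst → AProc
  | .choice lu w q x n pre cont, σ =>
      .choice lu w q (x.subst σ) n (fun i => (pre i).subst σ)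
        (fun i => (cont i).subst ((pre i).up σ))
  | .par P Q, σ => .par (P.subst σ) (Q.subst σ)
  | .res P, σ => .res (P.subst σ.up.up)
  | .cond v P Q, σ => .cond (v.subst σ) (P.subst σ) (Q.subst σ)
  | .nil, _ => .nil

/-- Forget the annotations. -/
def erase : AProc → Mix.Proc
  | .choice _ _ q x n pre cont => .choice q x n pre (fun i => (cont i).erase)
  | .par P Q => .par P.erase Q.erase
  | .res P => .res P.erase
  | .cond v P Q => .cond v P.erase Q.erase
  | .nil => .nil

/-- The encoding, as a function of annotated processes. -/
def enc : AProc → CMV.Proc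
  | .choice lu w q x n pre cont =>
      match lu with
      | .lin => Encoding.encLin w x ⟨n, pre, fun i => (cont i).enc⟩
      | .un => Encoding.encUn w q x ⟨n, pre, fun i => (cont i).enc⟩
  | .par P Q => .par P.enc Q.enc
  | .res P => .res P.enc
  | .cond v P Q => .cond v P.enc Q.enc
  | .nil => .nil

theorem subst_subst (P : AProc) (σ τ : Subst) :
    (P.subst σ).subst τ = P.subst (σ.comp τ) := by
  induction P generalizing σ τ <;>
    simp_all [AProc.subst, Val.subst_subst, Subst.up_comp, Mix.Pre.subst_subst, Mix.Pre.up_comp]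

@[simp] theorem subst_var (P : AProc) : P.subst .var = P := by
  induction P <;> simp_all [AProc.subst]

theorem erase_subst (P : AProc) (σ : Subst) : (P.subst σ).erase = P.erase.subst σ := by
  induction P generalizing σ <;> simp_all [AProc.subst, AProc.erase, Mix.Proc.subst]

end AProc

/-! ### Names

Configurations use global names: `2 * x` for the free variable `x`, and `nm k false`, `nm k true`
for the two ends of the channel `k`. -/

/-- The names of the ends of channel `k`. -/
def nm (k : ℕ) (o : Bool) : ℕ := 4 * k + (if o then 3 else 1)

@[simp] theorem nm_inj {k l : ℕ} {o p : Bool} : nm k o = nm l p ↔ k = l ∧ o = p := by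
  unfold nm
  cases o <;> cases p <;> simp <;> omega

@[simp] theorem nm_ne_even {k x : ℕ} {o : Bool} : nm k o ≠ 2 * x := by
  unfold nm; cases o <;> simp <;> omega

@[simp] theorem even_ne_nm {k x : ℕ} {o : Bool} : 2 * x ≠ nm k o := nm_ne_even.symm

theorem even_or_nm (y : ℕ) : (∃ x, y = 2 * x) ∨ ∃ k o, y = nm k o := by
  rcases Nat.even_or_odd' y with ⟨c, h | h⟩
  · exact .inl ⟨c, h⟩
  · rcases Nat.even_or_odd' c with ⟨k, h' | h'⟩
    · exact .inr ⟨k, false, by simp [nm]; omega⟩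
    · exact .inr ⟨k, true, by simp [nm]; omega⟩

/-- The names of free variables. -/
def freeNm : Subst := Subst.ofRen (2 * ·)

/-- The names of the ends of the channels in `K`. -/
def names (K : Multiset ℕ) : Set ℕ := {x | ∃ k ∈ K, ∃ o, x = nm k o}

/-- All names of free variables. -/
def evens : Set ℕ := {x | ∃ y, x = 2 * y}

/-! ### Flattening of processes, for both calculi at once -/

/-- What the two calculi have in common: parallel composition, restriction and structural
congruence. Everything else is a thread. -/
class PCalc (α : Type) where
  nil : α
  par : α → α → α
  res : α → α
  subst : α → Subst → α
  thr : α → Prop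
  cong : α → α → Prop
  subst_nil : ∀ σ, subst nil σ = nil
  subst_par : ∀ P Q σ, subst (par P Q) σ = par (subst P σ) (subst Q σ)
  subst_res : ∀ P σ, subst (res P) σ = res (subst P σ.up.up)
  subst_subst : ∀ P σ τ, subst (subst P σ) τ = subst P (σ.comp τ)
  subst_var : ∀ P, subst P .var = P
  par_inj : ∀ {P Q P' Q'}, par P Q = par P' Q' → P = P' ∧ Q = Q'
  res_inj : ∀ {P P'}, res P = res P' → P = P'
  refl : ∀ P, cong P P
  symm : ∀ {P Q}, cong P Q → cong Q P
  trans : ∀ {P Q R}, cong P Q → cong Q R → cong P R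
  par_cong : ∀ {P P' Q Q'}, cong P P' → cong Q Q' → cong (par P Q) (par P' Q')
  res_cong : ∀ {P P'}, cong P P' → cong (res P) (res P')
  par_nil : ∀ P, cong (par P nil) P
  par_comm : ∀ P Q, cong (par P Q) (par Q P)
  par_assoc : ∀ P Q R, cong (par P (par Q R)) (par (par P Q) R)
  res_swap : ∀ P, cong (res P) (res (subst P (Subst.ofRen swapEnds)))
  res_res : ∀ P, cong (res (res P)) (res (res (subst P (Subst.ofRen swapRes))))
  res_par : ∀ P Q, cong (par P (res Q)) (res (par (subst P (Subst.shift 2)) Q))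

namespace PCalc

variable {α : Type} [PCalc α]

/-- `Flat P K t`: opening the restrictions of `P` with names of the channels in `K` and dissolving
parallel compositions yields the threads `t`. -/
inductive Flat : α → Multiset ℕ → Multiset α → Prop
  | nil : Flat nil 0 0
  | par {P Q K L t u} : Flat P K t → Flat Q L u → Flat (par P Q) (K + L) (t + u)
  | res {P K t} (k : ℕ) (o : Bool) :
      Flat (subst P (Subst.opn (nm k o) (nm k !o))) K t → Flat (res P) (k ::ₘ K) t
  | thr {P} : thr P → Flat P 0 {P}

/-- `Supp F P`: all free variables of `P` are in `F`. -/
def Supp (F : Set ℕ) (P : α) : Prop :=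
  ∀ σ τ : Subst, (∀ x ∈ F, σ x = τ x) → subst P σ = subst P τ

/-- Parallel composition of a list. -/
def parL : List α → α
  | [] => nil
  | P :: l => par P (parL l)

/-- Extend `ρ`, which closes names, under the restriction of the channel `k`. -/
def ext (k : ℕ) (ρ : Subst) : Subst := fun x =>
  if x = nm k false then .var 0 else if x = nm k true then .var 1 else (ρ x).subst (Subst.shift 2)

/-- The process with the restrictions `K` and the threads `t`. -/
def NF : List ℕ → Subst → List α → α
  | [], ρ, t => parL (t.map (subst · ρ))
  | k :: K, ρ, t => res (NF K (ext k ρ) t)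

theorem Supp.mono {F G : Set ℕ} {P : α} (h : Supp F P) (hFG : F ⊆ G) : Supp G P :=
  fun σ τ hστ => h σ τ fun x hx => hστ x (hFG hx)

theorem Supp.par {F : Set ℕ} {P Q : α} (h : Supp F (par P Q)) : Supp F P ∧ Supp F Q := by
  refine ⟨fun σ τ hh => ?_, fun σ τ hh => ?_⟩ <;>
  · have := h σ τ hh
    rw [subst_par, subst_par] at this
    simp [par_inj this]

/-- Injectivity of `res` turns agreement on the restriction into agreement of the bodies under two
lifted binders. Substituting the values at `a` and `b` for the two bound indices converts this into
agreement on the opened body. -/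
theorem Supp.res {F : Set ℕ} {P : α} (h : Supp F (res P)) (a b : ℕ) :
    Supp (F ∪ {a, b}) (subst P (Subst.opn a b)) := by
  intro σ τ hh
  have h1 := h σ τ fun x hx => hh x (.inl hx)
  rw [subst_res, subst_res] at h1
  simp only [subst_subst]
  have h3 := congrArg (fun P => subst P
    (fun | 0 => σ a | 1 => σ b | x + 2 => .var x)) (res_inj h1)
  simp only [subst_subst] at h3
  -- The values are written with `σ`, yet the identity is needed for `σ` and `τ`; they agree at `a`
  -- and `b`.
  have key : ∀ υ : Subst, υ a = σ a → υ b = σ b →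
      Subst.comp υ.up.up (fun | 0 => σ a | 1 => σ b | x + 2 => .var x) =
        (Subst.opn a b).comp υ := by
    intro υ ha hb
    funext x
    match x with
    | 0 => exact ha.symm
    | 1 => exact hb.symm
    | x + 2 =>
      show (((υ x).subst _).subst _).subst _ = υ x
      rw [Val.subst_subst, Val.subst_subst]; exact Val.subst_var _
  rw [key σ rfl rfl, key τ (hh a (.inr (by simp))).symm (hh b (.inr (by simp))).symm] at h3
  exact h3

/-- Each opened restriction adds only the two ends of its own channel to the support. -/
theorem Supp.flat {P : α} {K : Multiset ℕ} {t : Multiset α} (h : Flat P K t) :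
    ∀ {F : Set ℕ}, Supp F P → ∀ Q ∈ t, Supp (F ∪ names K) Q := by
  induction h with
  | nil => simp
  | par _ _ ih1 ih2 =>
    intro F hF Q hQ
    rcases Multiset.mem_add.1 hQ with hQ | hQ
    · exact (ih1 hF.par.1 Q hQ).mono (Set.union_subset_union_right _ fun x ⟨k, hk, h⟩ =>
        ⟨k, Multiset.mem_add.2 (.inl hk), h⟩)
    · exact (ih2 hF.par.2 Q hQ).mono (Set.union_subset_union_right _ fun x ⟨k, hk, h⟩ =>
        ⟨k, Multiset.mem_add.2 (.inr hk), h⟩)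
  | res k o _ ih =>
    intro F hF Q hQ
    refine (ih (hF.res _ _) Q hQ).mono ?_
    rintro x ((hx | rfl | rfl) | ⟨l, hl, h⟩)
    · exact .inl hx
    · exact .inr ⟨k, by simp, o, rfl⟩
    · exact .inr ⟨k, by simp, !o, rfl⟩
    · exact .inr ⟨l, by simp [hl], h⟩
  | thr _ =>
    intro F hF Q hQ
    rw [Multiset.mem_singleton.1 hQ]
    exact hF.mono Set.subset_union_left

theorem parL_perm {l l' : List α} (h : l.Perm l') : cong (parL l) (parL l') := by
  induction h with
  | nil => exact refl _
  | cons P _ ih => exact par_cong (refl _) ih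
  | swap P Q l =>
    exact trans (par_assoc _ _ _) (trans (par_cong (par_comm _ _) (refl _)) (symm (par_assoc _ _ _)))
  | trans _ _ ih1 ih2 => exact trans ih1 ih2

theorem NF_perm_threads (K : List ℕ) (ρ : Subst) {t t' : List α} (h : t.Perm t') :
    cong (NF K ρ t) (NF K ρ t') := by
  induction K generalizing ρ with
  | nil => exact parL_perm (h.map _)
  | cons k K ih => exact res_cong (ih _)

theorem subst_parL (l : List α) (σ : Subst) : subst (parL l) σ = parL (l.map (subst · σ)) := by
  induction l with
  | nil => exact subst_nil σ
  | cons P l ih => simp [parL, subst_par, ih]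

theorem ext_comp (k : ℕ) (ρ τ : Subst) : (ext k ρ).comp τ.up.up = ext k (ρ.comp τ) := by
  funext x
  show (ext k ρ x).subst τ.up.up = ext k (ρ.comp τ) x
  unfold ext
  split_ifs with h1 h2
  · rfl
  · rfl
  · rw [Val.subst_subst, Subst.shift_two_comp_up, ← Val.subst_subst]; rfl

theorem NF_subst (K : List ℕ) (ρ τ : Subst) (t : List α) :
    subst (NF K ρ t) τ = NF K (ρ.comp τ) t := by
  induction K generalizing ρ τ with
  | nil => simp [NF, subst_parL, List.map_map, Function.comp_def, subst_subst]
  | cons k K ih => rw [NF, subst_res, ih, ext_comp, NF]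

/-- A common prefix of restrictions is a context. The relation stands for congruence as well as for
reduction, and the hypothesis ranges over all closing substitutions because these change under every
restriction. -/
theorem NF_append {R : α → α → Prop} (hR : ∀ {P Q}, R P Q → R (res P) (res Q)) (K : List ℕ)
    {L L' : List ℕ} {t t' : List α} (h : ∀ ρ, R (NF L ρ t) (NF L' ρ t')) (ρ : Subst) :
    R (NF (K ++ L) ρ t) (NF (K ++ L') ρ t') := by
  induction K generalizing ρ with
  | nil => exact h ρ
  | cons k K ih => exact hR (ih _)

/-- Neighbouring channels are exchanged by `res_res`. With a repeated channel the inner restriction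
would shadow the outer one, so distinctness matters. -/
theorem NF_perm_chans {K K' : List ℕ} (h : K.Perm K') (hK : K.Nodup) (ρ : Subst) (t : List α) :
    cong (NF K ρ t) (NF K' ρ t) := by
  induction h generalizing ρ with
  | nil => exact refl _
  | cons k _ ih => exact res_cong (ih (List.nodup_cons.1 hK).2 _)
  | swap k l K =>
    have hkl : l ≠ k := by
      intro h; simp [h] at hK
    refine trans (res_res _) ?_
    rw [NF_subst]
    have : (ext k (ext l ρ)).comp (Subst.ofRen swapRes) = ext l (ext k ρ) := by
      funext x
      unfold ext Subst.comp
      by_cases h1 : x = nm k false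
      · subst h1; simp [Ne.symm hkl, Val.subst, Subst.shift, Subst.ofRen, swapRes]
      by_cases h2 : x = nm k true
      · subst h2; simp [Ne.symm hkl, Val.subst, Subst.shift, Subst.ofRen, swapRes]
      by_cases h3 : x = nm l false
      · subst h3; simp [hkl, Val.subst, Subst.shift, Subst.ofRen, swapRes]
      by_cases h4 : x = nm l true
      · subst h4; simp [hkl, Val.subst, Subst.shift, Subst.ofRen, swapRes]
      simp only [h1, h2, h3, h4, if_false]
      simp only [Val.subst_subst]
      rfl
    rw [this]
    exact refl _
  | trans h1 _ ih1 ih2 => exact trans (ih1 hK _) (ih2 (h1.nodup_iff.1 hK) _)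

/-- Dissolving a parallel composition is associativity; opening a restriction is scope extrusion
over the remaining threads `r`, followed by an exchange of endpoints if `o` is `true`. Extrusion is
sound since the new channels avoid `F`, which supports both the process and `r`. -/
theorem NF_flat_base {P : α} {KP : Multiset ℕ} {tP : Multiset α} (hP : Flat P KP tP) :
    ∀ {F : Set ℕ} {Kl : List ℕ} {tl r : List α} (ρ : Subst), (Kl : Multiset ℕ) = KP →
      (tl : Multiset α) = tP → KP.Nodup → Supp F P → (∀ Q ∈ r, Supp F Q) →
      (∀ k ∈ KP, ∀ o, nm k o ∉ F) → cong (NF [] ρ (P :: r)) (NF Kl ρ (tl ++ r)) := by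
  induction hP with
  | nil =>
    intro F Kl tl r ρ hKl htl _ _ _ _
    rw [Multiset.coe_eq_zero] at hKl htl
    subst hKl htl
    simp only [NF, parL, List.map_cons, List.nil_append, subst_nil]
    exact trans (par_comm _ _) (par_nil _)
  | @par P Q K L t u _ _ ih1 ih2 =>
    intro F Kl tl r ρ hKl htl hnd hPQ hr hF
    have hf1 : Flat P K t := by assumption
    obtain ⟨hP, hQ⟩ := hPQ.par
    obtain ⟨hK, hL, hKL⟩ := Multiset.nodup_add.1 hnd
    have e1 : cong (NF [] ρ (par P Q :: r)) (NF [] ρ (P :: Q :: r)) := by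
      simp only [NF, parL, List.map_cons, subst_par]
      exact symm (par_assoc _ _ _)
    have e2 := ih1 (F := F) (Kl := K.toList) (tl := t.toList) (r := Q :: r) ρ (by simp) (by simp) hK
      hP (by simpa using ⟨hQ, hr⟩) (fun k hk => hF k (by simp [hk]))
    have e3 : cong (NF K.toList ρ (t.toList ++ Q :: r)) (NF (K.toList ++ []) ρ (Q :: (t.toList ++ r))) := by
      rw [List.append_nil]
      exact NF_perm_threads _ _ List.perm_middle
    -- The threads obtained from `P` now belong to the rest, so the support set grows by the names
    -- of `K`; these differ from the channels of `Q` because all channels are distinct.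
    have e4 := NF_append (R := cong) res_cong K.toList (L := []) (L' := L.toList)
      (t := Q :: (t.toList ++ r)) (t' := u.toList ++ (t.toList ++ r))
      (fun ρ => ih2 (F := F ∪ names K) ρ (by simp) (by simp) hL (hQ.mono Set.subset_union_left) (by
        intro R hR
        rcases List.mem_append.1 hR with hR | hR
        · exact hP.flat hf1 R (by simpa using hR)
        · exact (hr R hR).mono Set.subset_union_left)
        (by
          rintro k hk o (h | ⟨l, hl, o', h⟩)
          · exact hF k (by simp [hk]) o h
          · rw [nm_inj] at h
            exact (Multiset.disjoint_left.1 hKL) hl (h.1 ▸ hk))) ρ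
    have pK : (K.toList ++ L.toList).Perm Kl := by
      rw [← Multiset.coe_eq_coe, ← Multiset.coe_add]; simp [hKl]
    have e5 := NF_perm_chans pK (by rw [← Multiset.coe_nodup, ← Multiset.coe_add]; simpa using hnd) ρ
      (u.toList ++ (t.toList ++ r))
    have e6 : cong (NF Kl ρ (u.toList ++ (t.toList ++ r))) (NF Kl ρ (tl ++ r)) := by
      refine NF_perm_threads _ _ ?_
      rw [← List.append_assoc]
      refine List.Perm.append_right _ ?_
      rw [← Multiset.coe_eq_coe, ← Multiset.coe_add, htl, add_comm]; simp
    exact trans e1 (trans e2 (trans e3 (trans e4 (trans e5 e6))))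
  | @res P K t k o _ ih =>
    intro F Kl tl r ρ hKl htl hnd hP hr hF
    obtain ⟨hk, hK⟩ := Multiset.nodup_cons.1 hnd
    have hkF : ∀ o, nm k o ∉ F := hF k (by simp)
    have e1 : cong (NF [] ρ (res P :: r)) (NF [k] ρ (subst P (Subst.opn (nm k o) (nm k !o)) :: r)) := by
      simp only [NF, parL, List.map_cons, subst_res]
      refine trans (par_comm _ _) (trans (res_par _ _) ?_)
      refine trans (res_cong (par_comm _ _)) ?_
      have hr' : subst (parL (r.map (subst · ρ))) (Subst.shift 2) =
          parL (r.map (subst · (ext k ρ))) := by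
        rw [subst_parL, List.map_map]
        congr 1
        refine List.map_congr_left fun Q hQ => ?_
        simp only [Function.comp, subst_subst]
        refine hr Q hQ _ _ fun x hx => ?_
        unfold ext Subst.comp
        rw [if_neg (by rintro rfl; exact hkF _ hx), if_neg (by rintro rfl; exact hkF _ hx)]
      -- Opening with names and closing them again restores the bound indices, up to an exchange
      -- when `o` is `true`.
      have hP' : subst (subst P (Subst.opn (nm k o) (nm k !o))) (ext k ρ) =
          subst (subst P ρ.up.up) (Subst.ofRen (if o then swapEnds else id)) := by
        have h := hP (ext k ρ) (ρ.comp (Subst.shift 2)) (by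
          intro x hx
          unfold ext Subst.comp
          rw [if_neg (by rintro rfl; exact hkF _ hx), if_neg (by rintro rfl; exact hkF _ hx)])
        rw [subst_res, subst_res] at h
        have h' := congrArg (subst · (fun
          | 0 => .var (if o then 1 else 0)
          | 1 => .var (if o then 0 else 1)
          | x + 2 => .var x)) (res_inj h)
        simp only [subst_subst] at h' ⊢
        convert h' using 2
        · funext x
          match x with
          | 0 => cases o <;> simp [Subst.comp, Subst.opn, Val.subst, ext, Subst.up]
          | 1 => cases o <;> simp [Subst.comp, Subst.opn, Val.subst, ext, Subst.up, Subst.shift, Subst.ofRen]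
          | x + 2 =>
            show ext k ρ x = (((ext k ρ x).subst _).subst _).subst _
            rw [Val.subst_subst, Val.subst_subst]; exact (Val.subst_var _).symm
        · funext x
          match x with
          | 0 => cases o <;> simp [Subst.comp, Val.subst, Subst.up, Subst.ofRen, swapEnds]
          | 1 => cases o <;> simp [Subst.comp, Val.subst, Subst.up, Subst.ofRen, swapEnds, Subst.shift]
          | x + 2 =>
            show (((ρ x).subst _).subst _).subst _ = ((((ρ x).subst _).subst _).subst _).subst _
            simp only [Val.subst_subst]
            congr 1
            funext y
            cases o <;> rfl
      rw [hr', hP']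
      cases o with
      | false =>
        have : Subst.ofRen (if false = true then swapEnds else id) = .var := rfl
        rw [this, subst_var]
        exact refl _
      | true =>
        refine trans (res_swap _) ?_
        rw [subst_par]
        -- The threads over which the scope was extruded are weakened by two, so they do not notice
        -- the exchange of endpoints.
        have : subst (parL (r.map (subst · (ext k ρ)))) (Subst.ofRen swapEnds) =
            parL (r.map (subst · (ext k ρ))) := by
          rw [← hr', subst_subst]; rfl
        rw [this]
        exact refl _
    have e2 := NF_append (R := cong) res_cong [k] (L := []) (L' := K.toList)
      (fun ρ => ih (F := F ∪ {nm k o, nm k !o}) (tl := tl) (r := r) ρ (by simp) htl hK (hP.res _ _)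
        (fun Q hQ => (hr Q hQ).mono Set.subset_union_left) (by
          rintro l hl o' (h | h | h)
          · exact hF l (by simp [hl]) _ h
          · rw [nm_inj] at h; exact hk (h.1 ▸ hl)
          · rw [Set.mem_singleton_iff, nm_inj] at h; exact hk (h.1 ▸ hl))) ρ
    refine trans e1 (trans e2 (NF_perm_chans ?_ ?_ ρ _))
    · rw [← Multiset.coe_eq_coe, hKl]; simp [← Multiset.cons_coe]
    · simpa using ⟨hk, by rw [← Multiset.coe_nodup]; simpa using hK⟩
  | thr _ =>
    intro F Kl tl r ρ hKl htl _ _ _ _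
    rw [Multiset.coe_eq_zero] at hKl
    rw [Multiset.coe_eq_singleton] at htl
    subst hKl htl
    exact refl _

end PCalc

end MixedSessions

namespace MixedSessions

/-! ### Normal forms: flattening and closing are mutually inverse -/

namespace PCalc

variable {α : Type} [PCalc α]

/-- Names to indices of free variables. -/
def closeNm : Subst := Subst.ofRen (· / 2)

theorem freeNm_close : freeNm.comp closeNm = .var := by
  funext x
  show Val.var (2 * x / 2) = _
  simp

theorem NF_flat {P : α} {KP : Multiset ℕ} {tP : Multiset α} (hP : Flat P KP tP) {F : Set ℕ}
    {K Kl : List ℕ} {tl r : List α} (hKl : (Kl : Multiset ℕ) = KP) (htl : (tl : Multiset α) = tP)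
    (hnd : KP.Nodup) (hs : Supp F P) (hr : ∀ Q ∈ r, Supp F Q) (hF : ∀ k ∈ KP, ∀ o, nm k o ∉ F)
    (ρ : Subst) : cong (NF K ρ (P :: r)) (NF (K ++ Kl) ρ (tl ++ r)) := by
  have := NF_append (R := cong) res_cong K (L := []) (L' := Kl) (t := P :: r) (t' := tl ++ r)
    (fun ρ => NF_flat_base hP ρ hKl htl hnd hs hr hF) ρ
  rwa [List.append_nil] at this

theorem supp_freeNm (T : α) : Supp evens (subst T freeNm) := by
  intro σ τ h
  rw [subst_subst, subst_subst]
  congr 1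
  funext x
  exact h _ ⟨x, rfl⟩

theorem nm_notMem_evens (k : ℕ) (o : Bool) : nm k o ∉ evens := by
  rintro ⟨x, h⟩
  exact nm_ne_even h

/-- `closeNm` undoes `freeNm` on free variables, and the restrictions of the normal form rebind the
opened names; thus a flattening determines the process up to congruence. -/
theorem cong_NF {T : α} {K : List ℕ} {t : List α} (h : Flat (subst T freeNm) (K : Multiset ℕ) t)
    (hK : K.Nodup) : cong T (NF K closeNm t) := by
  have h1 := NF_flat (K := []) (r := []) h rfl rfl (by simpa using hK) (supp_freeNm T) (by simp)
    (fun k _ o => nm_notMem_evens k o) closeNm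
  simp only [NF, List.map_cons, List.map_nil, parL, subst_subst, freeNm_close, subst_var,
    List.nil_append, List.append_nil] at h1
  exact trans (symm (par_nil _)) h1

theorem flat_parL {t : List α} (h : ∀ P ∈ t, thr P) : Flat (parL t) 0 (t : Multiset α) := by
  induction t with
  | nil => exact .nil
  | cons P t ih =>
    have := Flat.par (.thr (h P (by simp))) (ih fun Q hQ => h Q (by simp [hQ]))
    rw [Multiset.singleton_add, zero_add] at this
    exact this

/-- Flattening may choose the name of each opened channel. Choosing the one that `ext` has just
closed, with orientation `false`, makes the two operations cancel. -/
theorem flat_NF {F : Set ℕ} {t : List α} (ht : ∀ P ∈ t, thr P ∧ Supp F P) (K : List ℕ) (ρ : Subst)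
    (hρ : ∀ x ∈ F, x ∉ names K → ρ x = .var x) : Flat (NF K ρ t) (K : Multiset ℕ) (t : Multiset α) := by
  induction K generalizing ρ with
  | nil =>
    have : t.map (subst · ρ) = t := by
      conv_rhs => rw [← List.map_id t]
      refine List.map_congr_left fun P hP => ?_
      have := (ht P hP).2 ρ .var fun x hx => hρ x hx (by simp [names])
      simpa [subst_var] using this
    rw [NF, this]
    exact flat_parL fun P hP => (ht P hP).1
  | cons k K ih =>
    rw [NF, ← Multiset.cons_coe]
    refine .res k false ?_
    rw [NF_subst]
    refine ih _ fun x hx hK => ?_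
    show (ext k ρ x).subst _ = _
    unfold ext
    split_ifs with h1 h2
    · rw [h1]; rfl
    · rw [h2]; rfl
    · rw [hρ x hx]
      · rfl
      · rintro ⟨l, hl, o, rfl⟩
        rw [Multiset.mem_coe, List.mem_cons] at hl
        rcases hl with rfl | hl
        · cases o <;> simp at h1 h2
        · exact hK ⟨l, by simpa using hl, o, rfl⟩

theorem flat_NF_free {t : List α} {K : List ℕ} (ht : ∀ P ∈ t, thr P ∧ Supp (evens ∪ names K) P) :
    Flat (subst (NF K closeNm t) freeNm) (K : Multiset ℕ) (t : Multiset α) := by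
  rw [NF_subst]
  refine flat_NF ht K _ ?_
  rintro x (⟨y, rfl⟩ | h) hx
  · show Val.var (2 * (2 * y / 2)) = _
    simp
  · exact absurd h hx

/-- The communication rules want the restriction of their channel immediately around the threads:
the channel is moved to the innermost place, and back after the step. -/
theorem NF_lift {R : α → α → Prop} (hres : ∀ {P Q}, R P Q → R (res P) (res Q))
    (hstruct : ∀ {P Q Q' P'}, cong P Q → R Q Q' → cong Q' P' → R P P') {K : List ℕ} {k : ℕ}
    (hk : k ∈ K) (hK : K.Nodup) {t t' : List α} (h : ∀ ρ, R (NF [k] ρ t) (NF [k] ρ t')) (ρ : Subst) :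
    R (NF K ρ t) (NF K ρ t') := by
  have hp : K.Perm (K.erase k ++ [k]) := (List.perm_cons_erase hk).trans
    (List.perm_append_singleton _ _).symm
  exact hstruct (NF_perm_chans hp hK _ _) (NF_append (R := R) (L := [k]) (L' := [k]) hres _ h ρ)
    (symm (NF_perm_chans hp hK _ _))

theorem Flat.thr_mem {P : α} {K : Multiset ℕ} {t : Multiset α} (h : Flat P K t) :
    ∀ Q ∈ t, PCalc.thr Q := by
  induction h with
  | nil => simp
  | par _ _ ih1 ih2 => 
    intro Q hQ
    rcases Multiset.mem_add.1 hQ with hQ | hQ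
    exacts [ih1 Q hQ, ih2 Q hQ]
  | res _ _ _ ih => exact ih
  | thr h => intro Q hQ; rwa [Multiset.mem_singleton.1 hQ]

end PCalc

open PCalc (Flat Supp NF)

/-! ### The two instances -/

namespace AProc

/-- Choices and conditionals. -/
def Thr : AProc → Prop
  | .choice .. => True
  | .cond .. => True
  | _ => False

/-- Congruence of annotated processes is congruence of their erasures, since the reductions to be
produced live in the calculus without annotations. -/
instance : PCalc AProc where
  nil := .nil
  par := .par
  res := .res
  subst := AProc.subst
  thr := Thr
  cong P Q := Mix.Cong P.erase Q.erase
  subst_nil _ := rfl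
  subst_par _ _ _ := rfl
  subst_res _ _ := rfl
  subst_subst := subst_subst
  subst_var := subst_var
  par_inj h := by injection h; constructor <;> assumption
  res_inj h := by injection h
  refl _ := .refl _
  symm := .symm
  trans := .trans
  par_cong := .par
  res_cong := .res
  par_nil _ := .par_nil _
  par_comm _ _ := .par_comm _ _
  par_assoc _ _ _ := .par_assoc _ _ _
  res_swap P := by
    show Mix.Cong (AProc.res _).erase (AProc.res _).erase
    simp only [erase, erase_subst]; exact .res_swap _
  res_res P := by
    show Mix.Cong (AProc.res (AProc.res _)).erase (AProc.res (AProc.res _)).erase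
    simp only [erase, erase_subst]; exact .res_res _
  res_par P Q := by
    show Mix.Cong (AProc.par _ (AProc.res _)).erase (AProc.res (AProc.par _ _)).erase
    simp only [erase, erase_subst]; exact .res_par _ _

/-- The set `X` of forbidden channels grows along the recursion, which keeps all chosen channels
distinct. -/
theorem exists_flat (P : AProc) (σ : Subst) (X : Finset ℕ) :
    ∃ K t, Flat (P.subst σ) K t ∧ K.Nodup ∧ ∀ k ∈ K, k ∉ X := by
  induction P generalizing σ X with
  | choice => exact ⟨0, _, .thr trivial, by simp, by simp⟩
  | cond => exact ⟨0, _, .thr trivial, by simp, by simp⟩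
  | nil => exact ⟨0, 0, .nil, by simp, by simp⟩
  | par P Q ih1 ih2 =>
    obtain ⟨K, t, h1, h2, h3⟩ := ih1 σ X
    obtain ⟨L, u, h4, h5, h6⟩ := ih2 σ (X ∪ K.toFinset)
    refine ⟨K + L, t + u, .par h1 h4, ?_, ?_⟩
    · rw [Multiset.nodup_add]
      exact ⟨h2, h5, Multiset.disjoint_left.2 fun hk hl => h6 _ hl (by simp [hk])⟩
    · intro k hk
      rcases Multiset.mem_add.1 hk with hk | hk
      exacts [h3 k hk, fun h => h6 k hk (by simp [h])]
  | res P ih =>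
    obtain ⟨k, hk⟩ := Infinite.exists_notMem_finset X
    obtain ⟨K, t, h1, h2, h3⟩ := ih (σ.up.up.comp (Subst.opn (nm k false) (nm k !false))) (insert k X)
    rw [← subst_subst] at h1
    refine ⟨k ::ₘ K, t, Flat.res k false h1, ?_, ?_⟩
    · exact Multiset.nodup_cons.2 ⟨fun h => h3 k h (by simp), h2⟩
    · intro l hl
      rcases Multiset.mem_cons.1 hl with rfl | hl
      exacts [hk, fun h => h3 l hl (by simp [h])]

/-- Every process has finitely many free variables. -/
theorem exists_supp (P : AProc) : ∃ N : ℕ, Supp {x | x < N} P := by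
  have hval : ∀ v : Val, ∃ N : ℕ, ∀ σ τ : Subst, (∀ x < N, σ x = τ x) → v.subst σ = v.subst τ := by
    intro v
    cases v with
    | var x => exact ⟨x + 1, fun σ τ h => h x (by omega)⟩
    | tt => exact ⟨0, fun _ _ _ => rfl⟩
    | ff => exact ⟨0, fun _ _ _ => rfl⟩
    | unit => exact ⟨0, fun _ _ _ => rfl⟩
  have hup : ∀ (N : ℕ) (σ τ : Subst), (∀ x < N, σ x = τ x) → ∀ x < N, σ.up x = τ.up x := by
    intro N σ τ h x hx
    cases x with
    | zero => rfl
    | succ x => show (σ x).subst _ = (τ x).subst _; rw [h x (by omega)]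
  induction P with
  | nil => exact ⟨0, fun _ _ _ => rfl⟩
  | par P Q ih1 ih2 =>
    obtain ⟨N, h1⟩ := ih1
    obtain ⟨M, h2⟩ := ih2
    refine ⟨max N M, fun σ τ h => ?_⟩
    show AProc.par (P.subst σ) (Q.subst σ) = AProc.par (P.subst τ) (Q.subst τ)
    congr 1
    · exact h1 σ τ fun x (hx : x < N) => h x (lt_max_of_lt_left hx)
    · exact h2 σ τ fun x (hx : x < M) => h x (lt_max_of_lt_right hx)
  | res P ih =>
    obtain ⟨N, h1⟩ := ih
    refine ⟨N, fun σ τ h => ?_⟩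
    show AProc.res _ = AProc.res _
    congr 1
    exact h1 _ _ (hup N _ _ (hup N _ _ h))
  | cond v P Q ih1 ih2 =>
    obtain ⟨N, h1⟩ := ih1
    obtain ⟨M, h2⟩ := ih2
    obtain ⟨L, h3⟩ := hval v
    refine ⟨max (max N M) L, fun σ τ h => ?_⟩
    show AProc.cond _ (P.subst σ) (Q.subst σ) = AProc.cond _ (P.subst τ) (Q.subst τ)
    congr 1
    · exact h3 σ τ fun x hx => h x (lt_max_of_lt_right hx)
    · exact h1 σ τ fun x (hx : x < N) => h x (lt_max_of_lt_left (lt_max_of_lt_left hx))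
    · exact h2 σ τ fun x (hx : x < M) => h x (lt_max_of_lt_left (lt_max_of_lt_right hx))
  | choice lu w q x n pre cont ih =>
    choose N hN using ih
    obtain ⟨M, hM⟩ := hval x
    have hpre : ∀ i, ∃ L : ℕ, ∀ σ τ : Subst, (∀ x < L, σ x = τ x) →
        (pre i).subst σ = (pre i).subst τ := by
      intro i
      cases pre i with
      | inp l => exact ⟨0, fun _ _ _ => rfl⟩
      | out l v =>
        obtain ⟨L, hL⟩ := hval v
        exact ⟨L, fun σ τ h => by simp only [Mix.Pre.subst, hL σ τ h]⟩
    choose L hL using hpre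
    have hb : ∀ i, max (N i) (L i) ≤ Finset.univ.sup fun i => max (N i) (L i) :=
      fun i => Finset.le_sup (f := fun i => max (N i) (L i)) (Finset.mem_univ i)
    refine ⟨max M (Finset.univ.sup fun i => max (N i) (L i)), fun σ τ h => ?_⟩
    show AProc.choice _ _ _ _ _ _ _ = AProc.choice _ _ _ _ _ _ _
    have hh : ∀ i, ∀ x < max (N i) (L i), σ x = τ x := fun i x hx =>
      h x (lt_max_of_lt_right (lt_of_lt_of_le hx (hb i)))
    congr 1
    · exact hM σ τ fun x hx => h x (lt_max_of_lt_left hx)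
    · funext i
      exact hL i σ τ fun x hx => hh i x (lt_max_of_lt_right hx)
    · funext i
      refine hN i _ _ fun x (hx : x < N i) => ?_
      have h0 : ∀ x < N i, σ x = τ x := fun x hx => hh i x (lt_max_of_lt_left hx)
      cases pre i with
      | out l v => exact h0 x hx
      | inp l => exact hup _ σ τ h0 x hx

end AProc

namespace CMV

/-- Everything but parallel compositions, restrictions and the terminated process. -/
def Proc.Thr : Proc → Prop
  | .par .. => False
  | .res .. => False
  | .nil => False
  | _ => True

instance : PCalc Proc where
  nil := .nil
  par := .par
  res := .res
  subst := Proc.subst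
  thr := Proc.Thr
  cong := Cong
  subst_nil _ := rfl
  subst_par _ _ _ := rfl
  subst_res _ _ := rfl
  subst_subst := Proc.subst_subst
  subst_var := Proc.subst_var
  par_inj h := by injection h; constructor <;> assumption
  res_inj h := by injection h
  refl _ := .refl _
  symm := .symm
  trans := .trans
  par_cong := .par
  res_cong := .res
  par_nil _ := .par_nil _
  par_comm _ _ := .par_comm _ _
  par_assoc _ _ _ := .par_assoc _ _ _
  res_swap _ := .res_swap _
  res_res _ := .res_res _
  res_par _ _ := .res_par _ _

theorem exists_flat (P : Proc) (σ : Subst) (X : Finset ℕ) :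
    ∃ K t, Flat (P.subst σ) K t ∧ K.Nodup ∧ ∀ k ∈ K, k ∉ X := by
  induction P generalizing σ X with
  | nil => exact ⟨0, 0, .nil, by simp, by simp⟩
  | par P Q ih1 ih2 =>
    obtain ⟨K, t, h1, h2, h3⟩ := ih1 σ X
    obtain ⟨L, u, h4, h5, h6⟩ := ih2 σ (X ∪ K.toFinset)
    refine ⟨K + L, t + u, .par h1 h4, ?_, ?_⟩
    · rw [Multiset.nodup_add]
      exact ⟨h2, h5, Multiset.disjoint_left.2 fun hk hl => h6 _ hl (by simp [hk])⟩
    · intro k hk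
      rcases Multiset.mem_add.1 hk with hk | hk
      exacts [h3 k hk, fun h => h6 k hk (by simp [h])]
  | res P ih =>
    obtain ⟨k, hk⟩ := Infinite.exists_notMem_finset X
    obtain ⟨K, t, h1, h2, h3⟩ := ih (σ.up.up.comp (Subst.opn (nm k false) (nm k !false))) (insert k X)
    rw [← Proc.subst_subst] at h1
    refine ⟨k ::ₘ K, t, Flat.res k false h1, ?_, ?_⟩
    · exact Multiset.nodup_cons.2 ⟨fun h => h3 k h (by simp), h2⟩
    · intro l hl
      rcases Multiset.mem_cons.1 hl with rfl | hl
      exacts [hk, fun h => h3 l hl (by simp [h])]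
  | _ => exact ⟨0, _, .thr trivial, by simp, by simp⟩

/-! ### Structural congruence of the target calculus, seen through flattening -/

section Inversion

theorem flat_nil_iff {K : Multiset ℕ} {t : Multiset Proc} :
    Flat Proc.nil K t ↔ K = 0 ∧ t = 0 := by
  constructor
  · generalize e : Proc.nil = R
    intro h
    cases h with
    | nil => exact ⟨rfl, rfl⟩
    | par => cases e
    | res => cases e
    | thr h => subst e; exact h.elim
  · rintro ⟨rfl, rfl⟩; exact .nil

theorem flat_par_iff {P Q : Proc} {K : Multiset ℕ} {t : Multiset Proc} :
    Flat (Proc.par P Q) K t ↔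
      ∃ K₁ K₂ t₁ t₂, Flat P K₁ t₁ ∧ Flat Q K₂ t₂ ∧ K = K₁ + K₂ ∧ t = t₁ + t₂ := by
  constructor
  · generalize e : Proc.par P Q = R
    intro h
    cases h with
    | nil => cases e
    | par h1 h2 => cases e; exact ⟨_, _, _, _, h1, h2, rfl, rfl⟩
    | res => cases e
    | thr h => subst e; exact h.elim
  · rintro ⟨_, _, _, _, h1, h2, rfl, rfl⟩; exact .par h1 h2

theorem flat_res_iff {P : Proc} {K : Multiset ℕ} {t : Multiset Proc} :
    Flat (Proc.res P) K t ↔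
      ∃ k o L, Flat (P.subst (Subst.opn (nm k o) (nm k !o))) L t ∧ K = k ::ₘ L := by
  constructor
  · generalize e : Proc.res P = R
    intro h
    cases h with
    | nil => cases e
    | par => cases e
    | res k o h => cases e; exact ⟨k, o, _, h, rfl⟩
    | thr h => subst e; exact h.elim
  · rintro ⟨k, o, L, h, rfl⟩; exact Flat.res k o h

theorem flat_thr_iff {P : Proc} (hP : P.Thr) {K : Multiset ℕ} {t : Multiset Proc} :
    Flat P K t ↔ K = 0 ∧ t = {P} := by
  constructor
  · intro h
    cases h with
    | nil => exact hP.elim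
    | par => exact hP.elim
    | res => exact hP.elim
    | thr => exact ⟨rfl, rfl⟩
  · rintro ⟨rfl, rfl⟩; exact .thr hP

end Inversion

theorem Cong.subst {P Q : Proc} (h : Cong P Q) (σ : Subst) : Cong (P.subst σ) (Q.subst σ) := by
  induction h generalizing σ with
  | refl => exact .refl _
  | symm _ ih => exact .symm (ih σ)
  | trans _ _ ih1 ih2 => exact .trans (ih1 σ) (ih2 σ)
  | out _ ih => exact .out (ih _)
  | inp _ ih => exact .inp (ih _)
  | sel _ ih => exact .sel (ih _)
  | bran _ ih => exact .bran fun i => ih i _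
  | par _ _ ih1 ih2 => exact .par (ih1 _) (ih2 _)
  | res _ ih => exact .res (ih _)
  | cond _ _ ih1 ih2 => exact .cond (ih1 _) (ih2 _)
  | par_nil => exact .par_nil _
  | par_comm => exact .par_comm _ _
  | par_assoc => exact .par_assoc _ _ _
  | res_nil => exact .res_nil
  | res_swap P =>
    refine .trans (.res_swap _) ?_
    simp only [Proc.subst, Proc.subst_subst]
    convert Cong.refl _ using 3
    funext x
    match x with
    | 0 => rfl
    | 1 => rfl
    | x + 2 =>
      show ((σ x).subst _).subst _ = (((σ x).subst _).subst _).subst _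
      simp only [Val.subst_subst]; rfl
  | res_res P =>
    refine .trans (.res_res _) ?_
    simp only [Proc.subst, Proc.subst_subst]
    convert Cong.refl _ using 4
    funext x
    match x with
    | 0 => rfl
    | 1 => rfl
    | 2 => rfl
    | 3 => rfl
    | x + 4 =>
      show ((((σ x).subst _).subst _).subst _).subst _ =
        (((((σ x).subst _).subst _).subst _).subst _).subst _
      simp only [Val.subst_subst]; rfl
  | res_par P Q =>
    refine .trans (.res_par _ _) ?_
    simp only [Proc.subst, Proc.subst_subst, Subst.shift_two_comp_up]
    exact .refl _

/-- Threads that agree up to structural congruence of their continuations. -/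
inductive TC : Proc → Proc → Prop
  | out {x v P P'} : Cong P P' → TC (.out x v P) (.out x v P')
  | inp {q x P P'} : Cong P P' → TC (.inp q x P) (.inp q x P')
  | sel {x l P P'} : Cong P P' → TC (.sel x l P) (.sel x l P')
  | bran {x n lab P P'} : (∀ i, Cong (P i) (P' i)) → TC (.bran x n lab P) (.bran x n lab P')
  | cond {v P P' Q Q'} : Cong P P' → Cong Q Q' → TC (.cond v P Q) (.cond v P' Q')

theorem TC.refl_thr {P : Proc} (h : P.Thr) : TC P P := by
  cases P with
  | out => exact .out (.refl _)
  | inp => exact .inp (.refl _)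
  | sel => exact .sel (.refl _)
  | bran => exact .bran fun _ => .refl _
  | cond => exact .cond (.refl _) (.refl _)
  | par => exact h.elim
  | res => exact h.elim
  | nil => exact h.elim

theorem TC.symm {P Q : Proc} (h : TC P Q) : TC Q P := by
  cases h with
  | out h => exact .out h.symm
  | inp h => exact .inp h.symm
  | sel h => exact .sel h.symm
  | bran h => exact .bran fun i => (h i).symm
  | cond h h' => exact .cond h.symm h'.symm

theorem TC.trans {P Q R : Proc} (h : TC P Q) (h' : TC Q R) : TC P R := by
  cases h with
  | out h => cases h' with | out h' => exact .out (h.trans h')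
  | inp h => cases h' with | inp h' => exact .inp (h.trans h')
  | sel h => cases h' with | sel h' => exact .sel (h.trans h')
  | bran h => cases h' with | bran h' => exact .bran fun i => (h i).trans (h' i)
  | cond h1 h2 => cases h' with | cond h3 h4 => exact .cond (h1.trans h3) (h2.trans h4)

/-- Configurations that agree up to structural congruence of continuations. -/
abbrev MTC : Multiset Proc → Multiset Proc → Prop := Multiset.Rel TC

theorem MTC.refl_thr {t : Multiset Proc} (h : ∀ P ∈ t, P.Thr) : MTC t t :=
  Multiset.rel_refl_of_refl_on fun P hP => TC.refl_thr (h P hP)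

theorem MTC.symm {t u : Multiset Proc} (h : MTC t u) : MTC u t := by
  induction h with
  | zero => exact .zero
  | cons h _ ih => exact .cons h.symm ih

theorem MTC.trans {t u v : Multiset Proc} (h : MTC t u) (h' : MTC u v) : MTC t v := by
  induction h generalizing v with
  | zero => exact h'
  | cons h _ ih =>
    obtain ⟨b, bs, h1, h2, rfl⟩ := Multiset.rel_cons_left.1 h'
    exact .cons (h.trans h1) (ih h2)

/-- Every flattening of `P` is matched by a flattening of `Q`. -/
def Flattens (P Q : Proc) : Prop :=
  ∀ (X : Finset ℕ) (K : Multiset ℕ) (t : Multiset Proc), Flat P K t → K.Nodup →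
    ∃ K' t', Flat Q K' t' ∧ K'.Nodup ∧ (∀ k ∈ K', k ∈ K ∨ k ∉ X) ∧ MTC t t'

theorem Flattens.of_eq {P Q : Proc} (h : ∀ K t, Flat P K t → Flat Q K t) : Flattens P Q :=
  fun _ K t hf hK => ⟨K, t, h K t hf, hK, fun _ hk => .inl hk, MTC.refl_thr hf.thr_mem⟩

theorem Flattens.trans {P Q R : Proc} (h : Flattens P Q) (h' : Flattens Q R) : Flattens P R := by
  intro X K t hf hK
  obtain ⟨K1, t1, h1, h2, h3, h4⟩ := h X K t hf hK
  obtain ⟨K2, t2, h5, h6, h7, h8⟩ := h' X K1 t1 h1 h2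
  refine ⟨K2, t2, h5, h6, fun k hk => ?_, h4.trans h8⟩
  rcases h7 k hk with h | h
  exacts [h3 k h, .inr h]

/-- New channels on one side must not clash with the other side. The first hypothesis is therefore
used with the old channels of the second component forbidden, the second one with the channels just
obtained for the first. -/
theorem Flattens.par {P P' Q Q' : Proc} (h : Flattens P P') (h' : Flattens Q Q') :
    Flattens (.par P Q) (.par P' Q') := by
  intro X K t hf hK
  obtain ⟨K1, K2, t1, t2, h1, h2, rfl, rfl⟩ := flat_par_iff.1 hf
  obtain ⟨n1, n2, hd⟩ := Multiset.nodup_add.1 hK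
  obtain ⟨L1, u1, a1, a2, a3, a4⟩ := h (X ∪ K2.toFinset) K1 t1 h1 n1
  obtain ⟨L2, u2, b1, b2, b3, b4⟩ := h' (X ∪ L1.toFinset) K2 t2 h2 n2
  refine ⟨L1 + L2, u1 + u2, .par a1 b1, ?_, ?_, Multiset.Rel.add a4 b4⟩
  · refine Multiset.nodup_add.2 ⟨a2, b2, Multiset.disjoint_left.2 fun {k} hk hk' => ?_⟩
    rcases b3 k hk' with h3 | h3
    · rcases a3 k hk with h4 | h4
      · exact Multiset.disjoint_left.1 hd h4 h3
      · exact h4 (by simp [h3])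
    · exact h3 (by simp [hk])
  · intro k hk
    rcases Multiset.mem_add.1 hk with hk | hk
    · rcases a3 k hk with h3 | h3
      exacts [.inl (by simp [h3]), .inr fun h => h3 (by simp [h])]
    · rcases b3 k hk with h3 | h3
      exacts [.inl (by simp [h3]), .inr fun h => h3 (by simp [h])]

/-- The equation of sets says that `c, d` are `a, b` in some order. Hence the same lemma serves
congruent bodies and the exchange of the two endpoints. -/
theorem Flattens.res {P P' : Proc} (h : ∀ a b, ∃ c d, ({(c, d), (d, c)} : Set (ℕ × ℕ)) = {(a, b), (b, a)} ∧
      Flattens (P.subst (Subst.opn a b)) (P'.subst (Subst.opn c d))) :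
    Flattens (.res P) (.res P') := by
  intro X K t hf hK
  obtain ⟨k, o, L, h1, rfl⟩ := flat_res_iff.1 hf
  obtain ⟨hk, hL⟩ := Multiset.nodup_cons.1 hK
  obtain ⟨c, d, hcd, h'⟩ := h (nm k o) (nm k !o)
  obtain ⟨L', t', a1, a2, a3, a4⟩ := h' (insert k X) L t h1 hL
  refine ⟨k ::ₘ L', t', ?_, ?_, ?_, a4⟩
  · have : (c, d) ∈ ({(nm k o, nm k !o), (nm k !o, nm k o)} : Set (ℕ × ℕ)) := by
      rw [← hcd]; simp
    rcases this with h | h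
    · cases h; exact Flat.res k o a1
    · cases h
      have := Flat.res (P := P') (t := t') (K := L') k (!o)
        (by rw [Bool.not_not]; exact a1)
      exact this
  · refine Multiset.nodup_cons.2 ⟨fun h => ?_, a2⟩
    rcases a3 k h with h | h
    exacts [hk h, h (by simp)]
  · intro l hl
    rcases Multiset.mem_cons.1 hl with rfl | hl
    · simp
    · rcases a3 l hl with h | h
      exacts [.inl (by simp [h]), .inr fun h' => h (by simp [h'])]

theorem Flattens.thr {P Q : Proc} (hP : P.Thr) (hQ : Q.Thr) (h : TC P Q) : Flattens P Q := by
  intro X K t hf hK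
  obtain ⟨rfl, rfl⟩ := (flat_thr_iff hP).1 hf
  exact ⟨0, {Q}, .thr hQ, by simp, by simp, Multiset.Rel.cons h .zero⟩

theorem Flattens.res_nil : Flattens .nil (.res .nil) := by
  intro X K t hf hK
  obtain ⟨rfl, rfl⟩ := flat_nil_iff.1 hf
  obtain ⟨k, hk⟩ := Infinite.exists_notMem_finset X
  exact ⟨{k}, 0, flat_res_iff.2 ⟨k, false, 0, .nil, rfl⟩, by simp, by simpa using hk, .zero⟩

theorem Flattens.nil_res : Flattens (.res .nil) .nil := by
  intro X K t hf hK
  obtain ⟨k, o, L, h, rfl⟩ := flat_res_iff.1 hf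
  obtain ⟨rfl, rfl⟩ := flat_nil_iff.1 h
  exact ⟨0, 0, .nil, by simp, by simp, .zero⟩

theorem subst_swapEnds_opn (P : Proc) (σ : Subst) (a b : ℕ) :
    (((P.subst (Subst.ofRen swapEnds)).subst σ.up.up).subst (Subst.opn a b)) =
      (P.subst σ.up.up).subst (Subst.opn b a) := by
  simp only [Proc.subst_subst]
  congr 1
  funext x
  match x with
  | 0 => rfl
  | 1 => rfl
  | x + 2 => exact (Subst.up_up_opn σ a b x).trans (Subst.up_up_opn σ b a x).symm

theorem subst_swapRes_opn (P : Proc) (σ : Subst) (a b c d : ℕ) :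
    (((P.subst (Subst.ofRen swapRes)).subst σ.up.up.up.up).subst (Subst.opn a b).up.up).subst
        (Subst.opn c d) =
      ((P.subst σ.up.up.up.up).subst (Subst.opn c d).up.up).subst (Subst.opn a b) := by
  simp only [Proc.subst_subst]
  congr 1
  funext x
  match x with
  | 0 => rfl
  | 1 => rfl
  | 2 => rfl
  | 3 => rfl
  | x + 4 =>
    show (((((((σ x).subst _).subst _).subst _).subst _).subst _).subst _) =
        (((((((σ x).subst _).subst _).subst _).subst _).subst _).subst _)
    simp only [Val.subst_subst]
    congr 1

theorem subst_shift_opn (P : Proc) (σ : Subst) (a b : ℕ) :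
    ((P.subst (Subst.shift 2)).subst σ.up.up).subst (Subst.opn a b) = P.subst σ := by
  simp only [Proc.subst_subst]
  congr 1
  funext x
  exact Subst.up_up_opn σ a b x

/-- Both directions are proved together because of symmetry, and under every substitution because
opening a restriction substitutes. Congruence below a prefix is not flattened; it becomes `TC`. -/
theorem Cong.flattens {P Q : Proc} (h : Cong P Q) (σ : Subst) :
    Flattens (P.subst σ) (Q.subst σ) ∧ Flattens (Q.subst σ) (P.subst σ) := by
  induction h generalizing σ with
  | refl => exact ⟨.of_eq fun _ _ h => h, .of_eq fun _ _ h => h⟩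
  | symm _ ih => exact (ih σ).symm
  | trans _ _ ih1 ih2 => exact ⟨(ih1 σ).1.trans (ih2 σ).1, (ih2 σ).2.trans (ih1 σ).2⟩
  | out h _ =>
    exact ⟨.thr trivial trivial (.out (h.subst σ)), .thr trivial trivial (.out (h.symm.subst σ))⟩
  | inp h _ =>
    exact ⟨.thr trivial trivial (.inp (h.subst _)), .thr trivial trivial (.inp (h.symm.subst _))⟩
  | sel h _ =>
    exact ⟨.thr trivial trivial (.sel (h.subst σ)), .thr trivial trivial (.sel (h.symm.subst σ))⟩
  | bran h _ =>
    exact ⟨.thr trivial trivial (.bran fun i => (h i).subst σ),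
      .thr trivial trivial (.bran fun i => (h i).symm.subst σ)⟩
  | cond h h' _ _ =>
    exact ⟨.thr trivial trivial (.cond (h.subst σ) (h'.subst σ)),
      .thr trivial trivial (.cond (h.symm.subst σ) (h'.symm.subst σ))⟩
  | par _ _ ih1 ih2 => exact ⟨.par (ih1 σ).1 (ih2 σ).1, .par (ih1 σ).2 (ih2 σ).2⟩
  | res _ ih =>
    refine ⟨.res fun a b => ⟨a, b, rfl, ?_⟩, .res fun a b => ⟨a, b, rfl, ?_⟩⟩
    · rw [Proc.subst_subst, Proc.subst_subst]; exact (ih _).1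
    · rw [Proc.subst_subst, Proc.subst_subst]; exact (ih _).2
  | par_nil P =>
    refine ⟨.of_eq fun K t h => ?_, .of_eq fun K t h => ?_⟩
    · obtain ⟨_, _, _, _, h1, h2, rfl, rfl⟩ := flat_par_iff.1 h
      obtain ⟨rfl, rfl⟩ := flat_nil_iff.1 h2
      simpa using h1
    · exact flat_par_iff.2 ⟨K, 0, t, 0, h, .nil, by simp, by simp⟩
  | par_comm P Q =>
    have : ∀ P Q : Proc, Flattens (.par P Q) (.par Q P) := fun P Q => .of_eq fun K t h => by
      obtain ⟨_, _, _, _, h1, h2, rfl, rfl⟩ := flat_par_iff.1 h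
      exact flat_par_iff.2 ⟨_, _, _, _, h2, h1, add_comm _ _, add_comm _ _⟩
    exact ⟨this _ _, this _ _⟩
  | par_assoc P Q R =>
    refine ⟨.of_eq fun K t h => ?_, .of_eq fun K t h => ?_⟩
    · obtain ⟨_, _, _, _, h1, h2, rfl, rfl⟩ := flat_par_iff.1 h
      obtain ⟨_, _, _, _, h3, h4, rfl, rfl⟩ := flat_par_iff.1 h2
      exact flat_par_iff.2 ⟨_, _, _, _, .par h1 h3, h4, (add_assoc _ _ _).symm, (add_assoc _ _ _).symm⟩
    · obtain ⟨_, _, _, _, h1, h2, rfl, rfl⟩ := flat_par_iff.1 h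
      obtain ⟨_, _, _, _, h3, h4, rfl, rfl⟩ := flat_par_iff.1 h1
      exact flat_par_iff.2 ⟨_, _, _, _, h3, .par h4 h2, add_assoc _ _ _, add_assoc _ _ _⟩
  | res_nil => exact ⟨.nil_res, .res_nil⟩
  | res_swap P =>
    refine ⟨.res fun a b => ⟨b, a, Set.pair_comm _ _, ?_⟩, .res fun a b => ⟨b, a, Set.pair_comm _ _, ?_⟩⟩
    · rw [subst_swapEnds_opn]; exact .of_eq fun _ _ h => h
    · rw [subst_swapEnds_opn]; exact .of_eq fun _ _ h => h
  | res_res P =>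
    refine ⟨.of_eq fun K t h => ?_, .of_eq fun K t h => ?_⟩
    · obtain ⟨k, o, _, h1, rfl⟩ := flat_res_iff.1 h
      obtain ⟨l, p, L, h2, rfl⟩ := flat_res_iff.1 h1
      refine flat_res_iff.2 ⟨l, p, k ::ₘ L, flat_res_iff.2 ⟨k, o, L, ?_, rfl⟩, Multiset.cons_swap _ _ _⟩
      rw [subst_swapRes_opn]; exact h2
    · obtain ⟨k, o, _, h1, rfl⟩ := flat_res_iff.1 h
      obtain ⟨l, p, L, h2, rfl⟩ := flat_res_iff.1 h1
      refine flat_res_iff.2 ⟨l, p, k ::ₘ L, flat_res_iff.2 ⟨k, o, L, ?_, rfl⟩, Multiset.cons_swap _ _ _⟩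
      rw [subst_swapRes_opn] at h2; exact h2
  | res_par P Q =>
    refine ⟨.of_eq fun K t h => ?_, .of_eq fun K t h => ?_⟩
    · obtain ⟨K1, _, t1, t2, h1, h2, rfl, rfl⟩ := flat_par_iff.1 h
      obtain ⟨k, o, L, h3, rfl⟩ := flat_res_iff.1 h2
      refine flat_res_iff.2 ⟨k, o, K1 + L, flat_par_iff.2 ⟨K1, L, t1, t2, ?_, h3, rfl, rfl⟩, ?_⟩
      · rw [subst_shift_opn]; exact h1
      · rw [Multiset.add_cons]
    · obtain ⟨k, o, _, h3, rfl⟩ := flat_res_iff.1 h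
      obtain ⟨K1, L, t1, t2, h1, h2, rfl, rfl⟩ := flat_par_iff.1 h3
      refine flat_par_iff.2 ⟨K1, k ::ₘ L, t1, t2, ?_, flat_res_iff.2 ⟨k, o, L, h2, rfl⟩, ?_, rfl⟩
      · rw [subst_shift_opn] at h1; exact h1
      · rw [Multiset.add_cons]

end CMV

end MixedSessions

namespace MixedSessions

/-! ### Tools for communication in normal forms -/

namespace PCalc

variable {α : Type} [PCalc α]

/-- The reduction rules put the active end at index `0`. If the active end is `(k, true)`, the
endpoints are exchanged first. -/
theorem NF_one (k : ℕ) (o : Bool) (ρ : Subst) : ∃ τ : Subst, τ (nm k o) = .var 0 ∧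
    τ (nm k !o) = .var 1 ∧ ∀ t : List α, cong (NF [k] ρ t) (res (parL (t.map (subst · τ)))) := by
  cases o with
  | false => exact ⟨ext k ρ, by simp [ext], by simp [ext], fun t => refl _⟩
  | true =>
    refine ⟨(ext k ρ).comp (Subst.ofRen swapEnds), ?_, ?_, fun t => ?_⟩
    · simp [ext, Subst.comp, Val.subst, Subst.ofRen, swapEnds]
    · simp [ext, Subst.comp, Val.subst, Subst.ofRen, swapEnds]
    · refine trans (res_swap _) ?_
      simp only [NF, subst_parL, List.map_map, Function.comp_def, subst_subst]
      exact refl _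

theorem notMem_supp {E : Set ℕ} (hE : E ⊆ evens) {K : Multiset ℕ} {k : ℕ} (hk : k ∉ K) (o : Bool) :
    nm k o ∉ E ∪ names K := by
  rintro (h | ⟨l, hl, p, h⟩)
  · exact nm_notMem_evens k o (hE h)
  · rw [nm_inj] at h; exact hk (h.1 ▸ hl)

theorem names_add (K L : Multiset ℕ) : names (K + L) = names K ∪ names L := by
  ext x
  simp only [names, Set.mem_ofPred_eq, Set.mem_union, Multiset.mem_add]
  constructor
  · rintro ⟨k, h | h, h'⟩
    exacts [.inl ⟨k, h, h'⟩, .inr ⟨k, h, h'⟩]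
  · rintro (⟨k, h, h'⟩ | ⟨k, h, h'⟩)
    exacts [⟨k, .inl h, h'⟩, ⟨k, .inr h, h'⟩]

/-- After a communication two continuations have to be flattened. The second is flattened beside the
threads of the first, whose support already includes the new channels. -/
theorem NF_flat_two {E : Set ℕ} (hE : E ⊆ evens) {K : List ℕ} {P Q : α} {r : List α}
    {KP KQ : Multiset ℕ} {tP tQ : Multiset α} (hP : Flat P KP tP) (hQ : Flat Q KQ tQ)
    (hK : ((K : Multiset ℕ) + (KP + KQ)).Nodup)
    (sP : Supp (E ∪ names K) P) (sQ : Supp (E ∪ names K) Q) (sr : ∀ R ∈ r, Supp (E ∪ names K) R)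
    {K1 : List ℕ} {t1 : List α} (hK1 : (K1 : Multiset ℕ) = K + (KP + KQ))
    (ht1 : (t1 : Multiset α) = tP + tQ + r) (ρ : Subst) :
    cong (NF K ρ (P :: Q :: r)) (NF K1 ρ t1) := by
  obtain ⟨h1, h2, h3⟩ := Multiset.nodup_add.1 hK
  obtain ⟨h4, h5, h6⟩ := Multiset.nodup_add.1 h2
  have dP : ∀ k ∈ KP, k ∉ (K : Multiset ℕ) := fun k hk hk' =>
    Multiset.disjoint_left.1 h3 hk' (by simp [hk])
  have dQ : ∀ k ∈ KQ, k ∉ (K : Multiset ℕ) := fun k hk hk' =>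
    Multiset.disjoint_left.1 h3 hk' (by simp [hk])
  have e1 := NF_flat (K := K) (Kl := KP.toList) (tl := tP.toList) (r := Q :: r) hP (by simp) (by simp)
    h4 sP (by simpa using ⟨sQ, sr⟩) (fun k hk o => notMem_supp hE (dP k hk) o) ρ
  have e2 : cong (NF (K ++ KP.toList) ρ (tP.toList ++ Q :: r))
      (NF (K ++ KP.toList) ρ (Q :: (tP.toList ++ r))) := NF_perm_threads _ _ List.perm_middle
  have hn : E ∪ names ((K ++ KP.toList : List ℕ) : Multiset ℕ) = (E ∪ names K) ∪ names KP := by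
    rw [← Multiset.coe_add, names_add, Set.union_assoc]; simp
  have e3 := NF_flat (F := E ∪ names ((K ++ KP.toList : List ℕ) : Multiset ℕ)) (K := K ++ KP.toList)
    (Kl := KQ.toList) (tl := tQ.toList) (r := tP.toList ++ r) hQ (by simp) (by simp) h5
    (by rw [hn]; exact sQ.mono Set.subset_union_left) (by
      intro R hR
      rw [hn]
      rcases List.mem_append.1 hR with hR | hR
      · exact sP.flat hP R (by simpa using hR)
      · exact (sr R hR).mono Set.subset_union_left)
    (fun k hk o => notMem_supp hE (by
      intro h
      rcases List.mem_append.1 h with h | h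
      · exact dQ k hk h
      · exact Multiset.disjoint_left.1 h6 (by simpa using h) hk) o) ρ
  have e4 : cong (NF (K ++ KP.toList ++ KQ.toList) ρ (tQ.toList ++ (tP.toList ++ r)))
      (NF K1 ρ (tQ.toList ++ (tP.toList ++ r))) := by
    have : ((K ++ KP.toList ++ KQ.toList : List ℕ) : Multiset ℕ) = K1 := by
      rw [hK1]; simp only [← Multiset.coe_add, Multiset.coe_toList, add_assoc]
    refine NF_perm_chans (Multiset.coe_eq_coe.1 this) ?_ _ _
    rw [← Multiset.coe_nodup, this, hK1]; exact hK
  have e5 : cong (NF K1 ρ (tQ.toList ++ (tP.toList ++ r))) (NF K1 ρ t1) := by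
    refine NF_perm_threads _ _ (Multiset.coe_eq_coe.1 ?_)
    rw [ht1]; simp only [← Multiset.coe_add, Multiset.coe_toList]; abel
  exact trans e1 (trans e2 (trans e3 (trans e4 e5)))

theorem Supp.flat_two {F : Set ℕ} {P Q : α} {KP KQ : Multiset ℕ} {tP tQ r : Multiset α}
    {E : Set ℕ} {K : Multiset ℕ} (hF : F = E ∪ names K)
    (hP : Flat P KP tP) (hQ : Flat Q KQ tQ) (sP : Supp F P) (sQ : Supp F Q) (sr : ∀ R ∈ r, Supp F R) :
    ∀ R ∈ tP + tQ + r, Supp (E ∪ names (K + (KP + KQ))) R := by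
  intro R hR
  rw [names_add, ← Set.union_assoc, ← hF, names_add]
  rcases Multiset.mem_add.1 hR with hR | hR
  · rcases Multiset.mem_add.1 hR with hR | hR
    · exact (sP.flat hP R hR).mono (Set.union_subset_union_right _ Set.subset_union_left)
    · exact (sQ.flat hQ R hR).mono (Set.union_subset_union_right _ Set.subset_union_right)
  · exact (sr R hR).mono Set.subset_union_left

end PCalc

open PCalc (Flat Supp NF parL)

/-- All variables of a value are in `F`. -/
def Val.Supp (F : Set ℕ) (v : Val) : Prop := ∀ x, v = .var x → x ∈ F

theorem Val.supp_of_subst {F : Set ℕ} {v : Val}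
    (h : ∀ σ τ : Subst, (∀ x ∈ F, σ x = τ x) → v.subst σ = v.subst τ) : v.Supp F := by
  rintro x rfl
  by_contra hx
  -- These two substitutions agree on `F` but differ at `x`.
  have := h (fun y => if y = x then .tt else .unit) (fun _ => .unit) (by
    intro y hy
    rw [if_neg]
    rintro rfl; exact hx hy)
  simp [Val.subst] at this

theorem Val.Supp.subst_eq {F : Set ℕ} {v : Val} (h : v.Supp F) {σ τ : Subst}
    (hh : ∀ x ∈ F, σ x = τ x) : v.subst σ = v.subst τ := by
  cases v with
  | var x => exact hh x (h x rfl)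
  | _ => rfl

/-- The reductions of both calculi commute with opening a bound variable. -/
theorem PCalc.Supp.inst {α : Type} [PCalc α] {F : Set ℕ} {Q : α} {v : Val} (hv : v.Supp F)
    (hQ : ∀ σ τ : Subst, (∀ x ∈ F, σ x = τ x) → PCalc.subst Q σ.up = PCalc.subst Q τ.up) :
    Supp F (PCalc.subst Q (Subst.inst v)) := by
  intro σ τ h
  have h1 := congrArg (fun P => PCalc.subst P (Subst.inst (v.subst σ))) (hQ σ τ h)
  simp only [PCalc.subst_subst] at h1 ⊢
  rw [Subst.up_inst, hv.subst_eq h, Subst.up_inst] at h1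
  exact h1

/-! ### Reduction of target configurations -/

namespace CMV

/-- What remains of an input after it was used. -/
def stay : Qual → Proc → Multiset Proc
  | .lin, _ => 0
  | .un, C => {C}

/-- Reduction of configurations; the names of new channels avoid `X`. -/
inductive MStep (X : Finset ℕ) : Multiset Proc → Multiset Proc → Prop
  | cond_tt {P Q r K t} : Flat P K t → K.Nodup → (∀ k ∈ K, k ∉ X) →
      MStep X (.cond .tt P Q ::ₘ r) (t + r)
  | cond_ff {P Q r K t} : Flat Q K t → K.Nodup → (∀ k ∈ K, k ∉ X) →
      MStep X (.cond .ff P Q ::ₘ r) (t + r)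
  | com {k o q v P Q r KP KQ tP tQ} : Flat P KP tP → Flat (Q.subst (Subst.inst v)) KQ tQ →
      (KP + KQ).Nodup → (∀ k ∈ KP + KQ, k ∉ X) →
      MStep X (.out (.var (nm k o)) v P ::ₘ .inp q (.var (nm k !o)) Q ::ₘ r)
        (tP + (tQ + stay q (.inp q (.var (nm k !o)) Q)) + r)
  | sel {k o n lab P Q r KP KQ tP tQ} (j : Fin n) : Flat P KP tP → Flat (Q j) KQ tQ →
      (KP + KQ).Nodup → (∀ k ∈ KP + KQ, k ∉ X) →
      MStep X (.sel (.var (nm k o)) (lab j) P ::ₘ .bran (.var (nm k !o)) n lab Q ::ₘ r)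
        (tP + tQ + r)

theorem MStep.mono {X Y : Finset ℕ} (h : X ⊆ Y) {t u : Multiset Proc} (hs : MStep Y t u) :
    MStep X t u := by
  cases hs with
  | cond_tt h1 h2 h3 => exact .cond_tt h1 h2 fun k hk hX => h3 k hk (h hX)
  | cond_ff h1 h2 h3 => exact .cond_ff h1 h2 fun k hk hX => h3 k hk (h hX)
  | com h1 h2 h3 h4 => exact .com h1 h2 h3 fun k hk hX => h4 k hk (h hX)
  | sel j h1 h2 h3 h4 => exact .sel j h1 h2 h3 fun k hk hX => h4 k hk (h hX)

theorem MStep.add {X : Finset ℕ} {t u : Multiset Proc} (hs : MStep X t u) (s : Multiset Proc) :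
    MStep X (t + s) (u + s) := by
  cases hs with
  | cond_tt h1 h2 h3 =>
    rw [Multiset.cons_add, add_assoc]; exact .cond_tt h1 h2 h3
  | cond_ff h1 h2 h3 =>
    rw [Multiset.cons_add, add_assoc]; exact .cond_ff h1 h2 h3
  | com h1 h2 h3 h4 =>
    rw [Multiset.cons_add, Multiset.cons_add, add_assoc]; exact .com h1 h2 h3 h4
  | sel j h1 h2 h3 h4 =>
    rw [Multiset.cons_add, Multiset.cons_add, add_assoc]; exact .sel j h1 h2 h3 h4

theorem Flattens.two {P Q P' Q' : Proc} (hP : Flattens P P') (hQ : Flattens Q Q') {X : Finset ℕ}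
    {KP KQ tP tQ} (fP : Flat P KP tP) (fQ : Flat Q KQ tQ) (hn : (KP + KQ).Nodup)
    (hX : ∀ k ∈ KP + KQ, k ∉ X) : ∃ KP' KQ' tP' tQ', Flat P' KP' tP' ∧ Flat Q' KQ' tQ' ∧
      (KP' + KQ').Nodup ∧ (∀ k ∈ KP' + KQ', k ∉ X) ∧ MTC tP tP' ∧ MTC tQ tQ' := by
  obtain ⟨K, t, h1, h2, h3, h4⟩ := hP.par hQ X _ _ (.par fP fQ) hn
  obtain ⟨n1, n2, d⟩ := Multiset.nodup_add.1 hn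
  obtain ⟨L1, u1, a1, a2, a3, a4⟩ := hP (X ∪ KQ.toFinset) KP tP fP n1
  obtain ⟨L2, u2, b1, b2, b3, b4⟩ := hQ (X ∪ L1.toFinset) KQ tQ fQ n2
  refine ⟨L1, L2, u1, u2, a1, b1, ?_, ?_, a4, b4⟩
  · refine Multiset.nodup_add.2 ⟨a2, b2, Multiset.disjoint_left.2 fun {k} hk hk' => ?_⟩
    rcases b3 k hk' with h3 | h3
    · rcases a3 k hk with h4 | h4
      · exact Multiset.disjoint_left.1 d h4 h3
      · exact h4 (by simp [h3])
    · exact h3 (by simp [hk])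
  · intro k hk
    rcases Multiset.mem_add.1 hk with hk | hk
    · rcases a3 k hk with h3 | h3
      exacts [hX k (by simp [h3]), fun h => h3 (by simp [h])]
    · rcases b3 k hk with h3 | h3
      exacts [hX k (by simp [h3]), fun h => h3 (by simp [h])]

theorem Cong.flattens' {P Q : Proc} (h : Cong P Q) : Flattens P Q := by
  have := (h.flattens .var).1
  simpa using this

/-- `TC` preserves the shape of a redex and alters only continuations; these are flattened afresh by
means of `Cong.flattens'`. -/
theorem MStep.congr {X : Finset ℕ} {t u t' : Multiset Proc} (h : MTC t u) (hs : MStep X t t') :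
    ∃ u', MStep X u u' ∧ MTC t' u' := by
  cases hs with
  | cond_tt h1 h2 h3 =>
    obtain ⟨b, bs, hb, hbs, rfl⟩ := Multiset.rel_cons_left.1 h
    cases hb with | cond hp hq =>
    obtain ⟨K', t', a1, a2, a3, a4⟩ := hp.flattens' X _ _ h1 h2
    refine ⟨_, .cond_tt a1 a2 fun k hk => ?_, .add a4 hbs⟩
    rcases a3 k hk with h | h
    exacts [h3 k h, h]
  | cond_ff h1 h2 h3 =>
    obtain ⟨b, bs, hb, hbs, rfl⟩ := Multiset.rel_cons_left.1 h
    cases hb with | cond hp hq =>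
    obtain ⟨K', t', a1, a2, a3, a4⟩ := hq.flattens' X _ _ h1 h2
    refine ⟨_, .cond_ff a1 a2 fun k hk => ?_, .add a4 hbs⟩
    rcases a3 k hk with h | h
    exacts [h3 k h, h]
  | @com k o q v P Q r KP KQ tP tQ h1 h2 h3 h4 =>
    obtain ⟨b, bs, hb, hbs, rfl⟩ := Multiset.rel_cons_left.1 h
    obtain ⟨c, cs, hc, hcs, rfl⟩ := Multiset.rel_cons_left.1 hbs
    cases hb with | out hp =>
    cases hc with | inp hq =>
    obtain ⟨_, _, _, _, a1, a2, a3, a4, a5, a6⟩ :=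
      Flattens.two hp.flattens' (hq.subst (Subst.inst v)).flattens' h1 h2 h3 h4
    refine ⟨_, .com a1 a2 a3 a4, .add (.add a5 (.add a6 ?_)) hcs⟩
    cases q
    · exact .zero
    · exact .cons (.inp hq) .zero
  | sel j h1 h2 h3 h4 =>
    obtain ⟨b, bs, hb, hbs, rfl⟩ := Multiset.rel_cons_left.1 h
    obtain ⟨c, cs, hc, hcs, rfl⟩ := Multiset.rel_cons_left.1 hbs
    cases hb with | sel hp =>
    cases hc with | bran hq =>
    obtain ⟨_, _, _, _, a1, a2, a3, a4, a5, a6⟩ :=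
      Flattens.two hp.flattens' (hq j).flattens' h1 h2 h3 h4
    exact ⟨_, .sel j a1 a2 a3 a4, .add (.add a5 a6) hcs⟩

theorem exists_flat_two (P Q : Proc) (X : Finset ℕ) : ∃ KP KQ tP tQ, Flat P KP tP ∧ Flat Q KQ tQ ∧
    (KP + KQ).Nodup ∧ ∀ k ∈ KP + KQ, k ∉ X := by
  obtain ⟨K, t, h1, h2, h3⟩ := exists_flat (.par P Q) .var X
  rw [Proc.subst_var] at h1
  obtain ⟨KP, KQ, tP, tQ, h4, h5, rfl, rfl⟩ := flat_par_iff.1 h1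
  exact ⟨KP, KQ, tP, tQ, h4, h5, h2, h3⟩

theorem flat_leave {q : Qual} {C P : Proc} (hC : C.Thr) {K : Multiset ℕ} {t : Multiset Proc}
    (h : Flat P K t) : Flat (leave q C P) K (t + stay q C) := by
  cases q with
  | lin => simpa [leave, stay] using h
  | un => exact flat_par_iff.2 ⟨K, 0, t, {C}, h, .thr hC, by simp, rfl⟩

/-- The set `X` makes the channels created by a step avoid those of the surrounding context. In the
case `struct` the configuration is changed by congruence before and after the step, so the result
matches only up to `MTC`. -/
theorem Step.mstep {T T' : Proc} (h : Step T T') : ∀ (σ : Subst) (X : Finset ℕ) (K : Multiset ℕ)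
    (t : Multiset Proc), Flat (T.subst σ) K t → K.Nodup → ∃ K' t' u, Flat (T'.subst σ) K' t' ∧
      K'.Nodup ∧ (∀ k ∈ K', k ∈ K ∨ k ∉ X) ∧ MStep X t u ∧ MTC u t' := by
  induction h with
  | cond_tt P Q =>
    intro σ X K t hf hK
    obtain ⟨rfl, rfl⟩ := (flat_thr_iff (by exact trivial)).1 hf
    obtain ⟨K', t', h1, h2, h3⟩ := exists_flat P σ X
    exact ⟨K', t', t' + 0, h1, h2, fun k hk => .inr (h3 k hk), .cond_tt h1 h2 h3,
      by rw [add_zero]; exact MTC.refl_thr h1.thr_mem⟩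
  | cond_ff P Q =>
    intro σ X K t hf hK
    obtain ⟨rfl, rfl⟩ := (flat_thr_iff (by exact trivial)).1 hf
    obtain ⟨K', t', h1, h2, h3⟩ := exists_flat Q σ X
    exact ⟨K', t', t' + 0, h1, h2, fun k hk => .inr (h3 k hk), .cond_ff h1 h2 h3,
      by rw [add_zero]; exact MTC.refl_thr h1.thr_mem⟩
  | com q v P Q R =>
    intro σ X K t hf hK
    obtain ⟨k, o, L, h1, rfl⟩ := flat_res_iff.1 hf
    obtain ⟨_, KR, _, tR, h2, hR, rfl, rfl⟩ := flat_par_iff.1 h1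
    obtain ⟨_, _, _, _, h3, h4, rfl, rfl⟩ := flat_par_iff.1 h2
    obtain ⟨rfl, rfl⟩ := (flat_thr_iff (by exact trivial)).1 h3
    obtain ⟨rfl, rfl⟩ := (flat_thr_iff (by exact trivial)).1 h4
    simp only [Proc.subst_subst, zero_add] at h1 hR hK ⊢
    set σ' := σ.up.up.comp (Subst.opn (nm k o) (nm k !o)) with hσ'
    obtain ⟨KP, KQ, tP, tQ, a1, a2, a3, a4⟩ := exists_flat_two (P.subst σ')
      ((Q.subst σ'.up).subst (Subst.inst (v.subst σ'))) (X ∪ (k ::ₘ KR).toFinset)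
    have e2 : (Q.subst σ'.up).subst (Subst.inst (v.subst σ')) = (Q.subst (Subst.inst v)).subst σ' := by
      rw [Proc.subst_subst, Proc.subst_subst, Subst.up_inst]
    have e1 : (Proc.inp q (.var 1) Q).subst σ' = .inp q (.var (nm k !o)) (Q.subst σ'.up) := rfl
    have hf' : Flat ((Proc.res (.par (.par P (leave q (.inp q (.var 1) Q) (Q.subst (Subst.inst v)))) R)).subst σ)
        (k ::ₘ (KP + KQ + KR))
        (tP + (tQ + stay q (.inp q (.var (nm k !o)) (Q.subst σ'.up))) + tR) := by
      refine flat_res_iff.2 ⟨k, o, _, ?_, rfl⟩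
      rw [Proc.subst_subst, ← hσ']
      refine .par (.par a1 ?_) hR
      rw [e2] at a2
      have := flat_leave (q := q) (C := .inp q (.var (nm k !o)) (Q.subst σ'.up)) trivial a2
      cases q
      · exact this
      · exact this
    refine ⟨_, _, _, hf', ?_, ?_, ?_, MTC.refl_thr hf'.thr_mem⟩
    · obtain ⟨hk, hKR⟩ := Multiset.nodup_cons.1 hK
      refine Multiset.nodup_cons.2 ⟨fun h => ?_, Multiset.nodup_add.2 ⟨a3, hKR,
        Multiset.disjoint_left.2 fun {l} hl hl' => a4 l hl (by simp [hl'])⟩⟩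
      rcases Multiset.mem_add.1 h with h | h
      exacts [a4 k h (by simp), hk h]
    · intro l hl
      rcases Multiset.mem_cons.1 hl with rfl | hl
      · exact .inl (by simp)
      rcases Multiset.mem_add.1 hl with h | h
      · exact .inr fun h' => a4 l h (by simp [h'])
      · exact .inl (by simp [h])
    · have := MStep.com (k := k) (o := o) (q := q) (r := tR) a1 a2 a3
        (fun k hk h => a4 k hk (Finset.mem_union_left _ h))
      convert this using 1
      rw [Multiset.singleton_add, Multiset.cons_add, Multiset.singleton_add]; rfl
  | @sel n lab j P Q R =>
    intro σ X K t hf hK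
    obtain ⟨k, o, L, h1, rfl⟩ := flat_res_iff.1 hf
    obtain ⟨_, KR, _, tR, h2, hR, rfl, rfl⟩ := flat_par_iff.1 h1
    obtain ⟨_, _, _, _, h3, h4, rfl, rfl⟩ := flat_par_iff.1 h2
    obtain ⟨rfl, rfl⟩ := (flat_thr_iff (by exact trivial)).1 h3
    obtain ⟨rfl, rfl⟩ := (flat_thr_iff (by exact trivial)).1 h4
    simp only [Proc.subst_subst, zero_add] at h1 hR hK ⊢
    set σ' := σ.up.up.comp (Subst.opn (nm k o) (nm k !o)) with hσ'
    obtain ⟨KP, KQ, tP, tQ, a1, a2, a3, a4⟩ := exists_flat_two (P.subst σ')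
      ((Q j).subst σ') (X ∪ (k ::ₘ KR).toFinset)
    have hf' : Flat ((Proc.res (.par (.par P (Q j)) R)).subst σ)
        (k ::ₘ (KP + KQ + KR)) (tP + tQ + tR) := by
      refine flat_res_iff.2 ⟨k, o, _, ?_, rfl⟩
      rw [Proc.subst_subst, ← hσ']
      exact .par (.par a1 a2) hR
    refine ⟨_, _, _, hf', ?_, ?_, ?_, MTC.refl_thr hf'.thr_mem⟩
    · obtain ⟨hk, hKR⟩ := Multiset.nodup_cons.1 hK
      refine Multiset.nodup_cons.2 ⟨fun h => ?_, Multiset.nodup_add.2 ⟨a3, hKR,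
        Multiset.disjoint_left.2 fun {l} hl hl' => a4 l hl (by simp [hl'])⟩⟩
      rcases Multiset.mem_add.1 h with h | h
      exacts [a4 k h (by simp), hk h]
    · intro l hl
      rcases Multiset.mem_cons.1 hl with rfl | hl
      · exact .inl (by simp)
      rcases Multiset.mem_add.1 hl with h | h
      · exact .inr fun h' => a4 l h (by simp [h'])
      · exact .inl (by simp [h])
    · have := MStep.sel (k := k) (o := o) (lab := lab) (Q := fun i => (Q i).subst σ') (r := tR) j a1 a2 a3
        (fun k hk h => a4 k hk (Finset.mem_union_left _ h))
      convert this using 1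
      rw [Multiset.singleton_add, Multiset.cons_add, Multiset.singleton_add]; rfl
  | par Q _ ih =>
    intro σ X K t hf hK
    obtain ⟨K1, K2, t1, t2, h1, h2, rfl, rfl⟩ := flat_par_iff.1 hf
    obtain ⟨n1, n2, d⟩ := Multiset.nodup_add.1 hK
    obtain ⟨K', t', u, a1, a2, a3, a4, a5⟩ := ih σ (X ∪ K2.toFinset) K1 t1 h1 n1
    refine ⟨K' + K2, t' + t2, u + t2, .par a1 h2, ?_, ?_,
      (a4.mono Finset.subset_union_left).add _, .add a5 (MTC.refl_thr h2.thr_mem)⟩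
    · refine Multiset.nodup_add.2 ⟨a2, n2, Multiset.disjoint_left.2 fun {l} hl hl' => ?_⟩
      rcases a3 l hl with h | h
      exacts [Multiset.disjoint_left.1 d h hl', h (by simp [hl'])]
    · intro l hl
      rcases Multiset.mem_add.1 hl with h | h
      · rcases a3 l h with h | h
        exacts [.inl (by simp [h]), .inr fun h' => h (by simp [h'])]
      · exact .inl (by simp [h])
  | res _ ih =>
    intro σ X K t hf hK
    obtain ⟨k, o, L, h1, rfl⟩ := flat_res_iff.1 hf
    obtain ⟨hk, hL⟩ := Multiset.nodup_cons.1 hK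
    rw [Proc.subst_subst] at h1
    obtain ⟨K', t', u, a1, a2, a3, a4, a5⟩ := ih _ (insert k X) L t h1 hL
    refine ⟨k ::ₘ K', t', u, flat_res_iff.2 ⟨k, o, K', by rw [Proc.subst_subst]; exact a1, rfl⟩, ?_, ?_,
      a4.mono (Finset.subset_insert _ _), a5⟩
    · refine Multiset.nodup_cons.2 ⟨fun h => ?_, a2⟩
      rcases a3 k h with h | h
      exacts [hk h, h (by simp)]
    · intro l hl
      rcases Multiset.mem_cons.1 hl with rfl | hl
      · simp
      · rcases a3 l hl with h | h
        exacts [.inl (by simp [h]), .inr fun h' => h (by simp [h'])]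
  | struct hc1 _ hc2 ih =>
    intro σ X K t hf hK
    obtain ⟨K1, t1, a1, a2, a3, a4⟩ := (hc1.flattens σ).1 X K t hf hK
    obtain ⟨K2, t2, u, b1, b2, b3, b4, b5⟩ := ih σ X K1 t1 a1 a2
    obtain ⟨K3, t3, c1, c2, c3, c4⟩ := (hc2.flattens σ).1 X K2 t2 b1 b2
    obtain ⟨u', d1, d2⟩ := b4.congr a4.symm
    refine ⟨K3, t3, u', c1, c2, fun k hk => ?_, d1, (d2.symm.trans b5).trans c4⟩
    rcases c3 k hk with h | h
    · rcases b3 k h with h | h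
      · exact a3 k h
      · exact .inr h
    · exact .inr h

/-- The configuration `t` represents the process `T`. -/
def Rep (T : Proc) (K : Multiset ℕ) (t : Multiset Proc) : Prop :=
  ∃ u, Flat (T.subst freeNm) K u ∧ K.Nodup ∧ MTC u t

theorem Rep.step {T T' : Proc} {K : Multiset ℕ} {t : Multiset Proc} (h : Rep T K t)
    (hs : Step T T') (X : Finset ℕ) : ∃ K' t', MStep X t t' ∧ Rep T' K' t' := by
  obtain ⟨u, h1, h2, h3⟩ := h
  obtain ⟨K', u', w, a1, a2, a3, a4, a5⟩ := hs.mstep freeNm X K u h1 h2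
  obtain ⟨t', b1, b2⟩ := a4.congr h3
  exact ⟨K', t', b1, u', a1, a2, a5.symm.trans b2⟩

theorem Proc.supp_out {F : Set ℕ} {x v : Val} {P : Proc} (h : Supp F (Proc.out x v P)) :
    x.Supp F ∧ v.Supp F ∧ Supp F P := by
  have : ∀ σ τ : Subst, (∀ x ∈ F, σ x = τ x) →
      x.subst σ = x.subst τ ∧ v.subst σ = v.subst τ ∧ P.subst σ = P.subst τ := by
    intro σ τ hh
    have := h σ τ hh
    injection this with h1 h2 h3
    exact ⟨h1, h2, h3⟩
  exact ⟨Val.supp_of_subst fun σ τ hh => (this σ τ hh).1,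
    Val.supp_of_subst fun σ τ hh => (this σ τ hh).2.1, fun σ τ hh => (this σ τ hh).2.2⟩

theorem Proc.supp_inp {F : Set ℕ} {q : Qual} {x : Val} {P : Proc} (h : Supp F (Proc.inp q x P)) :
    ∀ v : Val, v.Supp F → Supp F (P.subst (Subst.inst v)) := by
  intro v hv
  refine Supp.inst hv fun σ τ hh => ?_
  have := h σ τ hh
  injection this

theorem Proc.supp_sel {F : Set ℕ} {x : Val} {l : Lab} {P : Proc} (h : Supp F (Proc.sel x l P)) :
    x.Supp F ∧ Supp F P := by
  have : ∀ σ τ : Subst, (∀ x ∈ F, σ x = τ x) → x.subst σ = x.subst τ ∧ P.subst σ = P.subst τ := by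
    intro σ τ hh
    have := h σ τ hh
    injection this with h1 h2 h3
    exact ⟨h1, h3⟩
  exact ⟨Val.supp_of_subst fun σ τ hh => (this σ τ hh).1, fun σ τ hh => (this σ τ hh).2⟩

theorem Proc.supp_bran {F : Set ℕ} {x : Val} {n : ℕ} {lab : Fin n ↪ Lab} {P : Fin n → Proc}
    (h : Supp F (Proc.bran x n lab P)) (j : Fin n) : Supp F (P j) := by
  intro σ τ hh
  have := h σ τ hh
  injection this with h1 h2 h3 h4
  exact congrFun h4 j

theorem Proc.supp_cond {F : Set ℕ} {v : Val} {P Q : Proc} (h : Supp F (Proc.cond v P Q)) :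
    Supp F P ∧ Supp F Q := by
  have : ∀ σ τ : Subst, (∀ x ∈ F, σ x = τ x) → P.subst σ = P.subst τ ∧ Q.subst σ = Q.subst τ := by
    intro σ τ hh
    have := h σ τ hh
    injection this with h1 h2 h3
    exact ⟨h2, h3⟩
  exact ⟨fun σ τ hh => (this σ τ hh).1, fun σ τ hh => (this σ τ hh).2⟩

theorem flat_zero_zero : Flat Proc.nil 0 0 := Flat.nil

/-- A reduction of configurations is realised between normal forms: bring the redex to the front,
move its channel innermost, apply the rule, and flatten the two continuations. The lists may be
chosen, as the order of threads is immaterial. -/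
theorem MStep.real {X : Finset ℕ} {t t' : Multiset Proc} (hs : MStep X t t') (K : List ℕ)
    (hX : ∀ k ∈ K, k ∈ X) (hK : K.Nodup)
    (ht : ∀ P ∈ t, Supp (evens ∪ names K) P) :
    ∃ (tl tl' : List Proc) (K' : List ℕ), (tl : Multiset Proc) = t ∧ (tl' : Multiset Proc) = t' ∧
      K'.Nodup ∧ (∀ k ∈ K', k ∈ K ∨ k ∉ X) ∧ (∀ P ∈ tl', Supp (evens ∪ names K') P) ∧
      Step (NF K PCalc.closeNm tl) (NF K' PCalc.closeNm tl') := by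
  have fresh : ∀ {L : Multiset ℕ}, L.Nodup → (∀ k ∈ L, k ∉ X) → ((K : Multiset ℕ) + L).Nodup :=
    fun hL hLX => Multiset.nodup_add.2 ⟨by simpa using hK, hL,
      Multiset.disjoint_left.2 fun {l} hl hl' => hLX l hl' (hX l (by simpa using hl))⟩
  have hstruct : ∀ {P Q Q' P' : Proc}, PCalc.cong P Q → Step Q Q' → PCalc.cong Q' P' → Step P P' :=
    fun h1 h2 h3 => .struct h1 h2 h3
  -- combine a reduction with the flattening of the two continuations
  have fin : ∀ {P Q : Proc} {KP KQ : Multiset ℕ} {tP tQ r : Multiset Proc} {tl : List Proc},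
      Flat P KP tP → Flat Q KQ tQ → (KP + KQ).Nodup → (∀ k ∈ KP + KQ, k ∉ X) →
      Supp (evens ∪ names K) P → Supp (evens ∪ names K) Q → (∀ P ∈ r, Supp (evens ∪ names K) P) →
      Step (NF K PCalc.closeNm tl) (NF K PCalc.closeNm (P :: Q :: r.toList)) →
      ∃ (tl' : List Proc) (K' : List ℕ), (tl' : Multiset Proc) = tP + tQ + r ∧
      K'.Nodup ∧ (∀ k ∈ K', k ∈ K ∨ k ∉ X) ∧ (∀ P ∈ tl', Supp (evens ∪ names K') P) ∧
      Step (NF K PCalc.closeNm tl) (NF K' PCalc.closeNm tl') := by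
    intro P Q KP KQ tP tQ r tl fP fQ hn hX' sP sQ sr hstep
    have hK1 : (((K : Multiset ℕ) + (KP + KQ)).toList : Multiset ℕ) = K + (KP + KQ) :=
      Multiset.coe_toList _
    refine ⟨(tP + tQ + r).toList, ((K : Multiset ℕ) + (KP + KQ)).toList, Multiset.coe_toList _, ?_, ?_, ?_, ?_⟩
    · rw [← Multiset.coe_nodup, hK1]; exact fresh hn hX'
    · intro k hk
      rw [Multiset.mem_toList, Multiset.mem_add] at hk
      exact hk.imp (fun h => by simpa using h) (hX' k)
    · intro R hR
      rw [hK1]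
      exact Supp.flat_two rfl fP fQ sP sQ sr R (by simpa using hR)
    · refine .struct (.refl _) hstep ?_
      refine PCalc.NF_flat_two (α := Proc) subset_rfl fP fQ (fresh hn hX') sP sQ ?_ hK1 ?_ _
      · intro R hR; exact sr R (by simpa using hR)
      · rw [Multiset.coe_toList, Multiset.coe_toList]
  cases hs with
  | @cond_tt P Q r L t h1 h2 h3 =>
    have hc := Proc.supp_cond (ht (.cond .tt P Q) (by simp))
    -- A conditional has a single continuation; a terminated second one lets `fin` cover it as well.
    obtain ⟨tl', K', e1, e2, e3, e4, e5⟩ := fin (P := P) (Q := .nil) (r := r)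
      (tl := .cond .tt P Q :: r.toList) h1 flat_zero_zero
      (by simpa using h2) (by simpa using h3) hc.1 (fun _ _ _ => rfl) (fun R hR => ht R (by simp [hR])) (by
        have := PCalc.NF_append (α := Proc) (R := Step) (.res) K (L := []) (L' := [])
          (t := .cond .tt P Q :: r.toList) (t' := P :: .nil :: r.toList) (fun ρ => by
            refine .struct (.refl _) (.par _ (.cond_tt _ _)) ?_
            exact .par (.refl _) (.symm (.trans (.par_comm _ _) (.par_nil _)))) PCalc.closeNm
        simpa using this)
    exact ⟨_, tl', K', by rw [← Multiset.cons_coe, Multiset.coe_toList], by rw [e1, add_zero], e2, e3, e4, e5⟩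
  | @cond_ff P Q r L t h1 h2 h3 =>
    have hc := Proc.supp_cond (ht (.cond .ff P Q) (by simp))
    obtain ⟨tl', K', e1, e2, e3, e4, e5⟩ := fin (P := Q) (Q := .nil) (r := r)
      (tl := .cond .ff P Q :: r.toList) h1 flat_zero_zero
      (by simpa using h2) (by simpa using h3) hc.2 (fun _ _ _ => rfl) (fun R hR => ht R (by simp [hR])) (by
        have := PCalc.NF_append (α := Proc) (R := Step) (.res) K (L := []) (L' := [])
          (t := .cond .ff P Q :: r.toList) (t' := Q :: .nil :: r.toList) (fun ρ => by
            refine .struct (.refl _) (.par _ (.cond_ff _ _)) ?_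
            exact .par (.refl _) (.symm (.trans (.par_comm _ _) (.par_nil _)))) PCalc.closeNm
        simpa using this)
    exact ⟨_, tl', K', by rw [← Multiset.cons_coe, Multiset.coe_toList], by rw [e1, add_zero], e2, e3, e4, e5⟩
  | @com k o q v P Q r KP KQ tP tQ h1 h2 h3 h4 =>
    have sout := Proc.supp_out (ht (.out (.var (nm k o)) v P) (by simp))
    have sinp := ht (.inp q (.var (nm k !o)) Q) (by simp)
    -- The end of a channel outside `K` lies neither among the free names nor among the names of
    -- `K`, so it could not occur in a thread.
    have hk : k ∈ K := by
      by_contra hk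
      exact PCalc.notMem_supp subset_rfl (K := (K : Multiset ℕ)) (by simpa using hk) o (sout.1 _ rfl)
    obtain ⟨tl', K', e1, e2, e3, e4, e5⟩ := fin (P := P)
      (Q := leave q (.inp q (.var (nm k !o)) Q) (Q.subst (Subst.inst v))) (r := r)
      (tl := .out (.var (nm k o)) v P :: .inp q (.var (nm k !o)) Q :: r.toList) h1
      (flat_leave (C := .inp q (.var (nm k !o)) Q) trivial h2) h3 h4 sout.2.2 (by
        have := Proc.supp_inp sinp v sout.2.1
        cases q with
        | lin => exact this
        | un => exact fun σ τ hh => congrArg₂ Proc.par (this σ τ hh) (sinp σ τ hh))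
      (fun R hR => ht R (by simp [hR])) (by
        refine PCalc.NF_lift (α := Proc) (R := Step) (.res) hstruct hk hK (fun ρ => ?_) _
        obtain ⟨τ, hτ1, hτ2, hτ⟩ := PCalc.NF_one (α := Proc) k o ρ
        refine .struct (hτ _) (.struct (.res (.par_assoc _ _ _)) ?_ (.res (.symm (.par_assoc _ _ _))))
          (.symm (hτ _))
        show Step (.res (.par (.par (.out (τ (nm k o)) (v.subst τ) (P.subst τ))
          (.inp q (τ (nm k !o)) (Q.subst τ.up))) _)) _
        rw [hτ1, hτ2]
        have e : (Q.subst τ.up).subst (Subst.inst (v.subst τ)) = (Q.subst (Subst.inst v)).subst τ := by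
          rw [Proc.subst_subst, Proc.subst_subst, Subst.up_inst]
        have e' : (leave q (.inp q (.var (nm k !o)) Q) (Q.subst (Subst.inst v))).subst τ =
            leave q (.inp q (.var 1) (Q.subst τ.up)) ((Q.subst (Subst.inst v)).subst τ) := by
          cases q with
          | lin => rfl
          | un =>
            show Proc.par _ (.inp _ (τ _) _) = _
            rw [hτ2]; rfl
        have := Step.com q (v.subst τ) (P.subst τ) (Q.subst τ.up)
          (parL (r.toList.map (PCalc.subst · τ)))
        rw [e, ← e'] at this
        exact this)
    refine ⟨_, tl', K', ?_, e1, e2, e3, e4, e5⟩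
    rw [← Multiset.cons_coe, ← Multiset.cons_coe, Multiset.coe_toList]
  | @sel k o n lab P Q r KP KQ tP tQ j h1 h2 h3 h4 =>
    have ssel := Proc.supp_sel (ht (.sel (.var (nm k o)) (lab j) P) (by simp))
    have sbran := Proc.supp_bran (ht (.bran (.var (nm k !o)) n lab Q) (by simp)) j
    have hk : k ∈ K := by
      by_contra hk
      exact PCalc.notMem_supp subset_rfl (K := (K : Multiset ℕ)) (by simpa using hk) o (ssel.1 _ rfl)
    obtain ⟨tl', K', e1, e2, e3, e4, e5⟩ := fin (P := P) (Q := Q j) (r := r)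
      (tl := .sel (.var (nm k o)) (lab j) P :: .bran (.var (nm k !o)) n lab Q :: r.toList) h1
      h2 h3 h4 ssel.2 sbran
      (fun R hR => ht R (by simp [hR])) (by
        refine PCalc.NF_lift (α := Proc) (R := Step) (.res) hstruct hk hK (fun ρ => ?_) _
        obtain ⟨τ, hτ1, hτ2, hτ⟩ := PCalc.NF_one (α := Proc) k o ρ
        refine .struct (hτ _) (.struct (.res (.par_assoc _ _ _)) ?_ (.res (.symm (.par_assoc _ _ _))))
          (.symm (hτ _))
        show Step (.res (.par (.par (.sel (τ (nm k o)) (lab j) (P.subst τ))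
          (.bran (τ (nm k !o)) n lab (fun i => (Q i).subst τ))) _)) _
        rw [hτ1, hτ2]
        exact Step.sel j (P.subst τ) (fun i => (Q i).subst τ) _)
    refine ⟨_, tl', K', ?_, e1, e2, e3, e4, e5⟩
    rw [← Multiset.cons_coe, ← Multiset.cons_coe, Multiset.coe_toList]

theorem MStep.thr_mem {X : Finset ℕ} {t t' : Multiset Proc} (hs : MStep X t t')
    (ht : ∀ P ∈ t, P.Thr) : ∀ P ∈ t', P.Thr := by
  intro R hR
  cases hs with
  | cond_tt h1 _ _ =>
    rcases Multiset.mem_add.1 hR with h | h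
    exacts [h1.thr_mem R h, ht R (by simp [h])]
  | cond_ff h1 _ _ =>
    rcases Multiset.mem_add.1 hR with h | h
    exacts [h1.thr_mem R h, ht R (by simp [h])]
  | @com k o q v P Q r KP KQ tP tQ h1 h2 _ _ =>
    simp only [Multiset.mem_add] at hR
    rcases hR with (h | h | h) | h
    · exact h1.thr_mem R h
    · exact h2.thr_mem R h
    · cases q
      · simp [stay] at h
      · rw [Multiset.mem_singleton.1 h]; trivial
    · exact ht R (by simp [h])
  | sel j h1 h2 _ _ =>
    simp only [Multiset.mem_add] at hR
    rcases hR with (h | h) | h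
    exacts [h1.thr_mem R h, h2.thr_mem R h, ht R (by simp [h])]

theorem Rep.real {T : Proc} {K : Multiset ℕ} {t t' : Multiset Proc} (h : Rep T K t) {X : Finset ℕ}
    (hX : ∀ k ∈ K, k ∈ X) (hs : MStep X t t') :
    ∃ T' K', Step T T' ∧ Rep T' K' t' ∧ ∀ k ∈ K', k ∈ K ∨ k ∉ X := by
  obtain ⟨u, h1, h2, h3⟩ := h
  obtain ⟨u', hs', htc⟩ := hs.congr h3.symm
  obtain ⟨Kl, rfl⟩ := Quotient.exists_rep K
  obtain ⟨tl, tl', K', e1, e2, e3, e4, e5, e6⟩ := hs'.real Kl hX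
    (by simpa using h2) (fun P hP => (PCalc.supp_freeNm (α := Proc) T).flat h1 P hP)
  refine ⟨NF K' PCalc.closeNm tl', K', ?_, ⟨u', ?_, by simpa using e3, htc.symm⟩, e4⟩
  · refine .struct ?_ e6 (.refl _)
    exact PCalc.cong_NF (α := Proc) (by rw [e1]; exact h1) (by simpa using h2)
  · rw [← e2]
    exact PCalc.flat_NF_free (α := Proc) fun P hP =>
      ⟨hs'.thr_mem h1.thr_mem P (by rw [← e2]; simpa using hP), e5 P hP⟩

/-! ### Barbs of configurations -/

/-- The subject of a thread. -/
def Proc.subj : Proc → Option Val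
  | .out x _ _ => some x
  | .inp _ x _ => some x
  | .sel x _ _ => some x
  | .bran x _ _ _ => some x
  | _ => none

theorem Barb.flat {P : Proc} {x : ℕ} (h : Barb P x) : ∀ {σ : Subst} {y : ℕ} {K : Multiset ℕ}
    {t : Multiset Proc}, σ x = .var y → Flat (P.subst σ) K t → ∃ Q ∈ t, Q.subj = some (.var y) := by
  induction h with
  | out | inp | sel | bran =>
    intro σ y K t hσ hf
    obtain ⟨rfl, rfl⟩ := (flat_thr_iff (by exact trivial)).1 hf
    exact ⟨_, Multiset.mem_singleton_self _, congrArg some hσ⟩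
  | par_left _ ih =>
    intro σ y K t hσ hf
    obtain ⟨_, _, _, _, h1, h2, rfl, rfl⟩ := flat_par_iff.1 hf
    obtain ⟨Q, hQ, h⟩ := ih hσ h1
    exact ⟨Q, by simp [hQ], h⟩
  | par_right _ ih =>
    intro σ y K t hσ hf
    obtain ⟨_, _, _, _, h1, h2, rfl, rfl⟩ := flat_par_iff.1 hf
    obtain ⟨Q, hQ, h⟩ := ih hσ h2
    exact ⟨Q, by simp [hQ], h⟩
  | res _ ih =>
    intro σ y K t hσ hf
    obtain ⟨k, o, _, h1, rfl⟩ := flat_res_iff.1 hf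
    rw [Proc.subst_subst] at h1
    exact ih (by rw [Subst.up_up_opn]; exact hσ) h1

/-- Bound endpoints are opened to names of channels in `K`; a subject outside these names therefore
stems from a free variable. -/
theorem barb_of_flat (P : Proc) : ∀ {σ : Subst} {y : ℕ} {K : Multiset ℕ} {t : Multiset Proc},
    Flat (P.subst σ) K t → y ∉ names K → (∃ Q ∈ t, Q.subj = some (.var y)) →
    ∃ x, σ x = .var y ∧ Barb P x := by
  have hv : ∀ {v : Val} {σ : Subst} {y : ℕ}, some (v.subst σ) = some (.var y) →
      ∃ x, v = .var x ∧ σ x = .var y := by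
    intro v σ y h
    cases v with
    | var x => exact ⟨x, rfl, by simpa [Val.subst] using h⟩
    | _ => simp [Val.subst] at h
  induction P with
  | out v | inp _ v | sel v | bran v =>
    intro σ y K t hf hy ⟨Q, hQ, hs⟩
    obtain ⟨rfl, rfl⟩ := (flat_thr_iff (by exact trivial)).1 hf
    rw [Multiset.mem_singleton.1 hQ] at hs
    obtain ⟨x, rfl, hx⟩ := hv hs
    exact ⟨x, hx, by constructor⟩
  | cond =>
    intro σ y K t hf hy ⟨Q, hQ, hs⟩
    obtain ⟨rfl, rfl⟩ := (flat_thr_iff (by exact trivial)).1 hf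
    rw [Multiset.mem_singleton.1 hQ] at hs
    cases hs
  | nil =>
    intro σ y K t hf hy ⟨Q, hQ, hs⟩
    obtain ⟨rfl, rfl⟩ := flat_nil_iff.1 hf
    simp at hQ
  | par P Q ih1 ih2 =>
    intro σ y K t hf hy ⟨R, hR, hs⟩
    obtain ⟨_, _, _, _, h1, h2, rfl, rfl⟩ := flat_par_iff.1 hf
    rw [PCalc.names_add] at hy
    rcases Multiset.mem_add.1 hR with h | h
    · obtain ⟨x, hx, hb⟩ := ih1 h1 (fun h => hy (.inl h)) ⟨R, h, hs⟩
      exact ⟨x, hx, .par_left hb⟩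
    · obtain ⟨x, hx, hb⟩ := ih2 h2 (fun h => hy (.inr h)) ⟨R, h, hs⟩
      exact ⟨x, hx, .par_right hb⟩
  | res P ih =>
    intro σ y K t hf hy ⟨R, hR, hs⟩
    obtain ⟨k, o, L, h1, rfl⟩ := flat_res_iff.1 hf
    rw [Proc.subst_subst] at h1
    obtain ⟨x, hx, hb⟩ := ih h1 (fun ⟨l, hl, h⟩ => hy ⟨l, by simp [hl], h⟩) ⟨R, hR, hs⟩
    match x with
    | 0 => cases hx; exact absurd ⟨k, by simp, o, rfl⟩ hy
    | 1 => cases hx; exact absurd ⟨k, by simp, !o, rfl⟩ hy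
    | x + 2 =>
      rw [Subst.up_up_opn] at hx
      exact ⟨x, hx, .res hb⟩

theorem TC.subj_eq {P Q : Proc} (h : TC P Q) : P.subj = Q.subj := by
  cases h <;> rfl

theorem Rep.barb_iff {T : Proc} {K : Multiset ℕ} {t : Multiset Proc} (h : Rep T K t) (x : ℕ) :
    Barb T x ↔ ∃ Q ∈ t, Q.subj = some (.var (2 * x)) := by
  obtain ⟨u, h1, h2, h3⟩ := h
  have hiff : (∃ Q ∈ u, Q.subj = some (.var (2 * x))) ↔ ∃ Q ∈ t, Q.subj = some (.var (2 * x)) := by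
    constructor
    · rintro ⟨Q, hQ, hs⟩
      obtain ⟨R, hR, htc⟩ := Multiset.exists_mem_of_rel_of_mem h3 hQ
      exact ⟨R, hR, htc.subj_eq ▸ hs⟩
    · rintro ⟨Q, hQ, hs⟩
      obtain ⟨R, hR, htc⟩ := Multiset.exists_mem_of_rel_of_mem h3.symm hQ
      exact ⟨R, hR, htc.subj_eq ▸ hs⟩
  rw [← hiff]
  constructor
  · intro hb
    exact hb.flat (σ := freeNm) rfl h1
  · intro hh
    obtain ⟨y, hy, hb⟩ := barb_of_flat T h1 (by rintro ⟨k, _, o, h⟩; simp at h) hh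
    have : (2 * y) = 2 * x := by injection hy
    obtain rfl : y = x := by omega
    exact hb

end CMV

end MixedSessions

namespace MixedSessions

/-! ### Subtyping and duality -/

namespace Ty

theorem Unfolds.det {T H H' : Ty} (h : Unfolds T H) (h' : Unfolds T H') : H = H' := by
  induction h with
  | head h => cases h' with
    | head => rfl
    | mu => exact h.elim
  | mu _ ih => cases h' with
    | head h => exact h.elim
    | mu h' => exact ih h'

theorem PaySub.mono {R R' : Ty → Ty → Prop} (h : ∀ {S T}, R S T → R' S T) {p : Pol} {S T : Ty}
    (hs : PaySub R p S T) : PaySub R' p S T := by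
  cases p
  exacts [h hs, h hs]

theorem PaySub.comp {R : Ty → Ty → Prop} {p : Pol} {S T U : Ty} (h : PaySub R p S T)
    (h' : PaySub R p T U) : PaySub (fun S T => ∃ M, R S M ∧ R M T) p S U := by
  cases p
  exacts [⟨_, h', h⟩, ⟨_, h, h'⟩]

theorem SubHead.mono {R R' : Ty → Ty → Prop} (h : ∀ {S T}, R S T → R' S T) {H K : Ty}
    (hs : SubHead R H K) : SubHead R' H K := by
  cases hs with
  | tend => exact .tend
  | unit => exact .unit
  | bool => exact .bool
  | lin_int hd h1 h2 => exact .lin_int hd (fun a ha => (h1 a ha).mono h) fun a ha => h (h2 a ha)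
  | lin_ext hd h1 h2 => exact .lin_ext hd (fun a ha => (h1 a ha).mono h) fun a ha => h (h2 a ha)
  | un_int hd h1 => exact .un_int hd fun a ha => (h1 a ha).mono h
  | un_ext hd h1 => exact .un_ext hd fun a ha => (h1 a ha).mono h

theorem SubHead.comp {R : Ty → Ty → Prop} {H K L : Ty} (h : SubHead R H K) (h' : SubHead R K L) :
    SubHead (fun S T => ∃ M, R S M ∧ R M T) H L := by
  cases h with
  | tend => cases h'; exact .tend
  | unit => cases h'; exact .unit
  | bool => cases h'; exact .bool
  | lin_int hd h1 h2 => cases h' with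
    | lin_int hd' h3 h4 =>
      exact .lin_int (hd'.trans hd) (fun a ha => (h1 a (hd' ha)).comp (h3 a ha))
        fun a ha => ⟨_, h2 a (hd' ha), h4 a ha⟩
  | lin_ext hd h1 h2 => cases h' with
    | lin_ext hd' h3 h4 =>
      exact .lin_ext (hd.trans hd') (fun a ha => (h1 a ha).comp (h3 a (hd ha)))
        fun a ha => ⟨_, h2 a ha, h4 a (hd ha)⟩
  | un_int hd h1 => cases h' with
    | un_int hd' h3 => exact .un_int (hd'.trans hd) fun a ha => (h1 a (hd' ha)).comp (h3 a ha)
  | un_ext hd h1 => cases h' with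
    | un_ext hd' h3 => exact .un_ext (hd.trans hd') fun a ha => (h1 a ha).comp (h3 a (hd ha))

theorem SubTy.unfold {S T : Ty} (h : SubTy S T) :
    ∃ H K, Unfolds S H ∧ Unfolds T K ∧ SubHead SubTy H K := by
  obtain ⟨R, hR, h⟩ := h
  obtain ⟨H, K, h1, h2, h3⟩ := hR S T h
  exact ⟨H, K, h1, h2, h3.mono fun h => ⟨R, hR, h⟩⟩

/-- The relational composite is itself closed under the subtyping rules: unfolding is deterministic,
so both derivations see the same head of the middle type. -/
theorem SubTy.trans {S T U : Ty} (h : SubTy S T) (h' : SubTy T U) : SubTy S U := by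
  refine ⟨fun S T => ∃ M, SubTy S M ∧ SubTy M T, ?_, T, h, h'⟩
  rintro S U ⟨T, h, h'⟩
  obtain ⟨H, K, h1, h2, h3⟩ := h.unfold
  obtain ⟨K', L, h4, h5, h6⟩ := h'.unfold
  cases h2.det h4
  exact ⟨H, L, h1, h5, h3.comp h6⟩

/-- The reflexive closure of subtyping; subtyping is not reflexive on types that do not unfold. -/
def Sub (S T : Ty) : Prop := S = T ∨ SubTy S T

theorem Sub.rfl {S : Ty} : Sub S S := .inl (Eq.refl S)

theorem Sub.trans {S T U : Ty} (h : Sub S T) (h' : Sub T U) : Sub S U := by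
  rcases h with rfl | h
  · exact h'
  · rcases h' with rfl | h'
    exacts [.inr h, .inr (h.trans h')]

theorem PaySub.refl (p : Pol) (S : Ty) : PaySub Sub p S S := by
  cases p
  exacts [.rfl, .rfl]

theorem SubHead.refl {H : Ty} (h : H.IsHead) : SubHead Sub H H := by
  cases H with
  | tend => exact .tend
  | unit => exact .unit
  | bool => exact .bool
  | lin v dom pay cont => cases v with
    | int => exact .lin_int subset_rfl (fun _ _ => .refl _ _) fun _ _ => .rfl
    | ext => exact .lin_ext subset_rfl (fun _ _ => .refl _ _) fun _ _ => .rfl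
  | un v dom pay => cases v with
    | int => exact .un_int subset_rfl fun _ _ => .refl _ _
    | ext => exact .un_ext subset_rfl fun _ _ => .refl _ _
  | var => exact h.elim
  | mu => exact h.elim

theorem Sub.unfold {S K : Ty} (h : Sub S K) (hK : K.IsHead) : ∃ H, Unfolds S H ∧ SubHead Sub H K := by
  rcases h with rfl | h
  · exact ⟨S, .head hK, .refl hK⟩
  · obtain ⟨H, K', h1, h2, h3⟩ := h.unfold
    cases h2.det (.head hK)
    exact ⟨H, h1, h3.mono .inr⟩

/-- Head types that are unrestricted. -/
def UnrHead : Ty → Prop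
  | .tend => True
  | .unit => True
  | .bool => True
  | .un .. => True
  | _ => False

theorem unr_iff {T : Ty} : T.Unr ↔ ∃ H, Unfolds T H ∧ H.UnrHead := by
  constructor
  · rintro (h | h | h | ⟨_, _, _, h⟩)
    exacts [⟨_, h, trivial⟩, ⟨_, h, trivial⟩, ⟨_, h, trivial⟩, ⟨_, h, trivial⟩]
  · rintro ⟨H, h, hH⟩
    cases H with
    | tend => exact .inl h
    | unit => exact .inr (.inl h)
    | bool => exact .inr (.inr (.inl h))
    | un => exact .inr (.inr (.inr ⟨_, _, _, h⟩))
    | _ => exact hH.elim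

theorem SubHead.unr_iff {R : Ty → Ty → Prop} {H K : Ty} (h : SubHead R H K) :
    H.UnrHead ↔ K.UnrHead := by
  cases h <;> exact Iff.rfl

/-- Subtyping relates only heads with the same constructor, so it never mixes linear and
unrestricted types. -/
theorem Sub.unr_iff {S T : Ty} (h : Sub S T) : S.Unr ↔ T.Unr := by
  rcases h with rfl | h
  · exact Iff.rfl
  · obtain ⟨H, K, h1, h2, h3⟩ := h.unfold
    rw [Ty.unr_iff, Ty.unr_iff]
    constructor
    · rintro ⟨H', h4, h5⟩
      cases h1.det h4
      exact ⟨K, h2, h3.unr_iff.1 h5⟩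
    · rintro ⟨K', h4, h5⟩
      cases h2.det h4
      exact ⟨H, h1, h3.unr_iff.2 h5⟩

theorem unr_unit : Ty.unit.Unr := .inr (.inl (.head trivial))

theorem unr_bool : Ty.bool.Unr := .inr (.inr (.inl (.head trivial)))

theorem not_unr_lin {v dom pay cont} : ¬ (Ty.lin v dom pay cont).Unr := by
  rw [unr_iff]
  rintro ⟨H, h, hH⟩
  cases h with
  | head => exact hH

theorem unr_un {v dom pay} : (Ty.un v dom pay).Unr :=
  .inr (.inr (.inr ⟨_, _, _, .head trivial⟩))

theorem Equiv.symm {S T : Ty} (h : Equiv S T) : Equiv T S := ⟨h.2, h.1⟩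

theorem DualHead.mono {R R' : Ty → Ty → Prop} (h : ∀ {S T}, R S T → R' S T) {H K : Ty}
    (hs : DualHead R H K) : DualHead R' H K := by
  cases hs with
  | tend => exact .tend
  | lin hd h1 h2 => exact .lin hd h1 fun a ha => h (h2 a ha)
  | un hd h1 => exact .un hd h1

end Ty

@[simp] theorem Key.dual_dual (a : Key) : a.dual.dual = a := by
  rcases a with ⟨l, p⟩
  cases p <;> rfl

@[simp] theorem View.dual_dual (v : View) : v.dual.dual = v := by
  cases v <;> rfl

namespace Ty

theorem DualHead.symm {R : Ty → Ty → Prop} {H K : Ty} (h : DualHead R H K) :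
    DualHead (fun S T => R T S) K H := by
  cases h with
  | tend => exact .tend
  | @lin v dom dom' pay cont pay' cont' hd h1 h2 =>
    have hd' : ∀ a, a ∈ dom' ↔ Key.dual a ∈ dom := fun a => by rw [hd, Key.dual_dual]
    have key := DualHead.lin (R := fun S T => R T S) (v := v.dual) (pay := pay') (cont := cont')
      (pay' := pay) (cont' := cont) hd' (fun a ha => by
        have := h1 (Key.dual a) ((hd' a).1 ha)
        simp only [Key.dual_dual] at this
        exact this.symm) (fun a ha => by
        have := h2 (Key.dual a) ((hd' a).1 ha)
        simp only [Key.dual_dual] at this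
        exact this)
    rwa [View.dual_dual] at key
  | @un v dom dom' pay pay' hd h1 =>
    have hd' : ∀ a, a ∈ dom' ↔ Key.dual a ∈ dom := fun a => by rw [hd, Key.dual_dual]
    have key := DualHead.un (R := fun S T => R T S) (v := v.dual) (pay := pay')
      (pay' := pay) hd' (fun a ha => by
        have := h1 (Key.dual a) ((hd' a).1 ha)
        simp only [Key.dual_dual] at this
        exact this.symm)
    rwa [View.dual_dual] at key

theorem Dual.symm {S T : Ty} (h : Dual S T) : Dual T S := by
  obtain ⟨R, hR, h⟩ := h
  refine ⟨fun S T => R T S, fun S T h => ?_, h⟩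
  obtain ⟨H, K, h1, h2, h3⟩ := hR _ _ h
  exact ⟨K, H, h2, h1, h3.symm⟩

theorem Dual.unfold {S T : Ty} (h : Dual S T) :
    ∃ H K, Unfolds S H ∧ Unfolds T K ∧ DualHead Dual H K := by
  obtain ⟨R, hR, h⟩ := h
  obtain ⟨H, K, h1, h2, h3⟩ := hR S T h
  exact ⟨H, K, h1, h2, h3.mono fun h => ⟨R, hR, h⟩⟩

/-- The payloads at two connected choices fit. -/
def PayFit (p : Pol) (S T : Ty) : Prop :=
  match p with
  | .snd => Sub S T
  | .rcv => Sub T S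

/-- For a sender the chain is `S' <: S <: T <: T'`: contravariance at the sending end, equivalence
of dual payloads, covariance at the receiving end. For a receiver it runs the other way. -/
theorem PayFit.of {p : Pol} {S S' T T' : Ty} (h : PaySub Sub p S S') (he : Equiv S T)
    (h' : PaySub Sub p.dual T T') : PayFit p S' T' := by
  cases p with
  | snd => exact Sub.trans (Sub.trans h (.inr he.1)) h'
  | rcv => exact Sub.trans (Sub.trans h' (.inr he.2)) h

/-- What the duality of the types of two endpoints means for the types at which they are used. -/
theorem Dual.lin_lin {S T : Ty} (h : Dual S T) {w w' dom dom'} {pay cont : {a // a ∈ dom} → Ty}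
    {pay' cont' : {a // a ∈ dom'} → Ty} (h1 : Sub S (.lin w dom pay cont))
    (h2 : Sub T (.lin w' dom' pay' cont')) :
    w' = w.dual ∧ (w = .int → ∀ a ∈ dom, Key.dual a ∈ dom') ∧
      (w = .ext → ∀ a ∈ dom', Key.dual a ∈ dom) ∧
      ∀ a (ha : a ∈ dom) (ha' : Key.dual a ∈ dom'), PayFit a.2 (pay ⟨a, ha⟩) (pay' ⟨_, ha'⟩) ∧
        ∃ C D, Dual C D ∧ Sub C (cont ⟨a, ha⟩) ∧ Sub D (cont' ⟨_, ha'⟩) := by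
  obtain ⟨H, K, h3, h4, h5⟩ := h.unfold
  obtain ⟨H', h6, h7⟩ := h1.unfold trivial
  obtain ⟨K', h8, h9⟩ := h2.unfold trivial
  cases h3.det h6
  cases h4.det h8
  cases h7 with
  | lin_int hd p c =>
    cases h5 with
    | lin e q d =>
      -- The computed view is turned into a variable so that the subtyping judgement can be
      -- inverted.
      generalize hw : View.int.dual = w0 at h9
      cases h9 with
      | lin_int => cases hw
      | lin_ext hd' p' c' =>
        refine ⟨rfl, fun _ a ha => hd' ((e a).1 (hd ha)), fun h => by simp at h, fun a ha ha' => ?_⟩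
        exact ⟨.of (p a ha) (q a (hd ha)) (p' _ ((e a).1 (hd ha))), _, _, d a (hd ha), c a ha, c' _ _⟩
  | lin_ext hd p c =>
    cases h5 with
    | lin e q d =>
      generalize hw : View.ext.dual = w0 at h9
      cases h9 with
      | lin_ext => cases hw
      | lin_int hd' p' c' =>
        refine ⟨rfl, fun h => by simp at h, fun _ a ha => hd ((e _).2 (by simpa using hd' ha)), fun a ha ha' => ?_⟩
        have ha0 := (e a).2 (hd' ha')
        exact ⟨.of (p a ha0) (q a ha0) (p' _ ha'), _, _, d a ha0, c a ha0, c' _ _⟩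

theorem Dual.un_un {S T : Ty} (h : Dual S T) {w w' dom dom'} {pay : {a // a ∈ dom} → Ty}
    {pay' : {a // a ∈ dom'} → Ty} (h1 : Sub S (.un w dom pay)) (h2 : Sub T (.un w' dom' pay')) :
    w' = w.dual ∧ (w = .int → ∀ a ∈ dom, Key.dual a ∈ dom') ∧
      (w = .ext → ∀ a ∈ dom', Key.dual a ∈ dom) ∧
      ∀ a (ha : a ∈ dom) (ha' : Key.dual a ∈ dom'),
        PayFit a.2 (pay ⟨a, ha⟩) (pay' ⟨_, ha'⟩) := by
  obtain ⟨H, K, h3, h4, h5⟩ := h.unfold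
  obtain ⟨H', h6, h7⟩ := h1.unfold trivial
  obtain ⟨K', h8, h9⟩ := h2.unfold trivial
  cases h3.det h6
  cases h4.det h8
  cases h7 with
  | un_int hd p =>
    cases h5 with
    | un e q =>
      generalize hw : View.int.dual = w0 at h9
      cases h9 with
      | un_int => cases hw
      | un_ext hd' p' =>
        refine ⟨rfl, fun _ a ha => hd' ((e a).1 (hd ha)), fun h => by simp at h, fun a ha ha' => ?_⟩
        exact .of (p a ha) (q a (hd ha)) (p' _ ((e a).1 (hd ha)))
  | un_ext hd p =>
    cases h5 with
    | un e q =>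
      generalize hw : View.ext.dual = w0 at h9
      cases h9 with
      | un_ext => cases hw
      | un_int hd' p' =>
        refine ⟨rfl, fun h => by simp at h, fun _ a ha => hd ((e _).2 (by simpa using hd' ha)), fun a ha ha' => ?_⟩
        have ha0 := (e a).2 (hd' ha')
        exact .of (p a ha0) (q a ha0) (p' _ ha')

theorem Dual.not_lin_un {S T : Ty} (h : Dual S T) {w w' dom dom'} {pay cont : {a // a ∈ dom} → Ty}
    {pay' : {a // a ∈ dom'} → Ty} (h1 : Sub S (.lin w dom pay cont)) (h2 : Sub T (.un w' dom' pay')) :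
    False := by
  obtain ⟨H, K, h3, h4, h5⟩ := h.unfold
  obtain ⟨H', h6, h7⟩ := h1.unfold trivial
  obtain ⟨K', h8, h9⟩ := h2.unfold trivial
  cases h3.det h6
  cases h4.det h8
  cases h7 <;> cases h5 <;> cases h9

end Ty

open Ty (Sub)

/-! ### Typing of values and annotated processes -/

/-- Inversion of value typing. -/
theorem hasVal_iff {Γ : Ctx} {v : Val} {T : Ty} : HasVal Γ v T ↔
    (Γ.Unr ∧ (v = .unit ∧ Sub .unit T ∨ v = .tt ∧ Sub .bool T ∨ v = .ff ∧ Sub .bool T)) ∨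
    ∃ x S, v = .var x ∧ Γ x = some S ∧ Sub S T ∧ ∀ y U, y ≠ x → Γ y = some U → U.Unr := by
  constructor
  · intro h
    induction h with
    | unit h => exact .inl ⟨h, .inl ⟨rfl, .rfl⟩⟩
    | tt h => exact .inl ⟨h, .inr (.inl ⟨rfl, .rfl⟩)⟩
    | ff h => exact .inl ⟨h, .inr (.inr ⟨rfl, .rfl⟩)⟩
    | var h1 h2 => exact .inr ⟨_, _, rfl, h1, .rfl, h2⟩
    | sub _ hs ih =>
      rcases ih with ⟨h, ⟨rfl, h'⟩ | ⟨rfl, h'⟩ | ⟨rfl, h'⟩⟩ | ⟨x, S, rfl, h1, h2, h3⟩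
      · exact .inl ⟨h, .inl ⟨rfl, h'.trans (.inr hs)⟩⟩
      · exact .inl ⟨h, .inr (.inl ⟨rfl, h'.trans (.inr hs)⟩)⟩
      · exact .inl ⟨h, .inr (.inr ⟨rfl, h'.trans (.inr hs)⟩)⟩
      · exact .inr ⟨x, S, rfl, h1, h2.trans (.inr hs), h3⟩
  · have key : ∀ {S}, HasVal Γ v S → Sub S T → HasVal Γ v T := by
      rintro S h (rfl | hs)
      exacts [h, .sub h hs]
    rintro (⟨h, ⟨rfl, h'⟩ | ⟨rfl, h'⟩ | ⟨rfl, h'⟩⟩ | ⟨x, S, rfl, h1, h2, h3⟩)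
    exacts [key (.unit h) h', key (.tt h) h', key (.ff h) h', key (.var h1 h3) h2]

theorem HasVal.mono {Γ : Ctx} {v : Val} {S T : Ty} (h : HasVal Γ v S) (hs : Sub S T) :
    HasVal Γ v T := by
  rcases hs with rfl | hs
  exacts [h, .sub h hs]

/-- Typing of annotated processes. -/
inductive ATyped : Ctx → AProc → Prop
  | nil {Γ : Ctx} : Γ.Unr → ATyped Γ .nil
  | par {Γ Γ₁ Γ₂ : Ctx} {P Q} : Γ.Split Γ₁ Γ₂ → ATyped Γ₁ P → ATyped Γ₂ Q → ATyped Γ (.par P Q)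
  | res {Γ : Ctx} {S T : Ty} {P} : S.Dual T → ATyped ((Γ.push T).push S) P → ATyped Γ (.res P)
  | cond {Γ Γ₁ Γ₂ : Ctx} {v P Q} : Γ.Split Γ₁ Γ₂ → HasVal Γ₁ v .bool → ATyped Γ₂ P → ATyped Γ₂ Q →
      ATyped Γ (.cond v P Q)
  | choiceLin {Γ Γ₁ Γ₂ : Ctx} {x n : ℕ} {pre : Fin n → Mix.Pre} {cont : Fin n → AProc}
      {Δ : Fin n → Ctx} {w : View} {dom : Finset Key} {pay cty : {a : Key // a ∈ dom} → Ty}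
      (split : Γ.Split Γ₁ Γ₂) (subject : HasVal Γ₁ (.var x) (.lin w dom pay cty))
      (mem : ∀ i, (pre i).key ∈ dom) (cover : ∀ a ∈ dom, ∃ i, (pre i).key = a)
      (branch : ∀ i, BranchCtx (Γ₂.set x (cty ⟨_, mem i⟩)) (pre i) (pay ⟨_, mem i⟩) (Δ i))
      (body : ∀ i, ATyped (Δ i) (cont i)) :
      ATyped Γ (.choice .lin w .lin (.var x) n pre cont)
  | choiceUn {Γ Γ₁ Γ₂ : Ctx} {q : Qual} {x n : ℕ} {pre : Fin n → Mix.Pre} {cont : Fin n → AProc}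
      {Δ : Fin n → Ctx} {w : View} {dom : Finset Key} {pay : {a : Key // a ∈ dom} → Ty}
      (qual : q = .un → Γ.Unr)
      (split : Γ.Split Γ₁ Γ₂) (subject : HasVal Γ₁ (.var x) (.un w dom pay))
      (mem : ∀ i, (pre i).key ∈ dom) (cover : ∀ a ∈ dom, ∃ i, (pre i).key = a)
      (branch : ∀ i, BranchCtx Γ₂ (pre i) (pay ⟨_, mem i⟩) (Δ i))
      (body : ∀ i, ATyped (Δ i) (cont i)) :
      ATyped Γ (.choice .un w q (.var x) n pre cont)

/-- The encoding uses a derivation only to learn, at each choice, which rule was applied and with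
which view. Once these are recorded in the process, the derivation can be replaced by a mere
proposition; `ATyped.typing` goes back. -/
theorem Typing.annotate {Γ : Ctx} {S : Mix.Proc} (d : Typing Γ S) :
    ∃ A : AProc, A.erase = S ∧ A.enc = enc d ∧ ATyped Γ A := by
  induction d with
  | nil h => exact ⟨.nil, rfl, rfl, .nil h⟩
  | par h _ _ ih1 ih2 =>
    obtain ⟨A, rfl, h1, h2⟩ := ih1
    obtain ⟨B, rfl, h3, h4⟩ := ih2
    exact ⟨.par A B, rfl, by simp [AProc.enc, MixedSessions.enc, h1, h3], .par h h2 h4⟩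
  | res h _ ih =>
    obtain ⟨A, rfl, h1, h2⟩ := ih
    exact ⟨.res A, rfl, by simp [AProc.enc, MixedSessions.enc, h1], .res h h2⟩
  | @cond _ _ _ v _ _ h hv _ _ ih1 ih2 =>
    obtain ⟨A, rfl, h1, h2⟩ := ih1
    obtain ⟨B, rfl, h3, h4⟩ := ih2
    exact ⟨.cond v A B, rfl, by simp [AProc.enc, MixedSessions.enc, h1, h3], .cond h hv h2 h4⟩
  | @choiceLin _ _ _ x n pre cont _ w _ _ _ split subject mem cover branch _ ih =>
    choose A h1 h2 h3 using ih
    exact ⟨.choice .lin w .lin (.var x) n pre A, by simp [AProc.erase, h1],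
      by simp [AProc.enc, MixedSessions.enc, h2], .choiceLin split subject mem cover branch h3⟩
  | @choiceUn _ _ _ q x n pre cont _ w _ _ qual split subject mem cover branch _ ih =>
    choose A h1 h2 h3 using ih
    exact ⟨.choice .un w q (.var x) n pre A, by simp [AProc.erase, h1],
      by simp [AProc.enc, MixedSessions.enc, h2], .choiceUn qual split subject mem cover branch h3⟩

theorem ATyped.typing {Γ : Ctx} {A : AProc} (h : ATyped Γ A) :
    ∃ d : Typing Γ A.erase, enc d = A.enc := by
  induction h with
  | nil h => exact ⟨.nil h, rfl⟩
  | par h _ _ ih1 ih2 =>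
    obtain ⟨d, h1⟩ := ih1
    obtain ⟨e, h2⟩ := ih2
    exact ⟨.par h d e, by simp [AProc.enc, MixedSessions.enc, h1, h2]⟩
  | res h _ ih =>
    obtain ⟨d, h1⟩ := ih
    exact ⟨.res h d, by simp [AProc.enc, MixedSessions.enc, h1]⟩
  | cond h hv _ _ ih1 ih2 =>
    obtain ⟨d, h1⟩ := ih1
    obtain ⟨e, h2⟩ := ih2
    exact ⟨.cond h hv d e, by simp [AProc.enc, MixedSessions.enc, h1, h2]⟩
  | @choiceLin _ _ _ x n pre cont _ w _ _ _ split subject mem cover branch _ ih =>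
    choose d h1 using ih
    exact ⟨.choiceLin w split subject mem cover branch d, by simp [AProc.enc, MixedSessions.enc, h1]⟩
  | @choiceUn _ _ _ q x n pre cont _ w _ _ qual split subject mem cover branch _ ih =>
    choose d h1 using ih
    exact ⟨.choiceUn w qual split subject mem cover branch d,
      by simp [AProc.enc, MixedSessions.enc, h1]⟩

/-! ### The substitution lemma -/

/-- Values that may replace a variable of the unrestricted type `T`. -/
def UVal (Γ : Ctx) (v : Val) (T : Ty) : Prop :=
  v = .unit ∧ Sub .unit T ∨ v = .tt ∧ Sub .bool T ∨ v = .ff ∧ Sub .bool T ∨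
    ∃ y S, v = .var y ∧ Γ y = some S ∧ Sub S T

/-- `σ` maps the variables of `Δ` to values typed in `Γ` and uses every linear entry of `Γ`
exactly once. -/
structure SubstTy (Γ : Ctx) (σ : Subst) (Δ : Ctx) : Prop where
  un : ∀ x T, Δ x = some T → T.Unr → UVal Γ (σ x) T
  lin : ∀ x T, Δ x = some T → ¬ T.Unr → ∃ y S, σ x = .var y ∧ Γ y = some S ∧ Sub S T ∧
    ∀ x', Δ x' ≠ none → σ x' = .var y → x' = x
  onto : ∀ y S, Γ y = some S → ¬ S.Unr → ∃ x, Δ x ≠ none ∧ σ x = .var y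

/-- The preimage of a linear entry must itself be linear because subtyping respects linearity;
uniqueness is then part of `lin`. -/
theorem SubstTy.onto_lin {Γ Δ : Ctx} {σ : Subst} (h : SubstTy Γ σ Δ) {y : ℕ} {S : Ty}
    (hy : Γ y = some S) (hS : ¬ S.Unr) : ∃ x T, Δ x = some T ∧ ¬ T.Unr ∧ σ x = .var y ∧
      ∀ x', Δ x' ≠ none → σ x' = .var y → x' = x := by
  obtain ⟨x, hx, hσ⟩ := h.onto y S hy hS
  obtain ⟨T, hT⟩ := Option.ne_none_iff_exists'.1 hx
  have hTu : ¬ T.Unr := by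
    intro hu
    rcases h.un x T hT hu with ⟨h', _⟩ | ⟨h', _⟩ | ⟨h', _⟩ | ⟨y', S', h1, h2, h3⟩
    · rw [hσ] at h'; cases h'
    · rw [hσ] at h'; cases h'
    · rw [hσ] at h'; cases h'
    · rw [hσ] at h1; cases h1
      rw [hy] at h2; cases h2
      exact hS (h3.unr_iff.2 hu)
  obtain ⟨y', S', h1, h2, h3, h4⟩ := h.lin x T hT hTu
  rw [hσ] at h1; cases h1
  exact ⟨x, T, hT, hTu, hσ, h4⟩

theorem SubstTy.unr {Γ Δ : Ctx} {σ : Subst} (h : SubstTy Γ σ Δ) (hΔ : Δ.Unr) : Γ.Unr := by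
  intro y S hy
  by_contra hS
  obtain ⟨x, T, hT, hTu, _⟩ := h.onto_lin hy hS
  exact hTu (hΔ x T hT)

theorem SubstTy.hasVal {Γ Δ : Ctx} {σ : Subst} (h : SubstTy Γ σ Δ) {v : Val} {T : Ty}
    (hv : HasVal Δ v T) : HasVal Γ (v.subst σ) T := by
  rcases hasVal_iff.1 hv with ⟨hu, hc⟩ | ⟨x, S, rfl, h1, h2, h3⟩
  · refine hasVal_iff.2 (.inl ⟨h.unr hu, ?_⟩)
    rcases hc with ⟨rfl, h'⟩ | ⟨rfl, h'⟩ | ⟨rfl, h'⟩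
    exacts [.inl ⟨rfl, h'⟩, .inr (.inl ⟨rfl, h'⟩), .inr (.inr ⟨rfl, h'⟩)]
  · show HasVal Γ (σ x) T
    by_cases hS : S.Unr
    · have hu : Γ.Unr := h.unr fun y U hy => by
        by_cases hyx : y = x
        · subst hyx; rw [h1] at hy; cases hy; exact hS
        · exact h3 y U hyx hy
      rcases h.un x S h1 hS with ⟨h', hs⟩ | ⟨h', hs⟩ | ⟨h', hs⟩ | ⟨y, S', h', hs', hs⟩
      · exact hasVal_iff.2 (.inl ⟨hu, .inl ⟨h', hs.trans h2⟩⟩)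
      · exact hasVal_iff.2 (.inl ⟨hu, .inr (.inl ⟨h', hs.trans h2⟩)⟩)
      · exact hasVal_iff.2 (.inl ⟨hu, .inr (.inr ⟨h', hs.trans h2⟩)⟩)
      · exact hasVal_iff.2 (.inr ⟨y, S', h', hs', hs.trans h2, fun z U _ hz => hu z U hz⟩)
    · obtain ⟨y, S', h4, h5, h6, h7⟩ := h.lin x S h1 hS
      refine hasVal_iff.2 (.inr ⟨y, S', h4, h5, h6.trans h2, fun z U hzy hz => ?_⟩)
      by_contra hU
      obtain ⟨x', T', hT', hTu', hσ', _⟩ := h.onto_lin hz hU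
      by_cases hx : x' = x
      · subst hx; rw [h4] at hσ'; cases hσ'; exact hzy rfl
      · exact hTu' (h3 x' T' hx hT')

theorem Ctx.SplitAt.cases {o o₁ o₂ : Option Ty} (h : Ctx.SplitAt o o₁ o₂) :
    (o = Option.none ∧ o₁ = Option.none ∧ o₂ = Option.none) ∨ (∃ T, T.Unr ∧ o = some T ∧ o₁ = some T ∧ o₂ = some T) ∨
    (∃ T, ¬ T.Unr ∧ o = some T ∧ o₁ = some T ∧ o₂ = Option.none) ∨
    (∃ T, ¬ T.Unr ∧ o = some T ∧ o₁ = Option.none ∧ o₂ = some T) := by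
  cases h with
  | none => exact .inl ⟨rfl, rfl, rfl⟩
  | un h => exact .inr (.inl ⟨_, h, rfl, rfl, rfl⟩)
  | left h => exact .inr (.inr (.inl ⟨_, h, rfl, rfl, rfl⟩))
  | right h => exact .inr (.inr (.inr ⟨_, h, rfl, rfl, rfl⟩))

theorem Ctx.SplitAt.symm {o o₁ o₂ : Option Ty} (h : Ctx.SplitAt o o₁ o₂) :
    Ctx.SplitAt o o₂ o₁ := by
  cases h with
  | none => exact .none
  | un h => exact .un h
  | left h => exact .right h
  | right h => exact .left h

theorem Ctx.Split.symm {Γ Γ₁ Γ₂ : Ctx} (h : Γ.Split Γ₁ Γ₂) : Γ.Split Γ₂ Γ₁ := fun x => (h x).symm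

theorem Ctx.Split.of_left {Γ Γ₁ Γ₂ : Ctx} (h : Γ.Split Γ₁ Γ₂) {x : ℕ} {T : Ty}
    (hx : Γ₁ x = some T) : Γ x = some T := by
  rcases (h x).cases with ⟨h1, h2, h3⟩ | ⟨T', h0, h1, h2, h3⟩ | ⟨T', h0, h1, h2, h3⟩ |
    ⟨T', h0, h1, h2, h3⟩ <;> simp_all

theorem Ctx.Split.left_ne {Γ Γ₁ Γ₂ : Ctx} (h : Γ.Split Γ₁ Γ₂) {x : ℕ}
    (hx : Γ₁ x ≠ none) : Γ x ≠ none := by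
  obtain ⟨T, hT⟩ := Option.ne_none_iff_exists'.1 hx
  rw [h.of_left hT]; simp

theorem Ctx.Split.of_lin {Γ Γ₁ Γ₂ : Ctx} (h : Γ.Split Γ₁ Γ₂) {x : ℕ} {T : Ty}
    (hx : Γ x = some T) (hT : ¬ T.Unr) :
    (Γ₁ x = some T ∧ Γ₂ x = none) ∨ (Γ₁ x = none ∧ Γ₂ x = some T) := by
  rcases (h x).cases with ⟨h1, h2, h3⟩ | ⟨T', h0, h1, h2, h3⟩ | ⟨T', h0, h1, h2, h3⟩ |
    ⟨T', h0, h1, h2, h3⟩ <;> simp_all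

open Classical in
/-- The part of `Γ` that is unrestricted or satisfies `p`. -/
noncomputable def Ctx.part (Γ : Ctx) (p : ℕ → Prop) : Ctx := fun y =>
  match Γ y with
  | none => none
  | some S => if S.Unr ∨ p y then some S else none

theorem Ctx.part_eq_some {Γ : Ctx} {p : ℕ → Prop} {y : ℕ} {S : Ty} :
    Γ.part p y = some S ↔ Γ y = some S ∧ (S.Unr ∨ p y) := by
  unfold Ctx.part
  cases h : Γ y with
  | none => simp
  | some T =>
    simp only [Option.some.injEq]
    by_cases hp : T.Unr ∨ p y
    · rw [if_pos hp]
      constructor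
      · rintro ⟨⟩; exact ⟨rfl, hp⟩
      · rintro ⟨rfl, _⟩; rfl
    · rw [if_neg hp]
      constructor
      · rintro ⟨⟩
      · rintro ⟨rfl, h⟩; exact absurd h hp

theorem Ctx.part_split (Γ : Ctx) (p : ℕ → Prop) : Γ.Split (Γ.part p) (Γ.part fun y => ¬ p y) := by
  intro y
  unfold Ctx.part
  cases h : Γ y with
  | none => exact .none
  | some T =>
    by_cases hT : T.Unr
    · simp only [hT, true_or, if_true]; exact .un hT
    · by_cases hp : p y
      · simp only [hT, hp, not_true, or_self, or_true, if_true, if_false]; exact .left hT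
      · simp only [hT, hp, not_false_eq_true, or_self, or_true, if_true, if_false]; exact .right hT

/-- A linear entry of `Γ` goes to the left exactly if it is the image of a variable of `Δ₁`.
Preimages of linear entries are unique, so no linear variable of `Δ₂` misses its image. -/
theorem SubstTy.split {Γ Δ Δ₁ Δ₂ : Ctx} {σ : Subst} (h : SubstTy Γ σ Δ) (hs : Δ.Split Δ₁ Δ₂) :
    ∃ Γ₁ Γ₂, Γ.Split Γ₁ Γ₂ ∧ SubstTy Γ₁ σ Δ₁ ∧ SubstTy Γ₂ σ Δ₂ := by
  refine ⟨_, _, Ctx.part_split Γ fun y => ∃ x, Δ₁ x ≠ none ∧ σ x = .var y, ?_, ?_⟩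
  · constructor
    · intro x T hx hT
      have hx' := hs.of_left hx
      rcases h.un x T hx' hT with h' | h' | h' | ⟨y, S, h1, h2, h3⟩
      · exact .inl h'
      · exact .inr (.inl h')
      · exact .inr (.inr (.inl h'))
      · exact .inr (.inr (.inr ⟨y, S, h1, Ctx.part_eq_some.2 ⟨h2, .inl (h3.unr_iff.2 hT)⟩, h3⟩))
    · intro x T hx hT
      obtain ⟨y, S, h1, h2, h3, h4⟩ := h.lin x T (hs.of_left hx) hT
      exact ⟨y, S, h1, Ctx.part_eq_some.2 ⟨h2, .inr ⟨x, by simp [hx], h1⟩⟩, h3,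
        fun x' hx' => h4 x' (hs.left_ne hx')⟩
    · intro y S hy hS
      obtain ⟨_, h1 | h1⟩ := Ctx.part_eq_some.1 hy
      exacts [absurd h1 hS, h1]
  · constructor
    · intro x T hx hT
      have hx' := hs.symm.of_left hx
      rcases h.un x T hx' hT with h' | h' | h' | ⟨y, S, h1, h2, h3⟩
      · exact .inl h'
      · exact .inr (.inl h')
      · exact .inr (.inr (.inl h'))
      · exact .inr (.inr (.inr ⟨y, S, h1, Ctx.part_eq_some.2 ⟨h2, .inl (h3.unr_iff.2 hT)⟩, h3⟩))
    · intro x T hx hT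
      have hx' := hs.symm.of_left hx
      obtain ⟨y, S, h1, h2, h3, h4⟩ := h.lin x T hx' hT
      refine ⟨y, S, h1, Ctx.part_eq_some.2 ⟨h2, .inr ?_⟩, h3,
        fun x' hx' => h4 x' (hs.symm.left_ne hx')⟩
      rintro ⟨x', h5, h6⟩
      cases h4 x' (hs.left_ne h5) h6
      rcases hs.of_lin hx' hT with ⟨_, h7⟩ | ⟨h7, _⟩
      · rw [hx] at h7; cases h7
      · exact h5 h7
    · intro y S hy hS
      obtain ⟨h0, h1 | h1⟩ := Ctx.part_eq_some.1 hy
      · exact absurd h1 hS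
      · obtain ⟨x, hx, hσ⟩ := h.onto y S h0 hS
        refine ⟨x, fun h2 => h1 ⟨x, fun h3 => hx ?_, hσ⟩, hσ⟩
        rcases (hs x).cases with ⟨h4, _⟩ | ⟨T', _, _, h5, h6⟩ | ⟨T', _, _, h5, h6⟩ |
          ⟨T', _, _, h5, h6⟩
        · exact h4
        · rw [h3] at h5; cases h5
        · rw [h3] at h5; cases h5
        · rw [h2] at h6; cases h6

theorem SubstTy.push {Γ Δ : Ctx} {σ : Subst} (h : SubstTy Γ σ Δ) (T : Ty) :
    SubstTy (Γ.push T) σ.up (Δ.push T) := by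
  have up_succ : ∀ {x y : ℕ}, σ.up x = .var (y + 1) → ∃ x', x = x' + 1 ∧ σ x' = .var y := by
    intro x y hx
    cases x with
    | zero => cases hx
    | succ x =>
      refine ⟨x, rfl, ?_⟩
      have : (σ x).subst (Subst.shift 1) = .var (y + 1) := hx
      cases hv : σ x <;> rw [hv] at this <;> simp [Val.subst, Subst.shift, Subst.ofRen] at this
      rw [this]
  have up_zero : ∀ {x : ℕ}, σ.up x = .var 0 → x = 0 := by
    intro x hx
    cases x with
    | zero => rfl
    | succ x =>
      have : (σ x).subst (Subst.shift 1) = .var 0 := hx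
      cases hv : σ x <;> rw [hv] at this <;> simp [Val.subst, Subst.shift, Subst.ofRen] at this
  constructor
  · intro x U hx hU
    cases x with
    | zero => cases hx; exact .inr (.inr (.inr ⟨0, T, rfl, rfl, .rfl⟩))
    | succ x =>
      rcases h.un x U hx hU with ⟨h1, h2⟩ | ⟨h1, h2⟩ | ⟨h1, h2⟩ | ⟨y, S, h1, h2, h3⟩
      · exact .inl ⟨by simp [Subst.up, h1, Val.subst], h2⟩
      · exact .inr (.inl ⟨by simp [Subst.up, h1, Val.subst], h2⟩)
      · exact .inr (.inr (.inl ⟨by simp [Subst.up, h1, Val.subst], h2⟩))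
      · exact .inr (.inr (.inr ⟨y + 1, S, by simp [Subst.up, h1, Val.subst, Subst.shift, Subst.ofRen], h2, h3⟩))
  · intro x U hx hU
    cases x with
    | zero => cases hx; exact ⟨0, T, rfl, rfl, .rfl, fun x' _ hx' => up_zero hx'⟩
    | succ x =>
      obtain ⟨y, S, h1, h2, h3, h4⟩ := h.lin x U hx hU
      refine ⟨y + 1, S, by simp [Subst.up, h1, Val.subst, Subst.shift, Subst.ofRen], h2, h3,
        fun x' hx' hσ => ?_⟩
      obtain ⟨x'', rfl, hσ'⟩ := up_succ hσ
      rw [h4 x'' hx' hσ']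
  · intro y S hy hS
    cases y with
    | zero => exact ⟨0, by simp [Ctx.push], rfl⟩
    | succ y =>
      obtain ⟨x, hx, hσ⟩ := h.onto y S hy hS
      exact ⟨x + 1, hx, by simp [Subst.up, hσ, Val.subst, Subst.shift, Subst.ofRen]⟩

/-- No variable of `Δ` other than `x` is mapped to `y`, so changing the type of `y` affects `x`
alone. -/
theorem SubstTy.set {Γ Δ : Ctx} {σ : Subst} (h : SubstTy Γ σ Δ) {x y : ℕ} (hσ : σ x = .var y)
    (hu : ∀ x', Δ x' ≠ none → σ x' = .var y → x' = x) (C : Ty) :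
    SubstTy (Γ.set y C) σ (Δ.set x C) := by
  have ne : ∀ {x' : ℕ} {T : Ty}, x' ≠ x → Δ x' = some T → σ x' ≠ .var y :=
    fun hx hT h' => hx (hu _ (by simp [hT]) h')
  constructor
  · intro x' U hx' hU
    by_cases hx : x' = x
    · subst hx
      simp only [Ctx.set, Function.update_self, Option.some.injEq] at hx'
      subst hx'
      exact .inr (.inr (.inr ⟨y, C, hσ, by simp [Ctx.set], .rfl⟩))
    · simp only [Ctx.set, Function.update_of_ne hx] at hx'
      rcases h.un x' U hx' hU with h' | h' | h' | ⟨z, S, h1, h2, h3⟩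
      · exact .inl h'
      · exact .inr (.inl h')
      · exact .inr (.inr (.inl h'))
      · refine .inr (.inr (.inr ⟨z, S, h1, ?_, h3⟩))
        rw [Ctx.set, Function.update_of_ne, h2]
        rintro rfl; exact ne hx hx' h1
  · intro x' U hx' hU
    by_cases hx : x' = x
    · subst hx
      simp only [Ctx.set, Function.update_self, Option.some.injEq] at hx'
      subst hx'
      refine ⟨y, C, hσ, by simp [Ctx.set], .rfl, fun x'' hx'' h' => ?_⟩
      by_contra hne
      rw [Ctx.set, Function.update_of_ne hne] at hx''
      exact hne (hu _ hx'' h')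
    · simp only [Ctx.set, Function.update_of_ne hx] at hx'
      obtain ⟨z, S, h1, h2, h3, h4⟩ := h.lin x' U hx' hU
      have hzy : z ≠ y := by rintro rfl; exact ne hx hx' h1
      refine ⟨z, S, h1, by rw [Ctx.set, Function.update_of_ne hzy, h2], h3, fun x'' hx'' h' => ?_⟩
      by_cases hne : x'' = x
      · subst hne; rw [hσ] at h'; cases h'; exact absurd rfl hzy
      · rw [Ctx.set, Function.update_of_ne hne] at hx''
        exact h4 _ hx'' h'
  · intro z S hz hS
    by_cases hzy : z = y
    · subst hzy; exact ⟨x, by simp [Ctx.set], hσ⟩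
    · rw [Ctx.set, Function.update_of_ne hzy] at hz
      obtain ⟨x', hx', h'⟩ := h.onto z S hz hS
      refine ⟨x', ?_, h'⟩
      by_cases hne : x' = x
      · subst hne; simp [Ctx.set]
      · rwa [Ctx.set, Function.update_of_ne hne]

theorem SubstTy.branch {Γ Δ Δ' : Ctx} {σ : Subst} (h : SubstTy Γ σ Δ) {p : Mix.Pre} {S : Ty}
    (hb : BranchCtx Δ p S Δ') : ∃ Γ', BranchCtx Γ (p.subst σ) S Γ' ∧ SubstTy Γ' (p.up σ) Δ' := by
  cases hb with
  | out hs hv =>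
    obtain ⟨Γ₁, Γ₂, h1, h2, h3⟩ := h.split hs
    exact ⟨Γ₂, .out h1 (h2.hasVal hv), h3⟩
  | inp => exact ⟨_, .inp, h.push S⟩

/-- Constants only have types above `unit` and `bool`. Hence the subject of a choice is still a
variable after substitution. -/
theorem HasVal.choice_var {Γ : Ctx} {v : Val} {T : Ty} (hv : HasVal Γ v T)
    (hT : (∃ w dom pay cont, T = .lin w dom pay cont) ∨ ∃ w dom pay, T = .un w dom pay) :
    ∃ y, v = .var y := by
  have hd : T.IsHead := by
    rcases hT with ⟨_, _, _, _, rfl⟩ | ⟨_, _, _, rfl⟩ <;> trivial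
  have key : ∀ S : Ty, S = .unit ∨ S = .bool → ¬ Sub S T := by
    rintro S hS h
    obtain ⟨H, h1, h2⟩ := h.unfold hd
    rcases hS with rfl | rfl <;> cases h1 <;> cases h2 <;> simp at hT
  rcases hasVal_iff.1 hv with ⟨_, ⟨_, h⟩ | ⟨_, h⟩ | ⟨_, h⟩⟩ | ⟨x, _, rfl, _⟩
  · exact absurd h (key _ (.inl rfl))
  · exact absurd h (key _ (.inr rfl))
  · exact absurd h (key _ (.inr rfl))
  · exact ⟨x, rfl⟩

theorem ATyped.subst {Δ : Ctx} {A : AProc} (h : ATyped Δ A) :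
    ∀ {Γ : Ctx} {σ : Subst}, SubstTy Γ σ Δ → ATyped Γ (A.subst σ) := by
  induction h with
  | nil h => exact fun hσ => .nil (hσ.unr h)
  | par hs _ _ ih1 ih2 =>
    intro Γ σ hσ
    obtain ⟨Γ₁, Γ₂, h1, h2, h3⟩ := hσ.split hs
    exact .par h1 (ih1 h2) (ih2 h3)
  | res hd _ ih => exact fun hσ => .res hd (ih ((hσ.push _).push _))
  | cond hs hv _ _ ih1 ih2 =>
    intro Γ σ hσ
    obtain ⟨Γ₁, Γ₂, h1, h2, h3⟩ := hσ.split hs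
    exact .cond h1 (h2.hasVal hv) (ih1 h3) (ih2 h3)
  | @choiceLin Δ Δ₁ Δ₂ x n pre cont Δ' w dom pay cty split subject mem cover branch _ ih =>
    intro Γ σ hσ
    obtain ⟨Γ₁, Γ₂, h1, h2, h3⟩ := hσ.split split
    have hv := h2.hasVal subject
    obtain ⟨y, hy⟩ := hv.choice_var (.inl ⟨_, _, _, _, rfl⟩)
    rw [hy] at hv
    obtain ⟨S, hS, hsub⟩ : ∃ S, Δ₁ x = some S ∧ Sub S (.lin w dom pay cty) := by
      rcases hasVal_iff.1 subject with ⟨_, ⟨h, _⟩ | ⟨h, _⟩ | ⟨h, _⟩⟩ | ⟨x', S, hx, h, h', _⟩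
      · cases h
      · cases h
      · cases h
      · cases hx; exact ⟨S, h, h'⟩
    have hSu : ¬ S.Unr := fun h => Ty.not_unr_lin (hsub.unr_iff.1 h)
    obtain ⟨y', _, hy', _, _, huniq⟩ := hσ.lin x S (split.of_left hS) hSu
    have hyy : σ x = .var y := hy
    rw [hyy] at hy'; cases hy'
    -- The subject of a linear choice changes its type for the continuation; as its preimage is
    -- unique, this can be done on both sides of the substitution.
    have key : ∀ i, ∃ Γ', BranchCtx (Γ₂.set y (cty ⟨_, mem i⟩)) ((pre i).subst σ) (pay ⟨_, mem i⟩) Γ' ∧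
        SubstTy Γ' ((pre i).up σ) (Δ' i) := fun i =>
      (h3.set hyy (fun x' hx' => huniq x' (split.symm.left_ne hx')) _).branch (branch i)
    choose Γ' hb hs' using key
    have hk : ∀ i, ((pre i).subst σ).key = (pre i).key := fun i => Mix.Pre.key_subst _ _
    simp only [AProc.subst, hy]
    refine .choiceLin (Δ := Γ') h1 hv (fun i => by rw [hk]; exact mem i)
      (fun a ha => by simpa [hk] using cover a ha) (fun i => ?_) (fun i => ih i (hs' i))
    have he : (⟨((pre i).subst σ).key, by rw [hk]; exact mem i⟩ : {a // a ∈ dom}) = ⟨_, mem i⟩ := Subtype.ext (hk i)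
    rw [he]
    exact hb i
  | @choiceUn Δ Δ₁ Δ₂ q x n pre cont Δ' w dom pay qual split subject mem cover branch _ ih =>
    intro Γ σ hσ
    obtain ⟨Γ₁, Γ₂, h1, h2, h3⟩ := hσ.split split
    have hv := h2.hasVal subject
    obtain ⟨y, hy⟩ := hv.choice_var (.inr ⟨_, _, _, rfl⟩)
    rw [hy] at hv
    have key : ∀ i, ∃ Γ', BranchCtx Γ₂ ((pre i).subst σ) (pay ⟨_, mem i⟩) Γ' ∧
        SubstTy Γ' ((pre i).up σ) (Δ' i) := fun i => h3.branch (branch i)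
    choose Γ' hb hs' using key
    have hk : ∀ i, ((pre i).subst σ).key = (pre i).key := fun i => Mix.Pre.key_subst _ _
    simp only [AProc.subst, hy]
    refine .choiceUn (Δ := Γ') (fun h => hσ.unr (qual h)) h1 hv (fun i => by rw [hk]; exact mem i)
      (fun a ha => by simpa [hk] using cover a ha) (fun i => ?_) (fun i => ih i (hs' i))
    have he : (⟨((pre i).subst σ).key, by rw [hk]; exact mem i⟩ : {a // a ∈ dom}) = ⟨_, mem i⟩ := Subtype.ext (hk i)
    rw [he]
    exact hb i

end MixedSessions

namespace MixedSessions

open PCalc (Flat Supp NF parL)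
open Ty (Sub)

/-! ### Typed configurations of the source calculus -/

namespace Ctx

theorem SplitAt.assoc {o a b c d : Option Ty} (h : SplitAt o a b) (h' : SplitAt b c d) :
    ∃ e, SplitAt o c e ∧ SplitAt e a d := by
  rcases h.cases with ⟨rfl, rfl, rfl⟩ | ⟨T, hT, rfl, rfl, rfl⟩ | ⟨T, hT, rfl, rfl, rfl⟩ |
    ⟨T, hT, rfl, rfl, rfl⟩
  · cases h'; exact ⟨_, .none, .none⟩
  · cases h' with
    | un => exact ⟨_, .un hT, .un hT⟩
    | left h => exact absurd hT h
    | right h => exact absurd hT h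
  · cases h'; exact ⟨_, .right hT, .left hT⟩
  · cases h' with
    | un h => exact absurd h hT
    | left h => exact ⟨_, .left hT, .none⟩
    | right h => exact ⟨_, .right hT, .right hT⟩

theorem Split.assoc {Γ A B C D : Ctx} (h : Γ.Split A B) (h' : B.Split C D) :
    ∃ E, Γ.Split C E ∧ E.Split A D := by
  choose E h1 h2 using fun x => (h x).assoc (h' x)
  exact ⟨E, h1, h2⟩

/-- Reassociate `A ∘ (B ∘ C)` to `(A ∘ B) ∘ C`. -/
theorem Split.assoc' {Γ A B C D : Ctx} (h : Γ.Split A B) (h' : B.Split C D) :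
    ∃ E, Γ.Split E D ∧ E.Split A C := by
  obtain ⟨E, h1, h2⟩ := h.assoc h'.symm
  exact ⟨E, h1.symm, h2⟩

/-- An unrestricted part takes no linear entry away, and unrestricted entries are shared. -/
theorem Split.eq_of_unr {Γ Γ₁ Γ₂ : Ctx} (h : Γ.Split Γ₁ Γ₂) (h1 : Γ₁.Unr) : Γ₂ = Γ := by
  funext x
  rcases (h x).cases with ⟨e1, e2, e3⟩ | ⟨T, hT, e1, e2, e3⟩ | ⟨T, hT, e1, e2, e3⟩ |
    ⟨T, hT, e1, e2, e3⟩
  · rw [e1, e3]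
  · rw [e1, e3]
  · exact absurd (h1 x T e2) hT
  · rw [e1, e3]

/-- An unrestricted part of a context can be split off again. -/
theorem Split.again {Γ Γ₁ Γ₂ : Ctx} (h : Γ.Split Γ₁ Γ₂) (h1 : Γ₁.Unr) : Γ.Split Γ₁ Γ := by
  have := h
  rwa [h.eq_of_unr h1] at this

theorem Split.again' {Γ Γ₁ Γ₂ Γ₃ Γ₄ : Ctx} (h : Γ.Split Γ₁ Γ₂) (h' : Γ₂.Split Γ₃ Γ₄) (h3 : Γ₃.Unr) :
    Γ.Split Γ₃ Γ := by
  obtain ⟨E, h4, _⟩ := h.assoc h'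
  exact h4.again h3

theorem Split.update {Γ Γ₁ Γ₂ : Ctx} (h : Γ.Split Γ₁ Γ₂) (a : ℕ) {o o₁ o₂ : Option Ty}
    (ho : SplitAt o o₁ o₂) :
    Split (Function.update Γ a o) (Function.update Γ₁ a o₁) (Function.update Γ₂ a o₂) := by
  intro x
  by_cases hx : x = a
  · subst hx; simpa using ho
  · simpa [Function.update_of_ne hx] using h x

end Ctx

open Classical in
/-- The part of an entry that is shared. -/
noncomputable def Ty.shared (T : Ty) : Option Ty := if T.Unr then some T else none

theorem Ty.split_shared (T : Ty) : Ctx.SplitAt (some T) (some T) T.shared := by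
  unfold Ty.shared
  split_ifs with h
  exacts [.un h, .left h]

theorem Ty.shared_split (T : Ty) : Ctx.SplitAt T.shared T.shared T.shared := by
  unfold Ty.shared
  split_ifs with h
  exacts [.un h, .none]

theorem Ty.shared_eq_some {S T : Ty} (h : T.shared = some S) : S = T ∧ T.Unr := by
  unfold Ty.shared at h
  split_ifs at h with hT
  cases h
  exact ⟨rfl, hT⟩

/-- Narrowing and weakening as a special case of substitution. -/
theorem SubstTy.of_narrow {Γ Δ : Ctx} (h : ∀ x, (∀ T, Δ x = some T → ∃ S, Γ x = some S ∧ Sub S T) ∧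
    (Δ x = none → ∀ S, Γ x = some S → S.Unr)) : SubstTy Γ .var Δ := by
  constructor
  · intro x T hx _
    obtain ⟨S, h1, h2⟩ := (h x).1 T hx
    exact .inr (.inr (.inr ⟨x, S, rfl, h1, h2⟩))
  · intro x T hx _
    obtain ⟨S, h1, h2⟩ := (h x).1 T hx
    exact ⟨x, S, rfl, h1, h2, fun x' _ h' => by injection h'⟩
  · intro y S hy hS
    exact ⟨y, fun h' => hS ((h y).2 h' S hy), rfl⟩

theorem SubstTy.weaken {Δ : Ctx} {a : ℕ} (h : Δ a = none) (T : Ty) :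
    SubstTy (Function.update Δ a T.shared) .var Δ := by
  refine .of_narrow fun x => ?_
  by_cases hx : x = a
  · subst hx
    refine ⟨fun T' h' => (by rw [h] at h'; cases h'), fun _ S hS => ?_⟩
    rw [Function.update_self] at hS
    obtain ⟨rfl, hu⟩ := Ty.shared_eq_some hS
    exact hu
  · rw [Function.update_of_ne hx]
    exact ⟨fun T h' => ⟨T, h', .rfl⟩, fun h1 S h2 => (by rw [h1] at h2; cases h2)⟩

/-- A constant is typed in an unrestricted context and uses nothing up. A variable of linear type is
absent from `M`, so it is the image of index `0` only; every other linear entry of `E` is found in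
`M`. -/
theorem SubstTy.inst {E Δv M : Ctx} (hs : E.Split Δv M) {v : Val} {S : Ty} (hv : HasVal Δv v S) :
    SubstTy E (Subst.inst v) (M.push S) := by
  rcases hasVal_iff.1 hv with ⟨hu, hc⟩ | ⟨y, U, rfl, h1, h2, h3⟩
  · have hM := hs.eq_of_unr hu
    subst hM
    have hSu : S.Unr ∧ UVal M v S := by
      rcases hc with ⟨rfl, h⟩ | ⟨rfl, h⟩ | ⟨rfl, h⟩
      · exact ⟨h.unr_iff.1 Ty.unr_unit, .inl ⟨rfl, h⟩⟩
      · exact ⟨h.unr_iff.1 Ty.unr_bool, .inr (.inl ⟨rfl, h⟩)⟩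
      · exact ⟨h.unr_iff.1 Ty.unr_bool, .inr (.inr (.inl ⟨rfl, h⟩))⟩
    have hvv : ∀ z, v ≠ .var z := by
      rintro z rfl
      rcases hc with ⟨h, _⟩ | ⟨h, _⟩ | ⟨h, _⟩ <;> cases h
    constructor
    · intro x T hx hT
      cases x with
      | zero => cases hx; exact hSu.2
      | succ x => exact .inr (.inr (.inr ⟨x, T, rfl, hx, .rfl⟩))
    · intro x T hx hT
      cases x with
      | zero => cases hx; exact absurd hSu.1 hT
      | succ x =>
        refine ⟨x, T, rfl, hx, .rfl, fun x' _ h' => ?_⟩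
        cases x' with
        | zero => exact absurd h' (hvv x)
        | succ x' => injection h' with h'; rw [h']
    · intro z U hz _
      exact ⟨z + 1, by show M z ≠ none; simp [hz], rfl⟩
  · have hEy := hs.of_left h1
    constructor
    · intro x T hx hT
      cases x with
      | zero => cases hx; exact .inr (.inr (.inr ⟨y, U, rfl, hEy, h2⟩))
      | succ x => exact .inr (.inr (.inr ⟨x, T, rfl, hs.symm.of_left hx, .rfl⟩))
    · intro x T hx hT
      cases x with
      | zero =>
        cases hx
        refine ⟨y, U, rfl, hEy, h2, fun x' hx' h' => ?_⟩
        cases x' with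
        | zero => rfl
        | succ x' =>
          injection h' with h'
          subst h'
          rcases hs.of_lin hEy (fun h => hT (h2.unr_iff.1 h)) with ⟨_, h4⟩ | ⟨h4, _⟩
          · exact absurd h4 hx'
          · rw [h1] at h4; cases h4
      | succ x =>
        have hEx := hs.symm.of_left (show M x = some T from hx)
        refine ⟨x, T, rfl, hEx, .rfl, fun x' hx' h' => ?_⟩
        cases x' with
        | zero =>
          injection h' with h'
          subst h'
          rcases hs.of_lin hEx hT with ⟨_, h4⟩ | ⟨h4, _⟩
          · have : M y = some T := hx
            rw [h4] at this; cases this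
          · rw [h1] at h4; cases h4
        | succ x' => injection h' with h'; rw [h']
    · intro z W hz hW
      rcases hs.of_lin hz hW with ⟨h4, _⟩ | ⟨_, h4⟩
      · refine ⟨0, by simp [Ctx.push], ?_⟩
        have : z = y := by
          by_contra hne
          exact hW (h3 z W hne h4)
        rw [this]; rfl
      · exact ⟨z + 1, by show M z ≠ none; simp [h4], rfl⟩

/-- Typing of the parallel composition of the threads `s`. -/
inductive TConf : Ctx → Multiset AProc → Prop
  | nil {Γ : Ctx} : Γ.Unr → TConf Γ 0
  | cons {Γ Γ₁ Γ₂ : Ctx} {A s} : Γ.Split Γ₁ Γ₂ → ATyped Γ₁ A → TConf Γ₂ s → TConf Γ (A ::ₘ s)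

namespace TConf

/-- Since splitting is associative and commutative, any thread can be taken as the first one. -/
theorem inv {Γ : Ctx} {t : Multiset AProc} (h : TConf Γ t) : ∀ {A s}, t = A ::ₘ s →
    ∃ Γ₁ Γ₂, Γ.Split Γ₁ Γ₂ ∧ ATyped Γ₁ A ∧ TConf Γ₂ s := by
  induction h with
  | nil => intro A s h; exact absurd h.symm (Multiset.cons_ne_zero)
  | @cons Γ Γ₁ Γ₂ B u hs hB hu ih =>
    intro A s h
    rcases Multiset.cons_eq_cons.1 h with ⟨rfl, rfl⟩ | ⟨_, cs, rfl, rfl⟩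
    · exact ⟨_, _, hs, hB, hu⟩
    · obtain ⟨Γ₃, Γ₄, h1, h2, h3⟩ := ih rfl
      obtain ⟨E, h4, h5⟩ := hs.assoc h1
      exact ⟨Γ₃, E, h4, h2, .cons h5 hB h3⟩

theorem cons_iff {Γ : Ctx} {A : AProc} {s : Multiset AProc} :
    TConf Γ (A ::ₘ s) ↔ ∃ Γ₁ Γ₂, Γ.Split Γ₁ Γ₂ ∧ ATyped Γ₁ A ∧ TConf Γ₂ s :=
  ⟨fun h => h.inv rfl, fun ⟨_, _, h1, h2, h3⟩ => .cons h1 h2 h3⟩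

theorem parL {Γ : Ctx} {l : List AProc} (h : TConf Γ (l : Multiset AProc)) :
    ATyped Γ (PCalc.parL l) := by
  induction l generalizing Γ with
  | nil =>
    generalize hm : (([] : List AProc) : Multiset AProc) = m at h
    cases h with
    | nil h => exact .nil h
    | cons => exact absurd hm.symm (Multiset.cons_ne_zero)
  | cons A l ih =>
    rw [← Multiset.cons_coe] at h
    obtain ⟨_, _, h1, h2, h3⟩ := cons_iff.1 h
    exact .par h1 h2 (ih h3)

theorem narrow {Δ : Ctx} {s : Multiset AProc} (h : TConf Δ s) :
    ∀ {Γ : Ctx}, SubstTy Γ .var Δ → TConf Γ s := by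
  induction h with
  | nil h => exact fun hσ => .nil (hσ.unr h)
  | cons hs hA _ ih =>
    intro Γ hσ
    obtain ⟨Γ₁, Γ₂, h1, h2, h3⟩ := hσ.split hs
    have := hA.subst h2
    rw [AProc.subst_var] at this
    exact .cons h1 this (ih h3)

theorem mem {Γ : Ctx} {s : Multiset AProc} (h : TConf Γ s) {A : AProc} (hA : A ∈ s) :
    ∃ Γ₁ Γ₂, Γ.Split Γ₁ Γ₂ ∧ ATyped Γ₁ A := by
  obtain ⟨t, rfl⟩ := Multiset.exists_cons_of_mem hA
  obtain ⟨Γ₁, Γ₂, h1, h2, _⟩ := cons_iff.1 h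
  exact ⟨Γ₁, Γ₂, h1, h2⟩

/-- Flattening preserves typing. -/
theorem flat {P : AProc} {K : Multiset ℕ} {t : Multiset AProc} (hf : Flat P K t) :
    ∀ {Δ : Ctx} {r : Multiset AProc}, TConf Δ (P ::ₘ r) → K.Nodup →
      (∀ k ∈ K, ∀ o, Δ (nm k o) = none) → ∃ Δ', TConf Δ' (t + r) ∧
        (∀ x, x ∉ names K → Δ' x = Δ x) ∧
        ∀ k ∈ K, ∃ S T, Δ' (nm k false) = some S ∧ Δ' (nm k true) = some T ∧ S.Dual T := by
  induction hf with
  | nil =>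
    intro Δ r h _ _
    obtain ⟨Γ₁, Γ₂, h1, h2, h3⟩ := cons_iff.1 h
    have h2' : ATyped Γ₁ AProc.nil := h2
    cases h2' with
    | nil hu =>
      rw [h1.eq_of_unr hu] at h3
      exact ⟨Δ, by simpa using h3, fun _ _ => rfl, by simp⟩
  | @par P Q K L t u _ _ ih1 ih2 =>
    intro Δ r h hn hfr
    obtain ⟨nK, nL, hd⟩ := Multiset.nodup_add.1 hn
    obtain ⟨Γ₁, Γ₂, h1, h2, h3⟩ := cons_iff.1 h
    have h2' : ATyped Γ₁ (AProc.par P Q) := h2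
    cases h2' with
    | par hs hP hQ =>
      obtain ⟨E, e1, e2⟩ := h1.symm.assoc hs
      obtain ⟨Δ1, a1, a2, a3⟩ := ih1 (r := Q ::ₘ r) (.cons e1 hP (.cons e2.symm hQ h3)) nK
        (fun k hk => hfr k (by simp [hk]))
      have hne : ∀ l ∈ L, ∀ o, nm l o ∉ names K := by
        rintro l hl o ⟨k, hk, o', h⟩
        rw [nm_inj] at h
        exact Multiset.disjoint_left.1 hd hk (h.1 ▸ hl)
      obtain ⟨Δ2, b1, b2, b3⟩ := ih2 (Δ := Δ1) (r := t + r) (by rwa [← Multiset.add_cons]) nL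
        (fun l hl o => by rw [a2 _ (hne l hl o)]; exact hfr l (by simp [hl]) o)
      refine ⟨Δ2, ?_, ?_, ?_⟩
      · convert b1 using 1; abel
      · intro x hx
        rw [PCalc.names_add] at hx
        rw [b2 x fun h => hx (.inr h), a2 x fun h => hx (.inl h)]
      · intro k hk
        rcases Multiset.mem_add.1 hk with hk | hk
        · have hk' : ∀ o, nm k o ∉ names L := by
            rintro o ⟨l, hl, o', h⟩
            rw [nm_inj] at h
            exact Multiset.disjoint_left.1 hd hk (h.1 ▸ hl)
          rw [b2 _ (hk' _), b2 _ (hk' _)]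
          exact a3 k hk
        · exact b3 k hk
  | @res P K t k o _ ih =>
    intro Δ r h hn hfr
    obtain ⟨hk, nK⟩ := Multiset.nodup_cons.1 hn
    obtain ⟨Γ₁, Γ₂, h1, h2, h3⟩ := cons_iff.1 h
    have h2' : ATyped Γ₁ (AProc.res P) := h2
    cases h2' with
    | @res _ S T _ hd hP =>
      have hab : nm k o ≠ nm k !o := by simp
      have fa := hfr k (by simp) o
      have fb := hfr k (by simp) (!o)
      have n1 : ∀ {a}, Δ a = none → Γ₁ a = none := fun {a} ha => by
        by_contra h; exact h1.left_ne h ha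
      have n2 : ∀ {a}, Δ a = none → Γ₂ a = none := fun {a} ha => by
        by_contra h; exact h1.symm.left_ne h ha
      let up2 (Γ : Ctx) (p q : Option Ty) : Ctx := Function.update (Function.update Γ (nm k o) p) (nm k !o) q
      -- The other threads must share the new endpoints that have unrestricted types and must not
      -- get the linear ones; this is weakening.
      have w : SubstTy (up2 Γ₂ S.shared T.shared) .var Γ₂ := by
        have w1 := SubstTy.weaken (n2 fa) S
        have w2 := SubstTy.weaken (Δ := Function.update Γ₂ (nm k o) S.shared) (a := nm k !o)
          (by rw [Function.update_of_ne hab.symm]; exact n2 fb) T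
        refine .of_narrow fun x => ?_
        by_cases hx1 : x = nm k o
        · subst hx1
          refine ⟨fun U hU => (by rw [n2 fa] at hU; cases hU), fun _ U hU => ?_⟩
          simp only [up2, Function.update_of_ne hab, Function.update_self] at hU
          obtain ⟨rfl, h⟩ := Ty.shared_eq_some hU; exact h
        by_cases hx2 : x = nm k !o
        · subst hx2
          refine ⟨fun U hU => (by rw [n2 fb] at hU; cases hU), fun _ U hU => ?_⟩
          simp only [up2, Function.update_self] at hU
          obtain ⟨rfl, h⟩ := Ty.shared_eq_some hU; exact h
        simp only [up2, Function.update_of_ne hx1, Function.update_of_ne hx2]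
        exact ⟨fun T h' => ⟨T, h', .rfl⟩, fun h1 S h2 => (by rw [h1] at h2; cases h2)⟩
      have hsub : SubstTy (up2 Γ₁ (some S) (some T)) (Subst.opn (nm k o) (nm k !o))
          ((Γ₁.push T).push S) := by
        have ne1 : ∀ {x U}, Γ₁ x = some U → x ≠ nm k o ∧ x ≠ nm k !o := fun {x U} hx =>
          ⟨(by rintro rfl; rw [n1 fa] at hx; cases hx), (by rintro rfl; rw [n1 fb] at hx; cases hx)⟩
        have val : ∀ {x U}, Γ₁ x = some U → up2 Γ₁ (some S) (some T) x = some U := fun {x U} hx => by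
          simp only [up2, Function.update_of_ne (ne1 hx).1, Function.update_of_ne (ne1 hx).2, hx]
        have va : up2 Γ₁ (some S) (some T) (nm k o) = some S := by
          simp only [up2, Function.update_of_ne hab, Function.update_self]
        have vb : up2 Γ₁ (some S) (some T) (nm k !o) = some T := by
          simp only [up2, Function.update_self]
        have inj : ∀ {x x' y}, ((Γ₁.push T).push S) x ≠ none → ((Γ₁.push T).push S) x' ≠ none →
            Subst.opn (nm k o) (nm k !o) x = .var y → Subst.opn (nm k o) (nm k !o) x' = .var y →
            x = x' := by
          intro x x' y hx hx' h h'
          rw [← h'] at h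
          match x, x' with
          | 0, 0 => rfl
          | 1, 1 => rfl
          | 0, 1 => injection h with h; exact absurd h hab
          | 1, 0 => injection h with h; exact absurd h.symm hab
          | x + 2, 0 => injection h with h; exact absurd (h ▸ n1 fa) hx
          | x + 2, 1 => injection h with h; exact absurd (h ▸ n1 fb) hx
          | 0, x + 2 => injection h with h; exact absurd (h ▸ n1 fa) hx'
          | 1, x + 2 => injection h with h; exact absurd (h ▸ n1 fb) hx'
          | x + 2, x' + 2 => injection h with h; rw [h]
        have all : ∀ x U, ((Γ₁.push T).push S) x = some U →
            ∃ y, Subst.opn (nm k o) (nm k !o) x = .var y ∧ up2 Γ₁ (some S) (some T) y = some U := by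
          intro x U hx
          match x with
          | 0 => cases hx; exact ⟨_, rfl, va⟩
          | 1 => cases hx; exact ⟨_, rfl, vb⟩
          | x + 2 => exact ⟨x, rfl, val hx⟩
        constructor
        · intro x U hx _
          obtain ⟨y, h, h'⟩ := all x U hx
          exact .inr (.inr (.inr ⟨y, U, h, h', .rfl⟩))
        · intro x U hx _
          obtain ⟨y, h, h'⟩ := all x U hx
          exact ⟨y, U, h, h', .rfl, fun x' hx' h'' => inj hx' (by simp [hx]) h'' h⟩
        · intro y U hy _
          by_cases hy1 : y = nm k o
          · subst hy1; exact ⟨0, by simp [Ctx.push], rfl⟩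
          by_cases hy2 : y = nm k !o
          · subst hy2; exact ⟨1, by simp [Ctx.push], rfl⟩
          simp only [up2, Function.update_of_ne hy1, Function.update_of_ne hy2] at hy
          exact ⟨y + 2, by show Γ₁ y ≠ none; simp [hy], rfl⟩
      have hconf : TConf (up2 Δ (some S) (some T))
          (PCalc.subst P (Subst.opn (nm k o) (nm k !o)) ::ₘ r) :=
        .cons ((h1.update _ S.split_shared).update _ T.split_shared) (hP.subst hsub) (h3.narrow w)
      have hl : ∀ l ∈ K, ∀ o', nm l o' ≠ nm k o ∧ nm l o' ≠ nm k !o := by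
        intro l hl o'
        have : l ≠ k := by rintro rfl; exact hk hl
        simp [this]
      obtain ⟨Δ', a1, a2, a3⟩ := ih hconf nK (fun l hl' o' => by
        simp only [up2, Function.update_of_ne (hl l hl' o').1, Function.update_of_ne (hl l hl' o').2]
        exact hfr l (by simp [hl']) o')
      have hkn : ∀ o', nm k o' ∉ names K := by
        rintro o' ⟨l, hl', p, h⟩
        rw [nm_inj] at h
        exact hk (h.1 ▸ hl')
      refine ⟨Δ', a1, ?_, ?_⟩
      · intro x hx
        have hx1 : x ≠ nm k o := by rintro rfl; exact hx ⟨k, by simp, o, rfl⟩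
        have hx2 : x ≠ nm k !o := by rintro rfl; exact hx ⟨k, by simp, !o, rfl⟩
        rw [a2 x fun ⟨l, hl', p, h⟩ => hx ⟨l, by simp [hl'], p, h⟩]
        simp only [up2, Function.update_of_ne hx1, Function.update_of_ne hx2]
      · intro l hl'
        rcases Multiset.mem_cons.1 hl' with rfl | hl'
        · rw [a2 _ (hkn _), a2 _ (hkn _)]
          cases o with
          | false => exact ⟨S, T, by simp [up2], by simp [up2], hd⟩
          | true => exact ⟨T, S, by simp [up2], by simp [up2], hd.symm⟩
        · exact a3 l hl'
  | thr _ => intro Δ r h _ _; exact ⟨Δ, by simpa using h, fun _ _ => rfl, by simp⟩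

end TConf

/-! ### Typed choices and subject reduction for communication -/

/-- The data of a choice. -/
structure Ch where
  lu : Qual
  w : View
  q : Qual
  x : ℕ
  n : ℕ
  pre : Fin n → Mix.Pre
  cont : Fin n → AProc

/-- The choice as a process. -/
def Ch.proc (c : Ch) : AProc := .choice c.lu c.w c.q (.var c.x) c.n c.pre c.cont

/-- How the type `S` of the subject constrains the choice `c`. -/
inductive ChTy (c : Ch) (S : Ty) : Prop
  | lin {dom} {pay cty : {a : Key // a ∈ dom} → Ty} : c.lu = .lin → c.q = .lin →
      Sub S (.lin c.w dom pay cty) → (∀ a, a ∈ dom ↔ ∃ i, (c.pre i).key = a) → ChTy c S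
  | un {dom} {pay : {a : Key // a ∈ dom} → Ty} : c.lu = .un →
      Sub S (.un c.w dom pay) → (∀ a, a ∈ dom ↔ ∃ i, (c.pre i).key = a) → ChTy c S

theorem ATyped.chTy {Γ : Ctx} {c : Ch} (h : ATyped Γ c.proc) : ∃ S, Γ c.x = some S ∧ ChTy c S := by
  obtain ⟨lu, w, q, x, n, pre, cont⟩ := c
  have hvar : ∀ {Γ : Ctx} {T : Ty}, HasVal Γ (.var x) T → ∃ S, Γ x = some S ∧ Sub S T := by
    intro Γ T h
    rcases hasVal_iff.1 h with ⟨_, ⟨h, _⟩ | ⟨h, _⟩ | ⟨h, _⟩⟩ | ⟨x', S, hx, h, h', _⟩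
    · cases h
    · cases h
    · cases h
    · cases hx; exact ⟨S, h, h'⟩
  unfold Ch.proc at h
  cases h with
  | choiceLin split subject mem cover branch body =>
    obtain ⟨S, h1, h2⟩ := hvar subject
    exact ⟨S, split.of_left h1, .lin rfl rfl h2 fun a => ⟨cover a, by rintro ⟨i, rfl⟩; exact mem i⟩⟩
  | choiceUn qual split subject mem cover branch body =>
    obtain ⟨S, h1, h2⟩ := hvar subject
    exact ⟨S, split.of_left h1, .un rfl h2 fun a => ⟨cover a, by rintro ⟨i, rfl⟩; exact mem i⟩⟩

theorem ATyped.exists_ch {Γ : Ctx} {lu w q x n pre cont}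
    (h : ATyped Γ (.choice lu w q x n pre cont)) :
    ∃ y, x = .var y := by
  cases h with
  | choiceLin => exact ⟨_, rfl⟩
  | choiceUn => exact ⟨_, rfl⟩

/-- The constraints on two connected choices. -/
theorem ChTy.dual {c d : Ch} {S T : Ty} (hc : ChTy c S) (hd : ChTy d T) (h : S.Dual T) :
    c.lu = d.lu ∧ d.w = c.w.dual ∧
      (c.w = .int → ∀ i, ∃ j, (d.pre j).key = (c.pre i).key.dual) := by
  cases hc with
  | lin h1 h2 h3 h4 =>
    cases hd with
    | lin h5 h6 h7 h8 =>
      obtain ⟨e1, e2, _, _⟩ := h.lin_lin h3 h7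
      exact ⟨h1.trans h5.symm, e1, fun hw i => (h8 _).1 (e2 hw _ ((h4 _).2 ⟨i, rfl⟩))⟩
    | un h5 h6 h7 => exact (h.not_lin_un h3 h6).elim
  | un h1 h3 h4 =>
    cases hd with
    | lin h5 h6 h7 h8 => exact (h.symm.not_lin_un h7 h3).elim
    | un h5 h6 h7 =>
      obtain ⟨e1, e2, _, _⟩ := h.un_un h3 h6
      exact ⟨h1.trans h5.symm, e1, fun hw i => (h7 _).1 (e2 hw _ ((h4 _).2 ⟨i, rfl⟩))⟩

theorem ChTy.not_unr {c : Ch} {S : Ty} (h : ChTy c S) (hl : c.lu = .lin) : ¬ S.Unr := by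
  cases h with
  | lin _ _ h3 _ => exact fun h => Ty.not_unr_lin (h3.unr_iff.1 h)
  | un h => rw [hl] at h; cases h

/-- Linear endpoints are the subject of at most one thread. -/
theorem TConf.lin_unique {Δ : Ctx} {c d : Ch} {r : Multiset AProc}
    (h : TConf Δ (c.proc ::ₘ d.proc ::ₘ r)) (hl : c.lu = .lin) : c.x ≠ d.x := by
  intro hx
  obtain ⟨Γ₁, Γ₂, h1, h2, h3⟩ := cons_iff.1 h
  obtain ⟨Γ₃, Γ₄, h4, h5, h6⟩ := cons_iff.1 h3
  obtain ⟨S, hS, hc⟩ := h2.chTy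
  obtain ⟨T, hT, hd⟩ := h5.chTy
  have hu := hc.not_unr hl
  rcases h1.of_lin (h1.of_left hS) hu with ⟨_, h7⟩ | ⟨h7, _⟩
  · rw [hx, h4.of_left hT] at h7; cases h7
  · rw [hS] at h7; cases h7

/-- What remains of a choice after it was used. -/
def astay : Qual → AProc → Multiset AProc
  | .lin, _ => 0
  | .un, C => {C}

/-- The transmitted value takes its resources with it: the part `Δv` leaves the share of the sender
and is joined to the share `M₂` of the receiver. -/
theorem TConf.recombine {Δ M₁ N M₂ Δr Δv Δp : Ctx} {v : Val} {S : Ty} {P Q : AProc}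
    {r : Multiset AProc} (h1 : Δ.Split M₁ N) (h2 : N.Split M₂ Δr) (h3 : M₁.Split Δv Δp)
    (hv : HasVal Δv v S) (hP : ATyped Δp P) (hQ : ATyped (M₂.push S) Q) (hr : TConf Δr r) :
    TConf Δ (P ::ₘ Q.subst (Subst.inst v) ::ₘ r) := by
  obtain ⟨E, e1, e2⟩ := h1.symm.assoc h3.symm
  obtain ⟨F, f1, f2⟩ := e2.symm.assoc' h2
  exact .cons e1 hP (.cons f1 (hQ.subst (.inst f2 hv)) hr)

theorem ATyped.qual {Γ : Ctx} {c : Ch} (h : ATyped Γ c.proc) (hq : c.q = .un) : Γ.Unr := by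
  obtain ⟨lu, w, q, x, n, pre, cont⟩ := c
  unfold Ch.proc at h
  cases h with
  | choiceLin => cases hq
  | choiceUn qual => exact qual hq

/-- A persisting choice is supplied with a context that can be split off once more without taking
anything from the other threads. -/
theorem TConf.stay {Δ : Ctx} {s : Multiset AProc} (h : TConf Δ s) {Δ₁ : Ctx} {c : Ch}
    (hs : c.q = .un → Δ.Split Δ₁ Δ) (hc : ATyped Δ₁ c.proc) : TConf Δ (astay c.q c.proc + s) := by
  cases hq : c.q with
  | lin => simpa [astay] using h
  | un => rw [astay, Multiset.singleton_add]; exact .cons (hs hq) hc h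

/-- Subject reduction for communication. -/
theorem TConf.com {Δ : Ctx} {c d : Ch} {r : Multiset AProc} (h : TConf Δ (c.proc ::ₘ d.proc ::ₘ r))
    {S T : Ty} (hS : Δ c.x = some S) (hT : Δ d.x = some T) (hd : S.Dual T) (hne : c.x ≠ d.x)
    {i : Fin c.n} {j : Fin d.n} {l : Label} {v : Val} (hi : c.pre i = .out l v)
    (hj : d.pre j = .inp l) :
    ∃ Δ', TConf Δ' (c.cont i ::ₘ (d.cont j).subst (Subst.inst v) ::ₘ
        (astay c.q c.proc + (astay d.q d.proc + r))) ∧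
      (∀ x, x ≠ c.x → x ≠ d.x → Δ' x = Δ x) ∧
      ∃ S' T', Δ' c.x = some S' ∧ Δ' d.x = some T' ∧ S'.Dual T' := by
  obtain ⟨Δ₁, N, s1, t1, h3⟩ := cons_iff.1 h
  obtain ⟨Δ₂, Δr, s2, t2, hr⟩ := cons_iff.1 h3
  obtain ⟨S0, hS0, cS⟩ := t1.chTy
  obtain ⟨T0, hT0, cT⟩ := t2.chTy
  have e1 := s1.of_left hS0
  rw [hS] at e1; cases e1
  have e2 := s1.symm.of_left (s2.of_left hT0)
  rw [hT] at e2; cases e2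
  have hlu := (cS.dual cT hd).1
  -- persisting choices
  have stays : ∀ {Δ' : Ctx} {s : Multiset AProc}, (c.q = .un ∨ d.q = .un → Δ' = Δ) →
      TConf Δ' s → TConf Δ' (astay c.q c.proc + (astay d.q d.proc + s)) := by
    intro Δ' s hΔ hs
    refine TConf.stay (TConf.stay hs (fun hq => ?_) t2) (fun hq => ?_) t1
    · rw [hΔ (.inr hq)]; exact s1.again' s2 (t2.qual hq)
    · rw [hΔ (.inl hq)]; exact s1.again (t1.qual hq)
  have reorder : ∀ (A B : AProc) (s t : Multiset AProc), A ::ₘ B ::ₘ (s + (t + r)) = s + (t + (A ::ₘ B ::ₘ r)) := by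
    intro A B s t
    simp only [← Multiset.singleton_add]; abel
  simp only [reorder]
  obtain ⟨lu, w, q, x, n, pre, cont⟩ := c
  obtain ⟨lu', w', q', y, m, pre', cont'⟩ := d
  simp only [Ch.proc] at *
  obtain rfl : lu = lu' := hlu
  cases t1 with
  | @choiceUn _ Γ₁ Γ₂ _ _ _ _ _ Θ _ dom pay qual split subject mem cover branch body =>
    cases t2 with
    | @choiceUn _ Γ₁' Γ₂' _ _ _ _ _ Θ' _ dom' pay' qual' split' subject' mem' cover' branch' body' =>
      -- Unrestricted subjects keep their types, so the whole context stays as it is.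
      refine ⟨Δ, stays (fun _ => rfl) ?_, fun _ _ _ => rfl, S, T, hS, hT, hd⟩
      have sub1 : Sub S (.un w dom pay) ∧ Γ₁.Unr := by
        rcases hasVal_iff.1 subject with ⟨_, ⟨h, _⟩ | ⟨h, _⟩ | ⟨h, _⟩⟩ | ⟨x', U, hx, h, h', h''⟩
        · cases h
        · cases h
        · cases h
        · cases hx
          have := s1.of_left (split.of_left h)
          rw [hS] at this; cases this
          refine ⟨h', fun z W hz => ?_⟩
          by_cases hzx : z = x
          · subst hzx; rw [h] at hz; cases hz; exact h'.unr_iff.2 Ty.unr_un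
          · exact h'' z W hzx hz
      have sub2 : Sub T (.un w' dom' pay') ∧ Γ₁'.Unr := by
        rcases hasVal_iff.1 subject' with ⟨_, ⟨h, _⟩ | ⟨h, _⟩ | ⟨h, _⟩⟩ | ⟨x', U, hx, h, h', h''⟩
        · cases h
        · cases h
        · cases h
        · cases hx
          have := s1.symm.of_left (s2.of_left (split'.of_left h))
          rw [hT] at this; cases this
          refine ⟨h', fun z W hz => ?_⟩
          by_cases hzx : z = y
          · subst hzx; rw [h] at hz; cases hz; exact h'.unr_iff.2 Ty.unr_un
          · exact h'' z W hzx hz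
      have b1 := branch i
      have b2 := branch' j
      have hm := mem i
      have hm' := mem' j
      obtain ⟨_, _, _, fit⟩ := hd.un_un sub1.1 sub2.1
      have B1 := body i
      have B2 := body' j
      generalize Θ i = Θi at *
      generalize Θ' j = Θj at *
      have eΓ := split.eq_of_unr sub1.2
      have eΓ' := split'.eq_of_unr sub2.2
      subst eΓ eΓ'
      have hk1 : (pre i).key = (l, .snd) := by rw [hi]; rfl
      have hk2 : (pre' j).key = Key.dual (l, .snd) := by rw [hj]; rfl
      -- The payload is named because its index contains a proof about the prefix, which would block
      -- rewriting the prefix.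
      obtain ⟨p, hp⟩ : ∃ p, p = pay ⟨_, hm⟩ := ⟨_, rfl⟩
      obtain ⟨p', hp'⟩ : ∃ p', p' = pay' ⟨_, hm'⟩ := ⟨_, rfl⟩
      have hfit : Sub p p' := by
        have h1 : p = pay ⟨(l, .snd), hk1 ▸ hm⟩ := by
          rw [hp]; exact congrArg pay (Subtype.ext hk1)
        have h2 : p' = pay' ⟨Key.dual (l, .snd), hk2 ▸ hm'⟩ := by
          rw [hp']; exact congrArg pay' (Subtype.ext hk2)
        rw [h1, h2]
        exact fit (l, .snd) _ _
      rw [← hp, hi] at b1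
      rw [← hp', hj] at b2
      cases b1 with
      | out sv hv =>
        cases b2 with
        | inp => exact recombine s1 s2 sv (hv.mono hfit) B1 B2 hr
  | @choiceLin _ Γ₁ Γ₂ _ _ _ _ Θ _ dom pay cty split subject mem cover branch body =>
    cases t2 with
    | @choiceLin _ Γ₁' Γ₂' _ _ _ _ Θ' _ dom' pay' cty' split' subject' mem' cover' branch' body' =>
      have sub1 : Γ₁ x = some S ∧ Sub S (.lin w dom pay cty) ∧
          ∀ y U, y ≠ x → Γ₁ y = some U → U.Unr := by
        rcases hasVal_iff.1 subject with ⟨_, ⟨h, _⟩ | ⟨h, _⟩ | ⟨h, _⟩⟩ | ⟨x', U, hx, h, h', h''⟩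
        · cases h
        · cases h
        · cases h
        · cases hx
          have := s1.of_left (split.of_left h)
          rw [hS] at this; cases this
          exact ⟨h, h', h''⟩
      have sub2 : Γ₁' y = some T ∧ Sub T (.lin w' dom' pay' cty') ∧
          ∀ z U, z ≠ y → Γ₁' z = some U → U.Unr := by
        rcases hasVal_iff.1 subject' with ⟨_, ⟨h, _⟩ | ⟨h, _⟩ | ⟨h, _⟩⟩ | ⟨x', U, hx, h, h', h''⟩
        · cases h
        · cases h
        · cases h
        · cases hx
          have := s1.symm.of_left (s2.of_left (split'.of_left h))
          rw [hT] at this; cases this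
          exact ⟨h, h', h''⟩
      have hSu : ¬ S.Unr := fun h => Ty.not_unr_lin (sub1.2.1.unr_iff.1 h)
      have hTu : ¬ T.Unr := fun h => Ty.not_unr_lin (sub2.2.1.unr_iff.1 h)
      have b1 := branch i
      have b2 := branch' j
      have hm := mem i
      have hm' := mem' j
      obtain ⟨_, _, _, fit⟩ := hd.lin_lin sub1.2.1 sub2.2.1
      have B1 := body i
      have B2 := body' j
      generalize Θ i = Θi at *
      generalize Θ' j = Θj at *
      have hk1 : (pre i).key = (l, .snd) := by rw [hi]; rfl
      have hk2 : (pre' j).key = Key.dual (l, .snd) := by rw [hj]; rfl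
      obtain ⟨p, hp⟩ : ∃ p, p = pay ⟨_, hm⟩ := ⟨_, rfl⟩
      obtain ⟨p', hp'⟩ : ∃ p', p' = pay' ⟨_, hm'⟩ := ⟨_, rfl⟩
      obtain ⟨t, ht⟩ : ∃ t, t = cty ⟨_, hm⟩ := ⟨_, rfl⟩
      obtain ⟨t', ht'⟩ : ∃ t', t' = cty' ⟨_, hm'⟩ := ⟨_, rfl⟩
      -- `C` and `D` continue the declared types of the endpoints and are dual. The processes use
      -- supertypes `t` and `t'`, for which duality may fail; so the new context gets `C` and `D`,
      -- and the continuations are narrowed.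
      obtain ⟨hfit, C, D, hCD, hC, hD⟩ : Sub p p' ∧ ∃ C D, Ty.Dual C D ∧ Sub C t ∧ Sub D t' := by
        have h1 : p = pay ⟨(l, .snd), hk1 ▸ hm⟩ := by
          rw [hp]; exact congrArg pay (Subtype.ext hk1)
        have h2 : p' = pay' ⟨Key.dual (l, .snd), hk2 ▸ hm'⟩ := by
          rw [hp']; exact congrArg pay' (Subtype.ext hk2)
        have h3 : t = cty ⟨(l, .snd), hk1 ▸ hm⟩ := by
          rw [ht]; exact congrArg cty (Subtype.ext hk1)
        have h4 : t' = cty' ⟨Key.dual (l, .snd), hk2 ▸ hm'⟩ := by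
          rw [ht']; exact congrArg cty' (Subtype.ext hk2)
        rw [h1, h2, h3, h4]
        exact fit (l, .snd) _ _
      rw [← hp, ← ht, hi] at b1
      rw [← hp', ← ht', hj] at b2
      have hx1 : Δ₁ x = some S := hS0
      have hy2 : Δ₂ y = some T := hT0
      have hxN : N x = none := by
        rcases s1.of_lin hS hSu with ⟨_, h⟩ | ⟨h, _⟩
        · exact h
        · rw [hx1] at h; cases h
      have hyN : N y = some T := s2.of_left hy2
      have hy1 : Δ₁ y = none := by
        rcases s1.of_lin hT hTu with ⟨_, h⟩ | ⟨h, _⟩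
        · rw [hyN] at h; cases h
        · exact h
      have hx2 : Δ₂ x = none := by
        by_contra h; exact s2.left_ne h hxN
      have hxr : Δr x = none := by
        by_contra h; exact s2.symm.left_ne h hxN
      have hyr : Δr y = none := by
        rcases s2.of_lin hyN hTu with ⟨_, h⟩ | ⟨h, _⟩
        · exact h
        · rw [hy2] at h; cases h
      have hΓ₂ : ∀ z, z ≠ x → Γ₂ z = Δ₁ z := by
        intro z hz
        rcases (split z).cases with ⟨e1, _, e3⟩ | ⟨U, hU, e1, _, e3⟩ | ⟨U, hU, e1, e2, e3⟩ |
          ⟨U, hU, e1, _, e3⟩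
        · rw [e1, e3]
        · rw [e1, e3]
        · exact absurd (sub1.2.2 z U hz e2) hU
        · rw [e1, e3]
      have hΓ₂' : ∀ z, z ≠ y → Γ₂' z = Δ₂ z := by
        intro z hz
        rcases (split' z).cases with ⟨e1, _, e3⟩ | ⟨U, hU, e1, _, e3⟩ | ⟨U, hU, e1, e2, e3⟩ |
          ⟨U, hU, e1, _, e3⟩
        · rw [e1, e3]
        · rw [e1, e3]
        · exact absurd (sub2.2.2 z U hz e2) hU
        · rw [e1, e3]
      let up2 (Γ : Ctx) (p q : Option Ty) : Ctx := Function.update (Function.update Γ x p) y q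
      have upx : ∀ Γ p q, up2 Γ p q x = p := fun Γ p q => by
        simp only [up2, Function.update_of_ne hne, Function.update_self]
      have upy : ∀ Γ p q, up2 Γ p q y = q := fun Γ p q => by simp only [up2, Function.update_self]
      have upz : ∀ Γ p q z, z ≠ x → z ≠ y → up2 Γ p q z = Γ z := fun Γ p q z h1 h2 => by
        simp only [up2, Function.update_of_ne h2, Function.update_of_ne h1]
      have shu : ∀ {U W : Ty}, U.shared = some W → W.Unr := fun h => by
        obtain ⟨rfl, h'⟩ := Ty.shared_eq_some h; exact h'
      -- A linear type may continue as an unrestricted one, which then has to be visible in every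
      -- part of the context, including that of the opposite thread.
      have n1 : SubstTy (up2 Δ₁ (some C) D.shared) .var (Γ₂.set x t) := by
        refine .of_narrow fun z => ?_
        by_cases hzx : z = x
        · subst hzx
          rw [upx, Ctx.set, Function.update_self]
          exact ⟨fun U hU => ⟨C, rfl, by cases hU; exact hC⟩, fun h => by cases h⟩
        rw [Ctx.set, Function.update_of_ne hzx, hΓ₂ z hzx]
        by_cases hzy : z = y
        · subst hzy
          rw [upy, hy1]
          exact ⟨fun U hU => (by cases hU), fun _ U hU => shu hU⟩
        rw [upz _ _ _ z hzx hzy]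
        exact ⟨fun U hU => ⟨U, hU, .rfl⟩, fun h1 U h2 => by rw [h1] at h2; cases h2⟩
      have n2 : SubstTy (up2 Δ₂ C.shared (some D)) .var (Γ₂'.set y t') := by
        refine .of_narrow fun z => ?_
        by_cases hzy : z = y
        · subst hzy
          rw [upy, Ctx.set, Function.update_self]
          exact ⟨fun U hU => ⟨D, rfl, by cases hU; exact hD⟩, fun h => by cases h⟩
        rw [Ctx.set, Function.update_of_ne hzy, hΓ₂' z hzy]
        by_cases hzx : z = x
        · subst hzx
          rw [upx, hx2]
          exact ⟨fun U hU => (by cases hU), fun _ U hU => shu hU⟩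
        rw [upz _ _ _ z hzx hzy]
        exact ⟨fun U hU => ⟨U, hU, .rfl⟩, fun h1 U h2 => by rw [h1] at h2; cases h2⟩
      have n3 : SubstTy (up2 Δr C.shared D.shared) .var Δr := by
        refine .of_narrow fun z => ?_
        by_cases hzx : z = x
        · subst hzx
          rw [upx, hxr]
          exact ⟨fun U hU => (by cases hU), fun _ U hU => shu hU⟩
        by_cases hzy : z = y
        · subst hzy
          rw [upy, hyr]
          exact ⟨fun U hU => (by cases hU), fun _ U hU => shu hU⟩
        rw [upz _ _ _ z hzx hzy]
        exact ⟨fun U hU => ⟨U, hU, .rfl⟩, fun h1 U h2 => by rw [h1] at h2; cases h2⟩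
      have s1' := (s1.update x C.split_shared).update y D.split_shared.symm
      have s2' := (s2.update x C.shared_split).update y D.split_shared
      -- Nothing persists here, because the linear rule admits linear processes only.
      refine ⟨up2 Δ (some C) (some D), stays (fun h => by simp at h) ?_,
        fun z h1 h2 => upz _ _ _ z h1 h2, C, D, upx _ _ _, upy _ _ _, hCD⟩
      cases b1 with
      | out sv hv =>
        cases b2 with
        | inp =>
          obtain ⟨V, W, e1, e2, e3⟩ := n1.split sv
          have hv' := e2.hasVal hv
          rw [Val.subst_var] at hv'
          have hB1 := B1.subst e3
          rw [AProc.subst_var] at hB1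
          have hB2 := B2.subst (n2.push p')
          rw [Subst.up_var, AProc.subst_var] at hB2
          exact recombine s1' s2' e1 (hv'.mono hfit) hB1 hB2 (hr.narrow n3)

theorem TConf.cond {Δ : Ctx} {v : Val} {P Q : AProc} {r : Multiset AProc}
    (h : TConf Δ (.cond v P Q ::ₘ r)) (hv : ∀ x, v ≠ .var x) :
    TConf Δ (P ::ₘ r) ∧ TConf Δ (Q ::ₘ r) := by
  obtain ⟨Δ₁, N, s1, t1, h3⟩ := cons_iff.1 h
  cases t1 with
  | @cond _ Γ₁ Γ₂ _ _ _ hs hval hP hQ =>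
    have hu : Γ₁.Unr := by
      rcases hasVal_iff.1 hval with ⟨h, _⟩ | ⟨x, _, h, _⟩
      · exact h
      · exact absurd h (hv x)
    rw [hs.eq_of_unr hu] at hP hQ
    exact ⟨.cons s1 hP h3, .cons s1 hQ h3⟩

end MixedSessions

namespace MixedSessions

open PCalc (Flat Supp NF parL ext)
open Ty (Sub)

/-! ### Source configurations: typing of normal forms, reduction, reachability -/

theorem Val.subst_shift_eq_var {v : Val} {n y : ℕ} (h : v.subst (Subst.shift n) = .var y) :
    ∃ z, v = .var z ∧ y = z + n := by
  cases v with
  | var z => injection h with h; exact ⟨z, rfl, h.symm⟩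
  | _ => cases h

/-- Closing a channel under a restriction is well typed. -/
theorem SubstTy.ext {Γ Δ₀ Δ : Ctx} {ρ : Subst} {k : ℕ} {S T : Ty} (h : SubstTy Γ ρ Δ₀)
    (h0 : Δ (nm k false) = some S) (h1 : Δ (nm k true) = some T)
    (hΔ : ∀ x, (∀ o, x ≠ nm k o) → Δ x = Δ₀ x) (hk : ∀ o, Δ₀ (nm k o) = none) :
    SubstTy ((Γ.push T).push S) (PCalc.ext k ρ) Δ := by
  have e0 : PCalc.ext k ρ (nm k false) = .var 0 := by simp [PCalc.ext]
  have e1 : PCalc.ext k ρ (nm k true) = .var 1 := by simp [PCalc.ext]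
  have e2 : ∀ x, (∀ o, x ≠ nm k o) → PCalc.ext k ρ x = (ρ x).subst (Subst.shift 2) := by
    intro x hx; simp [PCalc.ext, hx false, hx true]
  have hcase : ∀ x, x = nm k false ∨ x = nm k true ∨ ∀ o, x ≠ nm k o := by
    intro x
    by_cases h0 : x = nm k false
    · exact .inl h0
    by_cases h1 : x = nm k true
    · exact .inr (.inl h1)
    · exact .inr (.inr fun o => by cases o <;> assumption)
  have hval : ∀ {x y}, PCalc.ext k ρ x = .var y → (x = nm k false ∧ y = 0) ∨ (x = nm k true ∧ y = 1) ∨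
      ∃ z, y = z + 2 ∧ ρ x = .var z ∧ ∀ o, x ≠ nm k o := by
    intro x y hx
    rcases hcase x with rfl | rfl | hxk
    · rw [e0] at hx; injection hx with hx; exact .inl ⟨rfl, hx.symm⟩
    · rw [e1] at hx; injection hx with hx; exact .inr (.inl ⟨rfl, hx.symm⟩)
    · rw [e2 x hxk] at hx
      obtain ⟨z, h, h'⟩ := Val.subst_shift_eq_var hx
      exact .inr (.inr ⟨z, h', h, hxk⟩)
  constructor
  · intro x U hx hU
    rcases hcase x with rfl | rfl | hxk
    · rw [h0] at hx; cases hx; exact .inr (.inr (.inr ⟨0, S, e0, rfl, .rfl⟩))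
    · rw [h1] at hx; cases hx; exact .inr (.inr (.inr ⟨1, T, e1, rfl, .rfl⟩))
    · rw [hΔ x hxk] at hx
      rw [e2 x hxk]
      rcases h.un x U hx hU with ⟨h', a⟩ | ⟨h', a⟩ | ⟨h', a⟩ | ⟨y, V, h', a, b⟩
      · exact .inl ⟨by rw [h']; rfl, a⟩
      · exact .inr (.inl ⟨by rw [h']; rfl, a⟩)
      · exact .inr (.inr (.inl ⟨by rw [h']; rfl, a⟩))
      · exact .inr (.inr (.inr ⟨y + 2, V, by rw [h']; rfl, a, b⟩))
  · intro x U hx hU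
    rcases hcase x with rfl | rfl | hxk
    · rw [h0] at hx; cases hx
      refine ⟨0, S, e0, rfl, .rfl, fun x' _ h' => ?_⟩
      rcases hval h' with ⟨h, _⟩ | ⟨_, h⟩ | ⟨z, h, _⟩
      · exact h
      · cases h
      · omega
    · rw [h1] at hx; cases hx
      refine ⟨1, T, e1, rfl, .rfl, fun x' _ h' => ?_⟩
      rcases hval h' with ⟨_, h⟩ | ⟨h, _⟩ | ⟨z, h, _⟩
      · cases h
      · exact h
      · omega
    · rw [hΔ x hxk] at hx
      obtain ⟨y, V, a, b, c, d⟩ := h.lin x U hx hU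
      refine ⟨y + 2, V, by rw [e2 x hxk, a]; rfl, b, c, fun x' hx' h' => ?_⟩
      rcases hval h' with ⟨_, h⟩ | ⟨_, h⟩ | ⟨z, h, h2, h3⟩
      · omega
      · omega
      · obtain rfl : z = y := by omega
        exact d x' (by rwa [← hΔ x' h3]) h2
  · intro y V hy hV
    match y with
    | 0 => exact ⟨_, by rw [h0]; simp, e0⟩
    | 1 => exact ⟨_, by rw [h1]; simp, e1⟩
    | y + 2 =>
      obtain ⟨x, hx, h'⟩ := h.onto y V hy hV
      have hxk : ∀ o, x ≠ nm k o := by rintro o rfl; exact hx (hk o)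
      exact ⟨x, by rwa [hΔ x hxk], by rw [e2 x hxk, h']; rfl⟩

/-- A context with the names of some channels removed. -/
noncomputable def Ctx.off (Δ : Ctx) (K : List ℕ) : Ctx :=
  open Classical in fun x => if x ∈ names (K : Multiset ℕ) then none else Δ x

/-- The names of `K` are bound by the restrictions, with dual types taken from `Δ`; hence the
closing substitution is only asked to account for the context without these names. -/
theorem TConf.typed_NF {Δ : Ctx} {t : List AProc} (ht : TConf Δ (t : Multiset AProc)) (K : List ℕ) :
    ∀ {Γ : Ctx} {ρ : Subst}, SubstTy Γ ρ (Δ.off K) → K.Nodup →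
      (∀ k ∈ K, ∃ S T, Δ (nm k false) = some S ∧ Δ (nm k true) = some T ∧ S.Dual T) →
      ATyped Γ (NF K ρ t) := by
  induction K with
  | nil =>
    intro Γ ρ h _ _
    have e : Δ.off [] = Δ := by
      funext x
      have : x ∉ names (([] : List ℕ) : Multiset ℕ) := by rintro ⟨k, hk, _⟩; simp at hk
      exact if_neg this
    rw [e] at h
    have := ht.parL.subst h
    have e' : (PCalc.parL t).subst ρ = NF [] ρ t := PCalc.subst_parL t ρ
    rwa [e'] at this
  | cons k K ih =>
    intro Γ ρ h hn hd
    obtain ⟨S, T, h0, h1, hST⟩ := hd k (by simp)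
    obtain ⟨hk, hn⟩ := List.nodup_cons.1 hn
    have hkK : ∀ o, nm k o ∉ names (K : Multiset ℕ) := by
      rintro o ⟨l, hl, p, h⟩
      rw [nm_inj] at h
      exact hk (h.1 ▸ by simpa using hl)
    refine .res hST (ih (SubstTy.ext h (by simp [Ctx.off, hkK, h0]) (by simp [Ctx.off, hkK, h1]) ?_ ?_) hn
      fun l hl => hd l (by simp [hl]))
    · intro x hx
      have : x ∈ names ((k :: K : List ℕ) : Multiset ℕ) ↔ x ∈ names (K : Multiset ℕ) := by
        constructor
        · rintro ⟨l, hl, p, hp⟩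
          rcases List.mem_cons.1 (by simpa using hl : l ∈ k :: K) with rfl | hl
          · exact (hx p hp).elim
          · exact ⟨l, by simpa using hl, p, hp⟩
        · rintro ⟨l, hl, p, h⟩
          exact ⟨l, by simpa using .inr (by simpa using hl), p, h⟩
      exact @if_congr _ _ _ (_) (_) _ _ _ _ this.symm rfl rfl
    · intro o
      have : nm k o ∈ names ((k :: K : List ℕ) : Multiset ℕ) := ⟨k, by simp, o, rfl⟩
      simp [Ctx.off, this]

/-- The names of the first `N` free variables. -/
def evensBelow (N : ℕ) : Set ℕ := {x | ∃ y < N, x = 2 * y}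

theorem evensBelow_subset (N : ℕ) : evensBelow N ⊆ evens := fun _ ⟨y, _, h⟩ => ⟨y, h⟩

/-- The context `Δ` types the free variables as in `Γ` and the channels in `K` by dual types. -/
structure Matches (Γ : Ctx) (K : Multiset ℕ) (Δ : Ctx) : Prop where
  free : ∀ x, Δ (2 * x) = Γ x
  dual : ∀ k ∈ K, ∃ S T, Δ (nm k false) = some S ∧ Δ (nm k true) = some T ∧ S.Dual T
  fresh : ∀ k, k ∉ K → ∀ o, Δ (nm k o) = none

/-- The threads `s` with the channels `K` are a configuration of a typed process that is reachable
from `S₀`. -/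
structure Src (Γ : Ctx) (S₀ : Mix.Proc) (N : ℕ) (K : Multiset ℕ) (s : Multiset AProc) : Prop where
  typed : ∃ Δ, TConf Δ s ∧ Matches Γ K Δ
  nodup : K.Nodup
  thr : ∀ P ∈ s, PCalc.thr P
  supp : ∀ P ∈ s, Supp (evensBelow N ∪ names K) P
  reach : ∃ A : AProc, Mix.Steps S₀ A.erase ∧ ATyped Γ A ∧ Flat (A.subst freeNm) K s

/-- Reduction of source configurations, with the new channels. -/
inductive SRed : Multiset AProc → Multiset ℕ → Multiset AProc → Prop
  | cond {v P Q A L t r} : (v = .tt ∧ A = P ∨ v = .ff ∧ A = Q) → Flat A L t →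
      SRed (.cond v P Q ::ₘ r) L (t + r)
  | com {c d : Ch} {k o l v KP KQ sP sQ r} (i : Fin c.n) (j : Fin d.n) : c.x = nm k o →
      d.x = nm k !o → c.pre i = .out l v → d.pre j = .inp l → Flat (c.cont i) KP sP →
      Flat ((d.cont j).subst (Subst.inst v)) KQ sQ →
      SRed (c.proc ::ₘ d.proc ::ₘ r) (KP + KQ)
        (sP + sQ + (astay c.q c.proc + (astay d.q d.proc + r)))

namespace Matches

theorem substTy {Γ Δ : Ctx} {Kl : List ℕ} (h : Matches Γ (Kl : Multiset ℕ) Δ) :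
    SubstTy Γ PCalc.closeNm (Δ.off Kl) := by
  have key : ∀ x T, Δ.off Kl x = some T → ∃ y, x = 2 * y ∧ Γ y = some T := by
    intro x T hx
    unfold Ctx.off at hx
    split_ifs at hx with hK
    rcases even_or_nm x with ⟨y, rfl⟩ | ⟨k, o, rfl⟩
    · exact ⟨y, rfl, by rw [← h.free, hx]⟩
    · rw [h.fresh k fun hk => hK ⟨k, hk, o, rfl⟩] at hx; cases hx
  have cl : ∀ y, PCalc.closeNm (2 * y) = .var y := fun y => by
    show Val.var (2 * y / 2) = _; simp
  constructor
  · intro x T hx _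
    obtain ⟨y, rfl, hy⟩ := key x T hx
    exact .inr (.inr (.inr ⟨y, T, cl y, hy, .rfl⟩))
  · intro x T hx _
    obtain ⟨y, rfl, hy⟩ := key x T hx
    refine ⟨y, T, cl y, hy, .rfl, fun x' hx' h' => ?_⟩
    obtain ⟨T', hT'⟩ := Option.ne_none_iff_exists'.1 hx'
    obtain ⟨y', rfl, _⟩ := key x' T' hT'
    rw [cl] at h'; injection h' with h'; rw [h']
  · intro y S hy _
    refine ⟨2 * y, ?_, cl y⟩
    have : 2 * y ∉ names (Kl : Multiset ℕ) := by rintro ⟨k, _, o, h⟩; simp at h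
    simp [Ctx.off, this, h.free, hy]

theorem add {Γ Δ Δ' : Ctx} {K L : Multiset ℕ} (h : Matches Γ K Δ)
    (h1 : ∀ x, x ∉ names L → Δ' x = Δ x) (hKL : ∀ k ∈ K, k ∉ L)
    (h2 : ∀ k ∈ L, ∃ S T, Δ' (nm k false) = some S ∧ Δ' (nm k true) = some T ∧ S.Dual T) :
    Matches Γ (K + L) Δ' := by
  have hL : ∀ {k o}, k ∉ L → nm k o ∉ names L := by
    rintro k o hk ⟨l, hl, p, h⟩
    rw [nm_inj] at h
    exact hk (h.1 ▸ hl)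
  constructor
  · intro x
    rw [h1 _ (by rintro ⟨k, _, o, h⟩; simp at h), h.free]
  · intro k hk
    rcases Multiset.mem_add.1 hk with hk | hk
    · rw [h1 _ (hL (hKL k hk)), h1 _ (hL (hKL k hk))]; exact h.dual k hk
    · exact h2 k hk
  · intro k hk o
    rw [Multiset.mem_add, not_or] at hk
    rw [h1 _ (hL hk.2), h.fresh k hk.1]

end Matches

namespace Src

variable {Γ : Ctx} {S₀ : Mix.Proc} {N : ℕ} {K L : Multiset ℕ} {s s' : Multiset AProc}

/-- Flattening one thread of a configuration. -/
theorem typed_flat {Δ : Ctx} {A : AProc} {r t : Multiset AProc} (hΔ : TConf Δ (A ::ₘ r))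
    (hm : Matches Γ K Δ) (hf : Flat A L t) (hn : (K + L).Nodup) :
    ∃ Δ', TConf Δ' (t + r) ∧ Matches Γ (K + L) Δ' := by
  obtain ⟨_, nL, hd⟩ := Multiset.nodup_add.1 hn
  obtain ⟨Δ', h1, h2, h3⟩ := hΔ.flat hf nL fun k hk o =>
    hm.fresh k (fun hK => Multiset.disjoint_left.1 hd hK hk) o
  exact ⟨Δ', h1, hm.add h2 (fun k hK => Multiset.disjoint_left.1 hd hK) h3⟩

theorem typed_red {Δ : Ctx} (hΔ : TConf Δ s) (hm : Matches Γ K Δ) (hs : SRed s L s')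
    (hk : ∀ {c : Ch} {k o}, c.proc ∈ s → c.x = nm k o → k ∈ K) (hn : (K + L).Nodup) :
    ∃ Δ', TConf Δ' s' ∧ Matches Γ (K + L) Δ' := by
  cases hs with
  | cond hv hf =>
    rcases hv with ⟨rfl, rfl⟩ | ⟨rfl, rfl⟩
    · exact typed_flat (hΔ.cond (by simp)).1 hm hf hn
    · exact typed_flat (hΔ.cond (by simp)).2 hm hf hn
  | @com c d k o l v KP KQ sP sQ r i j hc hd hi hj fP fQ =>
    have hkK : k ∈ K := hk (c := c) (by simp) hc
    obtain ⟨S, T, h0, h1, hST⟩ : ∃ S T, Δ c.x = some S ∧ Δ d.x = some T ∧ S.Dual T := by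
      obtain ⟨S, T, h0, h1, hST⟩ := hm.dual k hkK
      rw [hc, hd]
      cases o with
      | false => exact ⟨S, T, h0, h1, hST⟩
      | true => exact ⟨T, S, h1, h0, hST.symm⟩
    obtain ⟨Δ', a1, a2, S', T', a3, a4, a5⟩ := hΔ.com h0 h1 hST (by rw [hc, hd]; simp) hi hj
    have hm' : Matches Γ K Δ' := by
      constructor
      · intro x
        rw [a2 _ (by rw [hc]; simp) (by rw [hd]; simp), hm.free]
      · intro k' hk'
        by_cases hkk : k' = k
        · subst hkk
          cases o with
          | false => exact ⟨S', T', hc ▸ a3, hd ▸ a4, a5⟩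
          | true => exact ⟨T', S', hd ▸ a4, hc ▸ a3, a5.symm⟩
        · rw [a2 _ (by rw [hc]; simp [hkk]) (by rw [hd]; simp [hkk]),
            a2 _ (by rw [hc]; simp [hkk]) (by rw [hd]; simp [hkk])]
          exact hm.dual k' hk'
      · intro k' hk' p
        have hkk : k' ≠ k := by rintro rfl; exact hk' hkK
        rw [a2 _ (by rw [hc]; simp [hkk]) (by rw [hd]; simp [hkk]), hm.fresh k' hk']
    rw [← add_assoc] at hn
    obtain ⟨Δ1, b1, b2⟩ := typed_flat a1 hm' fP (Multiset.nodup_add.1 hn).1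
    rw [Multiset.add_cons] at b1
    obtain ⟨Δ2, c1, c2⟩ := typed_flat b1 b2 fQ hn
    refine ⟨Δ2, ?_, by rwa [add_assoc] at c2⟩
    convert c1 using 1
    abel

/-- The subject of a choice is typed, while ends of channels outside `K` have no type. -/
theorem chan_mem (h : Src Γ S₀ N K s) {c : Ch} {k : ℕ} {o : Bool} (hc : c.proc ∈ s)
    (hx : c.x = nm k o) : k ∈ K := by
  obtain ⟨Δ, hΔ, hm⟩ := h.typed
  obtain ⟨Γ₁, Γ₂, h1, h2⟩ := hΔ.mem hc
  obtain ⟨S, hS, _⟩ := h2.chTy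
  by_contra hk
  have := hm.fresh k hk o
  rw [← hx, h1.of_left hS] at this
  cases this

/-- What remains of a choice after it was used. -/
def aleave : Qual → AProc → AProc → AProc
  | .lin, _, P => P
  | .un, C, P => .par P C

theorem flat_aleave {q : Qual} {C P : AProc} (hC : PCalc.thr C) {t : Multiset AProc}
    (h : Flat P L t) : Flat (aleave q C P) L (t + astay q C) := by
  cases q with
  | lin => simpa [aleave, astay] using h
  | un =>
    have := h.par (.thr hC)
    rw [add_zero] at this
    exact this

theorem supp_choice {F : Set ℕ} {c : Ch} (h : Supp F c.proc) (i : Fin c.n) :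
    (∀ l v, c.pre i = .out l v → v.Supp F ∧ Supp F (c.cont i)) ∧
      ∀ l, c.pre i = .inp l → ∀ v : Val, v.Supp F → Supp F ((c.cont i).subst (Subst.inst v)) := by
  have key : ∀ σ τ : Subst, (∀ x ∈ F, σ x = τ x) → (c.pre i).subst σ = (c.pre i).subst τ ∧
      (c.cont i).subst ((c.pre i).up σ) = (c.cont i).subst ((c.pre i).up τ) := by
    intro σ τ hh
    have := h σ τ hh
    injection this with _ _ _ _ _ h1 h2
    exact ⟨congrFun h1 i, congrFun h2 i⟩
  refine ⟨fun l v hi => ⟨Val.supp_of_subst fun σ τ hh => ?_, fun σ τ hh => ?_⟩, fun l hi v hv => ?_⟩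
  · have := (key σ τ hh).1
    rw [hi] at this
    injection this
  · have := (key σ τ hh).2
    rw [hi] at this
    exact this
  · refine Supp.inst hv fun σ τ hh => ?_
    have := (key σ τ hh).2
    rw [hi] at this
    exact this

theorem erase_leave (q : Qual) (C P : AProc) (τ : Subst) :
    ((aleave q C P).subst τ).erase = Mix.leave q (C.subst τ).erase (P.subst τ).erase := by
  cases q <;> rfl

/-- A communication in a normal form. -/
theorem step_com {c d : Ch} {k : ℕ} {o : Bool} {l : Label} {v : Val} {i : Fin c.n} {j : Fin d.n}
    (hc : c.x = nm k o) (hd : d.x = nm k !o) (hi : c.pre i = .out l v) (hj : d.pre j = .inp l)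
    (r : List AProc) (ρ : Subst) :
    Mix.Step (NF [k] ρ (c.proc :: d.proc :: r)).erase
      (NF [k] ρ (aleave c.q c.proc (c.cont i) ::
        aleave d.q d.proc ((d.cont j).subst (Subst.inst v)) :: r)).erase := by
  obtain ⟨τ, hτ1, hτ2, hτ⟩ := PCalc.NF_one (α := AProc) k o ρ
  refine .struct (hτ _) (.struct (.res (.par_assoc _ _ _)) ?_ (.res (.symm (.par_assoc _ _ _))))
    (.symm (hτ _))
  have ec : (c.proc.subst τ).erase = .choice c.q (.var 0) c.n (fun i => (c.pre i).subst τ)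
      (fun i => ((c.cont i).subst ((c.pre i).up τ)).erase) := by
    show Mix.Proc.choice _ (τ c.x) _ _ _ = _
    rw [hc, hτ1]
  have ed : (d.proc.subst τ).erase = .choice d.q (.var 1) d.n (fun i => (d.pre i).subst τ)
      (fun i => ((d.cont i).subst ((d.pre i).up τ)).erase) := by
    show Mix.Proc.choice _ (τ d.x) _ _ _ = _
    rw [hd, hτ2]
  have ej : (((d.cont j).subst ((d.pre j).up τ)).erase).subst (Subst.inst (v.subst τ)) =
      (((d.cont j).subst (Subst.inst v)).subst τ).erase := by
    rw [← AProc.erase_subst, AProc.subst_subst, AProc.subst_subst, hj, Mix.Pre.up, Subst.up_inst]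
  have ei : ((c.cont i).subst ((c.pre i).up τ)).erase = ((c.cont i).subst τ).erase := by
    rw [hi, Mix.Pre.up]
  have := Mix.Step.com (q₁ := c.q) (q₂ := d.q) (pre₁ := fun i => (c.pre i).subst τ)
    (cont₁ := fun i => ((c.cont i).subst ((c.pre i).up τ)).erase)
    (pre₂ := fun i => (d.pre i).subst τ)
    (cont₂ := fun i => ((d.cont i).subst ((d.pre i).up τ)).erase)
    (R := (parL (r.map (PCalc.subst · τ)) : AProc).erase) i j l (v.subst τ)
    (by show (c.pre i).subst τ = _; rw [hi]; rfl) (by show (d.pre j).subst τ = _; rw [hj]; rfl)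
  rw [← ec, ← ed, ej, ei, ← erase_leave, ← erase_leave] at this
  exact this

/-- The part common to conditionals and communications. The new process witnessing reachability is
the normal form of the reduced configuration, which is typed by `TConf.typed_NF` and flattens back
by `flat_NF_free`. -/
theorem red_aux (h : Src Γ S₀ N K s) {Δ' : Ctx} (hΔ : TConf Δ' s') (hm : Matches Γ (K + L) Δ')
    (hn : (K + L).Nodup) {P Q : AProc} {KP KQ : Multiset ℕ} {sP sQ r : Multiset AProc}
    (fP : Flat P KP sP) (fQ : Flat Q KQ sQ) (hL : L = KP + KQ) (hs' : s' = sP + sQ + r)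
    (hP : Supp (evensBelow N ∪ names K) P) (hQ : Supp (evensBelow N ∪ names K) Q)
    (hr : ∀ A ∈ r, A ∈ s) {sl : List AProc} (hsl : (sl : Multiset AProc) = s)
    (hstep : ∀ Kl : List ℕ, (Kl : Multiset ℕ) = K →
      Mix.Step (NF Kl PCalc.closeNm sl).erase (NF Kl PCalc.closeNm (P :: Q :: r.toList)).erase) :
    Src Γ S₀ N (K + L) s' := by
  subst hL hs'
  have hsupp : ∀ A ∈ sP + sQ + r, Supp (evensBelow N ∪ names (K + (KP + KQ))) A :=
    Supp.flat_two rfl fP fQ hP hQ fun A hA => h.supp A (hr A hA)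
  have hthr : ∀ A ∈ sP + sQ + r, PCalc.thr A := by
    intro A hA
    rcases Multiset.mem_add.1 hA with hA | hA
    · rcases Multiset.mem_add.1 hA with hA | hA
      exacts [fP.thr_mem A hA, fQ.thr_mem A hA]
    · exact h.thr A (hr A hA)
  refine ⟨⟨Δ', hΔ, hm⟩, hn, hthr, hsupp, ?_⟩
  obtain ⟨A, h1, h2, h3⟩ := h.reach
  obtain ⟨K1, hK1⟩ : ∃ K1 : List ℕ, (K1 : Multiset ℕ) = K + (KP + KQ) :=
    ⟨_, Multiset.coe_toList _⟩
  obtain ⟨t1, ht1⟩ : ∃ t1 : List AProc, (t1 : Multiset AProc) = sP + sQ + r :=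
    ⟨_, Multiset.coe_toList _⟩
  have hKl : (K.toList : Multiset ℕ) = K := Multiset.coe_toList _
  refine ⟨NF K1 PCalc.closeNm t1, ?_, ?_, ?_⟩
  · refine .tail h1 (.struct ?_ (hstep K.toList hKl) ?_)
    · exact PCalc.cong_NF (α := AProc) (by rw [hKl, hsl]; exact h3)
        (by rw [← Multiset.coe_nodup, hKl]; exact h.nodup)
    · exact PCalc.NF_flat_two (α := AProc) (evensBelow_subset N) fP fQ (by rw [hKl]; exact hn)
        (by rw [hKl]; exact hP) (by rw [hKl]; exact hQ)
        (fun R hR => by rw [hKl]; exact h.supp R (hr R (by simpa using hR)))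
        (by rw [hKl]; exact hK1) (by rw [Multiset.coe_toList]; exact ht1) _
  · refine TConf.typed_NF (by rw [ht1]; exact hΔ) K1 (Matches.substTy (by rw [hK1]; exact hm))
      (by rw [← Multiset.coe_nodup, hK1]; exact hn) fun k hk => hm.dual k ?_
    rw [← hK1]; simpa using hk
  · rw [← hK1, ← ht1]
    refine PCalc.flat_NF_free (α := AProc) fun A hA => ⟨hthr A (by rw [← ht1]; simpa using hA), ?_⟩
    rw [hK1]
    exact (hsupp A (by rw [← ht1]; simpa using hA)).mono
      (Set.union_subset_union_left _ (evensBelow_subset N))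

theorem red (h : Src Γ S₀ N K s) (hs : SRed s L s') (hn : (K + L).Nodup) :
    Src Γ S₀ N (K + L) s' := by
  obtain ⟨Δ, hΔ, hm⟩ := h.typed
  obtain ⟨Δ', hΔ', hm'⟩ := typed_red hΔ hm hs (fun hc hx => h.chan_mem hc hx) hn
  have hstruct : ∀ {P Q Q' P' : AProc}, PCalc.cong P Q → Mix.Step Q.erase Q'.erase →
      PCalc.cong Q' P' → Mix.Step P.erase P'.erase := fun h1 h2 h3 => .struct h1 h2 h3
  cases hs with
  | @cond v P Q A _ t r hv fA =>
    have hcs : Supp (evensBelow N ∪ names K) A := by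
      have hc := h.supp (.cond v P Q) (by simp)
      intro σ τ hh
      have := hc σ τ hh
      injection this with _ h1 h2
      rcases hv with ⟨_, rfl⟩ | ⟨_, rfl⟩
      exacts [h1, h2]
    refine h.red_aux hΔ' hm' hn fA (Flat.nil (α := AProc)) (by simp) (by simp) hcs
      (fun _ _ _ => rfl) (r := r) (fun B hB => by simp [hB]) (sl := .cond v P Q :: r.toList)
      (by rw [← Multiset.cons_coe, Multiset.coe_toList]) fun Kl hKl => ?_
    have := PCalc.NF_append (α := AProc) (R := fun P Q => Mix.Step P.erase Q.erase) (.res) Kl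
      (L := []) (L' := []) (t := .cond v P Q :: r.toList) (t' := A :: AProc.nil :: r.toList)
      (fun ρ => by
        refine .struct (.refl _) (.par _ (P' := (A.subst ρ).erase) ?_) ?_
        · rcases hv with ⟨rfl, rfl⟩ | ⟨rfl, rfl⟩
          exacts [.cond_tt _ _, .cond_ff _ _]
        · exact .par (.refl _) (.symm (.trans (.par_comm _ _) (.par_nil _)))) PCalc.closeNm
    rw [List.append_nil] at this
    exact this
  | @com c d k o l v KP KQ sP sQ r i j hc hd hi hj fP fQ =>
    have hcs := h.supp c.proc (by simp)
    have hds := h.supp d.proc (by simp)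
    have hP := (supp_choice hcs i).1 l v hi
    have hQ := (supp_choice hds j).2 l hj v hP.1
    have hk : k ∈ K := h.chan_mem (c := c) (by simp) hc
    refine h.red_aux hΔ' hm' hn (flat_aleave (q := c.q) (C := c.proc) trivial fP)
      (flat_aleave (q := d.q) (C := d.proc) trivial fQ) rfl (r := r) (by abel) ?_ ?_
      (fun B hB => by simp [hB]) (sl := c.proc :: d.proc :: r.toList)
      (by rw [← Multiset.cons_coe, ← Multiset.cons_coe, Multiset.coe_toList]) fun Kl hKl => ?_
    · cases c.q with
      | lin => exact hP.2
      | un => exact fun σ τ hh => congrArg₂ AProc.par (hP.2 σ τ hh) (hcs σ τ hh)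
    · cases d.q with
      | lin => exact hQ
      | un => exact fun σ τ hh => congrArg₂ AProc.par (hQ σ τ hh) (hds σ τ hh)
    · exact PCalc.NF_lift (α := AProc) (R := fun P Q => Mix.Step P.erase Q.erase) (.res) hstruct
        (by rw [← Multiset.mem_coe, hKl]; exact hk)
        (by rw [← Multiset.coe_nodup, hKl]; exact h.nodup)
        (fun ρ => step_com hc hd hi hj _ ρ) _

/-- The initial configuration. -/
theorem init {A : AProc} (hA : ATyped Γ A) (X : Finset ℕ) : ∃ N K s, Src Γ A.erase N K s ∧
    Flat (A.subst freeNm) K s ∧ ∀ k ∈ K, k ∉ X := by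
  obtain ⟨N, hN⟩ := AProc.exists_supp A
  obtain ⟨K, s, h1, h2, h3⟩ := AProc.exists_flat A freeNm X
  obtain ⟨Δ₀, e1, e2⟩ : ∃ Δ₀ : Ctx, (∀ x, Δ₀ (2 * x) = Γ x) ∧ ∀ k o, Δ₀ (nm k o) = none := by
    classical
    refine ⟨fun y => if y % 2 = 0 then Γ (y / 2) else none, fun x => by simp, fun k o => ?_⟩
    refine if_neg ?_
    unfold nm; split_ifs <;> omega
  have hs : SubstTy Δ₀ freeNm Γ := by
    constructor
    · exact fun x T hx _ => .inr (.inr (.inr ⟨2 * x, T, rfl, by rw [e1, hx], .rfl⟩))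
    · refine fun x T hx _ => ⟨2 * x, T, rfl, by rw [e1, hx], .rfl, fun x' _ h' => ?_⟩
      have : 2 * x' = 2 * x := by injection h'
      omega
    · intro y S hy _
      rcases even_or_nm y with ⟨x, rfl⟩ | ⟨k, o, rfl⟩
      · exact ⟨x, by rw [← e1, hy]; simp, rfl⟩
      · rw [e2] at hy; cases hy
  -- The empty rest of the configuration must be typed in an unrestricted context, for which the
  -- shared entries of `Δ₀` serve.
  have hu : Ctx.Split Δ₀ Δ₀ fun x => (Δ₀ x).bind Ty.shared := by
    intro x
    show Ctx.SplitAt (Δ₀ x) (Δ₀ x) ((Δ₀ x).bind Ty.shared)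
    cases Δ₀ x with
    | none => exact .none
    | some T => exact T.split_shared
  have hm : Matches Γ 0 Δ₀ := ⟨e1, by simp, fun k _ o => e2 k o⟩
  have hc : TConf Δ₀ (A.subst freeNm ::ₘ 0) := by
    refine .cons hu (hA.subst hs) (.nil fun x T hT => ?_)
    obtain ⟨S, _, h⟩ := Option.bind_eq_some_iff.1 hT
    obtain ⟨rfl, h⟩ := Ty.shared_eq_some h
    exact h
  obtain ⟨Δ, c1, c2⟩ := typed_flat hc hm h1 (by rwa [zero_add])
  rw [zero_add] at c2
  rw [add_zero] at c1
  refine ⟨N, K, s, ⟨⟨Δ, c1, c2⟩, h2, h1.thr_mem, ?_, A, .refl, hA, h1⟩, h1, h3⟩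
  refine Supp.flat (α := AProc) h1 fun σ τ hh => ?_
  show (A.subst freeNm).subst σ = (A.subst freeNm).subst τ
  rw [AProc.subst_subst, AProc.subst_subst]
  exact hN _ _ fun x hx => hh _ ⟨x, hx, rfl⟩

end Src

end MixedSessions

namespace MixedSessions

open PCalc (Flat)

/-! ### The encoding and substitution -/

namespace Encoding

open CMV (Lab)

theorem parList_subst (l : List CMV.Proc) (σ : Subst) :
    (parList l).subst σ = parList (l.map (·.subst σ)) := by
  induction l with
  | nil => rfl
  | cons P l ih => simp [parList, CMV.Proc.subst, ih]

theorem ndChoice_subst {n : ℕ} (P : Fin n → CMV.Proc) (σ : Subst) :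
    (ndChoice P).subst σ = ndChoice fun i => (P i).subst σ := by
  have h : ∀ i, ((P i).subst (Subst.shift 2)).subst σ.up.up = ((P i).subst σ).subst (Subst.shift 2) := by
    intro i
    rw [CMV.Proc.subst_subst, CMV.Proc.subst_subst, Subst.shift_two_comp_up]
  unfold ndChoice
  simp only [CMV.Proc.subst, parList_subst, List.map_ofFn, h]
  rfl

/-- Nondeterministic choice over the elements of a list. -/
def ndList {ι : Type} (l : List ι) (f : ι → CMV.Proc) : CMV.Proc :=
  ndChoice fun j : Fin l.length => f (l.get j)

theorem ndList_subst {ι : Type} (l : List ι) (f : ι → CMV.Proc) (σ : Subst) :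
    (ndList l f).subst σ = ndList l fun i => (f i).subst σ :=
  ndChoice_subst _ _

theorem tag_dual_injective {l : List Key} (h : l.Nodup) :
    Function.Injective fun j : Fin l.length => Lab.tag (l.get j).dual := by
  intro i j hij
  have h1 : Key.dual (l.get i) = Key.dual (l.get j) := by simpa using hij
  have h2 := congrArg Key.dual h1
  rw [Key.dual_dual, Key.dual_dual] at h2
  exact List.nodup_iff_injective_get.1 h h2

/-- The branching offering the duals of the keys in a list. -/
def branList (y : Val) (l : List Key) (h : l.Nodup) (f : Key → CMV.Proc) : CMV.Proc :=
  .bran y l.length ⟨fun j => Lab.tag (l.get j).dual, tag_dual_injective h⟩ fun j => f (l.get j)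

namespace Branches

/-- Apply a substitution to all branches. -/
def subst (B : Branches) (σ : Subst) : Branches where
  n := B.n
  pre i := (B.pre i).subst σ
  cont i := (B.cont i).subst ((B.pre i).up σ)

theorem subst_subst (B : Branches) (σ τ : Subst) : (B.subst σ).subst τ = B.subst (σ.comp τ) := by
  simp [subst, Mix.Pre.subst_subst, Mix.Pre.up_comp, CMV.Proc.subst_subst]

@[simp] theorem subst_var (B : Branches) : B.subst .var = B := by
  simp [subst]

theorem shift_eq (B : Branches) (k : ℕ) : B.shift k = B.subst (Subst.shift k) := rfl

theorem keys_subst (B : Branches) (σ : Subst) : (B.subst σ).keys = B.keys := by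
  simp [keys, subst]

theorem group_subst (B : Branches) (σ : Subst) (a : Key) : (B.subst σ).group a = B.group a := by
  simp [group, subst]

theorem keys_nodup (B : Branches) : B.keys.Nodup := List.nodup_dedup _

theorem mem_keys {B : Branches} {a : Key} : a ∈ B.keys ↔ ∃ i, (B.pre i).key = a := by
  simp [keys, List.mem_ofFn]

theorem mem_group {B : Branches} {a : Key} {i : Fin B.n} : i ∈ B.group a ↔ (B.pre i).key = a := by
  simp [group]

theorem comm_subst (B : Branches) (y : Val) (i : Fin B.n) (σ : Subst) :
    (B.comm y i).subst σ = (B.subst σ).comm (y.subst σ) i := by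
  unfold comm subst
  cases h : B.pre i <;> simp [h, CMV.Proc.subst, Mix.Pre.subst, Mix.Pre.up]

/-- As a choice over a list rather than over `Fin` of its length, it allows the list of branches to
be rewritten without transporting indices. `branList` does the same for offers. -/
theorem deliver_eq (B : Branches) (y : Val) (a : Key) :
    B.deliver y a = ndList (B.group a) (B.comm y) := rfl

theorem deliver_subst (B : Branches) (y : Val) (a : Key) (σ : Subst) :
    (B.deliver y a).subst σ = (B.subst σ).deliver (y.subst σ) a := by
  rw [deliver_eq, deliver_eq, ndList_subst, group_subst]
  simp only [comm_subst]
  rfl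

theorem offer_eq (B : Branches) (y : Val) :
    B.offer y = branList y B.keys B.keys_nodup (B.deliver y) := rfl

theorem branList_congr (y : Val) {l l' : List Key} (h : l.Nodup) (h' : l'.Nodup)
    (f : Key → CMV.Proc) (e : l = l') : branList y l h f = branList y l' h' f := by
  subst e; rfl

theorem offer_subst (B : Branches) (y : Val) (σ : Subst) :
    (B.offer y).subst σ = (B.subst σ).offer (y.subst σ) := by
  rw [offer_eq, offer_eq, branList_congr _ _ B.keys_nodup _ (B.keys_subst σ)]
  unfold branList
  simp only [CMV.Proc.subst, deliver_subst]

theorem linInt_eq (B : Branches) (x : Val) :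
    B.linInt x = ndList B.keys fun a => .sel x (.tag a) (B.deliver x a) := rfl

theorem linInt_subst (B : Branches) (x : Val) (σ : Subst) :
    (B.linInt x).subst σ = (B.subst σ).linInt (x.subst σ) := by
  rw [linInt_eq, linInt_eq, ndList_subst, keys_subst]
  simp only [CMV.Proc.subst, deliver_subst]

/-- One option of an unrestricted internal choice. -/
def unOpt (B : Branches) (x : Val) (a : Key) : CMV.Proc :=
  .res (.out (x.subst (Subst.shift 2)) (.var 0)
    (.sel (.var 1) (.tag a) ((B.shift 2).deliver (.var 1) a)))

theorem unInt_eq (B : Branches) (x : Val) : B.unInt x = ndList B.keys (B.unOpt x) := rfl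

theorem unOpt_subst (B : Branches) (x : Val) (a : Key) (σ : Subst) :
    (B.unOpt x a).subst σ = (B.subst σ).unOpt (x.subst σ) a := by
  unfold unOpt
  simp only [CMV.Proc.subst, deliver_subst, shift_eq, subst_subst, Val.subst_subst,
    Subst.shift_two_comp_up]
  rfl

theorem unInt_subst (B : Branches) (x : Val) (σ : Subst) :
    (B.unInt x).subst σ = (B.subst σ).unInt (x.subst σ) := by
  rw [unInt_eq, unInt_eq, ndList_subst, keys_subst]
  simp only [unOpt_subst]

theorem unExt_subst (B : Branches) (q : Qual) (x : Val) (σ : Subst) :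
    (B.unExt q x).subst σ = (B.subst σ).unExt q (x.subst σ) := by
  unfold unExt
  simp only [CMV.Proc.subst, offer_subst, shift_eq, subst_subst, Subst.shift_comp_up]
  rfl

theorem rearm_subst (B : Branches) {u u' : ℕ} {σ : Subst} (h : σ u = .var u') :
    (B.rearm u).subst σ = (B.subst σ).rearm u' := by
  have h' : σ.up (u + 1) = .var (u' + 1) := by
    show (σ u).subst _ = _
    rw [h]; rfl
  unfold rearm subst
  congr 1
  funext i
  simp only
  cases hi : B.pre i <;>
    simp [CMV.Proc.subst, Mix.Pre.subst, Mix.Pre.up, Val.subst, h, h']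

end Branches

theorem encLin_subst (w : View) (x : Val) (B : Branches) (σ : Subst) :
    (encLin w x B).subst σ = encLin w (x.subst σ) (B.subst σ) := by
  cases w
  exacts [B.linInt_subst x σ, B.offer_subst x σ]

theorem encUn_subst (w : View) (q : Qual) (x : Val) (B : Branches) (σ : Subst) :
    (encUn w q x B).subst σ = encUn w q (x.subst σ) (B.subst σ) := by
  have e : (Subst.shift 3).comp σ.up.up.up = σ.comp (Subst.shift 3) := by
    funext y
    show (((σ y).subst _).subst _).subst _ = (σ y).subst _
    rw [Val.subst_subst, Val.subst_subst]; rfl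
  cases w with
  | ext => exact B.unExt_subst q x σ
  | int =>
    cases q with
    | lin => exact B.unInt_subst x σ
    | un =>
      have hr : ∀ B : Branches, (B.rearm 1).subst σ.up.up.up = (B.subst σ.up.up.up).rearm 1 :=
        fun B => B.rearm_subst rfl
      simp only [encUn, CMV.Proc.subst, Branches.unInt_subst, Val.subst_subst, hr,
        Branches.shift_eq, Branches.subst_subst, e]
      rfl

end Encoding

/-- All auxiliary channels of the encoding are bound, so a substitution reaches only subjects,
payloads and continuations. The annotations are not affected. -/
theorem AProc.enc_subst (A : AProc) (σ : Subst) : A.enc.subst σ = (A.subst σ).enc := by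
  induction A generalizing σ with
  | choice lu w q x n pre cont ih =>
    have e : Encoding.Branches.subst ⟨n, pre, fun i => (cont i).enc⟩ σ =
        ⟨n, fun i => (pre i).subst σ, fun i => ((cont i).subst ((pre i).up σ)).enc⟩ := by
      simp [Encoding.Branches.subst, ih]
    cases lu with
    | lin => simp only [AProc.enc, AProc.subst, Encoding.encLin_subst, e]
    | un => simp only [AProc.enc, AProc.subst, Encoding.encUn_subst, e]
  | par P Q ih1 ih2 => simp [AProc.enc, AProc.subst, CMV.Proc.subst, ih1, ih2]
  | res P ih => simp [AProc.enc, AProc.subst, CMV.Proc.subst, ih]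
  | cond v P Q ih1 ih2 => simp [AProc.enc, AProc.subst, CMV.Proc.subst, ih1, ih2]
  | nil => rfl

/-! ### Items -/

/-- An end of a channel. -/
abbrev Port : Type := ℕ × Bool

/-- The name of an end of a channel. -/
abbrev Port.nm (p : Port) : ℕ := MixedSessions.nm p.1 p.2

/-- The other end of the channel. -/
abbrev Port.flip (p : Port) : Port := (p.1, !p.2)

namespace CMV

open Encoding

/-- The threads of a nondeterministic choice. -/
def ndT {ι : Type} (p : Port) (l : List ι) (f : ι → Proc) : Multiset Proc :=
  .bran (.var p.nm) l.length (idxLab l.length) (fun j => f (l.get j)) ::ₘ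
    (List.ofFn fun i : Fin l.length => Proc.sel (.var p.flip.nm) (.idx i) .nil : Multiset Proc)

theorem flat_parList {l : List Proc} (h : ∀ P ∈ l, P.Thr) {K : Multiset ℕ} {t : Multiset Proc} :
    Flat (parList l) K t ↔ K = 0 ∧ t = l := by
  induction l generalizing K t with
  | nil => exact flat_nil_iff
  | cons P l ih =>
    have ih := fun {K t} => @ih (fun Q hQ => h Q (by simp [hQ])) K t
    have hP := fun {K t} => @flat_thr_iff P (h P (by simp)) K t
    simp only [parList, flat_par_iff, ih, hP]
    constructor
    · rintro ⟨_, _, _, _, ⟨rfl, rfl⟩, ⟨rfl, rfl⟩, rfl, rfl⟩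
      exact ⟨rfl, by simp⟩
    · rintro ⟨rfl, rfl⟩
      exact ⟨_, _, _, _, ⟨rfl, rfl⟩, ⟨rfl, rfl⟩, rfl, by simp⟩

/-- Opening the private channel undoes the weakening of the options; the only freedom left is the
name and the orientation of that channel. -/
theorem flat_ndList {ι : Type} {l : List ι} {f : ι → Proc} {K : Multiset ℕ} {t : Multiset Proc} :
    Flat (ndList l f) K t ↔ ∃ p : Port, K = {p.1} ∧ t = ndT p l f := by
  have key : ∀ k o L, Flat ((Proc.par (.bran (.var 0) l.length (idxLab l.length)
      (fun i => (f (l.get i)).subst (Subst.shift 2)))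
      (parList (List.ofFn fun i : Fin l.length => .sel (.var 1) (.idx i) .nil))).subst
        (Subst.opn (nm k o) (nm k !o))) L t ↔ L = 0 ∧ t = ndT (k, o) l f := by
    intro k o L
    have e : ∀ i : Fin l.length, ((f (l.get i)).subst (Subst.shift 2)).subst
        (Subst.opn (nm k o) (nm k !o)) = f (l.get i) := by
      intro i
      rw [Proc.subst_subst, Subst.shift_two_opn, Proc.subst_var]
    simp only [Proc.subst, parList_subst, List.map_ofFn, e]
    rw [flat_par_iff]
    simp only [flat_thr_iff (P := .bran _ _ _ _) trivial]
    rw [show ((fun x : Proc => x.subst (Subst.opn (nm k o) (nm k !o))) ∘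
      fun i : Fin l.length => Proc.sel (.var 1) (.idx i) .nil) =
      fun i : Fin l.length => Proc.sel (.var (nm k !o)) (.idx i) .nil from rfl]
    simp only [flat_parList (l := List.ofFn fun i : Fin l.length => Proc.sel (.var (nm k !o)) (.idx i) .nil)
      (by intro P hP; obtain ⟨i, rfl⟩ := List.mem_ofFn.1 hP; trivial)]
    constructor
    · rintro ⟨_, _, _, _, ⟨rfl, rfl⟩, ⟨rfl, rfl⟩, rfl, rfl⟩
      exact ⟨rfl, rfl⟩
    · rintro ⟨rfl, rfl⟩
      exact ⟨_, _, _, _, ⟨rfl, rfl⟩, ⟨rfl, rfl⟩, rfl, rfl⟩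
  rw [show ndList l f = Proc.res _ from rfl, flat_res_iff]
  constructor
  · rintro ⟨k, o, L, h1, rfl⟩
    obtain ⟨rfl, rfl⟩ := (key k o L).1 h1
    exact ⟨(k, o), rfl, rfl⟩
  · rintro ⟨⟨k, o⟩, rfl, rfl⟩
    exact ⟨k, o, 0, (key k o 0).2 ⟨rfl, rfl⟩, rfl⟩

/-- Here `p` is the end that the internal choice keeps, index `1` under the binder, and `p.flip` the
end that it sends. -/
theorem flat_unOpt {B : Branches} {x : ℕ} {a : Key} {K : Multiset ℕ} {t : Multiset Proc} :
    Flat (B.unOpt (.var x) a) K t ↔ ∃ p : Port, K = {p.1} ∧ t = {.out (.var x) (.var p.flip.nm)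
      (.sel (.var p.nm) (.tag a) (B.deliver (.var p.nm) a))} := by
  have key : ∀ k o, (Proc.out ((Val.var x).subst (Subst.shift 2)) (.var 0)
      (.sel (.var 1) (.tag a) ((B.shift 2).deliver (.var 1) a))).subst
        (Subst.opn (nm k !o) (nm k o)) = .out (.var x) (.var (nm k !o))
      (.sel (.var (nm k o)) (.tag a) (B.deliver (.var (nm k o)) a)) := by
    intro k o
    simp only [Proc.subst, Branches.deliver_subst, Branches.shift_eq, Branches.subst_subst,
      Subst.shift_two_opn, Branches.subst_var]
    rfl
  unfold Branches.unOpt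
  rw [flat_res_iff]
  constructor
  · rintro ⟨k, o, L, h1, rfl⟩
    have := key k (!o)
    rw [Bool.not_not] at this
    rw [this, flat_thr_iff (by exact trivial)] at h1
    obtain ⟨rfl, rfl⟩ := h1
    exact ⟨(k, !o), rfl, by simp⟩
  · rintro ⟨⟨k, o⟩, rfl, rfl⟩
    refine ⟨k, !o, 0, ?_, rfl⟩
    rw [Bool.not_not, key, flat_thr_iff (by exact trivial)]
    exact ⟨rfl, rfl⟩

end CMV

/-! ### Intermediate states of the encoding of choices -/

namespace Ch

open Encoding CMV

/-- The branches of a choice, with translated continuations. -/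
def br (c : Ch) : Branches := ⟨c.n, c.pre, fun i => (c.cont i).enc⟩

/-- The branches of a choice, within the loop that is restarted at `u` if there is one. -/
def eff (c : Ch) (lp : Option Port) : Branches where
  n := c.n
  pre := c.pre
  cont i := match lp with
    | none => (c.cont i).enc
    | some u => (c.br.rearm u.nm).cont i

theorem eff_none (c : Ch) : c.eff none = c.br := rfl

theorem eff_some (c : Ch) (u : Port) : c.eff (some u) = c.br.rearm u.nm := rfl

theorem keys_eff (c : Ch) (lp : Option Port) : (c.eff lp).keys = c.br.keys := rfl

/-- The replicated input of the loop of an unrestricted internal choice. -/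
def loop (c : Ch) (u : Port) : Proc :=
  .inp .un (.var u.flip.nm) (((c.br.shift 1).rearm (u.nm + 1)).unInt (.var (c.x + 1)))

/-- The loop, if there is one. -/
def loopT (c : Ch) : Option Port → Multiset Proc
  | none => 0
  | some u => {c.loop u}

/-- What follows once the key `a` has been selected. -/
def opt (c : Ch) (lp : Option Port) (a : Key) : Proc :=
  match c.lu with
  | .lin => .sel (.var c.x) (.tag a) (c.br.deliver (.var c.x) a)
  | .un => (c.eff lp).unOpt (.var c.x) a

end Ch

/-- The channel of a loop, if there is one. -/
def lown : Option Port → Multiset ℕ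
  | none => 0
  | some u => {u.1}

/-- One of two partners that are about to transmit: it is still to be decided which of the
branches is taken, or this is decided. -/
inductive Side (n : ℕ)
  | nd (p : Port)
  | chosen (i : Fin n)

/-- The states of the encoding of one or two choices. -/
inductive Item
  | plain (A : AProc)
  | idle (c : Ch) (u : Port)
  | nd (c : Ch) (lp : Option Port) (p : Port)
  | lcommit (c : Ch) (a : Key)
  | ucommit (c : Ch) (lp : Option Port) (a : Key) (pc : Port)
  | presel (c d : Ch) (lp : Option Port) (a : Key) (pc : Port)
  | flight (c d : Ch) (lp : Option Port) (a : Key) (pc : Port) (s : Side c.n) (s' : Side d.n)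

/-- The channel used by a side. -/
def Side.own {n : ℕ} : Side n → Multiset ℕ
  | .nd p => {p.1}
  | .chosen _ => 0

/-- The threads of a side. -/
def Side.tgt (B : Encoding.Branches) (y : Val) (a : Key) : Side B.n → Multiset CMV.Proc
  | .nd p => CMV.ndT p (B.group a) (B.comm y)
  | .chosen i => {B.comm y i}

/-- A choice is represented by its partner only if it does not persist. -/
def Ch.once (d : Ch) : Multiset AProc :=
  match d.q with
  | .lin => {d.proc}
  | .un => 0

/-- A choice that persists. -/
def Ch.kept (d : Ch) : Multiset AProc := astay d.q d.proc

/-- The channel `k` if it belongs to the state of a choice. -/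
def Ch.chan (c : Ch) (k : ℕ) : Multiset ℕ :=
  match c.lu with
  | .lin => 0
  | .un => {k}

namespace Item

/-- The choices that are represented. -/
def src : Item → Multiset AProc
  | .plain A => {A}
  | .idle c _ => {c.proc}
  | .nd c _ _ => {c.proc}
  | .lcommit c _ => {c.proc}
  | .ucommit c _ _ _ => {c.proc}
  | .presel c d _ _ _ => c.proc ::ₘ d.once
  | .flight c d _ _ _ _ _ => c.proc ::ₘ d.once

/-- The channels that belong to the state. -/
def own : Item → Multiset ℕ
  | .plain _ => 0
  | .idle _ u => {u.1}
  | .nd _ lp p => p.1 ::ₘ lown lp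
  | .lcommit _ _ => 0
  | .ucommit _ lp _ pc => pc.1 ::ₘ lown lp
  | .presel _ _ lp _ pc => pc.1 ::ₘ lown lp
  | .flight c _ lp _ pc s s' => c.chan pc.1 + (s.own + s'.own + lown lp)

/-- The threads of the state. -/
def tgt : Item → Multiset CMV.Proc
  | .plain A => {A.enc}
  | .idle c u => .out (.var u.nm) .unit .nil ::ₘ {c.loop u}
  | .nd c lp p => CMV.ndT p c.br.keys (c.opt lp) + c.loopT lp
  | .lcommit c a => {.sel (.var c.x) (.tag a) (c.br.deliver (.var c.x) a)}
  | .ucommit c lp a pc => .out (.var c.x) (.var pc.flip.nm)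
      (.sel (.var pc.nm) (.tag a) ((c.eff lp).deliver (.var pc.nm) a)) ::ₘ c.loopT lp
  | .presel c d lp a pc => .sel (.var pc.nm) (.tag a) ((c.eff lp).deliver (.var pc.nm) a) ::ₘ
      d.br.offer (.var pc.flip.nm) ::ₘ c.loopT lp
  | .flight c d lp a pc s s' => Side.tgt (c.eff lp) (.var pc.nm) a s +
      (Side.tgt d.br (.var pc.flip.nm) a.dual s' + c.loopT lp)

/-- The states of a process that was just translated. -/
def Init : Item → Prop
  | .plain _ => True
  | .idle _ _ => True
  | .nd _ lp _ => lp = none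
  | _ => False

end Item

/-- There is a loop exactly for unrestricted processes on unrestricted channels. -/
def Ch.LpOK (c : Ch) : Option Port → Prop
  | none => c.q = .lin
  | some _ => c.lu = .un ∧ c.q = .un

/-- A chosen branch has the right key. -/
def Side.wf {n : ℕ} (pre : Fin n → Mix.Pre) (a : Key) : Side n → Prop
  | .nd _ => True
  | .chosen i => (pre i).key = a

/-- `c` and `d` are an internal and an external choice on the two ends of a channel. -/
structure Opposed (c d : Ch) : Prop where
  int : c.w = .int
  ext : d.w = .ext
  lu : c.lu = d.lu
  chan : ∃ p : Port, c.x = p.nm ∧ d.x = p.flip.nm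

/-- Well-formed states. -/
def Item.wf : Item → Prop
  | .plain A => (∃ v P Q, A = .cond v P Q) ∨ ∃ c : Ch, A = c.proc ∧ c.w = .ext
  | .idle c _ => c.w = .int ∧ c.lu = .un ∧ c.q = .un
  | .nd c lp _ => c.w = .int ∧ c.LpOK lp
  | .lcommit c a => c.w = .int ∧ c.q = .lin ∧ c.lu = .lin ∧ a ∈ c.br.keys
  | .ucommit c lp a _ => c.w = .int ∧ c.LpOK lp ∧ c.lu = .un ∧ a ∈ c.br.keys
  | .presel c d lp a _ => Opposed c d ∧ c.LpOK lp ∧ c.lu = .un ∧ a ∈ c.br.keys ∧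
      a.dual ∈ d.br.keys
  | .flight c d lp a pc s s' => Opposed c d ∧ c.LpOK lp ∧ a ∈ c.br.keys ∧
      a.dual ∈ d.br.keys ∧ s.wf c.pre a ∧ s'.wf d.pre a.dual ∧
      (c.lu = .lin → d.q = .lin ∧ c.x = pc.nm ∧ d.x = pc.flip.nm)

/-- The choices on which a state depends. -/
def Item.need : Item → Multiset AProc
  | .presel _ d _ _ _ => d.kept
  | .flight _ d _ _ _ _ _ => d.kept
  | _ => 0

/-- The choices represented by a configuration. -/
def srcs (D : Multiset Item) : Multiset AProc := (D.map Item.src).sum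

/-- The channels of the states in a configuration. -/
def owns (D : Multiset Item) : Multiset ℕ := (D.map Item.own).sum

/-- The threads of a configuration. -/
def tgts (D : Multiset Item) : Multiset CMV.Proc := (D.map Item.tgt).sum

section
variable (I : Item) (D E : Multiset Item)
@[simp] theorem srcs_zero : srcs 0 = 0 := rfl
@[simp] theorem owns_zero : owns 0 = 0 := rfl
@[simp] theorem tgts_zero : tgts 0 = 0 := rfl
@[simp] theorem srcs_cons : srcs (I ::ₘ D) = I.src + srcs D := by simp [srcs]
@[simp] theorem owns_cons : owns (I ::ₘ D) = I.own + owns D := by simp [owns]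
@[simp] theorem tgts_cons : tgts (I ::ₘ D) = I.tgt + tgts D := by simp [tgts]
@[simp] theorem srcs_singleton : srcs {I} = I.src := by simp [srcs]
@[simp] theorem owns_singleton : owns {I} = I.own := by simp [owns]
@[simp] theorem tgts_singleton : tgts {I} = I.tgt := by simp [tgts]
@[simp] theorem srcs_add : srcs (D + E) = srcs D + srcs E := by simp [srcs]
@[simp] theorem owns_add : owns (D + E) = owns D + owns E := by simp [owns]
@[simp] theorem tgts_add : tgts (D + E) = tgts D + tgts E := by simp [tgts]
end

theorem mem_sum_map {α : Type} {f : Item → Multiset α} {D : Multiset Item} {x : α} :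
    x ∈ (D.map f).sum ↔ ∃ I ∈ D, x ∈ f I := by
  induction D using Multiset.induction_on with
  | empty => simp
  | cons I D ih => simp [ih]

theorem mem_tgts {D : Multiset Item} {Q : CMV.Proc} : Q ∈ tgts D ↔ ∃ I ∈ D, Q ∈ I.tgt := mem_sum_map

theorem mem_srcs {D : Multiset Item} {A : AProc} : A ∈ srcs D ↔ ∃ I ∈ D, A ∈ I.src := mem_sum_map

theorem mem_owns {D : Multiset Item} {k : ℕ} : k ∈ owns D ↔ ∃ I ∈ D, k ∈ I.own := mem_sum_map

theorem Ch.proc_inj {c d : Ch} : c.proc = d.proc ↔ c = d := by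
  refine ⟨fun h => ?_, fun h => h ▸ rfl⟩
  obtain ⟨lu, w, q, x, n, pre, cont⟩ := c
  obtain ⟨lu', w', q', x', n', pre', cont'⟩ := d
  simp only [Ch.proc, AProc.choice.injEq, Val.var.injEq] at h
  obtain ⟨rfl, rfl, rfl, rfl, rfl, h1, h2⟩ := h
  rw [heq_eq_eq] at h1 h2
  rw [h1, h2]

open CMV Encoding in
-- Of the three indices by which the branches are weakened inside the loop, two belong to its
-- channel and vanish on opening; the remaining one is the ignored input.
theorem flat_loop {c : Ch} {K : Multiset ℕ} {t : Multiset CMV.Proc}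
    (h : Flat (encUn .int .un (.var c.x) c.br) K t) :
    ∃ u : Port, K = {u.1} ∧ t = .out (.var u.nm) .unit .nil ::ₘ {c.loop u} := by
  obtain ⟨k, o, L, h1, rfl⟩ := flat_res_iff.1 h
  refine ⟨(k, o), ?_⟩
  have e : (Subst.shift 3).comp (Subst.opn (nm k o) (nm k !o)).up = Subst.shift 1 := by
    funext x; rfl
  have hr : ∀ B : Branches, (B.rearm 1).subst (Subst.opn (nm k o) (nm k !o)).up =
      (B.subst (Subst.opn (nm k o) (nm k !o)).up).rearm (nm k o + 1) := fun B => B.rearm_subst rfl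
  have hl : (Proc.inp .un (.var 1) (((c.br.shift 3).rearm 1).unInt ((Val.var c.x).subst (Subst.shift 3)))).subst
      (Subst.opn (nm k o) (nm k !o)) = c.loop (k, o) := by
    simp only [Ch.loop, Proc.subst, Branches.unInt_subst, hr, Branches.shift_eq,
      Branches.subst_subst, Val.subst_subst, e]
    rfl
  obtain ⟨_, _, _, _, h2, h3, rfl, rfl⟩ := flat_par_iff.1 h1
  obtain ⟨rfl, rfl⟩ := (flat_thr_iff (by exact trivial)).1 h2
  obtain ⟨rfl, rfl⟩ := (flat_thr_iff (by exact trivial)).1 h3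
  refine ⟨rfl, ?_⟩
  rw [← hl]; rfl

/-- Threads that occur in typed configurations. -/
def Closed (A : AProc) : Prop :=
  (∃ v P Q, A = .cond v P Q) ∨ ∃ c : Ch, A = c.proc ∧ (c.lu = .lin → c.q = .lin)

open CMV Encoding in
-- Conditionals and external choices are translated to single threads. Only internal choices start
-- with a restriction, belonging to a nondeterministic choice or, for an unrestricted process, to a
-- loop.
theorem exists_item {A : AProc} (hA : Closed A) {K : Multiset ℕ} {t : Multiset CMV.Proc}
    (h : Flat A.enc K t) : ∃ I : Item, (I.Init ∧ I.wf) ∧ I.src = {A} ∧ I.own = K ∧ I.tgt = t := by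
  rcases hA with ⟨v, P, Q, rfl⟩ | ⟨c, rfl, hq⟩
  · obtain ⟨rfl, rfl⟩ := (flat_thr_iff (by exact trivial)).1 h
    exact ⟨.plain (.cond v P Q), ⟨trivial, .inl ⟨v, P, Q, rfl⟩⟩, rfl, rfl, rfl⟩
  have plain : c.w = .ext → c.proc.enc.Thr →
      ∃ I : Item, (I.Init ∧ I.wf) ∧ I.src = {c.proc} ∧ I.own = K ∧ I.tgt = t := by
    intro hw hthr
    obtain ⟨rfl, rfl⟩ := (flat_thr_iff hthr).1 h
    exact ⟨.plain c.proc, ⟨trivial, .inr ⟨c, rfl, hw⟩⟩, rfl, rfl, rfl⟩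
  have nd : c.w = .int → c.q = .lin → ∀ {p : Port}, K = {p.1} → t = ndT p c.br.keys (c.opt none) →
      ∃ I : Item, (I.Init ∧ I.wf) ∧ I.src = {c.proc} ∧ I.own = K ∧ I.tgt = t := by
    rintro hw hq p rfl rfl
    exact ⟨.nd c none p, ⟨rfl, hw, hq⟩, rfl, rfl, by simp [Item.tgt, Ch.loopT]⟩
  obtain ⟨lu, w, q, x, n, pre, cont⟩ := c
  cases lu with
  | lin =>
    cases w with
    | ext => exact plain rfl trivial
    | int =>
      have h' : Flat (Branches.linInt ⟨n, pre, fun i => (cont i).enc⟩ (.var x)) K t := h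
      rw [Branches.linInt_eq, flat_ndList] at h'
      obtain ⟨p, h1, h2⟩ := h'
      exact nd rfl (hq rfl) h1 h2
  | un =>
    cases w with
    | ext => exact plain rfl trivial
    | int =>
      cases q with
      | lin =>
        have h' : Flat (Branches.unInt ⟨n, pre, fun i => (cont i).enc⟩ (.var x)) K t := h
        rw [Branches.unInt_eq, flat_ndList] at h'
        obtain ⟨p, h1, h2⟩ := h'
        exact nd rfl rfl h1 h2
      | un =>
        obtain ⟨u, h1, h2⟩ := flat_loop (c := ⟨.un, .int, .un, x, n, pre, cont⟩) h
        exact ⟨.idle _ u, ⟨trivial, rfl, rfl, rfl⟩, rfl, h1.symm, h2.symm⟩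

/-- `t` is obtained by translating and flattening the threads `s`. -/
inductive Comb : Multiset AProc → Multiset ℕ → Multiset CMV.Proc → Prop
  | zero : Comb 0 0 0
  | cons {A K t s L u} : Flat A.enc K t → Comb s L u → Comb (A ::ₘ s) (K + L) (t + u)

theorem Comb.add {s s' : Multiset AProc} {L L' : Multiset ℕ} {u u' : Multiset CMV.Proc}
    (h : Comb s L u) (h' : Comb s' L' u') : Comb (s + s') (L + L') (u + u') := by
  induction h with
  | zero => simpa using h'
  | cons hA _ ih =>
    rw [Multiset.cons_add, add_assoc, add_assoc]
    exact .cons hA ih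

theorem Comb.single {A : AProc} {K : Multiset ℕ} {t : Multiset CMV.Proc} (h : Flat A.enc K t) :
    Comb {A} K t := by
  have := Comb.cons h .zero
  simpa using this

theorem Comb.items {s : Multiset AProc} {L : Multiset ℕ} {u : Multiset CMV.Proc} (h : Comb s L u)
    (hs : ∀ A ∈ s, Closed A) : ∃ E : Multiset Item, (∀ I ∈ E, I.Init ∧ I.wf) ∧ srcs E = s ∧
      owns E = L ∧ tgts E = u := by
  induction h with
  | zero => exact ⟨0, by simp, rfl, rfl, rfl⟩
  | cons hA _ ih =>
    obtain ⟨E, h1, rfl, rfl, rfl⟩ := ih fun B hB => hs B (by simp [hB])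
    obtain ⟨I, h2, h3, rfl, rfl⟩ := exists_item (hs _ (by simp)) hA
    refine ⟨I ::ₘ E, ?_, by rw [srcs_cons, h3, Multiset.singleton_add], owns_cons _ _, tgts_cons _ _⟩
    intro J hJ
    rcases Multiset.mem_cons.1 hJ with rfl | hJ
    exacts [h2, h1 J hJ]

open CMV in
-- The encoding is homomorphic on parallel composition and restriction. So flattening an encoded
-- process amounts to flattening the source and then the translation of each of its threads.
theorem flat_enc (A : AProc) : ∀ {σ : Subst} {K : Multiset ℕ} {t : Multiset CMV.Proc},
    Flat (A.subst σ).enc K t → ∃ L s Ks, Flat (A.subst σ) L s ∧ Comb s Ks t ∧ K = L + Ks := by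
  induction A with
  | choice => exact fun {σ K t} h => ⟨0, _, K, .thr trivial, .single h, by simp⟩
  | cond => exact fun {σ K t} h => ⟨0, _, K, .thr trivial, .single h, by simp⟩
  | nil =>
    intro σ K t h
    obtain ⟨rfl, rfl⟩ := flat_nil_iff.1 h
    exact ⟨0, 0, 0, .nil, .zero, rfl⟩
  | par P Q ih1 ih2 =>
    intro σ K t h
    obtain ⟨_, _, _, _, h1, h2, rfl, rfl⟩ := flat_par_iff.1 h
    obtain ⟨L, s, Ks, a1, a2, rfl⟩ := ih1 h1
    obtain ⟨L', s', Ks', b1, b2, rfl⟩ := ih2 h2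
    exact ⟨_, _, _, .par a1 b1, a2.add b2, by abel⟩
  | res P ih =>
    intro σ K t h
    obtain ⟨k, o, L, h1, rfl⟩ := flat_res_iff.1 h
    rw [AProc.enc_subst, AProc.subst_subst] at h1
    obtain ⟨L', s, Ks, a1, a2, rfl⟩ := ih h1
    rw [← AProc.subst_subst] at a1
    exact ⟨k ::ₘ L', s, Ks, Flat.res k o a1, a2, by simp⟩

open CMV in
theorem exists_comb {A : AProc} {L : Multiset ℕ} {s : Multiset AProc} (h : Flat A L s) :
    ∀ X : Finset ℕ, ∃ Ks t, Comb s Ks t ∧ Flat A.enc (L + Ks) t ∧ Ks.Nodup ∧ ∀ k ∈ Ks, k ∉ X := by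
  induction h with
  | nil => exact fun X => ⟨0, 0, .zero, .nil, by simp, by simp⟩
  | @par P Q K L s s' _ _ ih1 ih2 =>
    intro X
    obtain ⟨Ks, t, a1, a2, a3, a4⟩ := ih1 X
    obtain ⟨Ks', t', b1, b2, b3, b4⟩ := ih2 (X ∪ Ks.toFinset)
    refine ⟨Ks + Ks', t + t', a1.add b1, ?_, Multiset.nodup_add.2 ⟨a3, b3, ?_⟩, ?_⟩
    · rw [add_add_add_comm]; exact .par a2 b2
    · exact Multiset.disjoint_left.2 fun hk hk' => b4 _ hk' (by simp [hk])
    · intro k hk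
      rcases Multiset.mem_add.1 hk with hk | hk
      exacts [a4 k hk, fun h => b4 k hk (by simp [h])]
  | @res P K s k o _ ih =>
    intro X
    obtain ⟨Ks, t, a1, a2, a3⟩ := ih X
    refine ⟨Ks, t, a1, ?_, a3⟩
    rw [Multiset.cons_add]
    refine Flat.res (α := Proc) k o ?_
    have : (PCalc.subst P (Subst.opn (nm k o) (nm k !o)) : AProc).enc = P.enc.subst _ :=
      (P.enc_subst _).symm
    rw [this] at a2
    exact a2
  | @thr A hA =>
    intro X
    obtain ⟨K, t, h1, h2, h3⟩ := exists_flat A.enc .var X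
    rw [Proc.subst_var] at h1
    exact ⟨K, t, .single h1, by rwa [zero_add], h2, h3⟩

/-- `A` decomposes into the channels `L` and the initial states `E`. -/
structure Dec (A : AProc) (L : Multiset ℕ) (E : Multiset Item) : Prop where
  src : Flat A L (srcs E)
  tgt : Flat A.enc (L + owns E) (tgts E)
  init : ∀ I ∈ E, I.Init ∧ I.wf

/-- This serves when a given target reduction dictates the flattening of the encoding; `Dec.of_src`
serves when the flattening of the source is prescribed. -/
theorem Dec.of_enc {A : AProc} {K : Multiset ℕ} {t : Multiset CMV.Proc} (h : Flat A.enc K t)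
    (hc : ∀ L s, L ≤ K → Flat A L s → ∀ B ∈ s, Closed B) :
    ∃ L E, Dec A L E ∧ K = L + owns E ∧ t = tgts E := by
  have h' := h
  rw [← A.subst_var] at h'
  obtain ⟨L, s, Ks, h1, h2, rfl⟩ := flat_enc A h'
  rw [A.subst_var] at h1
  obtain ⟨E, h3, rfl, rfl, rfl⟩ := h2.items (hc L s (Multiset.le_add_right _ _) h1)
  exact ⟨L, E, ⟨h1, h, h3⟩, rfl, rfl⟩

theorem Dec.of_src {A : AProc} {L : Multiset ℕ} {s : Multiset AProc} (h : Flat A L s)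
    (hc : ∀ B ∈ s, Closed B) (X : Finset ℕ) :
    ∃ E, Dec A L E ∧ srcs E = s ∧ (owns E).Nodup ∧ ∀ k ∈ owns E, k ∉ X := by
  obtain ⟨Ks, t, h1, h2, h3, h4⟩ := exists_comb h X
  obtain ⟨E, h5, rfl, rfl, rfl⟩ := h1.items hc
  exact ⟨E, ⟨h, h2, h5⟩, rfl, h3, h4⟩

theorem TConf.closed {Δ : Ctx} {s : Multiset AProc} (h : TConf Δ s) (hthr : ∀ A ∈ s, PCalc.thr A)
    {A : AProc} (hA : A ∈ s) : Closed A := by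
  obtain ⟨Γ₁, _, _, h2⟩ := h.mem hA
  have := hthr A hA
  cases A with
  | choice lu w q x n pre cont =>
    obtain ⟨y, rfl⟩ := h2.exists_ch
    refine .inr ⟨⟨lu, w, q, y, n, pre, cont⟩, rfl, ?_⟩
    rintro rfl
    cases h2; rfl
  | cond v P Q => exact .inl ⟨v, P, Q, rfl⟩
  | par => exact this.elim
  | res => exact this.elim
  | nil => exact this.elim

end MixedSessions

namespace MixedSessions

open PCalc (Flat)

/-! ### Transitions between configurations of items -/

/-- Configurations: states, source channels, dead channels and dead threads. -/
structure Cfg where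
  D : Multiset Item
  K : Multiset ℕ
  J : Multiset ℕ
  g : Multiset CMV.Proc

/-- The threads of a configuration. -/
def Cfg.tgt (C : Cfg) : Multiset CMV.Proc := tgts C.D + C.g

/-- The channels of a configuration. -/
def Cfg.chans (C : Cfg) : Multiset ℕ := owns C.D + C.J + C.K

namespace CMV

/-- The selections of a nondeterministic choice with `n` options. -/
def sels (p : Port) (n : ℕ) : Multiset Proc :=
  (List.ofFn fun i : Fin n => Proc.sel (.var p.flip.nm) (.idx i) .nil : List Proc)

theorem mem_sels {p : Port} {n : ℕ} {Q : Proc} :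
    Q ∈ sels p n ↔ ∃ i : Fin n, Q = .sel (.var p.flip.nm) (.idx i) .nil := by
  simp only [sels, Multiset.mem_coe, List.mem_ofFn, eq_comm]

/-- A nondeterministic choice over `l` picks `a` and leaves the selections `g`. -/
def Fired {ι : Type} (p : Port) (l : List ι) (a : ι) (g : Multiset Proc) : Prop :=
  ∃ j : Fin l.length, l.get j = a ∧
    sels p l.length = .sel (.var p.flip.nm) (.idx j) .nil ::ₘ g

theorem exists_fired {ι : Type} (p : Port) {l : List ι} {a : ι} (h : a ∈ l) : ∃ g, Fired p l a g := by
  obtain ⟨j, hj⟩ := List.mem_iff_get.1 h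
  obtain ⟨g, hg⟩ := Multiset.exists_cons_of_mem (mem_sels.2 ⟨j, rfl⟩ :
    Proc.sel (.var p.flip.nm) (.idx j) .nil ∈ sels p l.length)
  exact ⟨g, j, hj, hg⟩

theorem Fired.mem {ι : Type} {p : Port} {l : List ι} {a : ι} {g : Multiset Proc}
    (h : Fired p l a g) : a ∈ l := by
  obtain ⟨j, rfl, _⟩ := h
  exact List.get_mem l j

theorem Fired.dead {ι : Type} {p : Port} {l : List ι} {a : ι} {g : Multiset Proc}
    (h : Fired p l a g) : ∀ Q ∈ g, ∃ i, Q = .sel (.var p.flip.nm) (.idx i) .nil := by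
  obtain ⟨j, rfl, h⟩ := h
  intro Q hQ
  obtain ⟨i, hi⟩ := mem_sels.1 (h ▸ Multiset.mem_cons_of_mem hQ : Q ∈ sels p l.length)
  exact ⟨i, hi⟩

/-- The shapes of both configurations are hypotheses, so that applying the rule leaves mere
rearrangements of multisets. -/
theorem MStep.com_of {X : Finset ℕ} {p p' : Port} {q v P Q r KP KQ tP tQ t t'} (hp : p' = p.flip)
    (hP : Flat P KP tP) (hQ : Flat (Q.subst (Subst.inst v)) KQ tQ) (hn : (KP + KQ).Nodup)
    (hX : ∀ k ∈ KP + KQ, k ∉ X) (ht : t = .out (.var p.nm) v P ::ₘ .inp q (.var p'.nm) Q ::ₘ r)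
    (ht' : t' = tP + (tQ + stay q (.inp q (.var p'.nm) Q)) + r) : MStep X t t' := by
  subst hp ht ht'
  exact .com hP hQ hn hX

theorem MStep.sel_of {X : Finset ℕ} {p p' : Port} {n lab P Q r KP KQ tP tQ t t'} (j : Fin n)
    (hp : p' = p.flip)
    (hP : Flat P KP tP) (hQ : Flat (Q j) KQ tQ) (hn : (KP + KQ).Nodup)
    (hX : ∀ k ∈ KP + KQ, k ∉ X) {l : Lab} (hl : l = lab j)
    (ht : t = .sel (.var p.nm) l P ::ₘ .bran (.var p'.nm) n lab Q ::ₘ r)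
    (ht' : t' = tP + tQ + r) : MStep X t t' := by
  subst hp ht ht' hl
  exact .sel j hP hQ hn hX

theorem _root_.MixedSessions.Port.flip_flip (p : Port) : p.flip.flip = p :=
  Prod.ext rfl (Bool.not_not _)

theorem ndT_eq {ι : Type} (p : Port) (l : List ι) (f : ι → Proc) :
    ndT p l f = .bran (.var p.nm) l.length (Encoding.idxLab l.length) (fun j => f (l.get j)) ::ₘ
      sels p l.length := rfl

theorem Fired.mstep {ι : Type} {p : Port} {l : List ι} {f : ι → Proc} {a : ι}
    {g r KQ tQ t t'} {X : Finset ℕ} (h : Fired p l a g) (hf : Flat (f a) KQ tQ) (hn : KQ.Nodup)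
    (hX : ∀ k ∈ KQ, k ∉ X) (ht : t = ndT p l f + r) (ht' : t' = tQ + (g + r)) :
    MStep X t t' := by
  obtain ⟨j, rfl, h⟩ := h
  subst ht ht'
  refine MStep.sel_of (X := X) (p := p.flip) (p' := p) (lab := Encoding.idxLab l.length) (P := .nil)
    (Q := fun j => f (l.get j)) (r := g + r) j p.flip_flip.symm Flat.nil hf (by simpa using hn)
    (by simpa using hX) rfl ?_ (by simp)
  rw [ndT_eq, h, show Encoding.idxLab l.length j = .idx j from rfl]
  simp only [← Multiset.singleton_add]; abel

end CMV

/-- What a loop needs to be started again. -/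
def rearmT : Option Port → Multiset CMV.Proc
  | none => 0
  | some u => {.out (.var u.nm) .unit .nil}

/-- The idle loop, if there is one. -/
def Ch.back (c : Ch) : Option Port → Multiset Item
  | none => 0
  | some u => {.idle c u}

theorem Ch.tgts_back (c : Ch) (lp : Option Port) : tgts (c.back lp) = rearmT lp + c.loopT lp := by
  cases lp <;> simp [back, rearmT, loopT, Item.tgt]

/-- A choice that persists, as a state. -/
def Ch.keep (d : Ch) : Multiset Item :=
  match d.q with
  | .lin => 0
  | .un => {.plain d.proc}

/-- Inside a loop each continuation carries the output that restarts it; flattening splits this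
output off. -/
theorem Ch.flat_cont_out {c : Ch} {lp : Option Port} {i : Fin c.n} {l : Label} {v : Val}
    (hi : c.pre i = .out l v) {K : Multiset ℕ} {t : Multiset CMV.Proc} :
    Flat ((c.eff lp).cont i) K t ↔ ∃ t', Flat (c.cont i).enc K t' ∧ t = rearmT lp + t' := by
  cases lp with
  | none => exact ⟨fun h => ⟨t, h, by simp [rearmT]⟩, by
    rintro ⟨t', h, rfl⟩; rw [rearmT, zero_add]; exact h⟩
  | some u =>
    have e : (c.eff (some u)).cont i = .par (.out (.var u.nm) .unit .nil) (c.cont i).enc := by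
      show (c.br.rearm u.nm).cont i = _
      simp [Encoding.Branches.rearm, br, hi]
    rw [e, CMV.flat_par_iff]
    simp only [CMV.flat_thr_iff (P := .out _ _ _) trivial]
    constructor
    · rintro ⟨_, _, _, _, ⟨rfl, rfl⟩, h, rfl, rfl⟩
      exact ⟨_, by simpa using h, rfl⟩
    · rintro ⟨t', h, rfl⟩
      exact ⟨0, K, _, t', ⟨rfl, rfl⟩, h, by simp, rfl⟩

/-- Below an input the loop channel is shifted by one; instantiating the received value shifts it
back, and again the restarting output splits off. -/
theorem Ch.flat_cont_inp {c : Ch} {lp : Option Port} {i : Fin c.n} {l : Label} {v : Val}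
    (hi : c.pre i = .inp l) {K : Multiset ℕ} {t : Multiset CMV.Proc} :
    Flat (((c.eff lp).cont i).subst (Subst.inst v)) K t ↔
      ∃ t', Flat ((c.cont i).subst (Subst.inst v)).enc K t' ∧ t = rearmT lp + t' := by
  rw [← AProc.enc_subst]
  cases lp with
  | none => exact ⟨fun h => ⟨t, h, by simp [rearmT]⟩, by
    rintro ⟨t', h, rfl⟩; rw [rearmT, zero_add]; exact h⟩
  | some u =>
    have e : ((c.eff (some u)).cont i).subst (Subst.inst v) =
        .par (.out (.var u.nm) .unit .nil) ((c.cont i).enc.subst (Subst.inst v)) := by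
      show ((c.br.rearm u.nm).cont i).subst _ = _
      simp [Encoding.Branches.rearm, br, hi, CMV.Proc.subst, Val.subst, Subst.inst]
    rw [e, CMV.flat_par_iff]
    simp only [CMV.flat_thr_iff (P := .out _ _ _) trivial]
    constructor
    · rintro ⟨_, _, _, _, ⟨rfl, rfl⟩, h, rfl, rfl⟩
      exact ⟨_, by simpa using h, rfl⟩
    · rintro ⟨t', h, rfl⟩
      exact ⟨0, K, _, t', ⟨rfl, rfl⟩, h, by simp, rfl⟩

/-- `A₁` and `A₂` are the continuations of two branches after a communication. -/
inductive Comm : Mix.Pre → Mix.Pre → AProc → AProc → AProc → AProc → Prop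
  | out {l v P Q} : Comm (.out l v) (.inp l) P Q P (Q.subst (Subst.inst v))
  | inp {l v P Q} : Comm (.inp l) (.out l v) P Q (P.subst (Subst.inst v)) Q

theorem Ch.enc_lin {d : Ch} (hl : d.lu = .lin) (hw : d.w = .ext) :
    d.proc.enc = d.br.offer (.var d.x) := by
  obtain ⟨lu, w, q, x, n, pre, cont⟩ := d
  subst hl hw; rfl

theorem Ch.enc_un {d : Ch} (hl : d.lu = .un) (hw : d.w = .ext) :
    d.proc.enc = d.br.unExt d.q (.var d.x) := by
  obtain ⟨lu, w, q, x, n, pre, cont⟩ := d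
  subst hl hw; rfl

theorem Ch.tgts_keep {d : Ch} (hl : d.lu = .un) (hw : d.w = .ext) :
    tgts d.keep = CMV.stay d.q (d.br.unExt d.q (.var d.x)) := by
  unfold keep
  cases hq : d.q
  · rfl
  · simp [CMV.stay, Item.tgt, Ch.enc_un hl hw, hq]

open CMV

/-- Transitions; new channels avoid `X`. -/
inductive Trans (X : Finset ℕ) : Cfg → Cfg → Prop
  | cond {v P Q A r K J g L E} : (v = .tt ∧ A = P ∨ v = .ff ∧ A = Q) → Dec A L E →
      (L + owns E).Nodup → (∀ k ∈ L + owns E, k ∉ X) →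
      Trans X ⟨.plain (.cond v P Q) ::ₘ r, K, J, g⟩ ⟨E + r, K + L, J, g⟩
  | wake {c : Ch} {u p : Port} {r K J g} : p.1 ∉ X →
      Trans X ⟨.idle c u ::ₘ r, K, J, g⟩ ⟨.nd c (some u) p ::ₘ r, K, J, g⟩
  | pickLin {c : Ch} {lp : Option Port} {p : Port} {a g' r K J g} : c.lu = .lin →
      Fired p c.br.keys a g' →
      Trans X ⟨.nd c lp p ::ₘ r, K, J, g⟩ ⟨.lcommit c a ::ₘ r, K, p.1 ::ₘ J, g' + g⟩
  | pickUn {c : Ch} {lp : Option Port} {p pc : Port} {a g' r K J g} : c.lu = .un →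
      Fired p c.br.keys a g' → pc.1 ∉ X →
      Trans X ⟨.nd c lp p ::ₘ r, K, J, g⟩ ⟨.ucommit c lp a pc ::ₘ r, K, p.1 ::ₘ J, g' + g⟩
  | commLin {c d : Ch} {a : Key} {pc p p' : Port} {r K J g} : Opposed c d → c.lu = .lin →
      c.x = pc.nm → d.x = pc.flip.nm → a.dual ∈ d.br.keys → p.1 ∉ X → p'.1 ∉ X → p.1 ≠ p'.1 →
      Trans X ⟨.lcommit c a ::ₘ .plain d.proc ::ₘ r, K, J, g⟩
        ⟨.flight c d none a pc (.nd p) (.nd p') ::ₘ r, K, J, g⟩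
  | commUn {c d : Ch} {lp : Option Port} {a : Key} {pc : Port} {r K J g} : Opposed c d →
      c.lu = .un → a.dual ∈ d.br.keys →
      Trans X ⟨.ucommit c lp a pc ::ₘ .plain d.proc ::ₘ r, K, J, g⟩
        ⟨.presel c d lp a pc ::ₘ (d.keep + r), K, J, g⟩
  | select {c d : Ch} {lp : Option Port} {a : Key} {pc p p' : Port} {r K J g} : c.lu = .un →
      a.dual ∈ d.br.keys → p.1 ∉ X → p'.1 ∉ X → p.1 ≠ p'.1 →
      Trans X ⟨.presel c d lp a pc ::ₘ r, K, J, g⟩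
        ⟨.flight c d lp a pc (.nd p) (.nd p') ::ₘ r, K, J, g⟩
  | left {c d : Ch} {lp : Option Port} {a : Key} {pc p : Port} {s' : Side d.n} {i : Fin c.n}
      {g' r K J g} : Fired p ((c.eff lp).group a) i g' →
      Trans X ⟨.flight c d lp a pc (.nd p) s' ::ₘ r, K, J, g⟩
        ⟨.flight c d lp a pc (.chosen i) s' ::ₘ r, K, p.1 ::ₘ J, g' + g⟩
  | right {c d : Ch} {lp : Option Port} {a : Key} {pc p : Port} {s : Side c.n} {j : Fin d.n}
      {g' r K J g} : Fired p (d.br.group a.dual) j g' →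
      Trans X ⟨.flight c d lp a pc s (.nd p) ::ₘ r, K, J, g⟩
        ⟨.flight c d lp a pc s (.chosen j) ::ₘ r, K, p.1 ::ₘ J, g' + g⟩
  | done {c d : Ch} {lp : Option Port} {a : Key} {pc : Port} {i : Fin c.n} {j : Fin d.n}
      {A₁ A₂ L₁ L₂ E₁ E₂ r K J g} : Opposed c d →
      Comm (c.pre i) (d.pre j) (c.cont i) (d.cont j) A₁ A₂ → Dec A₁ L₁ E₁ → Dec A₂ L₂ E₂ →
      ((L₁ + owns E₁) + (L₂ + owns E₂)).Nodup →
      (∀ k ∈ (L₁ + owns E₁) + (L₂ + owns E₂), k ∉ X) →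
      Trans X ⟨.flight c d lp a pc (.chosen i) (.chosen j) ::ₘ r, K, J, g⟩
        ⟨E₁ + (E₂ + (c.back lp + r)), K + (L₁ + L₂), J, g⟩

theorem flat_deliver {B : Encoding.Branches} {y : Val} {a : Key} (p : Port) :
    Flat (B.deliver y a) {p.1} (ndT p (B.group a) (B.comm y)) := by
  rw [B.deliver_eq]
  exact flat_ndList.2 ⟨p, rfl, rfl⟩

theorem exists_offer_lab {B : Encoding.Branches} {a : Key} (h : a.dual ∈ B.keys) :
    ∃ j : Fin B.keys.length, B.keys.get j = a.dual ∧ B.extLab j = .tag a := by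
  obtain ⟨j, hj⟩ := List.mem_iff_get.1 h
  refine ⟨j, hj, ?_⟩
  show Lab.tag (B.keys.get j).dual = _
  rw [hj, Key.dual_dual]

theorem loop_inst (c : Ch) (u : Port) :
    (((c.br.shift 1).rearm (u.nm + 1)).unInt (.var (c.x + 1))).subst (Subst.inst .unit) =
      Encoding.ndList c.br.keys ((c.eff (some u)).unOpt (.var c.x)) := by
  rw [Encoding.Branches.unInt_subst, Encoding.Branches.rearm_subst (u := u.nm + 1) (u' := u.nm) _ rfl,
    Encoding.Branches.shift_eq, Encoding.Branches.subst_subst]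
  have : (Subst.shift 1).comp (Subst.inst .unit) = .var := by funext x; rfl
  rw [this, Encoding.Branches.subst_var, Encoding.Branches.unInt_eq]
  rfl

/-- Each transition was designed as one target reduction. This direction is used to steer a target
process along the protocol. -/
theorem Trans.mstep {X : Finset ℕ} {C C' : Cfg} (h : Trans X C C') (hw : ∀ I ∈ C.D, I.wf) :
    MStep X C.tgt C'.tgt := by
  cases h with
  | @cond v P Q A r K J g L E hv hA hn hX =>
    simp only [Cfg.tgt, tgts_cons, tgts_add, add_assoc]
    rcases hv with ⟨rfl, rfl⟩ | ⟨rfl, rfl⟩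
    · exact .cond_tt hA.tgt hn hX
    · exact .cond_ff hA.tgt hn hX
  | @wake c u p r K J g hp =>
    have hc : c.w = .int ∧ c.lu = .un ∧ c.q = .un := hw (.idle c u) (by simp)
    have ho : c.opt (some u) = (c.eff (some u)).unOpt (.var c.x) := by
      funext a; simp [Ch.opt, hc.2.1]
    refine MStep.com_of (p := u) (p' := u.flip) (v := .unit) (P := .nil) (q := .un)
      (Q := ((c.br.shift 1).rearm (u.nm + 1)).unInt (.var (c.x + 1))) rfl Flat.nil
      (KQ := {p.1}) (tQ := ndT p c.br.keys ((c.eff (some u)).unOpt (.var c.x))) ?_ (by simp)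
      (by simpa using hp) (r := tgts r + g) ?_ ?_
    · rw [loop_inst]; exact flat_ndList.2 ⟨p, rfl, rfl⟩
    · simp only [Cfg.tgt, tgts_cons, Item.tgt, Ch.loop]; simp only [Multiset.cons_add, Multiset.singleton_add]
    · simp only [Cfg.tgt, tgts_cons, Item.tgt, ho, stay, Ch.loopT, Ch.loop]; abel
  | @pickLin c lp p a g' r K J g hl hf =>
    have ho : c.opt lp a = .sel (.var c.x) (.tag a) (c.br.deliver (.var c.x) a) := by
      simp [Ch.opt, hl]
    have hlp : lp = none := by
      have hc : c.w = .int ∧ c.LpOK lp := hw (.nd c lp p) (by simp)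
      cases lp with
      | none => rfl
      | some u => have := hc.2.1; rw [hl] at this; cases this
    refine hf.mstep (f := c.opt lp) (KQ := 0) (by rw [ho]; exact .thr trivial) (by simp) (by simp)
      (r := c.loopT lp + (tgts r + g)) ?_ ?_
    · simp only [Cfg.tgt, tgts_cons, Item.tgt]; abel
    · subst hlp
      simp only [Cfg.tgt, tgts_cons, Item.tgt, Ch.loopT]; abel
  | @pickUn c lp p pc a g' r K J g hl hf hpc =>
    have ho : c.opt lp a = (c.eff lp).unOpt (.var c.x) a := by simp [Ch.opt, hl]
    refine hf.mstep (f := c.opt lp) (KQ := {pc.1})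
      (by rw [ho]; exact flat_unOpt.2 ⟨pc, rfl, rfl⟩) (by simp)
      (by simpa using hpc) (r := c.loopT lp + (tgts r + g)) ?_ ?_
    · simp only [Cfg.tgt, tgts_cons, Item.tgt]; abel
    · simp only [Cfg.tgt, tgts_cons, Item.tgt]; simp only [← Multiset.singleton_add]; abel
  | @commLin c d a pc p p' r K J g hcd hl hc hd ha hp hp' hpp =>
    obtain ⟨j, hj, hlab⟩ := exists_offer_lab ha
    refine MStep.sel_of (p := pc) (p' := pc.flip) j rfl (flat_deliver (B := c.br) (y := .var pc.nm) (a := a) p)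
      (Q := fun j => d.br.deliver (.var pc.flip.nm) (d.br.keys.get j))
      (by simp only [hj]; exact flat_deliver p') (by simpa using hpp) (by simpa using ⟨hp, hp'⟩)
      (lab := d.br.extLab) (l := .tag a) hlab.symm (r := tgts r + g) ?_ ?_
    · simp only [Cfg.tgt, tgts_cons, Item.tgt, Ch.enc_lin (hcd.lu ▸ hl) hcd.ext, hc, hd,
        Encoding.Branches.offer]; simp only [← Multiset.singleton_add]; abel
    · simp only [Cfg.tgt, tgts_cons, Item.tgt, Side.tgt, Ch.loopT, c.eff_none]; abel
  | @commUn c d lp a pc r K J g hcd hl ha =>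
    obtain ⟨p, hc, hd⟩ := hcd.chan
    have hdl : d.lu = .un := hcd.lu ▸ hl
    have e : ((d.br.shift 1).offer (.var 0)).subst (Subst.inst (.var pc.flip.nm)) =
        d.br.offer (.var pc.flip.nm) := by
      rw [Encoding.Branches.offer_subst, Encoding.Branches.shift_eq, Encoding.Branches.subst_subst]
      have : (Subst.shift 1).comp (Subst.inst (.var pc.flip.nm)) = .var := by funext x; rfl
      rw [this, Encoding.Branches.subst_var]; rfl
    refine MStep.com_of (p := p) (p' := p.flip) (v := .var pc.flip.nm) (q := d.q) rfl
      (P := .sel (.var pc.nm) (.tag a) ((c.eff lp).deliver (.var pc.nm) a)) (.thr trivial)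
      (Q := (d.br.shift 1).offer (.var 0)) (KQ := 0) (tQ := {d.br.offer (.var pc.flip.nm)})
      (by rw [e]; exact .thr trivial) (by simp) (by simp) (r := c.loopT lp + (tgts r + g)) ?_ ?_
    · simp only [Cfg.tgt, tgts_cons, Item.tgt, Ch.enc_un hdl hcd.ext, hc, hd,
        Encoding.Branches.unExt]; simp only [← Multiset.singleton_add]; abel
    · simp only [Cfg.tgt, tgts_cons, tgts_add, Item.tgt, Ch.tgts_keep hdl hcd.ext, hd,
        Encoding.Branches.unExt]; simp only [← Multiset.singleton_add]; abel
  | @select c d lp a pc p p' r K J g hl ha hp hp' hpp =>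
    obtain ⟨j, hj, hlab⟩ := exists_offer_lab ha
    refine MStep.sel_of (p := pc) (p' := pc.flip) j rfl
      (flat_deliver (B := c.eff lp) (y := .var pc.nm) (a := a) p)
      (Q := fun j => d.br.deliver (.var pc.flip.nm) (d.br.keys.get j))
      (by simp only [hj]; exact flat_deliver p') (by simpa using hpp) (by simpa using ⟨hp, hp'⟩)
      (lab := d.br.extLab) (l := .tag a) hlab.symm (r := c.loopT lp + (tgts r + g)) ?_ ?_
    · simp only [Cfg.tgt, tgts_cons, Item.tgt, Encoding.Branches.offer]; simp only [← Multiset.singleton_add]; abel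
    · simp only [Cfg.tgt, tgts_cons, Item.tgt, Side.tgt]; abel
  | @left c d lp a pc p s' i g' r K J g hf =>
    refine hf.mstep (f := (c.eff lp).comm (.var pc.nm)) (KQ := 0) (tQ := {(c.eff lp).comm (.var pc.nm) i}) (.thr ?_) (by simp) (by simp)
      (r := Side.tgt d.br (.var pc.flip.nm) a.dual s' + c.loopT lp + (tgts r + g)) ?_ ?_
    · unfold Encoding.Branches.comm; split <;> trivial
    · simp only [Cfg.tgt, tgts_cons, Item.tgt, Side.tgt]; abel
    · simp only [Cfg.tgt, tgts_cons, Item.tgt, Side.tgt]; abel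
  | @right c d lp a pc p s j g' r K J g hf =>
    refine hf.mstep (f := d.br.comm (.var pc.flip.nm)) (KQ := 0) (tQ := {d.br.comm (.var pc.flip.nm) j}) (.thr ?_) (by simp) (by simp)
      (r := Side.tgt (c.eff lp) (.var pc.nm) a s + c.loopT lp + (tgts r + g)) ?_ ?_
    · unfold Encoding.Branches.comm; split <;> trivial
    · simp only [Cfg.tgt, tgts_cons, Item.tgt, Side.tgt]; abel
    · simp only [Cfg.tgt, tgts_cons, Item.tgt, Side.tgt]; abel
  | @done c d lp a pc i j A₁ A₂ L₁ L₂ E₁ E₂ r K J g hcd hcomm h1 h2 hn hX =>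
    have hC : ∀ {x : Mix.Pre}, c.pre i = x → (c.eff lp).comm (.var pc.nm) i = match x with
        | .out _ v => .out (.var pc.nm) v ((c.eff lp).cont i)
        | .inp _ => .inp .lin (.var pc.nm) ((c.eff lp).cont i) := by
      rintro _ rfl; rfl
    have hD : ∀ {x : Mix.Pre}, d.pre j = x → d.br.comm (.var pc.flip.nm) j = match x with
        | .out _ v => .out (.var pc.flip.nm) v (d.cont j).enc
        | .inp _ => .inp .lin (.var pc.flip.nm) (d.cont j).enc := by
      rintro _ rfl; rfl
    generalize hx : c.pre i = x at hcomm
    generalize hy : d.pre j = y at hcomm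
    generalize hP : c.cont i = P at hcomm
    generalize hQ : d.cont j = Q at hcomm
    have hCx := hC hx
    have hDy := hD hy
    cases hcomm with
    | @out l v =>
      subst hP hQ
      refine MStep.com_of (p := pc) (p' := pc.flip) (q := .lin) rfl
        ((c.flat_cont_out (lp := lp) hx).2 ⟨_, h1.tgt, rfl⟩) (by rw [AProc.enc_subst]; exact h2.tgt) hn hX
        (r := c.loopT lp + (tgts r + g)) ?_ ?_
      · simp only [Cfg.tgt, tgts_cons, Item.tgt, Side.tgt, hCx, hDy]; simp only [← Multiset.singleton_add]; abel
      · simp only [Cfg.tgt, tgts_add, Ch.tgts_back, stay]; abel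
    | @inp l v =>
      subst hP hQ
      -- When the internal choice receives, the external one is the sender, so ports and
      -- continuations change places.
      refine MStep.com_of (p := pc.flip) (p' := pc) (q := .lin) pc.flip_flip.symm
        h2.tgt ((c.flat_cont_inp (lp := lp) hx).2 ⟨_, h1.tgt, rfl⟩)
        (by rw [add_comm]; exact hn) (by rw [add_comm]; exact hX)
        (r := c.loopT lp + (tgts r + g)) ?_ ?_
      · simp only [Cfg.tgt, tgts_cons, Item.tgt, Side.tgt, hCx, hDy]; simp only [← Multiset.singleton_add]; abel
      · simp only [Cfg.tgt, tgts_add, Ch.tgts_back, stay]; abel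

end MixedSessions

namespace MixedSessions

open PCalc (Flat)
open CMV

/-! ### Invariants of configurations -/

theorem Src.closed {Γ S₀ N K s} (h : Src Γ S₀ N K s) {A : AProc} (hA : A ∈ s) : Closed A := by
  obtain ⟨Δ, hΔ, _⟩ := h.typed
  exact hΔ.closed h.thr hA

/-- The invariant of the configurations that a translated process can reach. -/
structure Inv (Γ : Ctx) (S₀ : Mix.Proc) (N : ℕ) (C : Cfg) : Prop where
  src : Src Γ S₀ N C.K (srcs C.D)
  nodup : C.chans.Nodup
  wf : ∀ I ∈ C.D, I.wf
  need : ∀ I ∈ C.D, ∀ A ∈ I.need, Item.plain A ∈ C.D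
  dead : ∀ Q ∈ C.g, ∃ k ∈ C.J, ∃ o i, Q = .sel (.var (nm k o)) (.idx i) .nil

theorem Ch.mem_kept {d : Ch} {A : AProc} : A ∈ d.kept ↔ d.q = .un ∧ A = d.proc := by
  unfold kept astay
  cases d.q <;> simp

theorem Item.mem_need {I : Item} {A : AProc} (h : A ∈ I.need) : ∃ d : Ch, d.q = .un ∧ A = d.proc := by
  cases I <;> simp only [need, Multiset.notMem_zero] at h
  all_goals exact ⟨_, Ch.mem_kept.1 h⟩

/-- A loop exists exactly if the process is unrestricted; once idle again it represents what the
source rule lets persist. -/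
theorem srcs_back {c : Ch} {lp : Option Port} (h : c.LpOK lp) :
    srcs (c.back lp) = astay c.q c.proc := by
  cases lp with
  | none => rw [show c.q = .lin from h]; rfl
  | some u => rw [show c.q = .un from h.2]; simp [Ch.back, Item.src, astay]

theorem owns_back (c : Ch) (lp : Option Port) : owns (c.back lp) = lown lp := by
  cases lp <;> simp [Ch.back, Item.own, lown]

theorem srcs_keep (d : Ch) : srcs d.keep = d.kept := by
  unfold Ch.keep Ch.kept astay
  cases d.q <;> simp [Item.src]

theorem once_add_kept (d : Ch) : d.once + d.kept = {d.proc} := by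
  unfold Ch.once Ch.kept astay
  cases d.q <;> simp

theorem owns_keep (d : Ch) : owns d.keep = 0 := by
  unfold Ch.keep
  cases d.q <;> simp [Item.own]

theorem Ch.mem_back {c : Ch} {lp : Option Port} {I : Item} (h : I ∈ c.back lp) :
    ∃ u, lp = some u ∧ I = .idle c u := by
  cases lp with
  | none => exact absurd h (Multiset.notMem_zero _)
  | some u => exact ⟨u, rfl, Multiset.mem_singleton.1 h⟩

theorem Ch.mem_keep {d : Ch} {I : Item} : I ∈ d.keep ↔ d.q = .un ∧ I = .plain d.proc := by
  unfold keep
  cases d.q <;> simp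

variable {Γ : Ctx} {S₀ : Mix.Proc} {N : ℕ}

/-- The items `F` are exchanged for `G` while `r` is untouched. Items of `r` may rely on a
persistent external choice; `hkeep` ensures that `G` still contains it. -/
theorem Inv.replace {C C' : Cfg} (h : Inv Γ S₀ N C) {F G r : Multiset Item} (hD : C.D = F + r)
    (hD' : C'.D = G + r) {n : Multiset ℕ} (hn : n.Nodup) (hX : ∀ k ∈ n, k ∉ C.chans)
    (hc : C'.chans ≤ C.chans + n) (hs : Src Γ S₀ N C'.K (srcs C'.D)) (hw : ∀ I ∈ G, I.wf)
    (hneed : ∀ I ∈ G, ∀ A ∈ I.need, .plain A ∈ G + r)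
    (hkeep : ∀ d : Ch, d.q = .un → .plain d.proc ∈ F → .plain d.proc ∈ G) (hJ : C.J ≤ C'.J)
    (hdead : ∀ Q ∈ C'.g, Q ∈ C.g ∨ ∃ k ∈ C'.J, ∃ o i, Q = .sel (.var (nm k o)) (.idx i) .nil) :
    Inv Γ S₀ N C' where
  src := hs
  nodup := by
    refine Multiset.nodup_of_le hc (Multiset.nodup_add.2 ⟨h.nodup, hn, ?_⟩)
    exact Multiset.disjoint_left.2 fun hk hk' => hX _ hk' hk
  wf I hI := by
    rw [hD'] at hI
    rcases Multiset.mem_add.1 hI with hI | hI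
    · exact hw I hI
    · exact h.wf I (by rw [hD]; simp [hI])
  need I hI A hA := by
    rw [hD'] at hI ⊢
    rcases Multiset.mem_add.1 hI with hI | hI
    · exact hneed I hI A hA
    · have := h.need I (by rw [hD]; simp [hI]) A hA
      rw [hD] at this
      obtain ⟨d, hd, rfl⟩ := Item.mem_need hA
      rcases Multiset.mem_add.1 this with h' | h'
      · simp [hkeep d hd h']
      · simp [h']
  dead Q hQ := by
    rcases hdead Q hQ with h' | h'
    · obtain ⟨k, hk, h''⟩ := h.dead Q h'
      exact ⟨k, Multiset.mem_of_le hJ hk, h''⟩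
    · exact h'

theorem Comm.sred {c d : Ch} {p : Port} {i : Fin c.n} {j : Fin d.n} {A₁ A₂ L₁ L₂ s₁ s₂}
    (h : Comm (c.pre i) (d.pre j) (c.cont i) (d.cont j) A₁ A₂) (hc : c.x = p.nm)
    (hd : d.x = p.flip.nm) (h1 : Flat A₁ L₁ s₁) (h2 : Flat A₂ L₂ s₂) (r : Multiset AProc) :
    SRed (c.proc ::ₘ d.proc ::ₘ r) (L₁ + L₂)
      (s₁ + (s₂ + (astay c.q c.proc + (astay d.q d.proc + r)))) := by
  generalize hx : c.pre i = x at h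
  generalize hy : d.pre j = y at h
  generalize hP : c.cont i = P at h
  generalize hQ : d.cont j = Q at h
  cases h with
  | out =>
    subst hP hQ
    rw [← add_assoc]
    exact .com _ _ hc hd hx hy h1 h2
  | inp =>
    subst hP hQ
    have := SRed.com (c := d) (d := c) (r := r) j i hd (by rw [hc]; simp) hy hx h2 h1
    rw [Multiset.cons_swap] at this
    convert this using 1
    · rw [add_comm]
    · abel

/-- The partner `d` is represented by the flight itself if it is linear. If it persists, `need`
finds it as a separate plain state; in both cases it is present for the source communication. -/
theorem Inv.sred_done {c d : Ch} {lp : Option Port} {a : Key} {pc : Port} {i : Fin c.n}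
    {j : Fin d.n} {r : Multiset Item} {K J g} (h : Inv Γ S₀ N
      ⟨.flight c d lp a pc (.chosen i) (.chosen j) ::ₘ r, K, J, g⟩) {A₁ A₂ L₁ L₂ s₁ s₂}
    (hcomm : Comm (c.pre i) (d.pre j) (c.cont i) (d.cont j) A₁ A₂) (h1 : Flat A₁ L₁ s₁)
    (h2 : Flat A₂ L₂ s₂) : SRed (srcs (.flight c d lp a pc (.chosen i) (.chosen j) ::ₘ r))
      (L₁ + L₂) (s₁ + (s₂ + (srcs (c.back lp) + srcs r))) := by
  have hw : Opposed c d ∧ c.LpOK lp ∧ _ := h.wf _ (Multiset.mem_cons_self _ _)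
  obtain ⟨r₀, e1, e2⟩ : ∃ r₀, d.once + srcs r = d.proc ::ₘ r₀ ∧ astay d.q d.proc + r₀ = srcs r := by
    cases hq : d.q with
    | lin => exact ⟨srcs r, by simp [Ch.once, hq], by simp [astay]⟩
    | un =>
      have := h.need _ (Multiset.mem_cons_self _ _) d.proc (Ch.mem_kept.2 ⟨hq, rfl⟩)
      rcases Multiset.mem_cons.1 this with h' | h'
      · cases h'
      · obtain ⟨r', rfl⟩ := Multiset.exists_cons_of_mem h'
        exact ⟨srcs r', by simp [Ch.once, hq, Item.src], by simp [astay, Item.src]⟩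
  obtain ⟨p, hc, hd⟩ := hw.1.chan
  have e3 : srcs (.flight c d lp a pc (.chosen i) (.chosen j) ::ₘ r) = c.proc ::ₘ d.proc ::ₘ r₀ := by
    rw [srcs_cons, ← e1]; simp [Item.src]
  rw [e3, srcs_back hw.2.1, ← e2]
  exact hcomm.sred hc hd h1 h2 r₀

/-- What a transition does to the represented process. -/
def SrcStep (X : Finset ℕ) (C C' : Cfg) : Prop :=
  (C'.K = C.K ∧ srcs C'.D = srcs C.D) ∨
    ∃ L, SRed (srcs C.D) L (srcs C'.D) ∧ C'.K = C.K + L ∧ ∀ k ∈ L, k ∉ X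

/-- `n` bounds the new channels. The comparison of channels is an inequality because a completed
communication may give up its session channel. -/
theorem Inv.step {C C' : Cfg} {X : Finset ℕ} (h : Inv Γ S₀ N C) (hCX : ∀ k ∈ C.chans, k ∈ X)
    (hsrc : SrcStep X C C') {F G r : Multiset Item} (hD : C.D = F + r)
    (hD' : C'.D = G + r) {n : Multiset ℕ} (hn : n.Nodup) (hX : ∀ k ∈ n, k ∉ X)
    (hc : C'.chans ≤ C.chans + n) (hK : C'.K ≤ C.K + n) (hw : ∀ I ∈ G, I.wf)
    (hneed : ∀ I ∈ G, ∀ A ∈ I.need, .plain A ∈ G + r)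
    (hkeep : ∀ d : Ch, d.q = .un → .plain d.proc ∈ F → .plain d.proc ∈ G) (hJ : C.J ≤ C'.J)
    (hdead : ∀ Q ∈ C'.g, Q ∈ C.g ∨ ∃ k ∈ C'.J, ∃ o i, Q = .sel (.var (nm k o)) (.idx i) .nil) :
    Inv Γ S₀ N C' ∧ (∀ k ∈ C'.chans, k ∈ C.chans ∨ k ∉ X) ∧ SrcStep X C C' := by
  refine ⟨h.replace hD hD' hn (fun k hk hk' => hX k hk (hCX k hk')) hc ?_ hw hneed hkeep hJ hdead,
    fun k hk => ?_, hsrc⟩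
  · rcases hsrc with ⟨h1, h2⟩ | ⟨L, h1, h2, h3⟩
    · rw [h1, h2]; exact h.src
    · rw [h2]
      refine h.src.red h1 ?_
      rw [← h2]
      refine Multiset.nodup_of_le hK (Multiset.nodup_add.2 ⟨h.src.nodup, hn, ?_⟩)
      exact Multiset.disjoint_left.2 fun hk hk' => hX _ hk' (hCX _ (by simp [Cfg.chans, hk]))
  · rcases Multiset.mem_add.1 (Multiset.mem_of_le hc hk) with hk | hk
    exacts [.inl hk, .inr (hX k hk)]

/-- Only `cond` and `done` change the represented source process. For the other transitions it
remains to account for channels, well-formedness, needs and dead selections. -/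
theorem Trans.inv {X : Finset ℕ} {C C' : Cfg} (ht : Trans X C C') (h : Inv Γ S₀ N C)
    (hX : ∀ k ∈ C.chans, k ∈ X) :
    Inv Γ S₀ N C' ∧ (∀ k ∈ C'.chans, k ∈ C.chans ∨ k ∉ X) ∧ SrcStep X C C' := by
  have hwf := h.wf
  have e0 : ∀ k : ℕ, k ∈ (0 : Multiset ℕ) → k ∉ X := by simp
  cases ht with
  | @cond v P Q A r K J g L E hv hA hn hL =>
    refine h.step hX (.inr ⟨L, ?_, rfl, fun k hk => hL k (by simp [hk])⟩) (Multiset.singleton_add _ _).symm rfl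
      hn hL (le_of_eq ?_) ?_ (fun I hI => (hA.init I hI).2) ?_ ?_ le_rfl fun Q hQ => .inl hQ
    · simp only [srcs_cons, srcs_add, Item.src, Multiset.singleton_add]
      exact .cond hv hA.src
    · simp only [Cfg.chans, owns_cons, owns_add, Item.own]; abel
    · exact add_le_add_right (Multiset.le_add_right _ _) _
    · intro I hI A' hA'
      have := (hA.init I hI).1
      cases I <;> simp [Item.Init, Item.need] at this hA'
    · intro d _ hd
      have := Multiset.mem_singleton.1 hd
      cases this
  | @wake c u p r K J g hp =>
    have hw : c.w = .int ∧ c.lu = .un ∧ c.q = .un := hwf _ (Multiset.mem_cons_self _ _)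
    refine h.step hX (.inl ⟨rfl, by simp [Item.src]⟩) (Multiset.singleton_add _ _).symm
      (Multiset.singleton_add _ _).symm (n := {p.1}) (by simp) (by simpa using hp) (le_of_eq ?_)
      (Multiset.le_add_right _ _) ?_ ?_ ?_ le_rfl fun Q hQ => .inl hQ
    · simp only [Cfg.chans, owns_cons, Item.own, lown]; simp only [← Multiset.singleton_add]; abel
    · simpa [Item.wf, Ch.LpOK] using hw
    · simp [Item.need]
    · simp
  | @pickLin c lp p a g' r K J g hl hf =>
    have hw : c.w = .int ∧ c.LpOK lp := hwf _ (Multiset.mem_cons_self _ _)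
    have hlp : lp = none := by
      cases lp with
      | none => rfl
      | some u => have := hw.2.1; rw [hl] at this; cases this
    subst hlp
    refine h.step hX (.inl ⟨rfl, by simp [Item.src]⟩) (Multiset.singleton_add _ _).symm
      (Multiset.singleton_add _ _).symm (n := 0) (by simp) e0 (le_of_eq ?_)
      (Multiset.le_add_right _ _) ?_ ?_ ?_ (Multiset.le_cons_self _ _) fun Q hQ => ?_
    · simp only [Cfg.chans, owns_cons, Item.own, lown]; simp only [← Multiset.singleton_add]; abel
    · simpa [Item.wf] using ⟨hw.1, hw.2, hl, hf.mem⟩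
    · simp [Item.need]
    · simp
    · rcases Multiset.mem_add.1 hQ with hQ | hQ
      · obtain ⟨i, rfl⟩ := hf.dead Q hQ
        exact .inr ⟨p.1, by simp, _, _, rfl⟩
      · exact .inl hQ
  | @pickUn c lp p pc a g' r K J g hl hf hpc =>
    have hw : c.w = .int ∧ c.LpOK lp := hwf _ (Multiset.mem_cons_self _ _)
    refine h.step hX (.inl ⟨rfl, by simp [Item.src]⟩) (Multiset.singleton_add _ _).symm
      (Multiset.singleton_add _ _).symm (n := {pc.1}) (by simp) (by simpa using hpc) (le_of_eq ?_)
      (Multiset.le_add_right _ _) ?_ ?_ ?_ (Multiset.le_cons_self _ _) fun Q hQ => ?_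
    · simp only [Cfg.chans, owns_cons, Item.own]; simp only [← Multiset.singleton_add]; abel
    · simpa [Item.wf] using ⟨hw.1, hw.2, hl, hf.mem⟩
    · simp [Item.need]
    · simp
    · rcases Multiset.mem_add.1 hQ with hQ | hQ
      · obtain ⟨i, rfl⟩ := hf.dead Q hQ
        exact .inr ⟨p.1, by simp, _, _, rfl⟩
      · exact .inl hQ
  | @commLin c d a pc p p' r K J g hcd hl hc hd ha hp hp' hpp =>
    have hw : c.w = .int ∧ c.q = .lin ∧ c.lu = .lin ∧ a ∈ c.br.keys :=
      hwf _ (Multiset.mem_cons_self _ _)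
    -- On a linear channel the external choice cannot persist, so the flight takes it over entirely.
    have hdq : d.q = .lin := by
      rcases h.src.closed (A := d.proc) (by simp [Item.src]) with ⟨_, _, _, h'⟩ | ⟨d', h', h''⟩
      · cases h'
      · rw [Ch.proc_inj] at h'; subst h'
        exact h'' (hcd.lu ▸ hl)
    refine h.step hX (.inl ⟨rfl, ?_⟩) (F := {.lcommit c a, .plain d.proc}) (r := r)
      (by simp) (Multiset.singleton_add _ _).symm (n := {p.1, p'.1}) (by simpa using hpp)
      (by simpa using ⟨hp, hp'⟩) (le_of_eq ?_) (Multiset.le_add_right _ _) ?_ ?_ ?_ le_rfl fun Q hQ => .inl hQ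
    · simp [Item.src, Ch.once, hdq, Multiset.cons_swap]
    · simp only [Cfg.chans, owns_cons, Item.own, Ch.chan, hl, Side.own, lown,
        Multiset.insert_eq_cons]; simp only [← Multiset.singleton_add]; abel
    · simpa [Item.wf, Ch.LpOK, Side.wf] using ⟨hcd, hw.2.1, hw.2.2.2, ha, fun _ => ⟨hdq, hc, hd⟩⟩
    · simp [Item.need, Ch.mem_kept, hdq]
    · intro e he h'
      simp only [Multiset.insert_eq_cons, Multiset.mem_cons, Multiset.mem_singleton, reduceCtorEq,
        false_or, Item.plain.injEq, Ch.proc_inj] at h'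
      rw [h', hdq] at he; cases he
  | @commUn c d lp a pc r K J g hcd hl ha =>
    have hw : c.w = .int ∧ c.LpOK lp ∧ c.lu = .un ∧ a ∈ c.br.keys :=
      hwf _ (Multiset.mem_cons_self _ _)
    refine h.step hX (.inl ⟨rfl, ?_⟩) (F := {.ucommit c lp a pc, .plain d.proc})
      (G := .presel c d lp a pc ::ₘ d.keep) (r := r)
      (by simp) (by simp) (n := 0) (by simp) e0 (le_of_eq ?_) (Multiset.le_add_right _ _) ?_ ?_ ?_ le_rfl
      fun Q hQ => .inl hQ
    · simp only [srcs_cons, srcs_add, Item.src, srcs_keep, ← once_add_kept d]; simp only [← Multiset.singleton_add]; abel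
    · simp only [Cfg.chans, owns_cons, owns_add, Item.own, owns_keep]; simp only [← Multiset.singleton_add]; abel
    · intro I hI
      rcases Multiset.mem_cons.1 hI with rfl | hI
      · exact ⟨hcd, hw.2.1, hw.2.2.1, hw.2.2.2, ha⟩
      · obtain ⟨_, rfl⟩ := Ch.mem_keep.1 hI
        exact .inr ⟨d, rfl, hcd.ext⟩
    · intro I hI A hA
      rcases Multiset.mem_cons.1 hI with rfl | hI
      · obtain ⟨h1, rfl⟩ := Ch.mem_kept.1 hA
        simp [Ch.mem_keep, h1]
      · obtain ⟨_, rfl⟩ := Ch.mem_keep.1 hI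
        simp [Item.need] at hA
    · intro e he h'
      simp only [Multiset.insert_eq_cons, Multiset.mem_cons, Multiset.mem_singleton, reduceCtorEq,
        false_or, Item.plain.injEq, Ch.proc_inj] at h'
      subst h'
      simp [Ch.mem_keep, he]
  | @select c d lp a pc p p' r K J g hl ha hp hp' hpp =>
    have hw : Opposed c d ∧ c.LpOK lp ∧ c.lu = .un ∧ a ∈ c.br.keys ∧ a.dual ∈ d.br.keys :=
      hwf _ (Multiset.mem_cons_self _ _)
    refine h.step hX (.inl ⟨rfl, by simp [Item.src]⟩) (F := {.presel c d lp a pc}) (r := r)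
      (by simp) (Multiset.singleton_add _ _).symm (n := {p.1, p'.1}) (by simpa using hpp)
      (by simpa using ⟨hp, hp'⟩) (le_of_eq ?_) (Multiset.le_add_right _ _) ?_ ?_ ?_ le_rfl fun Q hQ => .inl hQ
    · simp only [Cfg.chans, owns_cons, Item.own, Ch.chan, hl, Side.own,
        Multiset.insert_eq_cons]; simp only [← Multiset.singleton_add]; abel
    · simpa [Item.wf, Side.wf, hl] using ⟨hw.1, hw.2.1, hw.2.2.2.1, ha⟩
    · intro I hI A hA
      rw [Multiset.mem_singleton] at hI; subst hI
      have := h.need _ (Multiset.mem_cons_self _ _) A hA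
      rw [Multiset.mem_cons] at this
      rcases this with h' | h'
      · cases h'
      · simp [h']
    · simp
  | @left c d lp a pc p s' i g' r K J g hf =>
    have hw : Opposed c d ∧ c.LpOK lp ∧ a ∈ c.br.keys ∧
      a.dual ∈ d.br.keys ∧ True ∧ s'.wf d.pre a.dual ∧
      (c.lu = .lin → d.q = .lin ∧ c.x = pc.nm ∧ d.x = pc.flip.nm) :=
      hwf _ (Multiset.mem_cons_self _ _)
    refine h.step hX (.inl ⟨rfl, by simp [Item.src]⟩) (F := {.flight c d lp a pc (.nd p) s'}) (r := r)
      (by simp) (Multiset.singleton_add _ _).symm (n := 0) (by simp) e0 (le_of_eq ?_) (Multiset.le_add_right _ _) ?_ ?_ ?_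
      (Multiset.le_cons_self _ _) fun Q hQ => ?_
    · simp only [Cfg.chans, owns_cons, Item.own, Side.own]; simp only [← Multiset.singleton_add]; abel
    · intro I hI
      rw [Multiset.mem_singleton] at hI; subst hI
      exact ⟨hw.1, hw.2.1, hw.2.2.1, hw.2.2.2.1, Encoding.Branches.mem_group.1 hf.mem, hw.2.2.2.2.2⟩
    · intro I hI A hA
      rw [Multiset.mem_singleton] at hI; subst hI
      have := h.need _ (Multiset.mem_cons_self _ _) A hA
      rw [Multiset.mem_cons] at this
      rcases this with h' | h'
      · cases h'
      · simp [h']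
    · simp
    · rcases Multiset.mem_add.1 hQ with hQ | hQ
      · obtain ⟨i, rfl⟩ := hf.dead Q hQ
        exact .inr ⟨p.1, by simp, _, _, rfl⟩
      · exact .inl hQ
  | @right c d lp a pc p s j g' r K J g hf =>
    have hw : Opposed c d ∧ c.LpOK lp ∧ a ∈ c.br.keys ∧
      a.dual ∈ d.br.keys ∧ s.wf c.pre a ∧ True ∧
      (c.lu = .lin → d.q = .lin ∧ c.x = pc.nm ∧ d.x = pc.flip.nm) :=
      hwf _ (Multiset.mem_cons_self _ _)
    refine h.step hX (.inl ⟨rfl, by simp [Item.src]⟩) (F := {.flight c d lp a pc s (.nd p)}) (r := r)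
      (by simp) (Multiset.singleton_add _ _).symm (n := 0) (by simp) e0 (le_of_eq ?_) (Multiset.le_add_right _ _) ?_ ?_ ?_
      (Multiset.le_cons_self _ _) fun Q hQ => ?_
    · simp only [Cfg.chans, owns_cons, Item.own, Side.own]; simp only [← Multiset.singleton_add]; abel
    · intro I hI
      rw [Multiset.mem_singleton] at hI; subst hI
      exact ⟨hw.1, hw.2.1, hw.2.2.1, hw.2.2.2.1, hw.2.2.2.2.1, Encoding.Branches.mem_group.1 hf.mem,
        hw.2.2.2.2.2.2⟩
    · intro I hI A hA
      rw [Multiset.mem_singleton] at hI; subst hI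
      have := h.need _ (Multiset.mem_cons_self _ _) A hA
      rw [Multiset.mem_cons] at this
      rcases this with h' | h'
      · cases h'
      · simp [h']
    · simp
    · rcases Multiset.mem_add.1 hQ with hQ | hQ
      · obtain ⟨i, rfl⟩ := hf.dead Q hQ
        exact .inr ⟨p.1, by simp, _, _, rfl⟩
      · exact .inl hQ
  | @done c d lp a pc i j A₁ A₂ L₁ L₂ E₁ E₂ r K J g hcd hcomm h1 h2 hn hL =>
    have hw : Opposed c d ∧ c.LpOK lp ∧ _ := hwf _ (Multiset.mem_cons_self _ _)
    -- The private session channel of an unrestricted communication is dropped from the account,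
    -- which is why the channels do not add up exactly.
    refine h.step hX (.inr ⟨L₁ + L₂, ?_, rfl, fun k hk => hL k ?_⟩)
      (F := {.flight c d lp a pc (.chosen i) (.chosen j)}) (G := E₁ + (E₂ + c.back lp)) (r := r)
      (by simp) (by simp only [add_assoc]) hn hL (le_trans (Multiset.le_add_left _ (c.chan pc.1))
        (le_of_eq ?_)) ?_ ?_ ?_ (by simp) le_rfl fun Q hQ => .inl hQ
    · simp only [srcs_add]
      exact h.sred_done hcomm h1.src h2.src
    · simp only [Multiset.mem_add] at hk ⊢; tauto
    · simp only [Cfg.chans, owns_cons, owns_add, Item.own, Side.own, owns_back]; abel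
    · refine add_le_add_right (le_trans (Multiset.le_add_right _ (owns E₁ + owns E₂)) (le_of_eq ?_)) _
      abel
    · intro I hI
      simp only [Multiset.mem_add] at hI
      rcases hI with hI | hI | hI
      · exact (h1.init I hI).2
      · exact (h2.init I hI).2
      · obtain ⟨u, rfl, rfl⟩ := Ch.mem_back hI
        exact ⟨hcd.int, hw.2.1⟩
    · intro I hI A hA
      simp only [Multiset.mem_add] at hI
      rcases hI with hI | hI | hI
      · have := (h1.init I hI).1
        cases I <;> simp [Item.Init, Item.need] at this hA
      · have := (h2.init I hI).1
        cases I <;> simp [Item.Init, Item.need] at this hA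
      · obtain ⟨u, rfl, rfl⟩ := Ch.mem_back hI
        simp [Item.need] at hA

end MixedSessions

namespace MixedSessions

open PCalc (Flat)
open CMV

/-! ### Threads of states -/

/-- The loop that accompanies a busy state. -/
def Item.lp : Item → Option Port
  | .nd _ lp _ => lp
  | .ucommit _ lp _ _ => lp
  | .presel _ _ lp _ _ => lp
  | .flight _ _ lp _ _ _ _ => lp
  | _ => none

/-- The channels that no other state uses. -/
def Item.hold : Item → Multiset ℕ
  | .flight _ _ lp _ pc s s' => pc.1 ::ₘ (s.own + s'.own + lown lp)
  | I => I.own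

theorem Item.mem_hold_of_lp {I : Item} {u : Port} (h : I.lp = some u) : u.1 ∈ I.hold := by
  cases I <;> simp only [lp, reduceCtorEq] at h <;> subst h <;> simp [hold, own, lown]

/-- The output threads of a state. -/
inductive OutIn : Item → Port → Val → Proc → Prop
  | idle {c u} : OutIn (.idle c u) u .unit .nil
  | ucommit {c : Ch} {lp a pc p} : c.x = Port.nm p → OutIn (.ucommit c lp a pc) p (.var pc.flip.nm)
      (.sel (.var pc.nm) (.tag a) ((c.eff lp).deliver (.var pc.nm) a))
  | left {c d : Ch} {lp a pc} {i : Fin c.n} {s' l v} : c.pre i = .out l v →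
      OutIn (.flight c d lp a pc (.chosen i) s') pc v ((c.eff lp).cont i)
  | right {c d : Ch} {lp a pc s} {j : Fin d.n} {l v} : d.pre j = .out l v →
      OutIn (.flight c d lp a pc s (.chosen j)) pc.flip v (d.cont j).enc

/-- The input threads of a state. -/
inductive InpIn : Item → Port → Qual → Proc → Prop
  | plain {d : Ch} {p} : d.lu = .un → d.w = .ext → d.x = Port.nm p →
      InpIn (.plain d.proc) p d.q ((d.br.shift 1).offer (.var 0))
  | idle {c : Ch} {u : Port} : InpIn (.idle c u) u.flip .un
      (((c.br.shift 1).rearm (u.nm + 1)).unInt (.var (c.x + 1)))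
  | loop {I : Item} {u Q} : I.lp = some u → InpIn I u.flip .un Q
  | left {c d : Ch} {lp a pc} {i : Fin c.n} {s' l} : c.pre i = .inp l →
      InpIn (.flight c d lp a pc (.chosen i) s') pc .lin ((c.eff lp).cont i)
  | right {c d : Ch} {lp a pc s} {j : Fin d.n} {l} : d.pre j = .inp l →
      InpIn (.flight c d lp a pc s (.chosen j)) pc.flip .lin (d.cont j).enc

/-- The selections of a state. -/
inductive SelIn : Item → Port → Lab → Proc → Prop
  | nd {c : Ch} {lp p i} : SelIn (.nd c lp p) p.flip (.idx i) .nil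
  | lcommit {c : Ch} {a p} : c.x = Port.nm p →
      SelIn (.lcommit c a) p (.tag a) (c.br.deliver (.var c.x) a)
  | presel {c d : Ch} {lp a pc} : SelIn (.presel c d lp a pc) pc (.tag a)
      ((c.eff lp).deliver (.var pc.nm) a)
  | left {c d : Ch} {lp a pc p s' i} : SelIn (.flight c d lp a pc (.nd p) s') p.flip (.idx i) .nil
  | right {c d : Ch} {lp a pc p s i} : SelIn (.flight c d lp a pc s (.nd p)) p.flip (.idx i) .nil

/-- The branchings of a state. -/
inductive BranIn : Item → Port → (n : ℕ) → (Fin n ↪ Lab) → (Fin n → Proc) → Prop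
  | plain {d : Ch} {p} : d.lu = .lin → d.w = .ext → d.x = Port.nm p →
      BranIn (.plain d.proc) p d.br.keys.length d.br.extLab
        (fun j => d.br.deliver (.var d.x) (d.br.keys.get j))
  | nd {c : Ch} {lp p} : BranIn (.nd c lp p) p c.br.keys.length (Encoding.idxLab _)
      (fun j => c.opt lp (c.br.keys.get j))
  | presel {c d : Ch} {lp a} {pc : Port} : BranIn (.presel c d lp a pc) pc.flip d.br.keys.length
      d.br.extLab (fun j => d.br.deliver (.var pc.flip.nm) (d.br.keys.get j))
  | left {c d : Ch} {lp a} {pc p : Port} {s'} : BranIn (.flight c d lp a pc (.nd p) s') p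
      ((c.eff lp).group a).length (Encoding.idxLab _)
      (fun j => (c.eff lp).comm (.var pc.nm) (((c.eff lp).group a).get j))
  | right {c d : Ch} {lp a} {pc p : Port} {s} : BranIn (.flight c d lp a pc s (.nd p)) p
      (d.br.group a.dual).length (Encoding.idxLab _)
      (fun j => d.br.comm (.var pc.flip.nm) ((d.br.group a.dual).get j))

theorem Ch.mem_loopT {c : Ch} {lp : Option Port} {Q : Proc} :
    Q ∈ c.loopT lp ↔ ∃ u, lp = some u ∧ Q = c.loop u := by
  cases lp <;> simp [loopT]

theorem mem_ndT {ι : Type} {p : Port} {l : List ι} {f : ι → Proc} {Q : Proc} : Q ∈ ndT p l f ↔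
    Q = .bran (.var p.nm) l.length (Encoding.idxLab l.length) (fun j => f (l.get j)) ∨
      ∃ i : Fin l.length, Q = .sel (.var p.flip.nm) (.idx i) .nil := by
  rw [ndT_eq, Multiset.mem_cons, mem_sels]

theorem Port.nm_inj {p p' : Port} : p.nm = p'.nm ↔ p = p' := by
  rw [MixedSessions.nm_inj, Prod.ext_iff]

theorem comm_out {B : Encoding.Branches} {y y' v : Val} {P : Proc} {i : Fin B.n}
    (h : Proc.out y' v P = B.comm y i) : y' = y ∧ P = B.cont i ∧ ∃ l, B.pre i = .out l v := by
  unfold Encoding.Branches.comm at h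
  split at h
  · rename_i hl
    injection h with h1 h2 h3
    exact ⟨h1, h3, _, h2 ▸ hl⟩
  · cases h

theorem comm_inp {B : Encoding.Branches} {y y' : Val} {q P} {i : Fin B.n}
    (h : Proc.inp q y' P = B.comm y i) :
    y' = y ∧ q = .lin ∧ P = B.cont i ∧ ∃ l, B.pre i = .inp l := by
  unfold Encoding.Branches.comm at h
  split at h
  · cases h
  · rename_i hl
    injection h with h1 h2 h3
    exact ⟨h2, h1, h3, _, hl⟩

theorem comm_cases (B : Encoding.Branches) (y : Val) (i : Fin B.n) :
    (∃ v P, B.comm y i = .out y v P) ∨ ∃ P, B.comm y i = .inp .lin y P := by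
  unfold Encoding.Branches.comm
  split
  exacts [.inl ⟨_, _, rfl⟩, .inr ⟨_, rfl⟩]

theorem enc_of_wf {A : AProc} (h : (Item.plain A).wf) : (∃ v P Q, A = .cond v P Q ∧
    A.enc = .cond v P.enc Q.enc) ∨ ∃ d : Ch, A = d.proc ∧ d.w = .ext ∧
      (d.lu = .lin ∧ A.enc = d.br.offer (.var d.x) ∨ d.lu = .un ∧ A.enc = d.br.unExt d.q (.var d.x)) := by
  rcases h with ⟨v, P, Q, rfl⟩ | ⟨d, rfl, hd⟩
  · exact .inl ⟨v, P, Q, rfl, rfl⟩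
  · refine .inr ⟨d, rfl, hd, ?_⟩
    cases hl : d.lu
    exacts [.inl ⟨rfl, d.enc_lin hl hd⟩, .inr ⟨rfl, d.enc_un hl hd⟩]

theorem Item.outIn {I : Item} (hw : I.wf) {p : Port} {v P} (h : .out (.var p.nm) v P ∈ I.tgt) :
    OutIn I p v P := by
  cases I with
  | plain A =>
    rw [tgt, Multiset.mem_singleton] at h
    rcases enc_of_wf hw with ⟨_, _, _, _, e⟩ | ⟨d, _, _, ⟨_, e⟩ | ⟨_, e⟩⟩ <;> rw [e] at h <;> cases h
  | idle c u =>
    simp only [tgt, Multiset.mem_cons, Multiset.mem_singleton, Proc.out.injEq, Val.var.injEq,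
      Port.nm_inj, Ch.loop, reduceCtorEq, or_false] at h
    obtain ⟨rfl, rfl, rfl⟩ := h
    exact .idle
  | nd c lp p' =>
    simp [tgt, mem_ndT, Ch.mem_loopT, Ch.loop] at h
  | lcommit c a => simp [tgt] at h
  | ucommit c lp a pc =>
    simp only [tgt, Multiset.mem_cons, Ch.mem_loopT, Proc.out.injEq, Val.var.injEq,
      Ch.loop, reduceCtorEq, and_false, exists_false, or_false] at h
    obtain ⟨h, rfl, rfl⟩ := h
    exact .ucommit h.symm
  | presel c d lp a pc => simp [tgt, Ch.mem_loopT, Ch.loop, Encoding.Branches.offer] at h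
  | flight c d lp a pc s s' =>
    simp only [tgt, Multiset.mem_add, Ch.mem_loopT, Ch.loop, reduceCtorEq, and_false, exists_false,
      or_false] at h
    rcases h with h | h
    · cases s with
      | nd p' => simp [Side.tgt, mem_ndT] at h
      | chosen i =>
        obtain ⟨h1, rfl, l, h2⟩ := comm_out (Multiset.mem_singleton.1 h)
        rw [Val.var.injEq, Port.nm_inj] at h1
        subst h1
        exact .left h2
    · cases s' with
      | nd p' => simp [Side.tgt, mem_ndT] at h
      | chosen i =>
        obtain ⟨h1, rfl, l, h2⟩ := comm_out (Multiset.mem_singleton.1 h)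
        rw [Val.var.injEq, Port.nm_inj] at h1
        subst h1
        exact .right h2

/-- For the loop of a busy state `InpIn` leaves the body open: the output that would trigger it is
not yet available, so the port alone leads to a contradiction later. -/
theorem Item.inpIn {I : Item} (hw : I.wf) {p : Port} {q Q} (h : .inp q (.var p.nm) Q ∈ I.tgt) :
    InpIn I p q Q := by
  cases I with
  | plain A =>
    rw [tgt, Multiset.mem_singleton] at h
    rcases enc_of_wf hw with ⟨_, _, _, _, e⟩ | ⟨d, rfl, hd, ⟨_, e⟩ | ⟨hl, e⟩⟩ <;> rw [e] at h
    · cases h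
    · cases h
    · simp only [Encoding.Branches.unExt, Proc.inp.injEq, Val.var.injEq] at h
      obtain ⟨rfl, h, rfl⟩ := h
      exact .plain hl hd h.symm
  | idle c u =>
    simp only [tgt, Multiset.mem_cons, Multiset.mem_singleton, Proc.inp.injEq, Val.var.injEq,
      Port.nm_inj, Ch.loop, reduceCtorEq, false_or] at h
    obtain ⟨rfl, rfl, rfl⟩ := h
    exact .idle
  | nd c lp p' =>
    simp only [tgt, Multiset.mem_add, mem_ndT, Ch.mem_loopT, Ch.loop, Proc.inp.injEq, Val.var.injEq,
      Port.nm_inj, reduceCtorEq, exists_false, false_or] at h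
    obtain ⟨u, hu, rfl, rfl, _⟩ := h
    exact .loop hu
  | lcommit c a => simp [tgt] at h
  | ucommit c lp a pc =>
    simp only [tgt, Multiset.mem_cons, Ch.mem_loopT, Ch.loop, Proc.inp.injEq, Val.var.injEq,
      Port.nm_inj, reduceCtorEq, false_or] at h
    obtain ⟨u, hu, rfl, rfl, _⟩ := h
    exact .loop hu
  | presel c d lp a pc =>
    simp only [tgt, Multiset.mem_cons, Ch.mem_loopT, Ch.loop, Proc.inp.injEq, Val.var.injEq,
      Port.nm_inj, Encoding.Branches.offer, reduceCtorEq, false_or] at h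
    obtain ⟨u, hu, rfl, rfl, _⟩ := h
    exact .loop hu
  | flight c d lp a pc s s' =>
    simp only [tgt, Multiset.mem_add, Ch.mem_loopT] at h
    rcases h with h | h | ⟨u, hu, h⟩
    · cases s with
      | nd p' => simp [Side.tgt, mem_ndT] at h
      | chosen i =>
        obtain ⟨h1, rfl, rfl, l, h2⟩ := comm_inp (Multiset.mem_singleton.1 h)
        rw [Val.var.injEq, Port.nm_inj] at h1
        subst h1
        exact .left h2
    · cases s' with
      | nd p' => simp [Side.tgt, mem_ndT] at h
      | chosen i =>
        obtain ⟨h1, rfl, rfl, l, h2⟩ := comm_inp (Multiset.mem_singleton.1 h)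
        rw [Val.var.injEq, Port.nm_inj] at h1
        subst h1
        exact .right h2
    · simp only [Ch.loop, Proc.inp.injEq, Val.var.injEq, Port.nm_inj] at h
      obtain ⟨rfl, rfl, _⟩ := h
      exact .loop hu

theorem Item.selIn {I : Item} (hw : I.wf) {p : Port} {l P} (h : .sel (.var p.nm) l P ∈ I.tgt) :
    SelIn I p l P := by
  cases I with
  | plain A =>
    rw [tgt, Multiset.mem_singleton] at h
    rcases enc_of_wf hw with ⟨_, _, _, _, e⟩ | ⟨d, _, _, ⟨_, e⟩ | ⟨_, e⟩⟩ <;> rw [e] at h <;> cases h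
  | idle c u => simp [tgt, Ch.loop] at h
  | nd c lp p' =>
    simp only [tgt, Multiset.mem_add, mem_ndT, Ch.mem_loopT, Ch.loop, Proc.sel.injEq, Val.var.injEq,
      Port.nm_inj, reduceCtorEq, and_false, exists_false, false_or, or_false] at h
    obtain ⟨i, rfl, rfl, rfl⟩ := h
    exact .nd
  | lcommit c a =>
    simp only [tgt, Multiset.mem_singleton, Proc.sel.injEq, Val.var.injEq] at h
    obtain ⟨h, rfl, rfl⟩ := h
    exact .lcommit h.symm
  | ucommit c lp a pc => simp [tgt, Ch.mem_loopT, Ch.loop] at h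
  | presel c d lp a pc =>
    simp only [tgt, Multiset.mem_cons, Ch.mem_loopT, Ch.loop, Proc.sel.injEq, Val.var.injEq,
      Port.nm_inj, Encoding.Branches.offer, reduceCtorEq, and_false, exists_false, or_false] at h
    obtain ⟨rfl, rfl, rfl⟩ := h
    exact .presel
  | flight c d lp a pc s s' =>
    simp only [tgt, Multiset.mem_add, Ch.mem_loopT, Ch.loop, reduceCtorEq, and_false, exists_false,
      or_false] at h
    rcases h with h | h
    · cases s with
      | nd p' =>
        simp only [Side.tgt, mem_ndT, Proc.sel.injEq, Val.var.injEq, Port.nm_inj, reduceCtorEq,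
          false_or] at h
        obtain ⟨i, rfl, rfl, rfl⟩ := h
        exact .left
      | chosen i =>
        rcases comm_cases (c.eff lp) (.var pc.nm) i with ⟨_, _, e⟩ | ⟨_, e⟩ <;>
          simp [Side.tgt, e] at h
    · cases s' with
      | nd p' =>
        simp only [Side.tgt, mem_ndT, Proc.sel.injEq, Val.var.injEq, Port.nm_inj, reduceCtorEq,
          false_or] at h
        obtain ⟨i, rfl, rfl, rfl⟩ := h
        exact .right
      | chosen i =>
        rcases comm_cases d.br (.var pc.flip.nm) i with ⟨_, _, e⟩ | ⟨_, e⟩ <;>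
          simp [Side.tgt, e] at h

theorem Item.branIn {I : Item} (hw : I.wf) {p : Port} {n lab Q}
    (h : .bran (.var p.nm) n lab Q ∈ I.tgt) : BranIn I p n lab Q := by
  cases I with
  | plain A =>
    rw [tgt, Multiset.mem_singleton] at h
    rcases enc_of_wf hw with ⟨_, _, _, _, e⟩ | ⟨d, rfl, hd, ⟨hl, e⟩ | ⟨hl, e⟩⟩ <;> rw [e] at h
    · cases h
    · simp only [Encoding.Branches.offer, Proc.bran.injEq, Val.var.injEq] at h
      obtain ⟨h, rfl, h1, h2⟩ := h
      rw [heq_eq_eq] at h1 h2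
      subst h1 h2
      exact .plain hl hd h.symm
    · cases h
  | idle c u => simp [tgt, Ch.loop] at h
  | nd c lp p' =>
    simp only [tgt, Multiset.mem_add, mem_ndT, Ch.mem_loopT, Ch.loop, Proc.bran.injEq, Val.var.injEq,
      Port.nm_inj, reduceCtorEq, and_false, exists_false, or_false] at h
    obtain ⟨rfl, rfl, h1, h2⟩ := h
    rw [heq_eq_eq] at h1 h2
    subst h1 h2
    exact .nd
  | lcommit c a => simp [tgt] at h
  | ucommit c lp a pc => simp [tgt, Ch.mem_loopT, Ch.loop] at h
  | presel c d lp a pc =>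
    simp only [tgt, Multiset.mem_cons, Ch.mem_loopT, Ch.loop, Proc.bran.injEq, Val.var.injEq,
      Port.nm_inj, Encoding.Branches.offer, reduceCtorEq, and_false, exists_false, false_or, or_false] at h
    obtain ⟨rfl, rfl, h1, h2⟩ := h
    rw [heq_eq_eq] at h1 h2
    subst h1 h2
    exact .presel
  | flight c d lp a pc s s' =>
    simp only [tgt, Multiset.mem_add, Ch.mem_loopT, Ch.loop, reduceCtorEq, and_false, exists_false,
      or_false] at h
    rcases h with h | h
    · cases s with
      | nd p' =>
        simp only [Side.tgt, mem_ndT, Proc.bran.injEq, Val.var.injEq, Port.nm_inj, reduceCtorEq,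
          exists_false, or_false] at h
        obtain ⟨rfl, rfl, h1, h2⟩ := h
        rw [heq_eq_eq] at h1 h2
        subst h1 h2
        exact .left
      | chosen i =>
        rcases comm_cases (c.eff lp) (.var pc.nm) i with ⟨_, _, e⟩ | ⟨_, e⟩ <;>
          simp [Side.tgt, e] at h
    · cases s' with
      | nd p' =>
        simp only [Side.tgt, mem_ndT, Proc.bran.injEq, Val.var.injEq, Port.nm_inj, reduceCtorEq,
          exists_false, or_false] at h
        obtain ⟨rfl, rfl, h1, h2⟩ := h
        rw [heq_eq_eq] at h1 h2
        subst h1 h2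
        exact .right
      | chosen i =>
        rcases comm_cases d.br (.var pc.flip.nm) i with ⟨_, _, e⟩ | ⟨_, e⟩ <;>
          simp [Side.tgt, e] at h

theorem Item.cond_mem {I : Item} (hw : I.wf) {v P Q} (h : Proc.cond v P Q ∈ I.tgt) :
    ∃ A B, I = .plain (.cond v A B) ∧ P = A.enc ∧ Q = B.enc := by
  cases I with
  | plain A =>
    rw [tgt, Multiset.mem_singleton] at h
    rcases enc_of_wf hw with ⟨_, A, B, rfl, e⟩ | ⟨d, rfl, hd, ⟨hl, e⟩ | ⟨hl, e⟩⟩ <;> rw [e] at h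
    · injection h with h1 h2 h3
      subst h1 h2 h3
      exact ⟨A, B, rfl, rfl, rfl⟩
    · cases h
    · cases h
  | idle c u => simp [tgt, Ch.loop] at h
  | nd c lp p' => simp [tgt, mem_ndT, Ch.mem_loopT, Ch.loop] at h
  | lcommit c a => simp [tgt] at h
  | ucommit c lp a pc => simp [tgt, Ch.mem_loopT, Ch.loop] at h
  | presel c d lp a pc => simp [tgt, Ch.mem_loopT, Ch.loop, Encoding.Branches.offer] at h
  | flight c d lp a pc s s' =>
    simp only [tgt, Multiset.mem_add, Ch.mem_loopT, Ch.loop, reduceCtorEq, and_false, exists_false,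
      or_false] at h
    rcases h with h | h
    · cases s with
      | nd p' => simp [Side.tgt, mem_ndT] at h
      | chosen i =>
        rcases comm_cases (c.eff lp) (.var pc.nm) i with ⟨_, _, e⟩ | ⟨_, e⟩ <;>
          simp [Side.tgt, e] at h
    · cases s' with
      | nd p' => simp [Side.tgt, mem_ndT] at h
      | chosen i =>
        rcases comm_cases d.br (.var pc.flip.nm) i with ⟨_, _, e⟩ | ⟨_, e⟩ <;>
          simp [Side.tgt, e] at h

/-- The threads of a state that can be observed. -/
theorem Item.subj_mem {I : Item} (hw : I.wf) {Q : Proc} {x : ℕ} (h : Q ∈ I.tgt)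
    (hx : Q.subj = some (.var (2 * x))) :
    ∃ c : Ch, c.proc ∈ I.src ∧ c.x = 2 * x ∧ (c.w = .int → 0 < c.n) := by
  have nmx : ∀ (p : Port), p.nm ≠ 2 * x := fun p => by simp
  have hnd : ∀ {ι : Type} {p : Port} {l : List ι} {f : ι → Proc}, Q ∉ ndT p l f := by
    intro ι p l f h
    rcases mem_ndT.1 h with rfl | ⟨_, rfl⟩ <;>
      simp only [Proc.subj, Option.some.injEq, Val.var.injEq] at hx <;> exact nmx _ hx
  have hlp : ∀ {c : Ch} {lp}, Q ∉ c.loopT lp := by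
    intro c lp h
    obtain ⟨u, _, rfl⟩ := Ch.mem_loopT.1 h
    simp only [Ch.loop, Proc.subj, Option.some.injEq, Val.var.injEq] at hx
    exact nmx _ hx
  have hk : ∀ {c : Ch} {a}, a ∈ c.br.keys → 0 < c.n := by
    intro c a h
    obtain ⟨i, _⟩ := Encoding.Branches.mem_keys.1 h
    exact i.pos
  cases I with
  | plain A =>
    rw [tgt, Multiset.mem_singleton] at h
    rcases enc_of_wf hw with ⟨_, A, B, rfl, e⟩ | ⟨d, rfl, hd, ⟨hl, e⟩ | ⟨hl, e⟩⟩ <;>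
      rw [h, e] at hx
    · simp [Proc.subj] at hx
    all_goals
      simp only [Encoding.Branches.offer, Encoding.Branches.unExt, Proc.subj, Option.some.injEq,
        Val.var.injEq] at hx
      exact ⟨d, by simp [src], hx, by simp [hd]⟩
  | idle c u =>
    simp only [tgt, Multiset.mem_cons, Multiset.mem_singleton] at h
    rcases h with rfl | rfl <;>
      simp only [Ch.loop, Proc.subj, Option.some.injEq, Val.var.injEq] at hx <;> exact absurd hx (nmx _)
  | nd c lp p' =>
    rcases Multiset.mem_add.1 h with h | h
    exacts [absurd h hnd, absurd h hlp]
  | lcommit c a =>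
    rw [tgt, Multiset.mem_singleton] at h
    subst h
    simp only [Proc.subj, Option.some.injEq, Val.var.injEq] at hx
    exact ⟨c, by simp [src], hx, fun _ => hk hw.2.2.2⟩
  | ucommit c lp a pc =>
    rcases Multiset.mem_cons.1 h with rfl | h
    · simp only [Proc.subj, Option.some.injEq, Val.var.injEq] at hx
      exact ⟨c, by simp [src], hx, fun _ => hk hw.2.2.2⟩
    · exact absurd h hlp
  | presel c d lp a pc =>
    simp only [tgt, Multiset.mem_cons] at h
    rcases h with rfl | rfl | h
    · simp only [Proc.subj, Option.some.injEq, Val.var.injEq] at hx; exact absurd hx (nmx _)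
    · simp only [Encoding.Branches.offer, Proc.subj, Option.some.injEq, Val.var.injEq] at hx
      exact absurd hx (nmx _)
    · exact absurd h hlp
  | flight c d lp a pc s s' =>
    have hs : ∀ {B : Encoding.Branches} {p : Port} {a} {s : Side B.n}, Q ∉ Side.tgt B (.var p.nm) a s := by
      intro B p a s h
      cases s with
      | nd => exact hnd h
      | chosen i =>
        rw [Side.tgt, Multiset.mem_singleton] at h
        subst h
        rcases comm_cases B (.var p.nm) i with ⟨_, _, e⟩ | ⟨_, e⟩ <;> rw [e] at hx <;>
          simp only [Proc.subj, Option.some.injEq, Val.var.injEq] at hx <;> exact nmx _ hx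
    simp only [tgt, Multiset.mem_add] at h
    rcases h with h | h | h
    exacts [absurd h hs, absurd h hs, absurd h hlp]

end MixedSessions

namespace MixedSessions

open PCalc (Flat)
open CMV

variable {Γ : Ctx} {S₀ : Mix.Proc} {N : ℕ}

/-! ### Reductions of configurations are transitions -/

/-- A communication between linear subjects runs on the source channel itself, which is held without
being owned. This is the only difference. -/
theorem Item.hold_cases {I : Item} {k : ℕ} (h : k ∈ I.hold) : k ∈ I.own ∨
    ∃ c d lp a pc s s', I = .flight c d lp a pc s s' ∧ c.lu = .lin ∧ k = pc.1 := by
  cases I with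
  | flight c d lp a pc s s' =>
    rcases Multiset.mem_cons.1 h with h | h
    · cases hl : c.lu with
      | lin => exact .inr ⟨_, _, _, _, _, _, _, rfl, hl, h⟩
      | un => exact .inl (by simp [own, Ch.chan, hl, h])
    · exact .inl (Multiset.mem_add.2 (.inr h))
  | _ => exact .inl h

namespace Inv

variable {C : Cfg}

theorem own_notMem (h : Inv Γ S₀ N C) {k : ℕ} (hk : k ∈ owns C.D) : k ∉ C.K := fun hk' =>
  Multiset.disjoint_left.1 (Multiset.nodup_add.1 h.nodup).2.2 (by simp [hk]) hk'

theorem own_src (h : Inv Γ S₀ N C) {k : ℕ} (hk : k ∈ owns C.D) {c : Ch} (hc : c.proc ∈ srcs C.D)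
    {o : Bool} : c.x ≠ nm k o := fun hx => h.own_notMem hk (h.src.chan_mem hc hx)

theorem hold_mem (h : Inv Γ S₀ N C) {I : Item} (hI : I ∈ C.D) {k : ℕ} (hk : k ∈ I.hold) :
    k ∈ owns C.D ∨ k ∈ C.K := by
  rcases Item.hold_cases hk with h' | ⟨c, d, lp, a, pc, s, s', rfl, hl, rfl⟩
  · exact .inl (mem_owns.2 ⟨I, hI, h'⟩)
  · have hw := h.wf _ hI
    exact .inr (h.src.chan_mem (c := c) (mem_srcs.2 ⟨_, hI, by simp [Item.src]⟩) (hw.2.2.2.2.2.2 hl).2.1)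

theorem dead_hold (h : Inv Γ S₀ N C) {I : Item} (hI : I ∈ C.D) {k : ℕ} (hk : k ∈ I.hold) :
    k ∉ C.J := by
  intro hJ
  have := h.nodup
  rw [show C.chans = owns C.D + C.J + C.K from rfl, Multiset.nodup_add, Multiset.nodup_add] at this
  rcases h.hold_mem hI hk with h' | h'
  · exact Multiset.disjoint_left.1 this.1.2.2 h' hJ
  · exact Multiset.disjoint_left.1 this.2.2 (by simp [hJ]) h'

theorem dead_src (h : Inv Γ S₀ N C) {k : ℕ} (hk : k ∈ C.J) {c : Ch} (hc : c.proc ∈ srcs C.D)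
    {o : Bool} : c.x ≠ nm k o := fun hx =>
  Multiset.disjoint_left.1 (Multiset.nodup_add.1 h.nodup).2.2 (by simp [hk]) (h.src.chan_mem hc hx)

/-- An owned channel is not a source channel at all. A linear flight already represents one choice
on each end of its channel, so a third choice there would use a linear endpoint twice. -/
theorem excl (h : Inv Γ S₀ N C) {I : Item} {r : Multiset Item} (hD : C.D = I ::ₘ r) {k : ℕ}
    (hk : k ∈ I.hold) {c : Ch} (hc : c.proc ∈ srcs r) {o : Bool} : c.x ≠ nm k o := by
  intro hx
  have hc' : c.proc ∈ srcs C.D := by rw [hD]; simp [hc]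
  rcases Item.hold_cases hk with h' | ⟨e, d, lp, a, pc, s, s', rfl, hl, rfl⟩
  · exact h.own_src (mem_owns.2 ⟨I, by simp [hD], h'⟩) hc' hx
  · have hw := h.wf (.flight e d lp a pc s s') (by simp [hD])
    obtain ⟨hq, he, hd⟩ := hw.2.2.2.2.2.2 hl
    obtain ⟨r', hr⟩ := Multiset.exists_cons_of_mem hc
    obtain ⟨Δ, hΔ, _⟩ := h.src.typed
    have e1 : srcs C.D = e.proc ::ₘ d.proc ::ₘ c.proc ::ₘ r' := by
      rw [hD, srcs_cons, hr]
      simp only [Item.src, Ch.once, hq]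
      simp only [Multiset.cons_add, Multiset.singleton_add]
    rw [e1] at hΔ
    have hdl : d.lu = .lin := hw.1.lu ▸ hl
    by_cases ho : o = pc.2
    · rw [Multiset.cons_swap d.proc] at hΔ
      exact hΔ.lin_unique hl (by rw [he, hx, ho])
    · rw [Multiset.cons_swap e.proc, Multiset.cons_swap e.proc] at hΔ
      refine hΔ.lin_unique hdl ?_
      rw [hd, hx]
      cases o <;> cases h2 : pc.2 <;> simp_all [Port.flip]

theorem hold_disj (h : Inv Γ S₀ N C) {I I' : Item} {r : Multiset Item} (hD : C.D = I ::ₘ r) {k : ℕ}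
    (hk : k ∈ I.hold) (hI' : I' ∈ r) : k ∉ I'.hold := by
  intro hk'
  rcases Item.hold_cases hk' with h' | ⟨e, d, lp, a, pc, s, s', rfl, hl, rfl⟩
  · rcases Item.hold_cases hk with h'' | ⟨e, d, lp, a, pc, s, s', rfl, hl, rfl⟩
    · have := (Multiset.nodup_add.1 (Multiset.nodup_add.1 h.nodup).1).1
      rw [hD, owns_cons, Multiset.nodup_add] at this
      exact Multiset.disjoint_left.1 this.2.2 h'' (mem_owns.2 ⟨I', hI', h'⟩)
    · have hw := h.wf (.flight e d lp a pc s s') (by simp [hD])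
      exact h.own_src (c := e) (mem_owns.2 ⟨I', by simp [hD, hI'], h'⟩)
        (by rw [hD]; simp [Item.src]) (hw.2.2.2.2.2.2 hl).2.1
  · have hw := h.wf (.flight e d lp a pc s s') (by simp [hD, hI'])
    exact h.excl hD hk (mem_srcs.2 ⟨_, hI', by simp [Item.src]⟩) (hw.2.2.2.2.2.2 hl).2.1

theorem hold_nodup (h : Inv Γ S₀ N C) {I : Item} (hI : I ∈ C.D) : I.hold.Nodup := by
  obtain ⟨r, hD⟩ := Multiset.exists_cons_of_mem hI
  have h1 := (Multiset.nodup_add.1 (Multiset.nodup_add.1 h.nodup).1).1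
  rw [hD, owns_cons, Multiset.nodup_add] at h1
  cases I with
  | flight c d lp a pc s s' =>
    have h2 := (Multiset.nodup_add.1 h1.1)
    cases hl : c.lu with
    | un =>
      have := h1.1
      rw [Item.own, Ch.chan, hl] at this
      exact this
    | lin =>
      refine Multiset.nodup_cons.2 ⟨fun hk => ?_, h2.2.1⟩
      have hw := h.wf _ hI
      exact h.own_src (c := c) (mem_owns.2 ⟨_, hI, Multiset.mem_add.2 (.inr hk)⟩)
        (mem_srcs.2 ⟨_, hI, by simp [Item.src]⟩) (hw.2.2.2.2.2.2 hl).2.1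
  | _ => exact h1.1

/-- One context types both choices, and its entries at the two ends of a channel are dual. Subtyping
can only remove labels on the internal side and add them on the external side. -/
theorem dual_types (h : Inv Γ S₀ N C) {c d : Ch} (hc : c.proc ∈ srcs C.D) (hd : d.proc ∈ srcs C.D)
    {p : Port} (hcx : c.x = p.nm) (hdx : d.x = p.flip.nm) : c.lu = d.lu ∧
      d.w = c.w.dual ∧ (c.w = .int → ∀ a ∈ c.br.keys, a.dual ∈ d.br.keys) := by
  have hk := h.src.chan_mem hc hcx
  obtain ⟨Δ, hΔ, hm⟩ := h.src.typed
  obtain ⟨S, T, h1, h2, hST⟩ : ∃ S T, Δ c.x = some S ∧ Δ d.x = some T ∧ S.Dual T := by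
    obtain ⟨S, T, h1, h2, hST⟩ := hm.dual _ hk
    rw [hcx, hdx]
    obtain ⟨k, o⟩ := p
    cases o
    exacts [⟨S, T, h1, h2, hST⟩, ⟨T, S, h2, h1, hST.symm⟩]
  have key : ∀ {e : Ch} {U}, e.proc ∈ srcs C.D → Δ e.x = some U → ChTy e U := by
    intro e U he hU
    obtain ⟨Γ₁, Γ₂, h3, h4⟩ := hΔ.mem he
    obtain ⟨V, hV, h5⟩ := h4.chTy
    rw [h3.of_left hV] at hU
    exact Option.some.inj hU ▸ h5
  obtain ⟨e1, e2, e3⟩ := (key hc h1).dual (key hd h2) hST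
  refine ⟨e1, e2, fun hw a ha => ?_⟩
  obtain ⟨i, rfl⟩ := Encoding.Branches.mem_keys.1 ha
  obtain ⟨j, hj⟩ := e3 hw i
  exact Encoding.Branches.mem_keys.2 ⟨j, hj⟩

theorem dual_keys (h : Inv Γ S₀ N C) {c d : Ch} (hc : c.proc ∈ srcs C.D) (hd : d.proc ∈ srcs C.D)
    {p : Port} (hcx : c.x = p.nm) (hdx : d.x = p.flip.nm) (hw : c.w = .int) : c.lu = d.lu ∧
      d.w = .ext ∧ ∀ a ∈ c.br.keys, a.dual ∈ d.br.keys := by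
  obtain ⟨e1, e2, e3⟩ := h.dual_types hc hd hcx hdx
  exact ⟨e1, by rw [e2, hw]; rfl, e3 hw⟩

theorem closed_red (h : Inv Γ S₀ N C) {X : Finset ℕ} (hX : ∀ k ∈ C.chans, k ∈ X)
    {L : Multiset ℕ} {s' : Multiset AProc} (hs : SRed (srcs C.D) L s') (hn : L.Nodup)
    (hL : ∀ k ∈ L, k ∉ X) : ∀ A ∈ s', Closed A := fun A hA =>
  (h.src.red hs (Multiset.nodup_add.2 ⟨h.src.nodup, hn, Multiset.disjoint_left.2 fun hk hk' =>
    hL _ hk' (hX _ (by simp [Cfg.chans, hk]))⟩)).closed hA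

theorem cond_trans {v : Val} {P Q A : AProc} {r : Multiset Item} {K J g}
    (h : Inv Γ S₀ N ⟨.plain (.cond v P Q) ::ₘ r, K, J, g⟩) {X : Finset ℕ}
    (hX : ∀ k ∈ Cfg.chans ⟨.plain (.cond v P Q) ::ₘ r, K, J, g⟩, k ∈ X)
    (hv : v = .tt ∧ A = P ∨ v = .ff ∧ A = Q) {L t} (hf : Flat A.enc L t) (hn : L.Nodup)
    (hL : ∀ k ∈ L, k ∉ X) : ∃ C', Trans X ⟨.plain (.cond v P Q) ::ₘ r, K, J, g⟩ C' ∧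
      C'.tgt = t + (tgts r + g) := by
  obtain ⟨L, E, h1, rfl, rfl⟩ := Dec.of_enc hf fun L' s hL' hs B hB => by
    have hs' : SRed (srcs (.plain (.cond v P Q) ::ₘ r)) L' (s + srcs r) := by
      simp only [srcs_cons, Item.src, Multiset.singleton_add]
      exact .cond hv hs
    exact h.closed_red hX hs' (Multiset.nodup_of_le hL' hn)
      (fun k hk => hL k (Multiset.mem_of_le hL' hk)) B (by simp [hB])
  refine ⟨_, .cond hv h1 hn hL, ?_⟩
  simp only [Cfg.tgt, tgts_add, add_assoc]

theorem done_trans {c d : Ch} {lp : Option Port} {a : Key} {pc : Port} {i : Fin c.n}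
    {j : Fin d.n} {r : Multiset Item} {K J g} (h : Inv Γ S₀ N
      ⟨.flight c d lp a pc (.chosen i) (.chosen j) ::ₘ r, K, J, g⟩) {X : Finset ℕ}
    (hX : ∀ k ∈ Cfg.chans ⟨.flight c d lp a pc (.chosen i) (.chosen j) ::ₘ r, K, J, g⟩, k ∈ X)
    {A₁ A₂ L₁ L₂ t₁ t₂} (hcomm : Comm (c.pre i) (d.pre j) (c.cont i) (d.cont j) A₁ A₂)
    (h1 : Flat A₁.enc L₁ t₁) (h2 : Flat A₂.enc L₂ t₂) (hn : (L₁ + L₂).Nodup)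
    (hL : ∀ k ∈ L₁ + L₂, k ∉ X) :
    ∃ C', Trans X ⟨.flight c d lp a pc (.chosen i) (.chosen j) ::ₘ r, K, J, g⟩ C' ∧
      C'.tgt = t₁ + (t₂ + (rearmT lp + c.loopT lp)) + (tgts r + g) := by
  have hw := h.wf _ (Multiset.mem_cons_self _ _)
  have fl : ∀ (A : AProc) (Y : Finset ℕ), ∃ L s, Flat A L s ∧ L.Nodup ∧ ∀ k ∈ L, k ∉ Y := by
    intro A Y
    obtain ⟨L, s, h1, h2, h3⟩ := A.exists_flat .var Y
    rw [AProc.subst_var] at h1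
    exact ⟨L, s, h1, h2, h3⟩
  have red : ∀ {M₁ M₂ s₁ s₂}, Flat A₁ M₁ s₁ → Flat A₂ M₂ s₂ → M₁.Nodup → M₂.Nodup →
      (∀ k ∈ M₁, k ∉ M₂) → (∀ k ∈ M₁, k ∉ X) → (∀ k ∈ M₂, k ∉ X) → ∀ B ∈ s₁ + s₂, Closed B := by
    intro M₁ M₂ s₁ s₂ f1 f2 n1 n2 hd x1 x2 B hB
    refine h.closed_red hX (h.sred_done hcomm f1 f2) (Multiset.nodup_add.2 ⟨n1, n2,
      Multiset.disjoint_left.2 fun hk => hd _ hk⟩) ?_ B ?_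
    · intro k hk
      rcases Multiset.mem_add.1 hk with hk | hk
      exacts [x1 k hk, x2 k hk]
    · rw [Multiset.mem_add] at hB
      simp only [Multiset.mem_add]; tauto
  obtain ⟨n1, n2, n3⟩ := Multiset.nodup_add.1 hn
  -- Subject reduction speaks about both continuations at once. To decompose one of them, the other
  -- is flattened with arbitrary fresh channels.
  obtain ⟨L₁, E₁, d1, rfl, rfl⟩ := Dec.of_enc h1 fun L' s hL' hs B hB => by
    obtain ⟨M, s', f1, f2, f3⟩ := fl A₂ (X ∪ L'.toFinset)
    exact red hs f1 (Multiset.nodup_of_le hL' n1) f2 (fun k hk hk' => f3 k hk' (by simp [hk]))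
      (fun k hk => hL k (Multiset.mem_add.2 (.inl (Multiset.mem_of_le hL' hk))))
      (fun k hk hk' => f3 k hk (by simp [hk'])) B (by simp [hB])
  obtain ⟨L₂, E₂, d2, rfl, rfl⟩ := Dec.of_enc h2 fun L' s hL' hs B hB => by
    obtain ⟨M, s', f1, f2, f3⟩ := fl A₁ (X ∪ L'.toFinset)
    exact red f1 hs f2 (Multiset.nodup_of_le hL' n2) (fun k hk hk' => f3 k hk (by simp [hk']))
      (fun k hk hk' => f3 k hk (by simp [hk']))
      (fun k hk => hL k (Multiset.mem_add.2 (.inr (Multiset.mem_of_le hL' hk)))) B (by simp [hB])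
  refine ⟨_, .done hw.1 hcomm d1 d2 hn hL, ?_⟩
  simp only [Cfg.tgt, tgts_add, Ch.tgts_back, add_assoc]

end Inv

theorem cons_cancel₂ {α : Type} {a b : α} {t r r' : Multiset α} (h : t = a ::ₘ b ::ₘ r)
    (h' : t = a ::ₘ b ::ₘ r') : r = r' := by
  rw [h, Multiset.cons_inj_right, Multiset.cons_inj_right] at h'
  exact h'

theorem offer_inst (B : Encoding.Branches) (y : Val) :
    ((B.shift 1).offer (.var 0)).subst (Subst.inst y) = B.offer y := by
  rw [Encoding.Branches.offer_subst, Encoding.Branches.shift_eq, Encoding.Branches.subst_subst]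
  have : (Subst.shift 1).comp (Subst.inst y) = .var := by funext x; rfl
  rw [this, Encoding.Branches.subst_var]; rfl

theorem key_label {p q : Mix.Pre} {a : Key} (h : p.key = a) (h' : q.key = a.dual) :
    (∀ {l v m}, p = .out l v → q = .inp m → m = l) ∧ ∀ {l v m}, q = .out l v → p = .inp m → m = l := by
  subst h
  constructor
  · rintro l v m rfl rfl; exact congrArg Prod.fst h'
  · rintro l v m rfl rfl; exact (congrArg Prod.fst h').symm

/-- Except for a committed output and a plain external input, each thread communicates on a channel
held by its item. Held channels are exclusive, so either both threads belong to the same item, and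
its state determines the transition, or a committed internal choice meets its external partner on a
source channel. -/
theorem Inv.com_trans {C : Cfg} (h : Inv Γ S₀ N C) {X : Finset ℕ} (hX : ∀ k ∈ C.chans, k ∈ X)
    {p : Port} {q v P Q r KP KQ tP tQ}
    (ht : C.tgt = .out (.var p.nm) v P ::ₘ .inp q (.var p.flip.nm) Q ::ₘ r) (hP : Flat P KP tP)
    (hQ : Flat (Q.subst (Subst.inst v)) KQ tQ) (hn : (KP + KQ).Nodup)
    (hL : ∀ k ∈ KP + KQ, k ∉ X) : ∃ C', Trans X C C' ∧
      C'.tgt = tP + (tQ + stay q (.inp q (.var p.flip.nm) Q)) + r := by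
  -- Dead threads are selections and can contribute neither an output nor an input.
  have dead : ∀ {T : Proc}, T ∈ C.tgt → (∀ y l, T ≠ .sel y l .nil) → ∃ I ∈ C.D, T ∈ I.tgt := by
    intro T hT hs
    rcases Multiset.mem_add.1 hT with h' | h'
    · exact mem_tgts.1 h'
    · obtain ⟨_, _, _, _, rfl⟩ := h.dead T h'
      exact absurd rfl (hs _ _)
  obtain ⟨I, hI, h1⟩ := dead (T := .out (.var p.nm) v P) (by rw [ht]; simp) (by simp)
  obtain ⟨I', hI', h2⟩ := dead (T := .inp q (.var p.flip.nm) Q) (by rw [ht]; simp) (by simp)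
  have o := Item.outIn (h.wf I hI) h1
  have i := Item.inpIn (h.wf I' hI') h2
  have hwI := h.wf I hI
  obtain ⟨D₁, hD⟩ := Multiset.exists_cons_of_mem hI
  have oh : p.1 ∈ I.hold ∨ ∃ c lp a pc, I = .ucommit c lp a pc ∧ c.x = p.nm ∧ v = .var pc.flip.nm ∧
      P = .sel (.var pc.nm) (.tag a) ((c.eff lp).deliver (.var pc.nm) a) := by
    cases o with
    | ucommit hx => exact .inr ⟨_, _, _, _, rfl, hx, rfl, rfl⟩
    | _ => exact .inl (by simp [Item.hold, Item.own])
  have ih : p.1 ∈ I'.hold ∨ ∃ d : Ch, I' = .plain d.proc ∧ d.lu = .un ∧ d.w = .ext ∧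
      d.x = p.flip.nm ∧ q = d.q ∧ Q = (d.br.shift 1).offer (.var 0) := by
    generalize hp : p.flip = p' at i
    have hp1 : p.1 = p'.1 := by rw [← hp]
    cases i with
    | plain h3 h4 h5 => exact .inr ⟨_, rfl, h3, h4, h5, rfl, rfl⟩
    | @loop _ u _ hu => exact .inl (by rw [hp1]; exact Item.mem_hold_of_lp (u := u) hu)
    | _ => exact .inl (by rw [hp1]; simp [Item.hold, Item.own])
  rw [hD, Multiset.mem_cons] at hI'
  rcases hI' with rfl | hI'
  · clear oh ih
    obtain ⟨D, K, J, g⟩ := C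
    simp only at hD
    subst hD
    have hnod := h.hold_nodup hI
    generalize hp : p.flip = p' at i ht
    cases o with
    | idle =>
      cases i with
      | loop hu => cases hu
      | idle =>
        rename_i c
        rw [loop_inst, flat_ndList] at hQ
        obtain ⟨p', rfl, rfl⟩ := hQ
        obtain ⟨rfl, rfl⟩ := flat_nil_iff.1 hP
        have hw : c.w = .int ∧ c.lu = .un ∧ c.q = .un := hwI
        have ho : c.opt (some p) = (c.eff (some p)).unOpt (.var c.x) := by
          funext a; simp [Ch.opt, hw.2.1]
        refine ⟨_, .wake (hL p'.1 (by simp)), ?_⟩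
        have := cons_cancel₂ (r' := tgts D₁ + g) ht (by
          simp only [Cfg.tgt, tgts_cons, Item.tgt, Ch.loop]
          simp only [Multiset.cons_add, Multiset.singleton_add])
        subst this
        simp only [Cfg.tgt, tgts_cons, Item.tgt, ho, stay, Ch.loopT, Ch.loop]; abel
    | ucommit hx =>
      rename_i c lp a pc
      cases i with
      | loop hu =>
        exact absurd hx (h.own_src (mem_owns.2 ⟨_, hI, by
          have := Item.mem_hold_of_lp hu
          rw [show p.1 = p.flip.1 from rfl, hp]; exact this⟩) (by simp [Item.src]))
    | left hi =>
      rename_i c d lp a i' s' l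
      have key : ∀ {u : Port}, lp = some u → p.flip = u.flip → False := by
        rintro u rfl hu
        have : p.1 = u.1 := by have := congrArg Prod.fst hu; exact this
        simp [Item.hold, lown, this] at hnod
      cases i with
      | loop hu => exact (key hu hp).elim
      | left hi' => rw [hi] at hi'; cases hi'
      | right hj =>
        rename_i m j
        have hw : _ ∧ _ ∧ _ ∧ _ ∧ (c.pre i').key = a ∧ (d.pre j).key = a.dual ∧ _ := hwI
        obtain rfl := (key_label hw.2.2.2.2.1 hw.2.2.2.2.2.1).1 hi hj
        rw [c.flat_cont_out hi] at hP
        obtain ⟨t, hP, rfl⟩ := hP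
        rw [AProc.enc_subst] at hQ
        obtain ⟨C', h3, h4⟩ := h.done_trans hX (by rw [hi, hj]; exact .out) hP hQ hn hL
        refine ⟨C', h3, ?_⟩
        have := cons_cancel₂ (r' := c.loopT lp + (tgts D₁ + g)) ht (by
          simp only [Cfg.tgt, tgts_cons, Item.tgt, Side.tgt, Encoding.Branches.comm,
            show (c.eff lp).pre i' = _ from hi, show d.br.pre j = _ from hj]
          simp only [Multiset.cons_add, Multiset.singleton_add, add_assoc]
          rfl)
        rw [h4, this]
        simp only [stay]; abel
    | right hj =>
      rename_i c d lp a pc s j l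
      have key : ∀ {u : Port}, lp = some u → p' = u.flip → False := by
        rintro u rfl rfl
        have : pc.1 = u.1 := by have := congrArg Prod.fst hp; exact this
        simp [Item.hold, lown, this] at hnod
      cases i with
      | loop hu => exact (key hu rfl).elim
      | right hj' => rw [hj] at hj'; cases hj'
      | left hi =>
        rename_i m i'
        have hw : _ ∧ _ ∧ _ ∧ _ ∧ (c.pre i').key = a ∧ (d.pre j).key = a.dual ∧ _ := hwI
        obtain rfl := (key_label hw.2.2.2.2.1 hw.2.2.2.2.2.1).2 hj hi
        rw [c.flat_cont_inp hi] at hQ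
        obtain ⟨t, hQ, rfl⟩ := hQ
        obtain ⟨C', h3, h4⟩ := h.done_trans hX (by rw [hi, hj]; exact .inp) hQ hP
          (by rwa [add_comm]) (by rwa [add_comm])
        refine ⟨C', h3, ?_⟩
        have := cons_cancel₂ (r' := c.loopT lp + (tgts D₁ + g)) ht (by
          simp only [Cfg.tgt, tgts_cons, Item.tgt, Side.tgt, Encoding.Branches.comm,
            show (c.eff lp).pre i' = _ from hi, show d.br.pre j = _ from hj]
          simp only [← Multiset.singleton_add]
          simp only [Ch.br, Ch.eff]
          abel)
        rw [h4, this]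
        simp only [stay]; abel
  · obtain ⟨D₂, rfl⟩ := Multiset.exists_cons_of_mem hI'
    rcases oh with oh | ⟨c, lp, a, pc, rfl, hcx, rfl, rfl⟩
    · rcases ih with ih | ⟨d, rfl, hl, hw, hx, rfl, rfl⟩
      · exact absurd ih (h.hold_disj hD oh hI')
      · exact absurd hx (h.excl hD oh (by simp [Item.src]))
    · rcases ih with ih | ⟨d, rfl, hl, hw, hx, rfl, rfl⟩
      · rw [Multiset.cons_swap] at hD
        exact absurd hcx (h.excl hD ih (by simp [Item.src]))
      · have hwc : c.w = .int ∧ c.LpOK lp ∧ c.lu = .un ∧ a ∈ c.br.keys := hwI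
        obtain ⟨e1, e2, e3⟩ := h.dual_keys (c := c) (d := d) (by rw [hD]; simp [Item.src])
          (by rw [hD]; simp [Item.src]) hcx hx hwc.1
        obtain ⟨D, K, J, g⟩ := C
        simp only at hD
        subst hD
        refine ⟨_, .commUn ⟨hwc.1, e2, e1, p, hcx, hx⟩ hwc.2.2.1 (e3 a hwc.2.2.2), ?_⟩
        obtain ⟨rfl, rfl⟩ := (flat_thr_iff (by exact trivial)).1 hP
        rw [offer_inst, flat_thr_iff (by exact trivial)] at hQ
        obtain ⟨rfl, rfl⟩ := hQ
        have := cons_cancel₂ (r' := c.loopT lp + (tgts D₂ + g)) ht (by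
          simp only [Cfg.tgt, tgts_cons, Item.tgt, Ch.enc_un hl hw, hcx, hx, Encoding.Branches.unExt]
          simp only [← Multiset.singleton_add]; abel)
        rw [this]
        simp only [Cfg.tgt, tgts_cons, tgts_add, Item.tgt, Ch.tgts_keep hl hw, hx,
          Encoding.Branches.unExt]
        simp only [← Multiset.singleton_add]; abel

end MixedSessions

namespace MixedSessions

open PCalc (Flat)
open CMV

variable {Γ : Ctx} {S₀ : Mix.Proc} {N : ℕ}

theorem exists_fired_get {ι : Type} (p : Port) (l : List ι) (j : Fin l.length) :
    ∃ g, Fired p l (l.get j) g ∧ sels p l.length = .sel (.var p.flip.nm) (.idx j) .nil ::ₘ g := by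
  obtain ⟨g, hg⟩ := Multiset.exists_cons_of_mem (mem_sels.2 ⟨j, rfl⟩ :
    Proc.sel (.var p.flip.nm) (.idx j) .nil ∈ sels p l.length)
  exact ⟨g, ⟨j, rfl, hg⟩, hg⟩

theorem extLab_eq {B : Encoding.Branches} {a : Key} {j : Fin B.keys.length}
    (h : Lab.tag a = B.extLab j) : B.keys.get j = a.dual := by
  have : a = (B.keys.get j).dual := by injection h
  rw [this, Key.dual_dual]

theorem flat_deliver_iff {B : Encoding.Branches} {y : Val} {a : Key} {K : Multiset ℕ}
    {t : Multiset Proc} : Flat (B.deliver y a) K t ↔ ∃ p : Port, K = {p.1} ∧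
      t = ndT p (B.group a) (B.comm y) := by
  rw [B.deliver_eq, flat_ndList]

/-- The same dichotomy as for communications: both threads lie in one item, or a committed linear
choice selects at its external partner. -/
theorem Inv.sel_trans {C : Cfg} (h : Inv Γ S₀ N C) {X : Finset ℕ}
    {p : Port} {n : ℕ} {l : Lab} {P : Proc} {lab : Fin n ↪ Lab} {Q : Fin n → Proc} {j : Fin n} {r KP KQ tP tQ}
    (hl : l = lab j)
    (ht : C.tgt = .sel (.var p.nm) l P ::ₘ .bran (.var p.flip.nm) n lab Q ::ₘ r) (hP : Flat P KP tP)
    (hQ : Flat (Q j) KQ tQ) (hn : (KP + KQ).Nodup)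
    (hL : ∀ k ∈ KP + KQ, k ∉ X) : ∃ C', Trans X C C' ∧ C'.tgt = tP + tQ + r := by
  obtain ⟨I', hI', h2⟩ : ∃ I ∈ C.D, Proc.bran (.var p.flip.nm) n lab Q ∈ I.tgt := by
    have : Proc.bran (.var p.flip.nm) n lab Q ∈ C.tgt := by rw [ht]; simp
    rcases Multiset.mem_add.1 this with h' | h'
    · exact mem_tgts.1 h'
    · obtain ⟨_, _, _, _, h''⟩ := h.dead _ h'
      cases h''
  have i := Item.branIn (h.wf I' hI') h2
  have ih : p.1 ∈ I'.hold ∨ ∃ d : Ch, I' = .plain d.proc ∧ d.lu = .lin ∧ d.w = .ext ∧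
      d.x = p.flip.nm ∧ (∀ a, lab j = .tag a → a.dual ∈ d.br.keys ∧
        Q j = d.br.deliver (.var d.x) a.dual) := by
    generalize hp : p.flip = p' at i
    have hp1 : p.1 = p'.1 := by rw [← hp]
    cases i with
    | plain h3 h4 h5 =>
      refine .inr ⟨_, rfl, h3, h4, h5, fun a ha => ?_⟩
      rw [← extLab_eq ha.symm]
      exact ⟨List.get_mem _ _, rfl⟩
    | _ => exact .inl (by rw [hp1]; simp [Item.hold, Item.own, Side.own])
  obtain ⟨I, hI, h1⟩ : ∃ I ∈ C.D, Proc.sel (.var p.nm) l P ∈ I.tgt := by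
    have : Proc.sel (.var p.nm) l P ∈ C.tgt := by rw [ht]; simp
    rcases Multiset.mem_add.1 this with h' | h'
    · exact mem_tgts.1 h'
    -- A dead selection finds no branching: its channel is neither held by an item nor the channel
    -- of a represented choice.
    · obtain ⟨k, hk, o, m, h''⟩ := h.dead _ h'
      injection h'' with h''
      rw [Val.var.injEq, nm_inj] at h''
      rw [← h''.1] at hk
      rcases ih with ih | ⟨d, rfl, h3, h4, h5, _⟩
      · exact absurd hk (h.dead_hold hI' ih)
      · exact absurd h5 (h.dead_src hk (mem_srcs.2 ⟨_, hI', by simp [Item.src]⟩))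
  have o := Item.selIn (h.wf I hI) h1
  have hwI := h.wf I hI
  obtain ⟨D₁, hD⟩ := Multiset.exists_cons_of_mem hI
  have oh : p.1 ∈ I.hold ∨ ∃ c a, I = .lcommit c a ∧ c.x = p.nm ∧ l = .tag a ∧
      P = c.br.deliver (.var c.x) a := by
    cases o with
    | lcommit hx => exact .inr ⟨_, _, rfl, hx, rfl, rfl⟩
    | _ => exact .inl (by simp [Item.hold, Item.own, Side.own])
  rw [hD, Multiset.mem_cons] at hI'
  rcases hI' with rfl | hI'
  · clear oh ih
    obtain ⟨D, K, J, g⟩ := C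
    simp only at hD
    subst hD
    have hnod := h.hold_nodup hI
    generalize hp : p.flip = p' at i ht
    cases o with
    | nd =>
      rename_i c lp p₁ i₀
      cases i
      have hj : i₀ = (j : ℕ) := by injection hl
      subst hj
      beta_reduce at hQ
      obtain ⟨rfl, rfl⟩ := flat_nil_iff.1 hP
      obtain ⟨g', hf, hg⟩ := exists_fired_get p' c.br.keys j
      have := cons_cancel₂ (r' := g' + (c.loopT lp + (tgts D₁ + g))) ht (by
          simp only [Cfg.tgt, tgts_cons, Item.tgt, ndT_eq, hg]
          simp only [← Multiset.singleton_add]; abel)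
      subst this
      cases hlu : c.lu with
      | lin =>
        have ho : c.opt lp (c.br.keys.get j) = .sel (.var c.x) (.tag (c.br.keys.get j))
            (c.br.deliver (.var c.x) (c.br.keys.get j)) := by simp [Ch.opt, hlu]
        have hlp : lp = none := by
          have hc : c.w = .int ∧ c.LpOK lp := hwI
          cases lp with
          | none => rfl
          | some u => have := hc.2.1; rw [hlu] at this; cases this
        rw [ho, flat_thr_iff (by exact trivial)] at hQ
        obtain ⟨rfl, rfl⟩ := hQ
        refine ⟨_, .pickLin hlu hf, ?_⟩
        subst hlp
        simp only [Cfg.tgt, tgts_cons, Item.tgt, Ch.loopT]; abel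
      | un =>
        have ho : c.opt lp (c.br.keys.get j) = (c.eff lp).unOpt (.var c.x) (c.br.keys.get j) := by
          simp [Ch.opt, hlu]
        rw [ho, flat_unOpt] at hQ
        obtain ⟨pc, rfl, rfl⟩ := hQ
        refine ⟨_, .pickUn (pc := pc) hlu hf (hL pc.1 (by simp)), ?_⟩
        simp only [Cfg.tgt, tgts_cons, Item.tgt]
        simp only [← Multiset.singleton_add]; abel
    | lcommit hx => cases i
    | presel =>
      rename_i c d lp a
      cases i
      have hw : Opposed c d ∧ c.LpOK lp ∧ c.lu = .un ∧ a ∈ c.br.keys ∧ a.dual ∈ d.br.keys := hwI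
      beta_reduce at hQ
      rw [extLab_eq hl] at hQ
      obtain ⟨p₁, rfl, rfl⟩ := flat_deliver_iff.1 hP
      obtain ⟨p₂, rfl, rfl⟩ := flat_deliver_iff.1 hQ
      refine ⟨_, .select (p := p₁) (p' := p₂) hw.2.2.1 hw.2.2.2.2 (hL _ (by simp)) (hL _ (by simp))
        (by simpa using hn), ?_⟩
      have := cons_cancel₂ (r' := c.loopT lp + (tgts D₁ + g)) ht (by
          simp only [Cfg.tgt, tgts_cons, Item.tgt, Encoding.Branches.offer]
          simp only [← Multiset.singleton_add]; abel)
      rw [this]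
      simp only [Cfg.tgt, tgts_cons, Item.tgt, Side.tgt]; abel
    | left =>
      rename_i c d lp a pc p₁ s' i₀
      cases i with
      | left =>
        have hj : i₀ = (j : ℕ) := by injection hl
        subst hj
        beta_reduce at hQ
        obtain ⟨rfl, rfl⟩ := flat_nil_iff.1 hP
        obtain ⟨g', hf, hg⟩ := exists_fired_get p' ((c.eff lp).group a) j
        have := cons_cancel₂ (r' := g' + (Side.tgt d.br (.var pc.flip.nm) a.dual s' +
          c.loopT lp + (tgts D₁ + g))) ht (by
            simp only [Cfg.tgt, tgts_cons, Item.tgt, Side.tgt, ndT_eq, hg]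
            simp only [← Multiset.singleton_add]; abel)
        subst this
        obtain ⟨rfl, rfl⟩ := (flat_thr_iff (by unfold Encoding.Branches.comm; split <;> trivial)).1 hQ
        refine ⟨_, .left hf, ?_⟩
        simp only [Cfg.tgt, tgts_cons, Item.tgt, Side.tgt]; abel
      | right =>
        have : p₁.1 = p'.1 := by have := congrArg Prod.fst hp; exact this
        simp [Item.hold, Side.own, this] at hnod
    | right =>
      rename_i c d lp a pc p₁ s i₀
      cases i with
      | right =>
        have hj : i₀ = (j : ℕ) := by injection hl
        subst hj
        beta_reduce at hQ
        obtain ⟨rfl, rfl⟩ := flat_nil_iff.1 hP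
        obtain ⟨g', hf, hg⟩ := exists_fired_get p' (d.br.group a.dual) j
        have := cons_cancel₂ (r' := g' + (Side.tgt (c.eff lp) (.var pc.nm) a s +
          c.loopT lp + (tgts D₁ + g))) ht (by
            simp only [Cfg.tgt, tgts_cons, Item.tgt, Side.tgt, ndT_eq, hg]
            simp only [← Multiset.singleton_add]; abel)
        subst this
        obtain ⟨rfl, rfl⟩ := (flat_thr_iff (by unfold Encoding.Branches.comm; split <;> trivial)).1 hQ
        refine ⟨_, .right hf, ?_⟩
        simp only [Cfg.tgt, tgts_cons, Item.tgt, Side.tgt]; abel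
      | left =>
        have : p₁.1 = p'.1 := by have := congrArg Prod.fst hp; exact this
        simp [Item.hold, Side.own, this] at hnod
  · obtain ⟨D₂, rfl⟩ := Multiset.exists_cons_of_mem hI'
    rcases oh with oh | ⟨c, a, rfl, hcx, rfl, rfl⟩
    · rcases ih with ih | ⟨d, rfl, h3, h4, hx, _⟩
      · exact absurd ih (h.hold_disj hD oh hI')
      · exact absurd hx (h.excl hD oh (by simp [Item.src]))
    · rcases ih with ih | ⟨d, rfl, h3, h4, hx, h5⟩
      · rw [Multiset.cons_swap] at hD
        exact absurd hcx (h.excl hD ih (by simp [Item.src]))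
      · have hwc : c.w = .int ∧ c.q = .lin ∧ c.lu = .lin ∧ a ∈ c.br.keys := hwI
        obtain ⟨e1, e2, e3⟩ := h.dual_keys (c := c) (d := d) (by rw [hD]; simp [Item.src])
          (by rw [hD]; simp [Item.src]) hcx hx hwc.1
        obtain ⟨D, K, J, g⟩ := C
        simp only at hD
        subst hD
        obtain ⟨h6, h7⟩ := h5 a hl.symm
        rw [h7] at hQ
        obtain ⟨p₁, rfl, rfl⟩ := flat_deliver_iff.1 hP
        obtain ⟨p₂, rfl, rfl⟩ := flat_deliver_iff.1 hQ
        refine ⟨_, .commLin (p := p₁) (p' := p₂) ⟨hwc.1, h4, e1, p, hcx, hx⟩ hwc.2.2.1 hcx hx h6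
          (hL _ (by simp)) (hL _ (by simp)) (by simpa using hn), ?_⟩
        have e : (Item.plain d.proc).tgt = {Proc.bran (.var p.flip.nm) n lab Q} := by
          rw [Item.tgt, Ch.enc_lin h3 h4]
          rw [Item.tgt, Ch.enc_lin h3 h4, Multiset.mem_singleton] at h2
          rw [h2]
        have := cons_cancel₂ (r' := tgts D₂ + g) ht (by
          simp only [Cfg.tgt, tgts_cons, e]
          simp only [Item.tgt, hcx]
          simp only [← Multiset.singleton_add]; abel)
        rw [this]
        simp only [Cfg.tgt, tgts_cons, Item.tgt, Side.tgt, Ch.loopT, c.eff_none, hcx, hx]; abel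

theorem Inv.cond_step {C : Cfg} (h : Inv Γ S₀ N C) {X : Finset ℕ} (hX : ∀ k ∈ C.chans, k ∈ X)
    {v : Val} {P Q R : Proc} {r L t} (ht : C.tgt = .cond v P Q ::ₘ r)
    (hv : v = .tt ∧ R = P ∨ v = .ff ∧ R = Q) (hf : Flat R L t) (hn : L.Nodup)
    (hL : ∀ k ∈ L, k ∉ X) : ∃ C', Trans X C C' ∧ C'.tgt = t + r := by
  obtain ⟨I, hI, h1⟩ : ∃ I ∈ C.D, Proc.cond v P Q ∈ I.tgt := by
    have : Proc.cond v P Q ∈ C.tgt := by rw [ht]; simp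
    rcases Multiset.mem_add.1 this with h' | h'
    · exact mem_tgts.1 h'
    · obtain ⟨_, _, _, _, h''⟩ := h.dead _ h'
      cases h''
  obtain ⟨A, B, rfl, rfl, rfl⟩ := Item.cond_mem (h.wf I hI) h1
  obtain ⟨D₁, hD⟩ := Multiset.exists_cons_of_mem hI
  obtain ⟨D, K, J, g⟩ := C
  simp only at hD
  subst hD
  obtain ⟨A', hv', rfl⟩ : ∃ A', (v = .tt ∧ A' = A ∨ v = .ff ∧ A' = B) ∧ R = A'.enc := by
    rcases hv with ⟨rfl, rfl⟩ | ⟨rfl, rfl⟩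
    exacts [⟨A, .inl ⟨rfl, rfl⟩, rfl⟩, ⟨B, .inr ⟨rfl, rfl⟩, rfl⟩]
  obtain ⟨C', h2, h3⟩ := h.cond_trans hX hv' hf hn hL
  refine ⟨C', h2, ?_⟩
  rw [h3]
  have e : Cfg.tgt ⟨.plain (.cond v A B) ::ₘ D₁, K, J, g⟩ =
      .cond v A.enc B.enc ::ₘ (tgts D₁ + g) := by
    simp only [Cfg.tgt, tgts_cons, Item.tgt, AProc.enc, Multiset.cons_add, Multiset.singleton_add]
  rw [e, Multiset.cons_inj_right] at ht
  rw [ht]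

theorem Inv.trans_of_mstep {C : Cfg} (h : Inv Γ S₀ N C) {X : Finset ℕ}
    (hX : ∀ k ∈ C.chans, k ∈ X) {t' : Multiset Proc} (hs : MStep X C.tgt t') :
    ∃ C', Trans X C C' ∧ C'.tgt = t' := by
  generalize ht : C.tgt = t at hs
  cases hs with
  | cond_tt hf hn hL => exact h.cond_step hX ht (.inl ⟨rfl, rfl⟩) hf hn hL
  | cond_ff hf hn hL => exact h.cond_step hX ht (.inr ⟨rfl, rfl⟩) hf hn hL
  | com hP hQ hn hL => exact h.com_trans (p := (_, _)) hX ht hP hQ hn hL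
  | sel j hP hQ hn hL => exact h.sel_trans (p := (_, _)) rfl ht hP hQ hn hL

end MixedSessions

namespace MixedSessions

open PCalc (Flat)
open CMV

variable {Γ : Ctx} {S₀ : Mix.Proc} {N : ℕ}

/-! ### Processes that are represented by configurations -/

/-- The process `T` is represented by `C`, and both do not use the channels in `Y`. -/
structure World (Γ : Ctx) (S₀ : Mix.Proc) (N : ℕ) (Y : Finset ℕ) (T : Proc) (C : Cfg) : Prop where
  rep : ∃ Kr, Rep T Kr C.tgt ∧ ∀ k ∈ Kr, k ∉ Y
  inv : Inv Γ S₀ N C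
  off : ∀ k ∈ C.chans, k ∉ Y

namespace World

variable {Y : Finset ℕ} {T : Proc} {C : Cfg}

/-- For transitions whose new channels may be chosen freely; the channels in `Y` stay reserved. -/
theorem trans {p : Cfg → Prop} (h : World Γ S₀ N Y T C)
    (hs : ∀ X : Finset ℕ, Y ⊆ X → ∃ C', Trans X C C' ∧ p C') :
    ∃ T' C', Step T T' ∧ World Γ S₀ N Y T' C' ∧ p C' := by
  obtain ⟨Kr, h1, h2⟩ := h.rep
  obtain ⟨C', h3, h4⟩ := hs (Kr.toFinset ∪ C.chans.toFinset ∪ Y) Finset.subset_union_right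
  obtain ⟨T', Kr', h5, h6, h7⟩ := h1.real (fun k hk => by simp [hk]) (h3.mstep h.inv.wf)
  obtain ⟨h8, h9, _⟩ := h3.inv h.inv fun k hk => by simp [hk]
  refine ⟨T', C', h5, ⟨⟨Kr', h6, fun k hk => ?_⟩, h8, fun k hk => ?_⟩, h4⟩
  · rcases h7 k hk with h' | h'
    · exact h2 k h'
    · simp only [Finset.mem_union, not_or] at h'; exact h'.2
  · rcases h9 k hk with h' | h'
    · exact h.off k h'
    · simp only [Finset.mem_union, not_or] at h'; exact h'.2

/-- For transitions that spend the reserved channels: the flattening to be reached was fixed in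
advance with channels from `Y`, which are now admitted as new. -/
theorem use {p : Cfg → Prop} (h : World Γ S₀ N Y T C)
    (hs : ∀ X : Finset ℕ, (∀ k ∈ C.chans, k ∈ X) → (∀ k ∈ Y, k ∉ X) → ∃ C', Trans X C C' ∧ p C') :
    ∃ T' C', Step T T' ∧ World Γ S₀ N ∅ T' C' ∧ p C' := by
  obtain ⟨Kr, h1, h2⟩ := h.rep
  obtain ⟨C', h3, h4⟩ := hs (Kr.toFinset ∪ C.chans.toFinset) (fun k hk => by simp [hk]) fun k hk hk' => by
    rcases Finset.mem_union.1 hk' with h' | h'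
    · exact h2 k (by simpa using h') hk
    · exact h.off k (by simpa using h') hk
  obtain ⟨T', Kr', h5, h6, _⟩ := h1.real (fun k hk => by simp [hk]) (h3.mstep h.inv.wf)
  obtain ⟨h8, _, _⟩ := h3.inv h.inv fun k hk => by simp [hk]
  exact ⟨T', C', h5, ⟨⟨Kr', h6, by simp⟩, h8, by simp⟩, h4⟩

theorem step {T' : Proc} (h : World Γ S₀ N ∅ T C) (hs : Step T T') (X : Finset ℕ) :
    ∃ C', World Γ S₀ N ∅ T' C' ∧ SrcStep X C C' := by
  obtain ⟨Kr, h1, _⟩ := h.rep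
  obtain ⟨Kr', t', h2, h3⟩ := h1.step hs (X ∪ C.chans.toFinset)
  obtain ⟨C', h4, rfl⟩ := h.inv.trans_of_mstep (fun k hk => by simp [hk]) h2
  obtain ⟨h5, _, h6⟩ := h4.inv h.inv fun k hk => by simp [hk]
  refine ⟨C', ⟨⟨Kr', h3, by simp⟩, h5, by simp⟩, ?_⟩
  rcases h6 with h6 | ⟨L, h6, h7, h8⟩
  · exact .inl h6
  · exact .inr ⟨L, h6, h7, fun k hk hk' => h8 k hk (by simp [hk'])⟩

theorem fresh (h : World Γ S₀ N Y T C) (A₁ A₂ : AProc) : ∃ L₁ L₂ s₁ s₂, Flat A₁ L₁ s₁ ∧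
    Flat A₂ L₂ s₂ ∧ (L₁ + L₂).Nodup ∧ World Γ S₀ N (L₁ + L₂).toFinset T C := by
  obtain ⟨Kr, h1, _⟩ := h.rep
  obtain ⟨L₁, s₁, a1, a2, a3⟩ := A₁.exists_flat .var (Kr.toFinset ∪ C.chans.toFinset)
  obtain ⟨L₂, s₂, b1, b2, b3⟩ := A₂.exists_flat .var (Kr.toFinset ∪ C.chans.toFinset ∪ L₁.toFinset)
  rw [AProc.subst_var] at a1 b1
  refine ⟨L₁, L₂, s₁, s₂, a1, b1, Multiset.nodup_add.2 ⟨a2, b2, Multiset.disjoint_left.2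
    fun hk hk' => b3 _ hk' (by simp [hk])⟩, ⟨Kr, h1, fun k hk hk' => ?_⟩, h.inv, fun k hk hk' => ?_⟩
  all_goals
    rw [Multiset.mem_toFinset, Multiset.mem_add] at hk'
    rcases hk' with hk' | hk'
    exacts [a3 k hk' (by simp [hk]), b3 k hk' (by simp [hk])]

variable {c d : Ch} {lp : Option Port} {a : Key} {pc p : Port} {r : Multiset Item}
  {K J : Multiset ℕ} {g : Multiset Proc}

theorem choose_left {s' : Side d.n} {i : Fin c.n}
    (h : World Γ S₀ N Y T ⟨.flight c d lp a pc (.nd p) s' ::ₘ r, K, J, g⟩)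
    (hi : (c.pre i).key = a) : ∃ T' J' g', Step T T' ∧
      World Γ S₀ N Y T' ⟨.flight c d lp a pc (.chosen i) s' ::ₘ r, K, J', g'⟩ := by
  obtain ⟨g', hg⟩ := exists_fired p (l := (c.eff lp).group a) (a := i)
    (Encoding.Branches.mem_group.2 hi)
  obtain ⟨T', C', h1, h2, rfl⟩ := h.trans (p := (· = _)) fun X _ => ⟨_, .left hg, rfl⟩
  exact ⟨T', _, _, h1, h2⟩

theorem choose_right {s : Side c.n} {j : Fin d.n}
    (h : World Γ S₀ N Y T ⟨.flight c d lp a pc s (.nd p) ::ₘ r, K, J, g⟩)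
    (hj : (d.pre j).key = a.dual) : ∃ T' J' g', Step T T' ∧
      World Γ S₀ N Y T' ⟨.flight c d lp a pc s (.chosen j) ::ₘ r, K, J', g'⟩ := by
  obtain ⟨g', hg⟩ := exists_fired p (l := d.br.group a.dual) (a := j)
    (Encoding.Branches.mem_group.2 hj)
  obtain ⟨T', C', h1, h2, rfl⟩ := h.trans (p := (· = _)) fun X _ => ⟨_, .right hg, rfl⟩
  exact ⟨T', _, _, h1, h2⟩

/-- The flattenings of the continuations are given, so that exactly the prescribed source
configuration is reached and not just one that differs in its channels. -/
theorem finish {i : Fin c.n} {j : Fin d.n}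
    (h : World Γ S₀ N Y T ⟨.flight c d lp a pc (.chosen i) (.chosen j) ::ₘ r, K, J, g⟩)
    {A₁ A₂ L₁ L₂ s₁ s₂} (hcomm : Comm (c.pre i) (d.pre j) (c.cont i) (d.cont j) A₁ A₂)
    (h1 : Flat A₁ L₁ s₁) (h2 : Flat A₂ L₂ s₂) (hn : (L₁ + L₂).Nodup) (hL : ∀ k ∈ L₁ + L₂, k ∈ Y) :
    ∃ T' C', Step T T' ∧ World Γ S₀ N ∅ T' C' ∧ C'.K = K + (L₁ + L₂) ∧ ∃ E, C'.D = E + r ∧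
      srcs E = s₁ + (s₂ + astay c.q c.proc) ∧ ∀ I ∈ E, I.Init := by
  have hw := h.inv.wf _ (Multiset.mem_cons_self _ _)
  refine h.use fun X hCX hY => ?_
  have hcl := h.inv.closed_red (X := X) hCX (h.inv.sred_done hcomm h1 h2) hn fun k hk => hY k (hL k hk)
  obtain ⟨E₁, d1, rfl, n1, o1⟩ := Dec.of_src h1 (fun B hB => hcl B (by simp [hB])) (X ∪ Y)
  obtain ⟨E₂, d2, rfl, n2, o2⟩ := Dec.of_src h2 (fun B hB => hcl B (by simp [hB]))
    (X ∪ Y ∪ (owns E₁).toFinset)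
  have e : (L₁ + owns E₁) + (L₂ + owns E₂) = (L₁ + L₂) + (owns E₁ + owns E₂) := by abel
  refine ⟨_, .done hw.1 hcomm d1 d2 ?_ ?_, rfl, E₁ + (E₂ + c.back lp), by simp only [add_assoc], ?_, ?_⟩
  · rw [e]
    refine Multiset.nodup_add.2 ⟨hn, Multiset.nodup_add.2 ⟨n1, n2, Multiset.disjoint_left.2
      fun hk hk' => o2 _ hk' (by simp [hk])⟩, Multiset.disjoint_left.2 fun hk hk' => ?_⟩
    rcases Multiset.mem_add.1 hk' with h' | h'
    exacts [o1 _ h' (by simp [hL _ hk]), o2 _ h' (by simp [hL _ hk])]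
  · intro k hk hkX
    rw [e] at hk
    rcases Multiset.mem_add.1 hk with hk | hk
    · exact hY k (hL k hk) hkX
    · rcases Multiset.mem_add.1 hk with h' | h'
      exacts [o1 _ h' (by simp [hkX]), o2 _ h' (by simp [hkX])]
  · simp only [srcs_add, srcs_back hw.2.1]
  · intro I hI
    simp only [Multiset.mem_add] at hI
    rcases hI with hI | hI | hI
    · exact (d1.init I hI).1
    · exact (d2.init I hI).1
    · obtain ⟨u, _, rfl⟩ := Ch.mem_back hI
      trivial

end World

theorem exists_comm {p q : Mix.Pre} (h : q.key = p.key.dual) (P Q : AProc) :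
    ∃ A₁ A₂, Comm p q P Q A₁ A₂ := by
  cases p with
  | out l v =>
    cases q with
    | out => cases (congrArg Prod.snd h : _)
    | inp m =>
      obtain rfl : m = l := congrArg Prod.fst h
      exact ⟨_, _, .out⟩
  | inp l =>
    cases q with
    | inp => cases (congrArg Prod.snd h : _)
    | out m v =>
      obtain rfl : m = l := congrArg Prod.fst h
      exact ⟨_, _, .inp⟩

/-! ### Completing communications and making commitments -/

/-- Whether a communication is in progress. -/
def Item.busy : Item → ℕ
  | .presel .. => 1
  | .flight .. => 1
  | _ => 0

/-- Whether an internal choice has been made but not been communicated. -/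
def Item.com : Item → ℕ
  | .lcommit .. => 1
  | .ucommit .. => 1
  | _ => 0

/-- The number of communications in progress. -/
def busy (D : Multiset Item) : ℕ := (D.map Item.busy).sum

/-- The number of internal choices that have been made but not been communicated. -/
def coms (D : Multiset Item) : ℕ := (D.map Item.com).sum

theorem Item.Init.busy {I : Item} (h : I.Init) : I.busy = 0 := by
  cases I <;> first | rfl | exact h.elim

theorem Item.Init.com {I : Item} (h : I.Init) : I.com = 0 := by
  cases I <;> first | rfl | exact h.elim

theorem busy_init {E : Multiset Item} (h : ∀ I ∈ E, I.Init) : busy E = 0 :=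
  Multiset.sum_eq_zero fun x hx => by
    obtain ⟨I, hI, rfl⟩ := Multiset.mem_map.1 hx
    exact (h I hI).busy

theorem coms_init {E : Multiset Item} (h : ∀ I ∈ E, I.Init) : coms E = 0 :=
  Multiset.sum_eq_zero fun x hx => by
    obtain ⟨I, hI, rfl⟩ := Multiset.mem_map.1 hx
    exact (h I hI).com

section
variable (I : Item) (D E : Multiset Item)
@[simp] theorem busy_cons : busy (I ::ₘ D) = I.busy + busy D := by simp [busy]
@[simp] theorem busy_add : busy (D + E) = busy D + busy E := by simp [busy]
@[simp] theorem coms_cons : coms (I ::ₘ D) = I.com + coms D := by simp [coms]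
@[simp] theorem coms_add : coms (D + E) = coms D + coms E := by simp [coms]
end

theorem keep_init (d : Ch) : ∀ I ∈ d.keep, I.Init := fun I hI => by
  obtain ⟨_, rfl⟩ := Ch.mem_keep.1 hI
  trivial

namespace World

variable {Y : Finset ℕ} {T : Proc} {C : Cfg}
variable {c d : Ch} {lp : Option Port} {a : Key} {pc p : Port} {r : Multiset Item}
  {K J : Multiset ℕ} {g : Multiset Proc}

/-- The selected key occurs on both sides, so each undecided side has a branch to pick, and dual
keys guarantee that the two branches can communicate. -/
theorem settle_flight {s : Side c.n} {s' : Side d.n}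
    (h : World Γ S₀ N Y T ⟨.flight c d lp a pc s s' ::ₘ r, K, J, g⟩) :
    ∃ T' C', Steps T T' ∧ World Γ S₀ N ∅ T' C' ∧ ∃ E, C'.D = E + r ∧ ∀ I ∈ E, I.Init := by
  have hw := h.inv.wf _ (Multiset.mem_cons_self _ _)
  obtain ⟨T₁, i, J₁, g₁, r1, hi, h1⟩ : ∃ T' i J' g', Steps T T' ∧ (c.pre i).key = a ∧
      World Γ S₀ N Y T' ⟨.flight c d lp a pc (.chosen i) s' ::ₘ r, K, J', g'⟩ := by
    cases s with
    | nd p =>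
      obtain ⟨i, hi⟩ := Encoding.Branches.mem_keys.1 hw.2.2.1
      obtain ⟨T', J', g', h1, h2⟩ := h.choose_left hi
      exact ⟨T', i, J', g', .single h1, hi, h2⟩
    | chosen i => exact ⟨T, i, J, g, .refl, hw.2.2.2.2.1, h⟩
  obtain ⟨T₂, j, J₂, g₂, r2, hj, h2⟩ : ∃ T' j J' g', Steps T₁ T' ∧ (d.pre j).key = a.dual ∧
      World Γ S₀ N Y T' ⟨.flight c d lp a pc (.chosen i) (.chosen j) ::ₘ r, K, J', g'⟩ := by
    cases s' with
    | nd p =>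
      obtain ⟨j, hj⟩ := Encoding.Branches.mem_keys.1 hw.2.2.2.1
      obtain ⟨T', J', g', h1, h2⟩ := h1.choose_right (j := j) hj
      exact ⟨T', j, J', g', .single h1, hj, h2⟩
    | chosen j => exact ⟨T₁, j, J₁, g₁, .refl, hw.2.2.2.2.2.1, h1⟩
  obtain ⟨A₁, A₂, hc⟩ := exists_comm (p := c.pre i) (q := d.pre j) (by rw [hi, hj]) (c.cont i) (d.cont j)
  obtain ⟨L₁, L₂, s₁, s₂, f1, f2, f3, h3⟩ := h2.fresh A₁ A₂
  obtain ⟨T₃, C', r3, h4, _, E, e1, _, e2⟩ := h3.finish hc f1 f2 f3 (by simp)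
  exact ⟨T₃, C', (r1.trans r2).tail r3, h4, E, e1, e2⟩

theorem select (h : World Γ S₀ N Y T ⟨.presel c d lp a pc ::ₘ r, K, J, g⟩) :
    ∃ T' p p', Step T T' ∧
      World Γ S₀ N Y T' ⟨.flight c d lp a pc (.nd p) (.nd p') ::ₘ r, K, J, g⟩ := by
  have hw := h.inv.wf _ (Multiset.mem_cons_self _ _)
  obtain ⟨T', C', h1, h2, p, p', rfl⟩ := h.trans (p := fun C' => ∃ p p', C' =
      ⟨.flight c d lp a pc (.nd p) (.nd p') ::ₘ r, K, J, g⟩)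
    fun X _ => by
      obtain ⟨k, hk⟩ := Infinite.exists_notMem_finset X
      obtain ⟨k', hk'⟩ := Infinite.exists_notMem_finset (insert k X)
      rw [Finset.mem_insert, not_or] at hk'
      exact ⟨_, .select (p := (k, true)) (p' := (k', true)) hw.2.2.1 hw.2.2.2.2 hk hk'.2 (Ne.symm hk'.1),
        _, _, rfl⟩
  exact ⟨T', p, p', h1, h2⟩

/-- All communications in progress can be completed. -/
theorem settle {n : ℕ} : ∀ {T C}, World Γ S₀ N ∅ T C → busy C.D = n →
    ∃ T' C', Steps T T' ∧ World Γ S₀ N ∅ T' C' ∧ busy C'.D = 0 := by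
  induction n with
  | zero => exact fun {T C} h hb => ⟨T, C, .refl, h, hb⟩
  | succ n ih =>
    intro T C h hb
    obtain ⟨I, hI, hne⟩ : ∃ I ∈ C.D, I.busy ≠ 0 := by
      by_contra! hh
      have : busy C.D = 0 := Multiset.sum_eq_zero fun x hx => by
        obtain ⟨I, hI, rfl⟩ := Multiset.mem_map.1 hx
        exact hh I hI
      omega
    obtain ⟨r, hr⟩ := Multiset.exists_cons_of_mem hI
    obtain ⟨D, K, J, g⟩ := C
    simp only at hr hb
    subst hr
    have key : ∀ {T₁ C₁}, Steps T T₁ → World Γ S₀ N ∅ T₁ C₁ → (∃ E, C₁.D = E + r ∧ ∀ I ∈ E, I.Init) →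
        I.busy = 1 → ∃ T' C', Steps T T' ∧ World Γ S₀ N ∅ T' C' ∧ busy C'.D = 0 := by
      rintro T₁ C₁ r1 h1 ⟨E, e1, e2⟩ hI
      rw [busy_cons, hI] at hb
      obtain ⟨T', C', r2, h2⟩ := ih h1 (by rw [e1, busy_add, busy_init e2]; omega)
      exact ⟨T', C', r1.trans r2, h2⟩
    cases I with
    | presel c d lp a pc =>
      obtain ⟨T₁, p, p', r1, h1⟩ := h.select
      obtain ⟨T₂, C₂, r2, h2, h3⟩ := h1.settle_flight
      exact key (.trans (.single r1) r2) h2 h3 rfl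
    | flight c d lp a pc s s' =>
      obtain ⟨T₂, C₂, r2, h2, h3⟩ := h.settle_flight
      exact key r2 h2 h3 rfl
    | _ => exact absurd rfl hne

end World

/-- The internal choice `c` has been resolved to the key `a`. -/
def Committed (I : Item) (c : Ch) (a : Key) : Prop :=
  I = .lcommit c a ∨ ∃ lp pc, I = .ucommit c lp a pc

/-- The internal choice `c` has not been resolved. -/
def Pending (I : Item) (c : Ch) : Prop := (∃ u, I = .idle c u) ∨ ∃ lp p, I = .nd c lp p

namespace World

variable {Y : Finset ℕ} {T : Proc} {C : Cfg}
variable {c d : Ch} {lp : Option Port} {a : Key} {pc p : Port} {r : Multiset Item}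
  {K J : Multiset ℕ} {g : Multiset Proc} {I : Item}

theorem pick_nd (h : World Γ S₀ N Y T ⟨.nd c lp p ::ₘ r, K, J, g⟩) (ha : a ∈ c.br.keys) :
    ∃ T' I' J' g', Step T T' ∧ World Γ S₀ N Y T' ⟨I' ::ₘ r, K, J', g'⟩ ∧ Committed I' c a := by
  obtain ⟨g', hg⟩ := exists_fired p ha
  cases hl : c.lu with
  | lin =>
    obtain ⟨T', C', h1, h2, rfl⟩ := h.trans (p := (· = _)) fun X _ => ⟨_, .pickLin hl hg, rfl⟩
    exact ⟨T', _, _, _, h1, h2, .inl rfl⟩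
  | un =>
    obtain ⟨T', C', h1, h2, pc, rfl⟩ := h.trans (p := fun C' => ∃ pc, C' =
      ⟨.ucommit c lp a pc ::ₘ r, K, p.1 ::ₘ J, g' + g⟩)
      fun X _ => by
        obtain ⟨k, hk⟩ := Infinite.exists_notMem_finset X
        exact ⟨_, .pickUn (pc := (k, true)) hl hg hk, _, rfl⟩
    exact ⟨T', _, _, _, h1, h2, .inr ⟨_, _, rfl⟩⟩

theorem pick (h : World Γ S₀ N Y T ⟨I ::ₘ r, K, J, g⟩) (hI : Pending I c) (ha : a ∈ c.br.keys) :
    ∃ T' I' J' g', Steps T T' ∧ World Γ S₀ N Y T' ⟨I' ::ₘ r, K, J', g'⟩ ∧ Committed I' c a := by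
  rcases hI with ⟨u, rfl⟩ | ⟨lp, p, rfl⟩
  · obtain ⟨T₁, C', r1, h2, p, rfl⟩ := h.trans (p := fun C' => ∃ p, C' =
      ⟨.nd c (some u) p ::ₘ r, K, J, g⟩)
      fun X _ => by
        obtain ⟨k, hk⟩ := Infinite.exists_notMem_finset X
        exact ⟨_, .wake (p := (k, true)) hk, _, rfl⟩
    obtain ⟨T', I', J', g', r2, h3⟩ := h2.pick_nd ha
    exact ⟨T', I', J', g', .trans (.single r1) (.single r2), h3⟩
  · obtain ⟨T', I', J', g', r2, h3⟩ := h.pick_nd ha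
    exact ⟨T', I', J', g', .single r2, h3⟩

theorem to_flight (h : World Γ S₀ N Y T ⟨I ::ₘ .plain d.proc ::ₘ r, K, J, g⟩) (hI : Committed I c a)
    {q : Port} (hc : c.x = q.nm) (hd : d.x = q.flip.nm) : ∃ T' lp pc p p', Steps T T' ∧
      World Γ S₀ N Y T' ⟨.flight c d lp a pc (.nd p) (.nd p') ::ₘ (d.keep + r), K, J, g⟩ := by
  have hwI := h.inv.wf I (by simp)
  have hcs : c.proc ∈ srcs (I ::ₘ .plain d.proc ::ₘ r) := by
    rcases hI with rfl | ⟨_, _, rfl⟩ <;> simp [Item.src]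
  have hds : d.proc ∈ srcs (I ::ₘ .plain d.proc ::ₘ r) := by simp [Item.src]
  rcases hI with rfl | ⟨lp, pc, rfl⟩
  · have hw : c.w = .int ∧ c.q = .lin ∧ c.lu = .lin ∧ a ∈ c.br.keys := hwI
    obtain ⟨e1, e2, e3⟩ := h.inv.dual_keys hcs hds hc hd hw.1
    obtain ⟨T', C', h1, h2, p, p', rfl⟩ := h.trans (p := fun C' => ∃ p p', C' =
      ⟨.flight c d none a q (.nd p) (.nd p') ::ₘ r, K, J, g⟩)
      fun X _ => by
        obtain ⟨k, hk⟩ := Infinite.exists_notMem_finset X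
        obtain ⟨k', hk'⟩ := Infinite.exists_notMem_finset (insert k X)
        rw [Finset.mem_insert, not_or] at hk'
        exact ⟨_, .commLin (p := (k, true)) (p' := (k', true)) ⟨hw.1, e2, e1, q, hc, hd⟩ hw.2.2.1 hc hd
          (e3 a hw.2.2.2) hk hk'.2 (Ne.symm hk'.1), _, _, rfl⟩
    have hq : d.q = .lin :=
      ((h2.inv.wf _ (Multiset.mem_cons_self _ _)).2.2.2.2.2.2 hw.2.2.1).1
    refine ⟨T', none, q, p, p', .single h1, ?_⟩
    have : d.keep = 0 := by unfold Ch.keep; rw [hq]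
    rw [this, zero_add]
    exact h2
  · have hw : c.w = .int ∧ c.LpOK lp ∧ c.lu = .un ∧ a ∈ c.br.keys := hwI
    obtain ⟨e1, e2, e3⟩ := h.inv.dual_keys hcs hds hc hd hw.1
    obtain ⟨T₁, C', r1, h2, rfl⟩ := h.trans (p := (· = _))
      fun X _ => ⟨_, .commUn ⟨hw.1, e2, e1, q, hc, hd⟩ hw.2.2.1 (e3 a hw.2.2.2), rfl⟩
    obtain ⟨T₂, p, p', r2, h3⟩ := h2.select
    exact ⟨T₂, _, _, p, p', .trans (.single r1) (.single r2), h3⟩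

/-- Once the key is fixed, the protocol runs through without obstacle and may end in any two
branches with that key. The commitment is used up and no new one arises. -/
theorem complete (h : World Γ S₀ N Y T ⟨I ::ₘ .plain d.proc ::ₘ r, K, J, g⟩)
    {i : Fin c.n} {j : Fin d.n} (hI : Committed I c (c.pre i).key) {q : Port} (hc : c.x = q.nm)
    (hd : d.x = q.flip.nm) (hj : (d.pre j).key = (c.pre i).key.dual)
    {A₁ A₂ L₁ L₂ s₁ s₂} (hcomm : Comm (c.pre i) (d.pre j) (c.cont i) (d.cont j) A₁ A₂)
    (h1 : Flat A₁ L₁ s₁) (h2 : Flat A₂ L₂ s₂) (hn : (L₁ + L₂).Nodup) (hL : ∀ k ∈ L₁ + L₂, k ∈ Y) :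
    ∃ T' C', Steps T T' ∧ World Γ S₀ N ∅ T' C' ∧ C'.K = K + (L₁ + L₂) ∧
      srcs C'.D = s₁ + (s₂ + (astay c.q c.proc + (astay d.q d.proc + srcs r))) ∧
      busy C'.D = busy r ∧ coms C'.D = coms r := by
  obtain ⟨T₁, lp, pc, p, p', r1, w1⟩ := h.to_flight hI hc hd
  obtain ⟨T₂, J₂, g₂, r2, w2⟩ := w1.choose_left (i := i) rfl
  obtain ⟨T₃, J₃, g₃, r3, w3⟩ := w2.choose_right (j := j) hj
  obtain ⟨T₄, C', r4, w4, e1, E, e2, e3, e4⟩ := w3.finish hcomm h1 h2 hn hL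
  refine ⟨T₄, C', ((r1.tail r2).tail r3).tail r4, w4, e1, ?_, ?_, ?_⟩
  · rw [e2, srcs_add, srcs_add, e3, srcs_keep, Ch.kept]; abel
  · rw [e2, busy_add, busy_add, busy_init e4, busy_init (keep_init d)]; omega
  · rw [e2, coms_add, coms_add, coms_init e4, coms_init (keep_init d)]; omega

end World

end MixedSessions

namespace MixedSessions

open PCalc (Flat)
open CMV

variable {Γ : Ctx} {S₀ : Mix.Proc} {N : ℕ}

/-! ### Following the reductions of the represented process -/

theorem settled_cases {I : Item} {c : Ch} (hb : I.busy = 0) (hw : I.wf) (hc : c.proc ∈ I.src) :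
    (c.w = .ext ∧ I = .plain c.proc) ∨ c.w = .int ∧ I.src = {c.proc} ∧
      (Pending I c ∧ I.com = 0 ∨ ∃ a ∈ c.br.keys, Committed I c a ∧ I.com = 1) := by
  cases I with
  | plain A =>
    rw [Item.src, Multiset.mem_singleton] at hc
    subst hc
    rcases hw with ⟨_, _, _, h⟩ | ⟨d, h, hd⟩
    · cases h
    · rw [Ch.proc_inj] at h
      exact .inl ⟨h ▸ hd, rfl⟩
  | idle e u =>
    rw [Item.src, Multiset.mem_singleton, Ch.proc_inj] at hc
    subst hc
    exact .inr ⟨hw.1, rfl, .inl ⟨.inl ⟨_, rfl⟩, rfl⟩⟩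
  | nd e lp p =>
    rw [Item.src, Multiset.mem_singleton, Ch.proc_inj] at hc
    subst hc
    exact .inr ⟨hw.1, rfl, .inl ⟨.inr ⟨_, _, rfl⟩, rfl⟩⟩
  | lcommit e a =>
    rw [Item.src, Multiset.mem_singleton, Ch.proc_inj] at hc
    subst hc
    exact .inr ⟨hw.1, rfl, .inr ⟨a, hw.2.2.2, .inl rfl, rfl⟩⟩
  | ucommit e lp a pc =>
    rw [Item.src, Multiset.mem_singleton, Ch.proc_inj] at hc
    subst hc
    exact .inr ⟨hw.1, rfl, .inr ⟨a, hw.2.2.2, .inr ⟨_, _, rfl⟩, rfl⟩⟩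
  | presel => cases hb
  | flight => cases hb

theorem busy_eq_zero {D : Multiset Item} (h : busy D = 0) {I : Item} (hI : I ∈ D) : I.busy = 0 := by
  obtain ⟨r, rfl⟩ := Multiset.exists_cons_of_mem hI
  rw [busy_cons] at h
  omega

/-- Either the given reduction can be followed, or some communication that has already been
selected can be performed instead. -/
def Follows (Γ : Ctx) (S₀ : Mix.Proc) (N : ℕ) (T : Proc) (C : Cfg) (L : Multiset ℕ)
    (s' : Multiset AProc) : Prop :=
  (∃ T' C', Steps T T' ∧ World Γ S₀ N ∅ T' C' ∧ C'.K = C.K + L ∧ srcs C'.D = s' ∧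
    busy C'.D = 0 ∧ coms C'.D ≤ coms C.D) ∨
  ∃ T' C' L', Steps T T' ∧ World Γ S₀ N ∅ T' C' ∧ SRed (srcs C.D) L' (srcs C'.D) ∧
    busy C'.D = 0 ∧ coms C'.D < coms C.D

namespace World

variable {Y : Finset ℕ} {T : Proc} {C : Cfg}

/-- With nothing in progress the external partner is a plain state. An unresolved internal choice
can pick the wanted key. A resolved one completes its own communication instead, whichever key it
has; this falls into the second alternative of `Follows` and removes a commitment. -/
theorem follow_com (h : World Γ S₀ N Y T C) (hb : busy C.D = 0) {c d : Ch} {p : Port} {i : Fin c.n}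
    {j : Fin d.n} {r : Multiset AProc} (hw : c.w = .int) (hr : srcs C.D = c.proc ::ₘ d.proc ::ₘ r)
    (hc : c.x = p.nm) (hd : d.x = p.flip.nm) (hj : (d.pre j).key = (c.pre i).key.dual)
    {A₁ A₂ L₁ L₂ s₁ s₂} (hcomm : Comm (c.pre i) (d.pre j) (c.cont i) (d.cont j) A₁ A₂)
    (h1 : Flat A₁ L₁ s₁) (h2 : Flat A₂ L₂ s₂) (hn : (L₁ + L₂).Nodup) (hL : ∀ k ∈ L₁ + L₂, k ∈ Y) :
    Follows Γ S₀ N T C (L₁ + L₂) (s₁ + (s₂ + (astay c.q c.proc + (astay d.q d.proc + r)))) := by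
  have hcs : c.proc ∈ srcs C.D := by rw [hr]; simp
  have hds : d.proc ∈ srcs C.D := by rw [hr]; simp
  obtain ⟨_, e2, e3⟩ := h.inv.dual_keys hcs hds hc hd hw
  obtain ⟨I, hI, hcI⟩ := mem_srcs.1 hcs
  obtain ⟨I', hI', hdI⟩ := mem_srcs.1 hds
  obtain rfl : I' = .plain d.proc := by
    rcases settled_cases (busy_eq_zero hb hI') (h.inv.wf _ hI') hdI with ⟨_, h'⟩ | ⟨h', _⟩
    · exact h'
    · rw [e2] at h'; cases h'
  rcases settled_cases (busy_eq_zero hb hI) (h.inv.wf _ hI) hcI with ⟨h', _⟩ | ⟨_, hsrc, hcase⟩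
  · rw [hw] at h'; cases h'
  obtain ⟨D₁, hD⟩ := Multiset.exists_cons_of_mem hI
  rw [hD, Multiset.mem_cons] at hI'
  rcases hI' with rfl | hI'
  · rw [Item.src, Multiset.mem_singleton, Ch.proc_inj] at hcI
    subst hcI
    rw [hw] at e2; cases e2
  obtain ⟨r', rfl⟩ := Multiset.exists_cons_of_mem hI'
  obtain ⟨D, K, J, g⟩ := C
  simp only at hD
  subst hD
  obtain rfl : r = srcs r' := by
    simp only [srcs_cons, hsrc, show (Item.plain d.proc).src = {d.proc} from rfl,
      Multiset.singleton_add, Multiset.cons_inj_right] at hr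
    exact hr.symm
  have hb' : busy r' = 0 := by
    simp only [busy_cons] at hb; omega
  have hcm : coms (I ::ₘ .plain d.proc ::ₘ r') = I.com + coms r' := by
    simp [Item.com]
  rcases hcase with ⟨hP, _⟩ | ⟨a, ha, hC, h1C⟩
  · obtain ⟨T₁, I₁, J₁, g₁, r1, w1, hC⟩ := h.pick hP (Encoding.Branches.mem_keys.2 ⟨i, rfl⟩ :
      (c.pre i).key ∈ c.br.keys)
    obtain ⟨T₂, C₂, r2, w2, k1, k2, k3, k4⟩ := w1.complete hC hc hd hj hcomm h1 h2 hn hL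
    exact .inl ⟨T₂, C₂, r1.trans r2, w2, k1, k2, k3.trans hb', by rw [k4, hcm]; omega⟩
  · obtain ⟨i', rfl⟩ := Encoding.Branches.mem_keys.1 ha
    obtain ⟨j', hj'⟩ := Encoding.Branches.mem_keys.1 (e3 _ ha)
    obtain ⟨A₁', A₂', hcomm'⟩ := exists_comm (p := c.pre i') (q := d.pre j') hj' (c.cont i') (d.cont j')
    obtain ⟨M₁, M₂, u₁, u₂, f1, f2, f3, w1⟩ := h.fresh A₁' A₂'
    obtain ⟨T₂, C₂, r2, w2, _, k2, k3, k4⟩ := w1.complete hC hc hd hj' hcomm' f1 f2 f3 (by simp)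
    refine .inr ⟨T₂, C₂, M₁ + M₂, r2, w2, ?_, k3.trans hb', by rw [k4, hcm]; omega⟩
    rw [k2, hr]
    exact hcomm'.sred hc hd f1 f2 _

theorem follow (h : World Γ S₀ N Y T C) (hb : busy C.D = 0) {L : Multiset ℕ} {s' : Multiset AProc}
    (hs : SRed (srcs C.D) L s') (hn : L.Nodup) (hL : ∀ k ∈ L, k ∈ Y) :
    Follows Γ S₀ N T C L s' := by
  generalize hr : srcs C.D = s at hs
  cases hs with
  | @cond v P Q A L t r hv hf =>
    obtain ⟨I, hI, hcI⟩ := mem_srcs.1 (by rw [hr]; simp : AProc.cond v P Q ∈ srcs C.D)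
    obtain rfl : I = .plain (.cond v P Q) := by
      have := busy_eq_zero hb hI
      cases I <;> simp only [Item.busy, one_ne_zero, Item.src, Multiset.mem_singleton] at this hcI
      · rw [hcI]
      all_goals cases hcI
    obtain ⟨D₁, hD⟩ := Multiset.exists_cons_of_mem hI
    obtain ⟨D, K, J, g⟩ := C
    simp only at hD
    subst hD
    obtain rfl : r = srcs D₁ := by
      simp only [srcs_cons, Item.src, Multiset.singleton_add, Multiset.cons_inj_right] at hr
      exact hr.symm
    obtain ⟨T', C', r1, w1, E, rfl, rfl, e1⟩ := h.use (p := fun C' => ∃ E, C' = ⟨E + D₁, K + L, J, g⟩ ∧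
        srcs E = t ∧ ∀ I ∈ E, I.Init) fun X hX hY => by
      have hcl := h.inv.closed_red (X := X) hX (by rw [hr]; exact .cond hv hf) hn
        fun k hk => hY k (hL k hk)
      obtain ⟨E, d1, rfl, n1, o1⟩ := Dec.of_src hf (fun B hB => hcl B (by simp [hB])) (X ∪ Y)
      refine ⟨_, .cond hv d1 (Multiset.nodup_add.2 ⟨hn, n1, Multiset.disjoint_left.2
        fun hk hk' => o1 _ hk' (by simp [hL _ hk])⟩) ?_, E, rfl, rfl, fun I hI => (d1.init I hI).1⟩
      intro k hk hkX
      rcases Multiset.mem_add.1 hk with hk | hk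
      exacts [hY k (hL k hk) hkX, o1 k hk (by simp [hkX])]
    refine .inl ⟨T', _, .single r1, w1, rfl, srcs_add _ _, ?_, ?_⟩
    · simp only [busy_cons] at hb
      rw [busy_add, busy_init e1]; omega
    · rw [coms_add, coms_init e1, coms_cons]; omega
  | @com c d k o l v KP KQ sP sQ r i j hc hd hi hj fP fQ =>
    have hcomm : Comm (c.pre i) (d.pre j) (c.cont i) (d.cont j) (c.cont i)
        ((d.cont j).subst (Subst.inst v)) := by rw [hi, hj]; exact .out
    have hcomm' : Comm (d.pre j) (c.pre i) (d.cont j) (c.cont i)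
        ((d.cont j).subst (Subst.inst v)) (c.cont i) := by rw [hi, hj]; exact .inp
    have hkey : (d.pre j).key = (c.pre i).key.dual := by rw [hi, hj]; rfl
    cases hw : c.w with
    | int =>
      have := h.follow_com hb (p := (k, o)) hw hr hc hd hkey hcomm fP fQ hn hL
      rwa [← add_assoc] at this
    | ext =>
      have hdw : d.w = .int := by
        have := (h.inv.dual_types (c := c) (d := d) (p := (k, o)) (by rw [hr]; simp)
          (by rw [hr]; simp) hc hd).2.1
        rw [this, hw]; rfl
      -- Here the external choice is the sender; `follow_com` is applied from the side of the
      -- internal choice.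
      rw [Multiset.cons_swap] at hr
      have := h.follow_com hb (p := (k, !o)) hdw hr hd (by rw [hc]; simp) (by rw [hkey, Key.dual_dual])
        hcomm' fQ fP (by rwa [add_comm]) (by rwa [add_comm])
      convert this using 1
      · rw [add_comm]
      · abel

end World

/-! ### Observations -/

/-- The free names on which a configuration of the source calculus can interact. -/
def tops (s : Multiset AProc) : Set ℕ :=
  {x | ∃ c : Ch, c.proc ∈ s ∧ c.x = 2 * x ∧ (c.w = .int → 0 < c.n)}

/-- Communication needs a channel with both ends bound, so a choice on a free name is never
consumed. -/
theorem SRed.tops_subset {s s' : Multiset AProc} {L : Multiset ℕ} (h : SRed s L s') :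
    tops s ⊆ tops s' := by
  rintro x ⟨e, he, hx, hn⟩
  refine ⟨e, ?_, hx, hn⟩
  cases h with
  | cond hv hf =>
    rcases Multiset.mem_cons.1 he with h' | h'
    · cases h'
    · simp [h']
  | com i j hc hd =>
    simp only [Multiset.mem_cons, Ch.proc_inj] at he
    rcases he with rfl | rfl | h'
    · rw [hc] at hx; simp at hx
    · rw [hd] at hx; simp at hx
    · simp [h']

theorem Src.tops_lt {K : Multiset ℕ} {s : Multiset AProc} (h : Src Γ S₀ N K s) {x : ℕ}
    (hx : x ∈ tops s) : x < N := by
  obtain ⟨c, hc, hcx, _⟩ := hx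
  have hs := h.supp _ hc
  have : (Val.var c.x).Supp (evensBelow N ∪ names K) := Val.supp_of_subst fun σ τ hh => by
    have := hs σ τ hh
    injection this
  rcases this c.x rfl with ⟨y, hy, e⟩ | ⟨k, _, o, e⟩
  · omega
  · rw [hcx] at e; simp at e

/-- The bound does not depend on the configuration, so the number of observable names attains a
maximum over all reachable ones. -/
theorem Src.ncard_tops {K : Multiset ℕ} {s : Multiset AProc} (h : Src Γ S₀ N K s) :
    (tops s).Finite ∧ (tops s).ncard ≤ N := by
  have hsub : tops s ⊆ Set.Iio N := fun x hx => h.tops_lt hx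
  refine ⟨(Set.finite_Iio N).subset hsub, ?_⟩
  have := Set.ncard_le_ncard hsub (Set.finite_Iio N)
  rwa [← Finset.coe_Iio, Set.ncard_coe_finset, Nat.card_Iio] at this

namespace World

variable {Y : Finset ℕ} {T : Proc} {C : Cfg}

theorem barb_tops (h : World Γ S₀ N Y T C) {x : ℕ} (hx : Barb T x) : x ∈ tops (srcs C.D) := by
  obtain ⟨Kr, h1, _⟩ := h.rep
  obtain ⟨Q, hQ, hs⟩ := (h1.barb_iff x).1 hx
  rcases Multiset.mem_add.1 hQ with hQ | hQ
  · obtain ⟨I, hI, hQ⟩ := mem_tgts.1 hQ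
    obtain ⟨c, hc, h2⟩ := Item.subj_mem (h.inv.wf I hI) hQ hs
    exact ⟨c, mem_srcs.2 ⟨I, hI, hc⟩, h2⟩
  · obtain ⟨k, _, o, i, rfl⟩ := h.inv.dead Q hQ
    simp [Proc.subj] at hs

theorem barb_of_mem (h : World Γ S₀ N Y T C) {x : ℕ} {I : Item} (hI : I ∈ C.D) {Q : Proc}
    (hQ : Q ∈ I.tgt) (hs : Q.subj = some (.var (2 * x))) : Barb T x := by
  obtain ⟨Kr, h1, _⟩ := h.rep
  exact (h1.barb_iff x).2 ⟨Q, Multiset.mem_add.2 (.inl (mem_tgts.2 ⟨I, hI, hQ⟩)), hs⟩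

theorem committed_barb (h : World Γ S₀ N Y T C) {x : ℕ} {I : Item} {c : Ch} {a : Key} (hI : I ∈ C.D)
    (hc : Committed I c a) (hx : c.x = 2 * x) : Barb T x := by
  rcases hc with rfl | ⟨lp, pc, rfl⟩
  · exact h.barb_of_mem hI (Multiset.mem_singleton_self _) (by rw [Proc.subj, hx])
  · exact h.barb_of_mem hI (Multiset.mem_cons_self _ _) (by rw [Proc.subj, hx])

/-- An external choice shows its subject at once, an internal one only after it has been resolved,
hence the weak barb. An internal choice without branches can never be resolved, which explains the
condition in `tops`. -/
theorem weakBarb (h : World Γ S₀ N Y T C) {x : ℕ} (hx : x ∈ tops (srcs C.D)) :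
    WeakBarb Step Barb T x := by
  obtain ⟨c, hc, hcx, hn⟩ := hx
  obtain ⟨I, hI, hcI⟩ := mem_srcs.1 hc
  have hw := h.inv.wf I hI
  by_cases hb : I.busy = 0
  · rcases settled_cases hb hw hcI with ⟨he, rfl⟩ | ⟨hi, _, ⟨hP, _⟩ | ⟨a, _, hC, _⟩⟩
    · refine ⟨T, .refl, h.barb_of_mem hI (Multiset.mem_singleton_self _) ?_⟩
      cases hl : c.lu with
      | lin => rw [Ch.enc_lin hl he, Encoding.Branches.offer, Proc.subj, hcx]
      | un => rw [Ch.enc_un hl he, Encoding.Branches.unExt, Proc.subj, hcx]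
    · obtain ⟨D₁, hD⟩ := Multiset.exists_cons_of_mem hI
      obtain ⟨D, K, J, g⟩ := C
      simp only at hD
      subst hD
      obtain ⟨T', I', J', g', r1, w1, hC⟩ := h.pick hP (Encoding.Branches.mem_keys.2 ⟨⟨0, hn hi⟩, rfl⟩)
      exact ⟨T', r1, w1.committed_barb (Multiset.mem_cons_self _ _) hC hcx⟩
    · exact ⟨T, .refl, h.committed_barb hI hC hcx⟩
  -- A communication in progress involves the two ends of a channel, never a free name.
  · have key : ∀ {e d : Ch}, Opposed e d → c.proc ∈ e.proc ::ₘ d.once → False := by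
      intro e d ho hm
      obtain ⟨p, h1, h2⟩ := ho.chan
      rcases Multiset.mem_cons.1 hm with h' | h'
      · rw [Ch.proc_inj] at h'; subst h'
        rw [hcx] at h1
        simpa using h1.symm
      · have : c.proc ∈ d.once + d.kept := Multiset.mem_add.2 (.inl h')
        rw [once_add_kept, Multiset.mem_singleton, Ch.proc_inj] at this
        subst this
        rw [hcx] at h2
        simpa using h2.symm
    cases I with
    | presel => exact (key hw.1 hcI).elim
    | flight => exact (key hw.1 hcI).elim
    | _ => exact absurd rfl hb

end World

/-! ### Stable configurations -/

/-- `C` represents a process that is reachable from `T₀`, no communications are in progress, it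
has as many observations as possible and as few internal choices as possible are resolved. -/
structure Good (Γ : Ctx) (S₀ : Mix.Proc) (N : ℕ) (T₀ T : Proc) (C : Cfg) : Prop where
  steps : Steps T₀ T
  world : World Γ S₀ N ∅ T C
  settled : busy C.D = 0
  extremal : ∀ T' C', Steps T₀ T' → World Γ S₀ N ∅ T' C' → busy C'.D = 0 →
    tops (srcs C.D) ⊆ tops (srcs C'.D) →
      tops (srcs C'.D) = tops (srcs C.D) ∧ coms C.D ≤ coms C'.D

theorem exists_min {α : Type*} (f : α → ℕ) {p : α → Prop} (h : ∃ a, p a) :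
    ∃ a, p a ∧ ∀ b, p b → f a ≤ f b := by
  obtain ⟨a, ha, hm⟩ := (InvImage.wf f Nat.lt_wfRel.wf).has_min {a | p a} h
  exact ⟨a, ha, fun b hb => not_lt.1 (hm b hb)⟩

/-- Two successive minimisations: of `N` minus the number of observable names, then of the number of
commitments among the optimal configurations. A superset of a finite set of maximal size equals it,
which yields the form stated in `extremal`. -/
theorem World.exists_good {T : Proc} {C : Cfg} (h : World Γ S₀ N ∅ T C) :
    ∃ T' C', Good Γ S₀ N T T' C' := by
  obtain ⟨T₁, C₁, r1, w1, b1⟩ := h.settle rfl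
  obtain ⟨⟨T₂, C₂⟩, h2, m2⟩ := exists_min
    (fun x : Proc × Cfg => N - (tops (srcs x.2.D)).ncard)
    (p := fun x => Steps T x.1 ∧ World Γ S₀ N ∅ x.1 x.2 ∧ busy x.2.D = 0) ⟨(T₁, C₁), r1, w1, b1⟩
  obtain ⟨⟨T₃, C₃⟩, ⟨h3, e3⟩, m3⟩ := exists_min (fun x : Proc × Cfg => coms x.2.D)
    (p := fun x => (Steps T x.1 ∧ World Γ S₀ N ∅ x.1 x.2 ∧ busy x.2.D = 0) ∧
      N - (tops (srcs x.2.D)).ncard = N - (tops (srcs C₂.D)).ncard) ⟨(T₂, C₂), h2, rfl⟩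
  refine ⟨T₃, C₃, h3.1, h3.2.1, h3.2.2, fun T' C' r' w' b' hsub => ?_⟩
  have f' := w'.inv.src.ncard_tops
  have f3 := h3.2.1.inv.src.ncard_tops
  have m := m2 (T', C') ⟨r', w', b'⟩
  simp only at m e3
  have heq := Set.eq_of_subset_of_ncard_le hsub (by omega) f'.1
  exact ⟨heq.symm, m3 (T', C') ⟨⟨r', w', b'⟩, by simp only [← heq]; exact e3⟩⟩

/-- The second alternative of `Follows` would give fewer commitments with no observable name lost,
against extremality. In the first one the commitments do not increase and the observable names stay
the same, so the result is extremal again. -/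
theorem Good.follow {T₀ T : Proc} {C : Cfg} {Y : Finset ℕ} (h : Good Γ S₀ N T₀ T C)
    (hY : World Γ S₀ N Y T C) {L : Multiset ℕ} {s' : Multiset AProc} (hs : SRed (srcs C.D) L s')
    (hn : L.Nodup) (hL : ∀ k ∈ L, k ∈ Y) :
    ∃ T' C', Good Γ S₀ N T₀ T' C' ∧ C'.K = C.K + L ∧ srcs C'.D = s' := by
  rcases hY.follow h.settled hs hn hL with ⟨T', C', r1, w1, k1, k2, b1, c1⟩ | ⟨T', C', L', r1, w1, k1, b1, c1⟩
  · have := (h.extremal T' C' (h.steps.trans r1) w1 b1 (k2 ▸ hs.tops_subset)).1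
    refine ⟨T', C', ⟨h.steps.trans r1, w1, b1, fun T'' C'' r2 w2 b2 hsub => ?_⟩, k1, k2⟩
    rw [this] at hsub ⊢
    have := h.extremal T'' C'' r2 w2 b2 hsub
    exact ⟨this.1, c1.trans this.2⟩
  · have := (h.extremal T' C' (h.steps.trans r1) w1 b1 k1.tops_subset).2
    omega

/-- The processes that represent the same source process as a good configuration. -/
def Like (Γ : Ctx) (S₀ : Mix.Proc) (N : ℕ) (T₀ : Proc) (B : Set ℕ) (P : Proc) : Prop :=
  ∃ C, World Γ S₀ N ∅ P C ∧ ∃ T₁ C₁, Good Γ S₀ N T₀ T₁ C₁ ∧ C₁.K = C.K ∧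
    srcs C₁.D = srcs C.D ∧ tops (srcs C₁.D) = B

namespace Like

variable {T₀ : Proc} {B : Set ℕ} {P P' : Proc}

theorem step (h : Like Γ S₀ N T₀ B P) (hs : Step P P') : Like Γ S₀ N T₀ B P' := by
  obtain ⟨C, w, T₁, C₁, hg, hK, hsrc, hB⟩ := h
  obtain ⟨Kr, h1, _⟩ := hg.world.rep
  -- The channels created by this step must also be fresh for the good process, which is going to
  -- copy the source reduction with the same channels.
  obtain ⟨C', w', hC'⟩ := w.step hs (Kr.toFinset ∪ C₁.chans.toFinset)
  rcases hC' with ⟨e1, e2⟩ | ⟨L, hr, e1, hL⟩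
  · exact ⟨C', w', T₁, C₁, hg, hK.trans e1.symm, hsrc.trans e2.symm, hB⟩
  · have hn : L.Nodup := by
      have := w'.inv.src.nodup
      rw [e1] at this
      exact (Multiset.nodup_add.1 this).2.1
    have w1 : World Γ S₀ N L.toFinset T₁ C₁ :=
      ⟨⟨Kr, h1, fun k hk hk' => hL k (by simpa using hk') (by simp [hk])⟩, hg.world.inv,
        fun k hk hk' => hL k (by simpa using hk') (by simp [hk])⟩
    rw [← hsrc] at hr
    obtain ⟨T₂, C₂, hg2, k1, k2⟩ := hg.follow w1 hr hn (by simp)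
    refine ⟨C', w', T₂, C₂, hg2, by rw [k1, e1, hK], k2, ?_⟩
    rw [← hB]
    exact (hg.extremal T₂ C₂ hg2.steps hg2.world hg2.settled (k2 ▸ hr.tops_subset)).1

theorem steps (h : Like Γ S₀ N T₀ B P) (hs : Steps P P') : Like Γ S₀ N T₀ B P' := by
  induction hs with
  | refl => exact h
  | tail _ hs ih => exact ih.step hs

theorem weakBarb_iff (h : Like Γ S₀ N T₀ B P) (x : ℕ) : WeakBarb Step Barb P x ↔ x ∈ B := by
  constructor
  · rintro ⟨P', hs, hx⟩
    obtain ⟨C, w, T₁, C₁, _, _, hsrc, rfl⟩ := h.steps hs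
    rw [hsrc]
    exact w.barb_tops hx
  · intro hx
    obtain ⟨C, w, T₁, C₁, _, _, hsrc, rfl⟩ := h
    rw [hsrc] at hx
    exact w.weakBarb hx

/-- The class is closed under reduction and its members all have the weak barbs `B`, so every move
can be answered by idling. -/
theorem bisim {Q : Proc} (h : Like Γ S₀ N T₀ B P) (h' : Like Γ S₀ N T₀ B Q) : Bisim P Q := by
  refine ⟨fun P Q => Like Γ S₀ N T₀ B P ∧ Like Γ S₀ N T₀ B Q, ?_, h, h'⟩
  rintro P Q ⟨hP, hQ⟩
  exact ⟨fun P' hs => ⟨Q, .refl, hP.steps hs, hQ⟩, fun Q' hs => ⟨P, .refl, hP, hQ.steps hs⟩,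
    fun x => (hP.weakBarb_iff x).trans (hQ.weakBarb_iff x).symm⟩

end Like

/-- A fresh encoding starts in initial states, without commitments and without dead threads. This is
applied at the beginning, and at the end to the source process that was found. -/
theorem Src.world {K : Multiset ℕ} {s : Multiset AProc} (h : Src Γ S₀ N K s) {A : AProc}
    (hA : Flat (A.subst freeNm) K s) :
    ∃ C, World Γ S₀ N ∅ A.enc C ∧ C.K = K ∧ srcs C.D = s := by
  obtain ⟨E, h1, rfl, h2, h3⟩ := Dec.of_src hA (fun B hB => h.closed hB) K.toFinset
  have hn : (K + owns E).Nodup := Multiset.nodup_add.2 ⟨h.nodup, h2, Multiset.disjoint_left.2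
    fun hk hk' => h3 _ hk' (by simp [hk])⟩
  refine ⟨⟨E, K, 0, 0⟩, ⟨⟨K + owns E, ⟨tgts E, ?_, hn, ?_⟩, by simp⟩, ⟨h, ?_, fun I hI => (h1.init I hI).2,
    ?_, by simp⟩, by simp⟩, rfl, rfl⟩
  · rw [AProc.enc_subst]; exact h1.tgt
  · simp only [Cfg.tgt, add_zero]
    exact MTC.refl_thr h1.tgt.thr_mem
  · simp only [Cfg.chans, add_zero]
    rwa [add_comm]
  · intro I hI A hA
    have := (h1.init I hI).1
    cases I <;> simp [Item.Init, Item.need] at this hA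

theorem World.steps {T T' : Proc} {C : Cfg} (h : World Γ S₀ N ∅ T C) (hs : Steps T T') :
    ∃ C', World Γ S₀ N ∅ T' C' := by
  induction hs with
  | refl => exact ⟨C, h⟩
  | tail _ hs ih =>
    obtain ⟨C', h'⟩ := ih
    obtain ⟨C'', h'', _⟩ := h'.step hs ∅
    exact ⟨C'', h''⟩

end MixedSessions

/-! ### Operational soundness -/

theorem mainTheorem6 (Γ : MixedSessions.Ctx) (S : MixedSessions.Mix.Proc)
    (d : MixedSessions.Typing Γ S) (T : MixedSessions.CMV.Proc)
    (h : MixedSessions.CMV.Steps (MixedSessions.enc d) T) :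
    ∃ (S' : MixedSessions.Mix.Proc) (d' : MixedSessions.Typing Γ S'),
      MixedSessions.Mix.Steps S S' ∧
      ∃ T' : MixedSessions.CMV.Proc,
        MixedSessions.CMV.Steps T T' ∧ MixedSessions.CMV.Bisim T' (MixedSessions.enc d') := by
  obtain ⟨A, rfl, hA, hty⟩ := d.annotate
  obtain ⟨N, K, s, hsrc, hflat, _⟩ := MixedSessions.Src.init hty ∅
  obtain ⟨C, hw, _, _⟩ := hsrc.world hflat
  rw [hA] at hw
  obtain ⟨C₀, hw₀⟩ := hw.steps h
  -- The target process is chosen before the source process: the latter is read off the extremal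
  -- configuration.
  obtain ⟨T', C', hg⟩ := hw₀.exists_good
  obtain ⟨A', hs, hty', hflat'⟩ := hg.world.inv.src.reach
  obtain ⟨d', hd'⟩ := hty'.typing
  -- The encoding of that source process represents the same threads over the same source channels,
  -- though all its internal choices are still unresolved; this is what `Like` asks for.
  obtain ⟨C'', hw'', hK, hsr⟩ := hg.world.inv.src.world hflat'
  rw [← hd'] at hw''
  exact ⟨A'.erase, d', hs, T', hg.steps, MixedSessions.Like.bisim
    ⟨C', hg.world, T', C', hg, rfl, rfl, rfl⟩ ⟨C'', hw'', T', C', hg, hK.symm, hsr.symm, rfl⟩⟩
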